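/- Let $k$ be an algebraically closed field of characteristic $0$, $S=k[[u,v]]$, $m\ge 1$, and let $G\subset GL(ku+kv)$ be a finite group, acting on $S$ by $k$-algebra automorphisms and acting on the matrix algebra $k^{m\times m}$ by $k$-algebra automorphisms. Let $G$ act on $B=S\otimes_k k^{m\times m}$ by the tensor product of these actions, and put $R=S^G$, $A=B^G$. Let $s,t$ be a basis of $ku+kv$, let $L=(t=0)\subset\operatorname{Spec}S$ be a line of reflection of $G$ with stabiliser $H\subset G$, and assume that $s$ is chosen such that $H$ acts diagonally on $ks+kt$. Let $C\subset\operatorname{Spec}R$ be the image of $L$. Assume that the inertia group $I=\{h\in H: h(s)=s\}$ is generated by $\sigma$ (so $\sigma\neq1$) and that $H=I\times J$ with $J=\langle\tau\rangle$. Let $\sigma,\tau$ act on $k^{m\times m}$ as conjugation by invertible matrices $b_\sigma,b_\tau$. Let $\hat S$ be the completion of the local ring $S_{(t)}$, $\hat B=\hat S\otimes_k k^{m\times m}$, $\hat R=\hat S^H$ and $\hat A=\hat B^H$, and let $k(\hat A)=\hat A\otimes_{\hat R}\operatorname{Frac}\hat R$. Here an algebra $\Lambda$ over a normal noetherian $k$-domain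 $O$ is a normal order if it is a finitely generated reflexive torsion-free $O$-module, $\Lambda\otimes_O\operatorname{Frac}O$ is a central simple $\operatorname{Frac}O$-algebra, and for every prime $p\subset O$ of height one: $\Lambda_p$ is hereditary; $\operatorname{Hom}_{O_p}(\Lambda_p,O_p)$ is isomorphic to $\Lambda_p$ as a left module and as a right module; and $\Lambda_p$ is a maximal $O_p$-order if the residue field $\kappa(p)$ has finite transcendence degree over $k$. If $A_C$ is the localisation of $A$ at $C$, with Jacobson radical $\mathfrak J$, let $E$ be the centre of $A_C/\mathfrak J$, an algebra over the function field $k(C)$; the ramification index of $A$ along $C$ is $\dim_{k(C)}E$, and the cover of the normalisation of $C$ determined by $A$ is the spectrum of the integral closure in $E$ of the coordinate ring of the normalisation of $C$. Then: 1. $\hat A$ is a normal order over $\hat R$ if and only if all eigenspaces of $b_\sigma$ have the same dimension. 2. In this case, the ramification index of $A$ along $C$ is the number of distinct eigenvalues of $b_\sigma$. 3. There is a unique scalar $\eta\in k$ with $b_\sigma b_\tau=\eta\,b_\tau b_\sigma$, and $\eta$ is a primitive $e$-th root of unity, where $e$ is the index of the central simple algebra $k(\hat A)$. Equivalently, $e$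 is the ramification index, over the closed point, of the cover of the normalisation of $C$ determined by $A$ (at every closed point of the cover). -/

import Mathlib

open scoped TensorProduct

universe u

noncomputable section

namespace QuotientOrder

/-! ### Orders over a normal base -/

section Orders

variable (O : Type u) [CommRing O] (Λ : Type u) [Ring Λ] [Algebra O Λ]

/-- A ring is hereditary if all its left ideals and all its right ideals are projective. -/
def IsHereditary (Λ : Type u) [Ring Λ] : Prop :=
  (∀ I : Submodule Λ Λ, Module.Projective Λ I) ∧
    ∀ I : Submodule Λᵐᵒᵖ Λ, Module.Projective Λᵐᵒᵖ I

/-- `Hom_O(Λ, O)` is isomorphic to `Λ` as a left `Λ`-module, for `(a • f) x = f (x * a)`. -/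
def IsLeftSelfDual : Prop :=
  ∃ φ : Λ ≃ₗ[O] (Λ →ₗ[O] O), ∀ a b x : Λ, φ (a * b) x = φ b (x * a)

/-- `Hom_O(Λ, O)` is isomorphic to `Λ` as a right `Λ`-module, for `(f • a) x = f (a * x)`. -/
def IsRightSelfDual : Prop :=
  ∃ φ : Λ ≃ₗ[O] (Λ →ₗ[O] O), ∀ a b x : Λ, φ (b * a) x = φ b (a * x)

/-- The generic fibre `k(Λ) = Λ ⊗ Frac O`. -/
abbrev GenericFibre : Type u := FractionRing O ⊗[O] Λ

/-- `Λ` is an `O`-order: finitely generated and torsion-free as an `O`-module, with central simple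
generic fibre. -/
structure IsOrder : Prop where
  finite : Module.Finite O Λ
  torsionFree : Module.IsTorsionFree O Λ
  central : Algebra.IsCentral (FractionRing O) (GenericFibre O Λ)
  simple : IsSimpleRing (GenericFibre O Λ)

/-- `Λ` is maximal, with respect to inclusion, among the `O`-orders in its generic fibre. (An
`O`-subalgebra of the generic fibre that is finitely generated over `O` and contains `Λ` is
automatically an order with the same generic fibre.) -/
def IsMaximalOrder : Prop :=
  ∀ M : Subalgebra O (GenericFibre O Λ), Module.Finite O M →
    (Algebra.TensorProduct.includeRight : Λ →ₐ[O] GenericFibre O Λ).range ≤ M →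
      M = (Algebra.TensorProduct.includeRight : Λ →ₐ[O] GenericFibre O Λ).range

/-- The local ring `Λ_p = O_p ⊗ Λ` of `Λ` at a prime `p` of the base. -/
abbrev OrderAt (p : Ideal O) [p.IsPrime] : Type u := Localization.AtPrime p ⊗[O] Λ

/-- `Λ` is a normal order over (the spectrum of) the `k`-algebra `O`. At a height one prime `p` of
a normal noetherian domain the ring `O_p` is a discrete valuation ring, so that the local dualising
module `ω_p = Hom(Λ_p, ω_{O_p})` is `Hom(Λ_p, O_p)`. -/
structure IsNormalOrder (k : Type u) [Field k] [Algebra k O] : Prop where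
  isDomain : IsDomain O
  isNoetherian : IsNoetherianRing O
  isIntegrallyClosed : IsIntegrallyClosed O
  isOrder : IsOrder O Λ
  hereditary : ∀ (p : Ideal O) [p.IsPrime], p.height = 1 → IsHereditary (OrderAt O Λ p)
  leftSelfDual : ∀ (p : Ideal O) [p.IsPrime], p.height = 1 →
    IsLeftSelfDual (Localization.AtPrime p) (OrderAt O Λ p)
  rightSelfDual : ∀ (p : Ideal O) [p.IsPrime], p.height = 1 →
    IsRightSelfDual (Localization.AtPrime p) (OrderAt O Λ p)
  maximal : ∀ (p : Ideal O) [p.IsPrime], p.height = 1 →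
    Algebra.trdeg k p.ResidueField < Cardinal.aleph0 →
      IsMaximalOrder (Localization.AtPrime p) (OrderAt O Λ p)
  reflexive : Module.IsReflexive O Λ

/-! ### Ramification -/

/-- The ring `Λ_p / J`, with `J` the Jacobson radical of `Λ_p`. -/
abbrev ResidueRing (p : Ideal O) [p.IsPrime] : Type u :=
  OrderAt O Λ p ⧸ Ring.jacobson (OrderAt O Λ p)

/-- The centre of `Λ_p / J`, as an algebra over the residue field `κ(p)`: if `Λ_p / J` is a product
of `r` matrix algebras over a field `L`, this is `L ^ r`. (For an order, `Λ_p / J` is killed by the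
maximal ideal of `O_p`, so that tensoring with `κ(p)` only records the `κ(p)`-structure.) -/
abbrev ResidueCentre (p : Ideal O) [p.IsPrime] : Type u :=
  p.ResidueField ⊗[Localization.AtPrime p]
    Subalgebra.center (Localization.AtPrime p) (ResidueRing O Λ p)

/-- The ramification index of `Λ` at the codimension one point `p`: the degree of `L ^ r` over
`κ(p)`. -/
def ramificationIndex (p : Ideal O) [p.IsPrime] : ℕ :=
  Module.finrank p.ResidueField (ResidueCentre O Λ p)

/-- The coordinate ring of the normalisation of the curve `C = Spec (O / p)`. -/
abbrev CurveNormalization (p : Ideal O) [p.IsPrime] : Type u :=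
  integralClosure O p.ResidueField

/-- The coordinate ring of the cover of the normalisation of `C = Spec (O / p)` determined by `Λ`:
the integral closure of the coordinate ring of the normalised curve in `L ^ r`. -/
abbrev RamificationCover (p : Ideal O) [p.IsPrime] : Type u :=
  integralClosure (CurveNormalization O p) (ResidueCentre O Λ p)

/-- Every closed point of the cover of the normalisation of `C = Spec (O / p)` determined by `Λ`
has ramification index `e` over the closed point of the normalisation below it. -/
def HasClosedPointRamification (p : Ideal O) [p.IsPrime] (e : ℕ) : Prop :=
  ∀ P : Ideal (RamificationCover O Λ p), P.IsMaximal →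
    P.ramificationIdx (CurveNormalization O p) = e

/-- The central simple `K`-algebra `D` has index `e`: it is a matrix algebra over a central
division algebra of dimension `e ^ 2`. -/
def HasIndex (K : Type u) [CommRing K] (D : Type u) [Ring D] [Algebra K D] (e : ℕ) : Prop :=
  ∃ (n : ℕ) (E : Type u) (_ : DivisionRing E) (_ : Algebra K E),
    0 < n ∧ Algebra.IsCentral K E ∧ Module.Finite K E ∧ Module.finrank K E = e ^ 2 ∧
      Nonempty (D ≃ₐ[K] Matrix (Fin n) (Fin n) E)

end Orders

/-! ### Invariants -/

section Invariants

variable {k : Type u} [Field k] {T : Type u} [CommRing T] [Algebra k T]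
  {M : Type u} [Ring M] [Algebra k M] {ι : Type*}

/-- The subring of `T` fixed by all the given endomorphisms. -/
def invariants (φ : ι → T →ₐ[k] T) : Subalgebra k T where
  carrier := {x | ∀ i, φ i x = x}
  mul_mem' hx hy i := by rw [map_mul, hx i, hy i]
  add_mem' hx hy i := by rw [map_add, hx i, hy i]
  algebraMap_mem' c i := (φ i).commutes c

/-- The subring of `T ⊗ M` fixed by the endomorphisms `φ i ⊗ ψ i`, as an algebra over the ring of
invariants of `T`. -/
def invariantOrder (φ : ι → T →ₐ[k] T) (ψ : ι → M →ₐ[k] M) :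
    Subalgebra (invariants φ) (T ⊗[k] M) where
  carrier := {x | ∀ i, Algebra.TensorProduct.map (φ i) (ψ i) x = x}
  mul_mem' hx hy i := by rw [map_mul, hx i, hy i]
  add_mem' hx hy i := by rw [map_add, hx i, hy i]
  algebraMap_mem' c i := by
    change Algebra.TensorProduct.map (φ i) (ψ i) ((c : T) ⊗ₜ[k] (1 : M)) = (c : T) ⊗ₜ[k] (1 : M)
    rw [Algebra.TensorProduct.map_tmul, map_one, c.2 i]

end Invariants

/-! ### Completion at a prime of the base -/

section Completion

variable {k : Type u} [Field k] {S : Type u} [CommRing S] [Algebra k S]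

/-- The stabiliser of the point `L` of `Spec S` for a group acting on `S`. -/
def stabilizer {G : Type*} [Group G] (ρ : G →* (S ≃ₐ[k] S)) (L : Ideal S) : Subgroup G where
  carrier := {g | L = L.comap (ρ g : S →ₐ[k] S).toRingHom}
  one_mem' := by
    ext x
    simp
  mul_mem' {a b} ha hb := by
    ext x
    have h1 := SetLike.ext_iff.1 ha (ρ b x)
    have h2 := SetLike.ext_iff.1 hb x
    simp only [Ideal.mem_comap] at h1 h2 ⊢
    simpa using h2.trans h1
  inv_mem' {a} ha := by
    ext x
    have h1 := SetLike.ext_iff.1 ha (ρ a⁻¹ x)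
    simp only [Ideal.mem_comap] at h1 ⊢
    simpa using h1.symm

variable (L : Ideal S) [L.IsPrime]

/-- The local ring `S_L`, completed. -/
abbrev LocalCompletion : Type u :=
  AdicCompletion (IsLocalRing.maximalIdeal (Localization.AtPrime L)) (Localization.AtPrime L)

/-- The endomorphism of `S_L` induced by an endomorphism of `S` that preserves `L`. -/
def localMap (f : S →ₐ[k] S) (hf : L = L.comap f.toRingHom) :
    Localization.AtPrime L →ₐ[k] Localization.AtPrime L where
  __ := Localization.localRingHom L L f.toRingHom hf
  commutes' c := by
    simp [IsScalarTower.algebraMap_apply k S (Localization.AtPrime L),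
      Localization.localRingHom_to_map]

theorem pow_le_comap_localMap (f : S →ₐ[k] S) (hf : L = L.comap f.toRingHom) (n : ℕ) :
    IsLocalRing.maximalIdeal (Localization.AtPrime L) ^ n ≤
      (IsLocalRing.maximalIdeal (Localization.AtPrime L) ^ n).comap (localMap L f hf) := by
  have h : IsLocalRing.maximalIdeal (Localization.AtPrime L) ≤
      (IsLocalRing.maximalIdeal (Localization.AtPrime L)).comap (localMap L f hf) := fun x hx =>
    map_nonunit (Localization.localRingHom L L f.toRingHom hf) x hx
  exact (Ideal.pow_right_mono h n).trans (Ideal.le_comap_pow _ n)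

/-- The endomorphism of the completion of `S_L` induced by an endomorphism of `S` that
preserves `L`. -/
def completedMap (f : S →ₐ[k] S) (hf : L = L.comap f.toRingHom) :
    LocalCompletion L →ₐ[k] LocalCompletion L :=
  AdicCompletion.liftAlgHom _
    (fun n => (Ideal.quotientMapₐ _ (localMap L f hf) (pow_le_comap_localMap L f hf n)).comp
      ((AdicCompletion.evalₐ _ n).restrictScalars k))
    (by
      intro m n hle
      ext x
      obtain ⟨r, rfl⟩ := AdicCompletion.mk_surjective _ _ x
      have h : r.val n - r.val m ∈ IsLocalRing.maximalIdeal (Localization.AtPrime L) ^ m :=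
        Ideal.Quotient.eq.1 (AdicCompletion.Ideal.mk_eq_mk _ hle r)
      have h' := pow_le_comap_localMap L f hf m h
      rw [Ideal.mem_comap, map_sub] at h'
      simpa using Ideal.Quotient.eq.2 h')

end Completion

/-! ### The order `B ^ G` and its completion -/

section Quotient

variable {k : Type u} [Field k] {S : Type u} [CommRing S] [Algebra k S]
  {M : Type u} [Ring M] [Algebra k M] {G : Type*} [Group G]

/-- The ring of invariants `R = S ^ G`. -/
abbrev baseRing (ρ : G →* (S ≃ₐ[k] S)) : Subalgebra k S :=
  invariants fun g : G => (ρ g : S →ₐ[k] S)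

/-- The `R`-algebra `A = B ^ G`, for `G` acting on `B = S ⊗ M` through the tensor product of
actions on `S` and on `M`. -/
abbrev quotientOrder (ρ : G →* (S ≃ₐ[k] S)) (β : G →* (M ≃ₐ[k] M)) :
    Subalgebra (baseRing ρ) (S ⊗[k] M) :=
  invariantOrder (fun g : G => (ρ g : S →ₐ[k] S)) fun g : G => (β g : M →ₐ[k] M)

/-- The invariants `Ŝ ^ H` in the completion `Ŝ` of `S` at `L` of the stabiliser `H` of `L`. -/
abbrev completedBaseRing (ρ : G →* (S ≃ₐ[k] S)) (L : Ideal S) [L.IsPrime] :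
    Subalgebra k (LocalCompletion L) :=
  invariants fun h : stabilizer ρ L => completedMap L (ρ h.1 : S →ₐ[k] S) h.2

/-- The invariants `B̂ ^ H` in the completion `B̂ = Ŝ ⊗ M` of `B = S ⊗ M` at `L` of the stabiliser
`H` of `L`. -/
abbrev completedOrder (ρ : G →* (S ≃ₐ[k] S)) (β : G →* (M ≃ₐ[k] M)) (L : Ideal S) [L.IsPrime] :
    Subalgebra (completedBaseRing ρ L) (LocalCompletion L ⊗[k] M) :=
  invariantOrder (fun h : stabilizer ρ L => completedMap L (ρ h.1 : S →ₐ[k] S) h.2)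
    fun h : stabilizer ρ L => (β h.1 : M →ₐ[k] M)

/-- The prime of `R = S ^ G` defining the image of the curve `L` in `Spec R`. -/
abbrev imagePrime (ρ : G →* (S ≃ₐ[k] S)) (L : Ideal S) : Ideal (baseRing ρ) :=
  L.comap (algebraMap (baseRing ρ) S)

end Quotient

end QuotientOrder

end

/-!
# Quotients of matrix algebras over a plane by a finite group, along a line of reflection

Along the line `t = 0` everything can be written down explicitly. In the completion the stabiliser
`⟨σ⟩ × ⟨τ⟩` acts by `σ t = ζ t`, `σ s = s`, and, after multiplying `t` by a power of the unit `s`,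
by `τ s = ξ s`, `τ t = t`, with primitive roots of unity `ζ, ξ` of the orders `n, N` of `σ, τ`
(`TameAction`, `exists_tameAction`). The commutator of `bσ` and `bτ` is a scalar `η`, because `σ` and
`τ` commute; if `η` has order `e`, then `bσ` is diagonal and `bτ` a shift, up to scalars, in a basis
indexed by `ZMod e × F` (`exists_basis_of_commute_up_to_root`). The scalars of `bτ` become, after
rescaling the basis, powers of `ξ` that are constant along the shift, and are absorbed by conjugation
with a diagonal matrix of powers of the unit `s` (`Frame.equiv`). So the invariants become the model
order: matrices over the completion whose entries are eigenvectors of `σ`, for the ratios of the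
eigenvalues `α` of `bσ`, and on which `τ` is the shift of the indices (`Frame`, `modelOrder`,
`modelOrderEquiv`).

For the model order all properties are computed.

* It is hereditary, being a bimodule retract of a matrix ring over a discrete valuation ring: project
  by averaging (`IsLeftHereditary.of_bimodule_retract`, `isLeftHereditary_matrix`).
* By trace duality its dual is, up to a scalar, the ideal of matrices with entries divisible by `t`.
  Self-duality therefore means that this ideal is generated by one element. The valuation of
  the determinant of a generator is `n` times the multiplicity of any given weight, so all
  multiplicities are equal (`card_eq_of_exists_generator`); conversely a monomial matrix whose
  entries are powers of `t` is a generator (`isSelfDual_of_card_eq`).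
* The maximality condition in the definition of a normal order is void, since the residue field of the
  completed base has infinite transcendence degree (`aleph0_le_trdeg_completedBaseRing`).
* If `F` is a point, then the model order has no zero divisors generically (`det_ne_zero`), its
  centre is the base, and it is free of rank `e ^ 2` by a Vandermonde argument. In general
  conjugation by powers of `t` makes the generic fibre a matrix algebra over that division algebra.
  So the index is `e` (`hasIndex_modelOrder`).

For the ramification of the invariants of the uncompleted algebra the same normal form is used over
the function field `k((s))` of the line. Reduction modulo `t` identifies the local order modulo its
radical with the block matrices over `k((s))`, one block for each eigenvalue of `bσ`, on which the
shift is the substitution `s ↦ ξ s` (`lineResidueModel`). Surjectivity holds up to denominators by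
summing over the group (`exists_invariant_reduction`), and the kernel is quasi-regular by the adjugate
formula (`exists_mul_eq_algebraMap`). The centre is the algebra of functions of the eigenvalue `α`
equivariant for `α ↦ η α` and `s ↦ ξ s`. By interpolation at the eigenvalues its dimension over
`k((s ^ N))` is their number (`CentreModel.finrank_eq`). Each of its factors, one for each orbit of
eigenvalues, is `k((s ^ (N / e)))`, whose ring of integers `k⟦s ^ (N / e)⟧` is totally ramified of
index `e` over `k⟦s ^ N⟧` (`ramificationIdx_weightSeries`).
-/

noncomputable section

set_option linter.unusedSectionVars false

namespace QuotientOrder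

/-! ### Linear coordinates on the power series ring -/

section PowerSeriesRing

variable {k : Type u} [Field k]

/-- The ring `k[[u, v]]`. -/
abbrev PlaneRing (k : Type u) [Field k] : Type u := MvPowerSeries (Fin 2) k

/-- The `k`-space of linear forms in `u` and `v`. -/
abbrev linearForms (k : Type u) [Field k] : Submodule k (PlaneRing k) :=
  Submodule.span k (Set.range (MvPowerSeries.X : Fin 2 → PlaneRing k))

theorem exists_eq_C_add_X_mul_add_X_mul (F : PlaneRing k) :
    ∃ (c : k) (G H : PlaneRing k),
      F = algebraMap k (PlaneRing k) c + MvPowerSeries.X 0 * G + MvPowerSeries.X 1 * H := by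
  classical
  let E : PlaneRing k := fun m => if m 0 = 0 then MvPowerSeries.coeff m F else 0
  have hE : ∀ m, MvPowerSeries.coeff m E = if m 0 = 0 then MvPowerSeries.coeff m F else 0 :=
    fun m => rfl
  have h0 : MvPowerSeries.X 0 ∣ F - E := by
    rw [MvPowerSeries.X_dvd_iff]
    intro m hm
    simp [hE, hm]
  have h1 : MvPowerSeries.X 1 ∣ E - MvPowerSeries.C (MvPowerSeries.constantCoeff F) := by
    rw [MvPowerSeries.X_dvd_iff]
    intro m hm
    rw [map_sub, hE, MvPowerSeries.coeff_C]
    by_cases h : m = 0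
    · subst h
      simp
    · have : m 0 ≠ 0 := by
        intro h'
        apply h
        ext i
        fin_cases i <;> simp [h', hm]
      simp [h, this]
  obtain ⟨G, hG⟩ := h0
  obtain ⟨H, hH⟩ := h1
  refine ⟨MvPowerSeries.constantCoeff F, G, H, ?_⟩
  rw [← hG, ← hH, ← MvPowerSeries.c_eq_algebraMap]
  ring

/-- A homomorphism out of `k[[u, v]]` into a power series ring is determined by the images of the
variables as soon as these have no constant term. -/
theorem algHom_ext_of_constantCoeff_eq_zero {τ : Type*} (f g : PlaneRing k →ₐ[k] MvPowerSeries τ k)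
    (h0 : ∀ i, MvPowerSeries.constantCoeff (f (MvPowerSeries.X i)) = 0)
    (h : ∀ i, f (MvPowerSeries.X i) = g (MvPowerSeries.X i)) : f = g := by
  have key : ∀ (d : ℕ) (F : PlaneRing k), (d : ℕ∞) ≤ (f F - g F).order := by
    intro d
    induction d with
    | zero => simp
    | succ d ih =>
      intro F
      obtain ⟨c, G, H, rfl⟩ := exists_eq_C_add_X_mul_add_X_mul F
      have e : f (algebraMap k (PlaneRing k) c + MvPowerSeries.X 0 * G + MvPowerSeries.X 1 * H)
          - g (algebraMap k (PlaneRing k) c + MvPowerSeries.X 0 * G + MvPowerSeries.X 1 * H)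
          = f (MvPowerSeries.X 0) * (f G - g G) + f (MvPowerSeries.X 1) * (f H - g H) := by
        simp only [map_add, map_mul, AlgHom.commutes, ← h]
        ring
      have one_le : ∀ (i : Fin 2) (K : PlaneRing k),
          ((d + 1 : ℕ) : ℕ∞) ≤ (f (MvPowerSeries.X i) * (f K - g K)).order := by
        intro i K
        refine le_trans ?_ MvPowerSeries.le_order_mul
        rw [Nat.cast_add, add_comm]
        exact add_le_add (MvPowerSeries.one_le_order_iff_constCoeff_eq_zero.2 (h0 i)) (ih K)
      rw [e]
      exact le_trans (le_min (one_le 0 G) (one_le 1 H)) MvPowerSeries.min_order_le_add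
  ext1 F
  rw [← sub_eq_zero, ← MvPowerSeries.order_eq_top_iff]
  exact ENat.eq_top_iff_forall_ge.2 fun d => key d F

theorem constantCoeff_eq_zero_of_mem_linearForms {f : PlaneRing k} (hf : f ∈ linearForms k) :
    MvPowerSeries.constantCoeff f = 0 := by
  induction hf using Submodule.span_induction with
  | mem x hx => obtain ⟨i, rfl⟩ := hx; simp
  | zero => simp
  | add x y _ _ hx hy => simp [hx, hy]
  | smul a x _ hx =>
    rw [← MvPowerSeries.coeff_zero_eq_constantCoeff_apply] at hx ⊢
    simp [hx]

/-- Linear coordinates `s, t` on `k[[u, v]]`. -/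
structure IsLinearCoordinates (s t : PlaneRing k) : Prop where
  left_mem : s ∈ linearForms k
  right_mem : t ∈ linearForms k
  linearIndependent : LinearIndependent k ![s, t]

namespace IsLinearCoordinates

variable {s t : PlaneRing k} (h : IsLinearCoordinates s t)
include h

theorem exists_eq_of_mem_linearForms {f : PlaneRing k} (hf : f ∈ linearForms k) :
    ∃ a b : k, f = a • s + b • t := by
  have hle : Submodule.span k (Set.range ![s, t]) ≤ linearForms k := by
    rw [Submodule.span_le]
    rintro _ ⟨i, rfl⟩
    fin_cases i
    · exact h.left_mem
    · exact h.right_mem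
  have hfin : FiniteDimensional k (linearForms k) :=
    FiniteDimensional.span_of_finite k (Set.finite_range _)
  have heq : Submodule.span k (Set.range ![s, t]) = linearForms k := by
    apply Submodule.eq_of_le_of_finrank_le hle
    rw [finrank_span_eq_card h.linearIndependent]
    exact (finrank_range_le_card _)
  rw [← heq, Matrix.range_cons, Matrix.range_cons, Matrix.range_empty, Set.union_empty,
    Set.singleton_union, Submodule.mem_span_pair] at hf
  obtain ⟨a, b, e⟩ := hf
  exact ⟨a, b, e.symm⟩

theorem eq_zero_of_smul_add_smul_eq_zero {a b : k} (e : a • s + b • t = 0) : a = 0 ∧ b = 0 :=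
  LinearIndependent.pair_iff.1 h.linearIndependent a b e

end IsLinearCoordinates

theorem hasSubst_of_mem_linearForms {f g : PlaneRing k} (hf : f ∈ linearForms k)
    (hg : g ∈ linearForms k) : MvPowerSeries.HasSubst ![f, g] := by
  apply MvPowerSeries.hasSubst_of_constantCoeff_zero
  intro i
  fin_cases i
  · exact constantCoeff_eq_zero_of_mem_linearForms hf
  · exact constantCoeff_eq_zero_of_mem_linearForms hg

theorem hasSubst_zero_X : MvPowerSeries.HasSubst ![(0 : PowerSeries k), PowerSeries.X] := by
  apply MvPowerSeries.hasSubst_of_constantCoeff_zero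
  intro i
  fin_cases i
  · simp
  · exact PowerSeries.constantCoeff_X

/-- Restriction of power series in `u, v` to the line `u = 0`. -/
def restrictAxis (k : Type u) [Field k] : PlaneRing k →ₐ[k] PowerSeries k :=
  MvPowerSeries.substAlgHom hasSubst_zero_X

theorem X_dvd_of_restrictAxis_eq_zero {F : PlaneRing k} (hF : restrictAxis k F = 0) :
    MvPowerSeries.X 0 ∣ F := by
  rw [MvPowerSeries.X_dvd_iff]
  intro m hm
  have h1 := congrArg (MvPowerSeries.coeff (Finsupp.single () (m 1))) hF
  rw [restrictAxis, MvPowerSeries.substAlgHom_apply, MvPowerSeries.coeff_subst hasSubst_zero_X,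
    finsum_eq_single _ m] at h1
  · have e : (m.prod fun i n => (![(0 : PowerSeries k), PowerSeries.X] i) ^ n)
        = PowerSeries.X ^ (m 1) := by
      rw [Finsupp.prod_fintype _ _ (by simp)]
      simp [hm]
    rw [e] at h1
    have e2 : MvPowerSeries.coeff (Finsupp.single () (m 1)) (PowerSeries.X ^ (m 1) : PowerSeries k)
        = 1 := by
      change PowerSeries.coeff (m 1) _ = 1
      rw [PowerSeries.coeff_X_pow_self]
    rw [e2] at h1
    simpa using h1
  · intro d hd
    rw [Finsupp.prod_fintype _ _ (by simp)]
    simp only [Fin.prod_univ_two, Matrix.cons_val_zero, Matrix.cons_val_one]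
    by_cases hd0 : d 0 = 0
    · have hd1 : m 1 ≠ d 1 := by
        intro e
        apply hd
        ext i
        fin_cases i <;> simp [hd0, hm, e]
      have e2 : MvPowerSeries.coeff (Finsupp.single () (m 1))
          (PowerSeries.X ^ (d 1) : PowerSeries k) = 0 := by
        change PowerSeries.coeff (m 1) _ = 0
        rw [PowerSeries.coeff_X_pow, if_neg hd1]
      simp [hd0, e2]
    · simp [hd0]

namespace IsLinearCoordinates

variable {s t : PlaneRing k} (h : IsLinearCoordinates s t)
include h

/-- Restriction to the line `t = 0` with parameter `s`. -/
theorem exists_restriction : ∃ ev : PlaneRing k →ₐ[k] PowerSeries k,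
    ev s = PowerSeries.X ∧ ev t = 0 ∧ (∀ F, ev F = 0 → t ∣ F) ∧ Function.Surjective ev := by
  choose a b hab using fun i => h.exists_eq_of_mem_linearForms
    (Submodule.subset_span ⟨i, rfl⟩ : MvPowerSeries.X i ∈ linearForms k)
  have hX : ∀ i, (MvPowerSeries.X i : PlaneRing k) ∈ linearForms k :=
    fun i => Submodule.subset_span ⟨i, rfl⟩
  -- the substitution carrying the standard coordinates to `t, s`, and its inverse `θ'`
  let θ : PlaneRing k →ₐ[k] PlaneRing k :=
    MvPowerSeries.substAlgHom (hasSubst_of_mem_linearForms h.right_mem h.left_mem)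
  have hθ0 : θ (MvPowerSeries.X 0) = t := MvPowerSeries.substAlgHom_X _ _
  have hθ1 : θ (MvPowerSeries.X 1) = s := MvPowerSeries.substAlgHom_X _ _
  have hmem : ∀ i, a i • (MvPowerSeries.X 1 : PlaneRing k) + b i • MvPowerSeries.X 0
      ∈ linearForms k := fun i =>
    add_mem (Submodule.smul_mem _ _ (hX 1)) (Submodule.smul_mem _ _ (hX 0))
  let θ' : PlaneRing k →ₐ[k] PlaneRing k :=
    MvPowerSeries.substAlgHom (hasSubst_of_mem_linearForms (hmem 0) (hmem 1))
  have hθ' : ∀ i, θ' (MvPowerSeries.X i) = a i • MvPowerSeries.X 1 + b i • MvPowerSeries.X 0 := by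
    intro i
    refine (MvPowerSeries.substAlgHom_X _ _).trans ?_
    fin_cases i <;> rfl
  -- `θ'` reads off the coordinates of a linear form in the basis `s, t`
  have hlin : ∀ f ∈ linearForms k, ∀ x y : k, f = x • s + y • t →
      θ' f = x • MvPowerSeries.X 1 + y • MvPowerSeries.X 0 := by
    intro f hf
    induction hf using Submodule.span_induction with
    | mem f hf =>
      obtain ⟨i, rfl⟩ := hf
      intro x y e
      have e2 : (a i - x) • s + (b i - y) • t = 0 := by
        rw [sub_smul, sub_smul, sub_add_sub_comm, ← e, ← hab i, sub_self]
      obtain ⟨e3, e4⟩ := h.eq_zero_of_smul_add_smul_eq_zero e2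
      rw [hθ', sub_eq_zero.1 e3, sub_eq_zero.1 e4]
    | zero =>
      intro x y e
      obtain ⟨rfl, rfl⟩ := h.eq_zero_of_smul_add_smul_eq_zero e.symm
      simp
    | add f g hf hg ihf ihg =>
      intro x y e
      obtain ⟨x1, y1, e1⟩ := h.exists_eq_of_mem_linearForms hf
      have e2 : g = (x - x1) • s + (y - y1) • t := by
        rw [sub_smul, sub_smul, sub_add_sub_comm, ← e, ← e1, add_sub_cancel_left]
      rw [map_add, ihf _ _ e1, ihg _ _ e2]
      module
    | smul c f hf ih =>
      intro x y e
      obtain ⟨x1, y1, e1⟩ := h.exists_eq_of_mem_linearForms hf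
      have e2 : (c * x1 - x) • s + (c * y1 - y) • t = 0 := by
        have : c • f - c • f = 0 := sub_self _
        nth_rw 1 [e1] at this
        rw [e] at this
        rw [← this]
        module
      obtain ⟨e3, e4⟩ := h.eq_zero_of_smul_add_smul_eq_zero e2
      rw [map_smul, ih _ _ e1, ← sub_eq_zero.1 e3, ← sub_eq_zero.1 e4]
      module
  have hs' : θ' s = MvPowerSeries.X 1 := by simpa using hlin s h.left_mem 1 0 (by simp)
  have ht' : θ' t = MvPowerSeries.X 0 := by simpa using hlin t h.right_mem 0 1 (by simp)
  have hcomp : θ.comp θ' = AlgHom.id k (PlaneRing k) := by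
    have hi : ∀ i, (θ.comp θ') (MvPowerSeries.X i) = MvPowerSeries.X i := by
      intro i
      rw [AlgHom.comp_apply, hθ', map_add, map_smul, map_smul, hθ0, hθ1, ← hab]
    refine algHom_ext_of_constantCoeff_eq_zero _ _ (fun i => ?_) hi
    rw [hi]
    simp
  have r0 : restrictAxis k (MvPowerSeries.X 0) = 0 := MvPowerSeries.substAlgHom_X _ _
  have r1 : restrictAxis k (MvPowerSeries.X 1) = PowerSeries.X := MvPowerSeries.substAlgHom_X _ _
  refine ⟨(restrictAxis k).comp θ', ?_, ?_, ?_, ?_⟩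
  · simp [hs', r1]
  · simp [ht', r0]
  · intro F hF
    obtain ⟨G, hG⟩ := X_dvd_of_restrictAxis_eq_zero hF
    refine ⟨θ G, ?_⟩
    have := DFunLike.congr_fun hcomp F
    rw [AlgHom.comp_apply, AlgHom.id_apply] at this
    have hG' : θ' F = MvPowerSeries.X 0 * G := hG
    rw [← this, hG', map_mul, hθ0]
  · intro f
    -- a power series `f` in the parameter is the restriction of `f(s)`
    have hsub : PowerSeries.HasSubst s := PowerSeries.HasSubst.of_constantCoeff_zero
      (constantCoeff_eq_zero_of_mem_linearForms h.left_mem)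
    refine ⟨PowerSeries.subst s f, ?_⟩
    rw [AlgHom.comp_apply]
    have e1 : θ' (PowerSeries.subst s f) = PowerSeries.subst (MvPowerSeries.X 1) f := by
      rw [← hs']
      have hc := hasSubst_of_mem_linearForms (hmem 0) (hmem 1)
      have := MvPowerSeries.subst_comp_subst_apply (R := k) hsub.const hc f
      rw [PowerSeries.subst_def, PowerSeries.subst_def]
      change (MvPowerSeries.substAlgHom hc) _ = _
      rw [MvPowerSeries.substAlgHom_apply, this]
      simp only [θ', MvPowerSeries.substAlgHom_apply]
    rw [e1]
    have hX1 : PowerSeries.HasSubst (MvPowerSeries.X 1 : PlaneRing k) :=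
      PowerSeries.HasSubst.of_constantCoeff_zero (by simp)
    rw [restrictAxis, MvPowerSeries.substAlgHom_apply, PowerSeries.subst_def,
      MvPowerSeries.subst_comp_subst_apply hX1.const hasSubst_zero_X,
      MvPowerSeries.subst_X hasSubst_zero_X]
    change MvPowerSeries.subst (fun _ => PowerSeries.X) f = f
    have := MvPowerSeries.subst_self (σ := Unit) (R := k)
    exact congrFun this f

end IsLinearCoordinates

end PowerSeriesRing


/-! ### The completion along a principal prime -/

section CompletionAlongPrincipalPrime

/-- A local ring whose maximal ideal is generated by a non-nilpotent element and whose maximal-adic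
topology is separated is a discrete valuation ring. -/
theorem isDomain_and_isDiscreteValuationRing_of_span_singleton {T : Type*} [CommRing T]
    [IsLocalRing T] {t : T} (ht : IsLocalRing.maximalIdeal T = Ideal.span {t})
    (hnil : ∀ n : ℕ, t ^ n ≠ 0) (hsep : ∀ x : T, (∀ n : ℕ, t ^ n ∣ x) → x = 0) :
    ∃ _ : IsDomain T, IsDiscreteValuationRing T := by
  have hfac : ∀ x : T, x ≠ 0 → ∃ (n : ℕ) (v : T), IsUnit v ∧ x = t ^ n * v := by
    intro x hx
    by_contra hcon
    push Not at hcon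
    apply hx
    apply hsep
    intro n
    induction n with
    | zero => simp
    | succ n ih =>
      obtain ⟨v, hv⟩ := ih
      have hv' : ¬ IsUnit v := fun hu => hcon n v hu hv
      have : v ∈ Ideal.span {t} := by
        rw [← ht]
        exact (IsLocalRing.mem_maximalIdeal v).2 hv'
      obtain ⟨w, rfl⟩ := Ideal.mem_span_singleton.1 this
      exact ⟨w, by rw [hv]; ring⟩
  have hntriv : Nontrivial T := inferInstance
  have hdom : IsDomain T := by
    have : NoZeroDivisors T := ⟨by
      intro a b hab
      by_contra hcon
      push Not at hcon
      obtain ⟨n, v, hv, rfl⟩ := hfac a hcon.1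
      obtain ⟨m, w, hw, rfl⟩ := hfac b hcon.2
      have : t ^ (n + m) * (v * w) = 0 := by rw [← hab]; ring
      exact hnil (n + m) (((hv.mul hw).mul_left_eq_zero).1 this)⟩
    exact NoZeroDivisors.to_isDomain T
  refine ⟨hdom, ?_⟩
  have hirr : Irreducible t := by
    have ht0 : t ≠ 0 := by simpa using hnil 1
    apply Prime.irreducible
    rw [← Ideal.span_singleton_prime ht0, ← ht]
    infer_instance
  apply IsDiscreteValuationRing.ofHasUnitMulPowIrreducibleFactorization
  refine ⟨t, hirr, fun {x} hx => ?_⟩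
  obtain ⟨n, v, hv, rfl⟩ := hfac x hx
  exact ⟨n, hv.unit, rfl⟩

variable {k : Type u} [Field k]

variable {S : Type u} [CommRing S] [Algebra k S] (L : Ideal S) [L.IsPrime]

theorem evalₐ_completedMap (f : S →ₐ[k] S) (hf : L = L.comap f.toRingHom) (n : ℕ)
    (x : LocalCompletion L) (r : Localization.AtPrime L)
    (hr : AdicCompletion.evalₐ (IsLocalRing.maximalIdeal (Localization.AtPrime L)) n x
      = Ideal.Quotient.mk _ r) :
    AdicCompletion.evalₐ (IsLocalRing.maximalIdeal (Localization.AtPrime L)) n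
      (completedMap L f hf x) = Ideal.Quotient.mk _ (localMap L f hf r) := by
  rw [completedMap, AdicCompletion.evalₐ_liftAlgHom]
  · simp only [AlgHom.comp_apply, AlgHom.restrictScalars_apply]
    rw [hr]
    rfl
  · intro a b hle
    ext y
    obtain ⟨v, rfl⟩ := AdicCompletion.mk_surjective _ _ y
    have h := pow_le_comap_localMap L f hf a
      (Ideal.Quotient.eq.1 (AdicCompletion.Ideal.mk_eq_mk _ hle v))
    rw [Ideal.mem_comap, map_sub] at h
    simpa using Ideal.Quotient.eq.2 h

theorem completedMap_algebraMap (f : S →ₐ[k] S) (hf : L = L.comap f.toRingHom) (x : S) :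
    completedMap L f hf (algebraMap S (LocalCompletion L) x)
      = algebraMap S (LocalCompletion L) (f x) := by
  apply AdicCompletion.ext_evalₐ
  intro n
  have h : ∀ y : S, AdicCompletion.evalₐ (IsLocalRing.maximalIdeal (Localization.AtPrime L)) n
      (algebraMap S (LocalCompletion L) y)
        = Ideal.Quotient.mk _ (algebraMap S (Localization.AtPrime L) y) := fun y => by
    rw [IsScalarTower.algebraMap_apply S (Localization.AtPrime L) (LocalCompletion L),
      AlgHom.commutes]
    rfl
  rw [evalₐ_completedMap L f hf n _ _ (h x), h]
  refine congrArg (Ideal.Quotient.mk _) ?_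
  exact Localization.localRingHom_to_map L L f.toRingHom hf x

theorem completedMap_id (hf : L = L.comap (AlgHom.id k S).toRingHom) :
    completedMap L (AlgHom.id k S) hf = AlgHom.id k _ := by
  ext1 x
  apply AdicCompletion.ext_evalₐ
  intro n
  obtain ⟨r, hr⟩ := Ideal.Quotient.mk_surjective (AdicCompletion.evalₐ _ n x)
  rw [evalₐ_completedMap L _ hf n _ _ hr.symm, AlgHom.id_apply, ← hr]
  refine congrArg (Ideal.Quotient.mk _) ?_
  exact DFunLike.congr_fun (Localization.localRingHom_id L) r

theorem completedMap_comp (f g : S →ₐ[k] S) (hf : L = L.comap f.toRingHom)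
    (hg : L = L.comap g.toRingHom) (hfg : L = L.comap (f.comp g).toRingHom) :
    completedMap L (f.comp g) hfg = (completedMap L f hf).comp (completedMap L g hg) := by
  ext1 x
  apply AdicCompletion.ext_evalₐ
  intro n
  obtain ⟨r, hr⟩ := Ideal.Quotient.mk_surjective (AdicCompletion.evalₐ _ n x)
  rw [AlgHom.comp_apply, evalₐ_completedMap L _ hfg n _ _ hr.symm,
    evalₐ_completedMap L f hf n _ _ (evalₐ_completedMap L g hg n _ _ hr.symm)]
  refine congrArg (Ideal.Quotient.mk _) ?_
  exact DFunLike.congr_fun (Localization.localRingHom_comp L L L g.toRingHom hg f.toRingHom hf) r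

variable {κ : Type u} [Field κ] [Algebra k κ]

/-- The completion along a principal prime `(t)` of a noetherian domain is a discrete valuation ring
with uniformiser `t`, and it has the same residue field as the local ring. -/
theorem localCompletion_structure [IsDomain S] [IsNoetherianRing S] {t : S} (ht0 : t ≠ 0)
    (hL : L = Ideal.span {t}) (ev : S →ₐ[k] κ) (hker : ∀ F, ev F = 0 ↔ t ∣ F)
    (hfrac : ∀ z : κ, ∃ F G, ev G ≠ 0 ∧ z * ev G = ev F) :
    ∃ (_ : IsDomain (LocalCompletion L)) (_ : IsDiscreteValuationRing (LocalCompletion L))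
      (êv : LocalCompletion L →ₐ[k] κ),
      (∀ F, êv (algebraMap S _ F) = ev F) ∧ Function.Surjective êv ∧
        ∀ z, êv z = 0 ↔ algebraMap S _ t ∣ z := by
  have hmemL : ∀ F, F ∈ L ↔ ev F = 0 := fun F => by rw [hL, Ideal.mem_span_singleton, hker]
  have hnoeth : IsNoetherianRing (Localization.AtPrime L) :=
    IsLocalization.isNoetherianRing L.primeCompl (Localization.AtPrime L) (R := S) inferInstance
  have hdomL : IsDomain (Localization.AtPrime L) :=
    IsLocalization.isDomain_of_le_nonZeroDivisors (Localization.AtPrime L)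
      (Ideal.primeCompl_le_nonZeroDivisors L)
  have hmax : IsLocalRing.maximalIdeal (Localization.AtPrime L)
      = Ideal.span {algebraMap S (Localization.AtPrime L) t} := by
    rw [← Localization.AtPrime.map_eq_maximalIdeal]
    refine (congrArg (Ideal.map _) hL).trans ?_
    rw [Ideal.map_span, Set.image_singleton]
  have hmaxhat : IsLocalRing.maximalIdeal (LocalCompletion L)
      = Ideal.span {algebraMap S (LocalCompletion L) t} := by
    refine AdicCompletion.maximalIdeal_eq_map.trans ((congrArg (Ideal.map _) hmax).trans ?_)
    rw [Ideal.map_span, Set.image_singleton]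
    rfl
  have hinjL : Function.Injective (algebraMap S (Localization.AtPrime L)) :=
    IsLocalization.injective _ (Ideal.primeCompl_le_nonZeroDivisors L)
  -- the uniformiser is not nilpotent: this is seen in the quotients of the local ring, where it
  -- would otherwise be a unit
  have hnil : ∀ d : ℕ, algebraMap S (LocalCompletion L) t ^ d ≠ 0 := by
    intro d hd
    have h1 := congrArg (AdicCompletion.evalₐ
      (IsLocalRing.maximalIdeal (Localization.AtPrime L)) (d + 1)) hd
    rw [map_pow, IsScalarTower.algebraMap_apply S (Localization.AtPrime L) (LocalCompletion L),
      AlgHom.commutes, map_zero, ← map_pow] at h1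
    have h2 := Ideal.Quotient.eq_zero_iff_mem.1 h1
    rw [hmax, Ideal.span_singleton_pow, Ideal.mem_span_singleton] at h2
    obtain ⟨w, hw⟩ := h2
    set t' := algebraMap S (Localization.AtPrime L) t with ht'
    have ht'0 : t' ≠ 0 := by
      rw [ht', Ne, map_eq_zero_iff _ hinjL]
      exact ht0
    have h3 : t' ^ d * (1 - t' * w) = 0 := by
      rw [mul_sub, mul_one, sub_eq_zero]
      calc t' ^ d = t' ^ (d + 1) * w := hw
        _ = _ := by ring
    have h4 : 1 - t' * w = 0 := (mul_eq_zero.1 h3).resolve_left (pow_ne_zero _ ht'0)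
    have h5 : IsUnit t' := IsUnit.of_mul_eq_one _ (sub_eq_zero.1 h4).symm
    have h6 : t' ∈ IsLocalRing.maximalIdeal (Localization.AtPrime L) := by
      rw [hmax]
      exact Ideal.mem_span_singleton_self _
    exact h6 h5
  have hsep : ∀ x : LocalCompletion L,
      (∀ d : ℕ, algebraMap S (LocalCompletion L) t ^ d ∣ x) → x = 0 := by
    intro x hx
    apply IsHausdorff.haus (inferInstance : IsHausdorff
      (IsLocalRing.maximalIdeal (LocalCompletion L)) (LocalCompletion L))
    intro d
    rw [SModEq.zero, hmaxhat, Ideal.span_singleton_pow, smul_eq_mul, Ideal.mul_top]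
    exact Ideal.mem_span_singleton.2 (hx d)
  obtain ⟨hdom, hdvr⟩ := isDomain_and_isDiscreteValuationRing_of_span_singleton hmaxhat hnil hsep
  -- the map to the residue field factors through the completion because it kills the maximal ideal
  -- of the local ring
  let evL : Localization.AtPrime L →+* κ :=
    IsLocalization.lift (M := L.primeCompl) (g := (ev : S →+* κ)) fun y => by
      rw [isUnit_iff_ne_zero]
      exact fun h => y.2 ((hmemL _).2 h)
  have hevL : ∀ F, evL (algebraMap S _ F) = ev F := fun F => IsLocalization.lift_eq _ _
  have hle : IsLocalRing.maximalIdeal (Localization.AtPrime L) ≤ RingHom.ker evL := by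
    rw [hmax, Ideal.span_singleton_le_iff_mem, RingHom.mem_ker, hevL, hker]
  let e0 : LocalCompletion L →+* κ :=
    (Ideal.Quotient.lift _ evL fun a ha => hle ha).comp
      (AdicCompletion.evalOneₐ (IsLocalRing.maximalIdeal (Localization.AtPrime L))).toRingHom
  have he0 : ∀ F, e0 (algebraMap S _ F) = ev F := by
    intro F
    rw [← hevL]
    rfl
  let êv : LocalCompletion L →ₐ[k] κ :=
    { e0 with
      commutes' := fun c => by
        change e0 _ = _
        rw [IsScalarTower.algebraMap_apply k S (LocalCompletion L), he0, AlgHom.commutes] }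
  have hêv : ∀ F, êv (algebraMap S _ F) = ev F := he0
  refine ⟨hdom, hdvr, êv, hêv, ?_, ?_⟩
  · intro z
    obtain ⟨F, G, hG, e⟩ := hfrac z
    have hGu : IsUnit (algebraMap S (LocalCompletion L) G) := by
      by_contra hcon
      have := (IsLocalRing.mem_maximalIdeal _).2 hcon
      rw [hmaxhat, Ideal.mem_span_singleton] at this
      obtain ⟨w, hw⟩ := this
      apply hG
      rw [← hêv, hw, map_mul, hêv, (hker t).2 dvd_rfl, zero_mul]
    refine ⟨algebraMap S _ F * (hGu.unit⁻¹ : (LocalCompletion L)ˣ), ?_⟩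
    have e2 : êv (algebraMap S _ F * (hGu.unit⁻¹ : (LocalCompletion L)ˣ)) * ev G = z * ev G := by
      rw [← hêv G, ← map_mul, mul_assoc, IsUnit.val_inv_mul, mul_one, hêv, hêv, e]
    exact mul_right_cancel₀ hG e2
  · intro z
    rw [← Ideal.mem_span_singleton, ← hmaxhat, ← RingHom.mem_ker]
    -- the kernel contains the maximal ideal, hence equals it
    have : RingHom.ker êv = IsLocalRing.maximalIdeal (LocalCompletion L) := by
      apply (IsLocalRing.maximalIdeal.isMaximal _).eq_of_le (RingHom.ker_ne_top _) ?_ |>.symm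
      rw [hmaxhat, Ideal.span_singleton_le_iff_mem, RingHom.mem_ker, hêv, hker]
    rw [this]

/-- The map induced on the residue field of the completion is determined by the map on the
coordinate ring of the curve. -/
theorem residue_completedMap {t : S} (ev : S →ₐ[k] κ)
    (hker : ∀ F, ev F = 0 ↔ t ∣ F)
    (hfrac : ∀ z : κ, ∃ F G, ev G ≠ 0 ∧ z * ev G = ev F) (êv : LocalCompletion L →ₐ[k] κ)
    (hêv : ∀ F, êv (algebraMap S _ F) = ev F)
    (hkerhat : ∀ z, êv z = 0 ↔ algebraMap S _ t ∣ z)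
    (f : S →ₐ[k] S) (hf : L = L.comap f.toRingHom) (φ : κ →+* κ)
    (hφ : ∀ F, ev (f F) = φ (ev F)) (z : LocalCompletion L) :
    êv (completedMap L f hf z) = φ (êv z) := by
  obtain ⟨F, G, hG, e⟩ := hfrac (êv z)
  have h1 : êv (z * algebraMap S _ G - algebraMap S _ F) = 0 := by
    rw [map_sub, map_mul, hêv, hêv, e, sub_self]
  obtain ⟨w, hw⟩ := (hkerhat _).1 h1
  have h2 := congrArg (fun y => êv (completedMap L f hf y)) hw
  simp only [map_sub, map_mul, completedMap_algebraMap, hêv] at h2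
  have h3 : ev (f t) = 0 := by rw [hφ, (hker t).2 dvd_rfl, map_zero]
  rw [h3, zero_mul, hφ, hφ, sub_eq_zero, ← e, map_mul] at h2
  exact mul_right_cancel₀ ((map_ne_zero φ).2 hG) h2

end CompletionAlongPrincipalPrime


/-! ### A normal form for two operators commuting up to a root of unity -/

section NormalForm

variable {k : Type u} [Field k] [IsAlgClosed k] [CharZero k]
  {V : Type u} [AddCommGroup V] [Module k V] [FiniteDimensional k V]

theorem iSup_eigenspace_eq_top_of_pow_eq_smul (A : Module.End k V) {n : ℕ} (hn : n ≠ 0) {a : k}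
    (ha : a ≠ 0) (hA : A ^ n = a • 1) : ⨆ μ, A.eigenspace μ = ⊤ := by
  have hss : A.IsSemisimple := by
    apply Module.End.isSemisimple_of_squarefree_aeval_eq_zero
      (p := Polynomial.X ^ n - Polynomial.C a)
    · exact (Polynomial.separable_X_pow_sub_C a (by exact_mod_cast hn) ha).squarefree
    · simp [hA, Algebra.algebraMap_eq_smul_one]
  rw [← Module.End.iSup_maxGenEigenspace_eq_top A]
  exact iSup_congr fun μ => (hss.isFinitelySemisimple.maxGenEigenspace_eq_eigenspace μ).symm

theorem exists_basis_eigenvectors (A : Module.End k V) {n : ℕ} (hn : n ≠ 0) {a : k}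
    (ha : a ≠ 0) (hA : A ^ n = a • 1) :
    ∃ (w : Module.Basis (Fin (Module.finrank k V)) k V) (μ : Fin (Module.finrank k V) → k),
      ∀ i, A (w i) = μ i • w i := by
  classical
  have hint := DirectSum.isInternal_submodule_of_iSupIndep_of_iSup_eq_top A.eigenspaces_iSupIndep
    (iSup_eigenspace_eq_top_of_pow_eq_smul A hn ha hA)
  let w0 := hint.collectedBasis fun μ => Module.finBasis k (A.eigenspace μ)
  have : Fintype (Σ μ : k, Fin (Module.finrank k (A.eigenspace μ))) :=
    Module.Basis.fintypeIndexOfRankLtAleph0 w0 (Module.rank_lt_aleph0 k V)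
  have hcard : Fintype.card (Σ μ : k, Fin (Module.finrank k (A.eigenspace μ)))
      = Module.finrank k V := (Module.finrank_eq_card_basis w0).symm
  let ε := Fintype.equivFinOfCardEq hcard
  refine ⟨w0.reindex ε, fun i => (ε.symm i).1, fun i => ?_⟩
  rw [Module.Basis.reindex_apply]
  exact Module.End.mem_eigenspace_iff.1 (hint.collectedBasis_mem _ (ε.symm i))

omit [IsAlgClosed k] [CharZero k] in
/-- Representatives for the orbits of multiplication by a root of unity. -/
theorem exists_orbit_representative {e : ℕ} (he : e ≠ 0) {η : k} (hη : η ^ e = 1) :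
    ∃ rep : k → k, (∀ x, ∃ i < e, x = η ^ i * rep x) ∧ ∀ (i : ℕ) (x : k), rep (η ^ i * x) = rep x := by
  let st : Setoid k :=
    { r := fun x y => ∃ i : ℕ, y = η ^ i * x
      iseqv :=
        { refl := fun x => ⟨0, by simp⟩
          symm := by
            rintro x y ⟨i, rfl⟩
            refine ⟨(e - 1) * i, ?_⟩
            rw [← mul_assoc, ← pow_add, ← Nat.succ_mul, Nat.succ_eq_add_one,
              Nat.sub_add_cancel (Nat.pos_of_ne_zero he), pow_mul, hη, one_pow, one_mul]
          trans := by
            rintro x y z ⟨i, rfl⟩ ⟨j, rfl⟩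
            exact ⟨j + i, by rw [pow_add, mul_assoc]⟩ } }
  refine ⟨fun x => (Quotient.mk st x).out, fun x => ?_, fun i x => ?_⟩
  · obtain ⟨i, hi⟩ := Quotient.exact (Quotient.out_eq (Quotient.mk st x))
    refine ⟨i % e, Nat.mod_lt _ (Nat.pos_of_ne_zero he), ?_⟩
    rw [← pow_eq_pow_mod i hη]
    exact hi
  · refine congrArg Quotient.out (Quotient.sound (?_ : ∃ j : ℕ, _ = _)).symm
    exact ⟨i, rfl⟩

omit [IsAlgClosed k] [CharZero k] [FiniteDimensional k V] in
theorem injective_of_pow_eq_smul {B : Module.End k V} {N : ℕ} (hN : N ≠ 0) {b : k} (hb : b ≠ 0)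
    (hB : B ^ N = b • 1) (i : ℕ) : Function.Injective (B ^ i) := by
  have hBinj : Function.Injective B := by
    intro x y hxy
    have hz : ∀ z, b • z = (B ^ (N - 1)) (B z) := fun z => by
      have : (B ^ (N - 1) * B) z = b • z := by
        rw [← pow_succ, Nat.sub_add_cancel (Nat.pos_of_ne_zero hN), hB]
        simp
      rw [← this]; rfl
    have : b • x = b • y := by rw [hz, hz, hxy]
    exact smul_right_injective V hb this
  induction i with
  | zero => exact fun x y h => h
  | succ i ih =>
    rw [pow_succ', Module.End.coe_mul]
    exact hBinj.comp ih

omit [IsAlgClosed k] [CharZero k] [FiniteDimensional k V] in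
theorem pow_apply_mem_eigenspace {A B : Module.End k V} {η : k} (hAB : A * B = η • (B * A))
    (i : ℕ) {μ : k} {v : V} (hv : v ∈ A.eigenspace μ) : (B ^ i) v ∈ A.eigenspace (η ^ i * μ) := by
  have hAB' : ∀ v, A (B v) = η • B (A v) := fun v => by
    have := DFunLike.congr_fun hAB v
    simpa using this
  induction i with
  | zero => simpa using hv
  | succ i ih =>
    rw [Module.End.mem_eigenspace_iff] at ih ⊢
    rw [pow_succ', Module.End.mul_apply, hAB', ih, map_smul, smul_smul, pow_succ', mul_assoc]

omit [IsAlgClosed k] [CharZero k] [FiniteDimensional k V] in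
theorem linearIndependent_orbits {A B : Module.End k V} {N : ℕ} (hN : N ≠ 0) {b η : k}
    (hb : b ≠ 0) (hB : B ^ N = b • 1) {e : ℕ} [NeZero e] (hAB : A * B = η • (B * A))
    {R : Type u} [Fintype R] (r : R → k) (d : R → ℕ)
    (hinj : Function.Injective fun p : ZMod e × R => η ^ p.1.val * r p.2)
    (w : ∀ ρ, Module.Basis (Fin (d ρ)) k (A.eigenspace (r ρ)))
    (γ : (Σ ρ, Fin (d ρ)) → k) (hγ : ∀ l, γ l ≠ 0) :
    LinearIndependent k fun q : ZMod e × (Σ ρ, Fin (d ρ)) =>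
      (γ q.2)⁻¹ ^ q.1.val • (B ^ q.1.val) (w q.2.1 q.2.2 : V) := by
  have hind := A.eigenspaces_iSupIndep.comp hinj
  rw [Fintype.linearIndependent_iff]
  intro g hg
  rw [iSupIndep_iff_finsetSum_eq_zero_imp_eq_zero] at hind
  let S : ZMod e × R → V := fun p => (B ^ p.1.val)
    ((∑ j, (g (p.1, ⟨p.2, j⟩) * (γ ⟨p.2, j⟩)⁻¹ ^ p.1.val) • w p.2 j : A.eigenspace (r p.2)) : V)
  have hS : ∑ p, S p = 0 := by
    rw [← hg, Fintype.sum_prod_type, Fintype.sum_prod_type]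
    refine Finset.sum_congr rfl fun i _ => ?_
    rw [Fintype.sum_sigma]
    refine Finset.sum_congr rfl fun ρ _ => ?_
    simp only [S, AddSubmonoidClass.coe_finsetSum, Submodule.coe_smul, map_sum, map_smul,
      smul_smul]
  have hS0 : ∀ p, S p = 0 := fun p => hind Finset.univ S
    (fun p _ => pow_apply_mem_eigenspace hAB _ (Subtype.mem _)) hS p (Finset.mem_univ p)
  rintro ⟨i, ⟨ρ, j⟩⟩
  have h3 : (∑ j, (g (i, ⟨ρ, j⟩) * (γ ⟨ρ, j⟩)⁻¹ ^ i.val) • w ρ j) = 0 :=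
    Subtype.ext (injective_of_pow_eq_smul hN hb hB i.val ((hS0 (i, ρ)).trans (by simp)))
  have h4 := Fintype.linearIndependent_iff.1 (w ρ).linearIndependent _ h3 j
  exact (mul_eq_zero.1 h4).resolve_right (pow_ne_zero _ (inv_ne_zero (hγ _)))

theorem span_orbits {A B : Module.End k V} {n N : ℕ} (hn : n ≠ 0) (hN : N ≠ 0) {a b η : k}
    (ha : a ≠ 0) (hb : b ≠ 0) (hA : A ^ n = a • 1) (hB : B ^ N = b • 1) {e : ℕ} [NeZero e]
    (hη : η ^ e = 1) (hAB : A * B = η • (B * A)) {R : Type u} [Fintype R] (r : R → k) (d : R → ℕ)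
    (hcover : ∀ μ, A.HasEigenvalue μ → ∃ i < e, ∃ ρ, μ = η ^ i * r ρ)
    (w : ∀ ρ, Module.Basis (Fin (d ρ)) k (A.eigenspace (r ρ)))
    (γ : (Σ ρ, Fin (d ρ)) → k) (hγ : ∀ l, γ l ≠ 0) :
    ⊤ ≤ Submodule.span k (Set.range fun q : ZMod e × (Σ ρ, Fin (d ρ)) =>
      (γ q.2)⁻¹ ^ q.1.val • (B ^ q.1.val) (w q.2.1 q.2.2 : V)) := by
  rw [← iSup_eigenspace_eq_top_of_pow_eq_smul A hn ha hA, iSup_le_iff]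
  intro μ v hv
  by_cases hv0 : v = 0
  · rw [hv0]; exact Submodule.zero_mem _
  obtain ⟨i, hie, ρ, hi⟩ := hcover μ (Module.End.hasEigenvalue_of_hasEigenvector ⟨hv, hv0⟩)
  have hle : i ≤ N * e := hie.le.trans (Nat.le_mul_of_pos_left e (Nat.pos_of_ne_zero hN))
  -- `v = B ^ i v'` with `v'` in the eigenspace of the representative
  have hBN : ∀ x, (B ^ i) ((B ^ (N * e - i)) x) = b ^ e • x := by
    intro x
    rw [← Module.End.mul_apply, ← pow_add, Nat.add_sub_cancel' hle, pow_mul, hB, smul_pow, one_pow]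
    rfl
  obtain ⟨v', hv'mem, rfl⟩ : ∃ v' ∈ A.eigenspace (r ρ), (B ^ i) v' = v := by
    refine ⟨(b ^ e)⁻¹ • (B ^ (N * e - i)) v, ?_, ?_⟩
    · have h1 := pow_apply_mem_eigenspace hAB (N * e - i) hv
      have h2 : η ^ (N * e - i) * μ = r ρ := by
        rw [hi, ← mul_assoc, ← pow_add, Nat.sub_add_cancel hle, mul_comm N, pow_mul, hη, one_pow,
          one_mul]
      rw [h2] at h1
      exact Submodule.smul_mem _ _ h1
    · rw [map_smul, hBN, smul_smul, inv_mul_cancel₀ (pow_ne_zero _ hb), one_smul]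
  have h6 : v' = ∑ j, (w ρ).repr ⟨v', hv'mem⟩ j • (w ρ j : V) := by
    have := congrArg Subtype.val ((w ρ).sum_repr ⟨v', hv'mem⟩)
    rw [AddSubmonoidClass.coe_finsetSum] at this
    exact this.symm
  rw [h6, map_sum]
  refine Submodule.sum_mem _ fun j _ => ?_
  rw [map_smul]
  apply Submodule.smul_mem
  have h7 : (B ^ i) (w ρ j : V) = γ ⟨ρ, j⟩ ^ i • ((γ ⟨ρ, j⟩)⁻¹ ^ (i : ZMod e).val •
      (B ^ (i : ZMod e).val) (w ρ j : V)) := by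
    rw [ZMod.val_natCast, Nat.mod_eq_of_lt hie, smul_smul, ← mul_pow, mul_inv_cancel₀ (hγ _),
      one_pow, one_smul]
  rw [h7]
  exact Submodule.smul_mem _ _ (Submodule.subset_span ⟨((i : ZMod e), ⟨ρ, j⟩), rfl⟩)

/-- A basis of an eigenspace of `A` consisting of eigenvectors of `B ^ e`, where `B ^ e` commutes
with `A`. The eigenvalues are recorded through `e`-th roots. -/
theorem exists_basis_eigenspace {A B : Module.End k V} {N : ℕ} (hN : N ≠ 0) {b η : k}
    (hb : b ≠ 0) (hB : B ^ N = b • 1) {e : ℕ} (he : e ≠ 0) (hη : η ^ e = 1)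
    (hAB : A * B = η • (B * A)) (α : k) :
    ∃ (w : Module.Basis (Fin (Module.finrank k (A.eigenspace α))) k (A.eigenspace α))
      (γ : Fin (Module.finrank k (A.eigenspace α)) → k),
      ∀ j, γ j ≠ 0 ∧ (B ^ e) (w j : V) = γ j ^ e • (w j : V) := by
  have hst : ∀ v ∈ A.eigenspace α, (B ^ e) v ∈ A.eigenspace α := fun v hv => by
    simpa [hη] using pow_apply_mem_eigenspace hAB e hv
  have hpow : ((B ^ e).restrict hst) ^ N = (b ^ e) • 1 := by
    ext v
    rw [Module.End.pow_restrict N]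
    simp only [LinearMap.restrict_apply, LinearMap.smul_apply, Module.End.one_apply,
      Submodule.coe_smul]
    rw [← pow_mul, mul_comm, pow_mul, hB, smul_pow, one_pow]
    rfl
  obtain ⟨w, β, h⟩ := exists_basis_eigenvectors ((B ^ e).restrict hst) hN (pow_ne_zero e hb) hpow
  choose γ hγ using fun j => IsAlgClosed.exists_pow_nat_eq (β j) (Nat.pos_of_ne_zero he)
  have h' : ∀ j, (B ^ e) (w j : V) = γ j ^ e • (w j : V) := fun j => by
    rw [hγ]
    exact congrArg Subtype.val (h j)
  refine ⟨w, γ, fun j => ⟨fun h0 => ?_, h' j⟩⟩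
  have h1 := h' j
  rw [h0, zero_pow he, zero_smul] at h1
  exact (w.ne_zero j) (Subtype.ext (injective_of_pow_eq_smul hN hb hB e (by rw [h1]; simp)))

/-- Two operators of finite order up to scalars with `A * B = η • (B * A)`, `η` a primitive `e`-th
root of unity, are simultaneously monomial: in a basis indexed by `ZMod e × F`, the operator `A` is
diagonal and `B` shifts the first index, up to a scalar depending only on the second one. The label
`ℓ` numbers the vectors `u (0, l)` that belong to the same eigenspace. -/
theorem exists_basis_of_commute_up_to_root (A B : Module.End k V) {n N : ℕ} (hn : n ≠ 0)
    (hN : N ≠ 0) {a b η : k} (ha : a ≠ 0) (hb : b ≠ 0) (hA : A ^ n = a • 1) (hB : B ^ N = b • 1)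
    {e : ℕ} [NeZero e] (hη : IsPrimitiveRoot η e) (hAB : A * B = η • (B * A)) :
    ∃ (F : Type u) (_ : Fintype F) (_ : DecidableEq F) (u : Module.Basis (ZMod e × F) k V)
      (α c : F → k) (ℓ : F → ℕ),
      (∀ i l, A (u (i, l)) = (η ^ i.val * α l) • u (i, l)) ∧
      (∀ i l, B (u (i, l)) = c l • u (i + 1, l)) ∧
      (∀ l, ℓ l < Module.finrank k (A.eigenspace (α l))) ∧
      ∀ l l' (i : ℕ), ℓ l = ℓ l' → α l' = η ^ i * α l → l = l' := by
  classical
  have he : e ≠ 0 := NeZero.ne e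
  obtain ⟨rep, hrep, hrep2⟩ := exists_orbit_representative he hη.pow_eq_one
  have : Finite {μ : k // A.HasEigenvalue μ} :=
    inferInstanceAs (Finite (Module.End.Eigenvalues A))
  have hfinR : Finite {α : k // A.HasEigenvalue α ∧ rep α = α} := Finite.of_injective
    (fun x => (⟨x.1, x.2.1⟩ : {μ : k // A.HasEigenvalue μ})) fun x y hxy =>
      Subtype.ext (congrArg (fun z => z.1) hxy)
  -- one eigenvalue `r ρ` of `A` for each orbit of multiplication by `η` on the eigenvalues
  obtain ⟨R, hR, r, hr1, hr2, hr3⟩ : ∃ (R : Type u) (_ : Fintype R) (r : R → k),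
      Function.Injective r ∧ (∀ ρ, A.HasEigenvalue (r ρ) ∧ rep (r ρ) = r ρ) ∧
        ∀ α, A.HasEigenvalue α → rep α = α → ∃ ρ, r ρ = α :=
    ⟨_, Fintype.ofFinite {α : k // A.HasEigenvalue α ∧ rep α = α}, Subtype.val,
      Subtype.val_injective, fun ρ => ρ.2, fun α h1 h2 => ⟨⟨α, h1, h2⟩, rfl⟩⟩
  -- `B ^ e` commutes with `A`: its eigenvectors in the representative eigenspaces start the cycles
  choose w γ hw using fun ρ => exists_basis_eigenspace hN hb hB he hη.pow_eq_one hAB (r ρ)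
  have hA0 : ∀ v : V, v ≠ 0 → A v ≠ 0 := fun v hv h0 => hv (by
    have := injective_of_pow_eq_smul hn ha hA 1
    rw [pow_one] at this
    exact this (by rw [h0, map_zero]))
  -- `B` moves the eigenspace of `μ` to that of `η * μ`; the eigenvalues `η ^ i * r ρ` with `i < e`
  -- are distinct and exhaust all eigenvalues
  have hinj : Function.Injective fun p : ZMod e × R => η ^ p.1.val * r p.2 := by
    rintro ⟨i, ρ⟩ ⟨j, ρ'⟩ h
    simp only at h
    have h1 : r ρ = r ρ' := by
      rw [← (hr2 ρ).2, ← (hr2 ρ').2, ← hrep2 i.val, h, hrep2]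
    have hα0 : r ρ ≠ 0 := by
      intro h0
      obtain ⟨v, hv⟩ := (hr2 ρ).1.exists_hasEigenvector
      exact hA0 v hv.2 (by rw [hv.apply_eq_smul, h0, zero_smul])
    rw [← h1] at h
    have h2 := hη.pow_inj (ZMod.val_lt i) (ZMod.val_lt j) (mul_right_cancel₀ hα0 h)
    exact Prod.ext (ZMod.val_injective e h2) (hr1 h1)
  have hcover : ∀ μ, A.HasEigenvalue μ → ∃ i < e, ∃ ρ, μ = η ^ i * r ρ := by
    intro μ hμ
    obtain ⟨i, hie, hi⟩ := hrep μ
    have hev : A.HasEigenvalue (rep μ) := by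
      obtain ⟨v, hv⟩ := hμ.exists_hasEigenvector
      have h1 := pow_apply_mem_eigenspace hAB (e - i) hv.1
      have h2 : η ^ (e - i) * μ = rep μ := by
        nth_rw 1 [hi]
        rw [← mul_assoc, ← pow_add, Nat.sub_add_cancel hie.le, hη.pow_eq_one, one_mul]
      rw [h2] at h1
      refine Module.End.hasEigenvalue_of_hasEigenvector ⟨h1, fun h0 => hv.2 ?_⟩
      exact injective_of_pow_eq_smul hN hb hB (e - i) (by rw [h0, map_zero])
    have hrr : rep (rep μ) = rep μ := by
      nth_rw 2 [hi]
      rw [hrep2]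
    obtain ⟨ρ, hρ⟩ := hr3 _ hev hrr
    exact ⟨i, hie, ρ, by rw [hρ]; exact hi⟩
  let γ' : (Σ ρ, Fin (Module.finrank k (A.eigenspace (r ρ)))) → k := fun l => γ l.1 l.2
  have hγ' : ∀ l, γ' l ≠ 0 := fun l => (hw l.1 l.2).1
  have hmem : ∀ q : ZMod e × (Σ ρ, Fin (Module.finrank k (A.eigenspace (r ρ)))),
      (γ' q.2)⁻¹ ^ q.1.val • (B ^ q.1.val) (w q.2.1 q.2.2 : V)
        ∈ A.eigenspace (η ^ q.1.val * r q.2.1) := fun q =>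
    Submodule.smul_mem _ _ (pow_apply_mem_eigenspace hAB _ (Subtype.mem _))
  refine ⟨_, inferInstance, inferInstance, Module.Basis.mk
    (linearIndependent_orbits hN hb hB hAB r _ hinj w γ' hγ')
    (span_orbits hn hN ha hb hA hB hη.pow_eq_one hAB r _ hcover w γ' hγ'), fun l => r l.1, γ',
    fun l => l.2, ?_, ?_, fun l => l.2.2, ?_⟩
  · intro i l
    rw [Module.Basis.mk_apply]
    exact Module.End.mem_eigenspace_iff.1 (hmem (i, l))
  · intro i l
    rw [Module.Basis.mk_apply, Module.Basis.mk_apply]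
    have hstep : B ((γ' l)⁻¹ ^ i.val • (B ^ i.val) (w l.1 l.2 : V))
        = γ' l • ((γ' l)⁻¹ ^ (i.val + 1) • (B ^ (i.val + 1)) (w l.1 l.2 : V)) := by
      rw [map_smul, smul_smul, pow_succ' B, Module.End.mul_apply, pow_succ, mul_comm (_ ^ i.val),
        ← mul_assoc, mul_inv_cancel₀ (hγ' _), one_mul]
    refine hstep.trans (congrArg (γ' l • ·) ?_)
    have hlt := ZMod.val_lt i
    -- at the end of the cycle `B ^ e` acts by the eigenvalue `γ ^ e`, which the normalisation by
    -- powers of `γ` absorbs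
    rcases Nat.lt_or_ge (i.val + 1) e with h1 | h1
    · have h2 : (i + 1).val = i.val + 1 := by
        rw [ZMod.val_add, ZMod.val_one_eq_one_mod, Nat.add_mod_mod, Nat.mod_eq_of_lt h1]
      simp only [h2]
    · have h2 : i.val + 1 = e := by omega
      have h3 : (i + 1).val = 0 := by
        rw [ZMod.val_add, ZMod.val_one_eq_one_mod, Nat.add_mod_mod, h2, Nat.mod_self]
      simp only [h2, h3]
      rw [(hw l.1 l.2).2, smul_smul, inv_pow, inv_mul_cancel₀ (pow_ne_zero _ (hγ' l))]
      simp
  · rintro ⟨ρ, j⟩ ⟨ρ', j'⟩ i hj hα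
    simp only at hj hα
    have h1 : r ρ = r ρ' := by
      rw [← (hr2 ρ).2, ← (hr2 ρ').2, hα, hrep2]
    obtain rfl : ρ = ρ' := hr1 h1
    exact Sigma.ext rfl (heq_of_eq (Fin.ext hj))

omit [IsAlgClosed k] [CharZero k] [FiniteDimensional k V] in
theorem repr_apply_of_basis {ι : Type*} [Fintype ι] {A : Module.End k V}
    {u : Module.Basis ι k V} {α : ι → k} (h : ∀ q, A (u q) = α q • u q) (v : V) (q : ι) :
    u.repr (A v) q = α q * u.repr v q := by
  classical
  have : A v = ∑ j, (u.repr v j * α j) • u j := by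
    conv_lhs => rw [← u.sum_repr v]
    simp only [map_sum, map_smul, h, smul_smul]
  rw [this, u.repr_sum_self, mul_comm]

omit [IsAlgClosed k] [CharZero k] [FiniteDimensional k V] in
theorem hasEigenvalue_iff_of_basis {ι : Type*} [Fintype ι] (A : Module.End k V)
    (u : Module.Basis ι k V) (α : ι → k) (h : ∀ q, A (u q) = α q • u q) (μ : k) :
    A.HasEigenvalue μ ↔ ∃ q, α q = μ := by
  constructor
  · intro hμ
    obtain ⟨v, hv⟩ := hμ.exists_hasEigenvector
    by_contra hcon
    push Not at hcon
    apply hv.2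
    apply u.ext_elem
    intro q
    have h1 : u.repr (A v) q = α q * u.repr v q := repr_apply_of_basis h v q
    rw [hv.apply_eq_smul] at h1
    simp only [map_smul, Finsupp.smul_apply, smul_eq_mul] at h1
    have h2 : (α q - μ) * u.repr v q = 0 := by rw [sub_mul, h1, sub_self]
    simpa using (mul_eq_zero.1 h2).resolve_left (sub_ne_zero.2 (hcon q))
  · rintro ⟨q, rfl⟩
    exact Module.End.hasEigenvalue_of_hasEigenvector
      ⟨Module.End.mem_eigenspace_iff.2 (h q), u.ne_zero q⟩

omit [IsAlgClosed k] [CharZero k] [FiniteDimensional k V] in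
theorem finrank_eigenspace_of_basis {ι : Type*} [Fintype ι] (A : Module.End k V)
    (u : Module.Basis ι k V) (α : ι → k) (h : ∀ q, A (u q) = α q • u q) (μ : k) :
    Module.finrank k (A.eigenspace μ) = Nat.card {q // α q = μ} := by
  classical
  have hli : LinearIndependent k fun q : {q // α q = μ} => u q :=
    u.linearIndependent.comp _ Subtype.val_injective
  have hspan : Submodule.span k (Set.range fun q : {q // α q = μ} => u q) = A.eigenspace μ := by
    apply le_antisymm
    · rw [Submodule.span_le]
      rintro _ ⟨q, rfl⟩
      have := h q.1
      rw [q.2] at this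
      exact Module.End.mem_eigenspace_iff.2 this
    · intro v hv
      rw [← u.sum_repr v]
      refine Submodule.sum_mem _ fun q _ => ?_
      by_cases hq : α q = μ
      · exact Submodule.smul_mem _ _ (Submodule.subset_span ⟨⟨q, hq⟩, rfl⟩)
      · have h1 : u.repr (A v) q = α q * u.repr v q := repr_apply_of_basis h v q
        rw [Module.End.mem_eigenspace_iff.1 hv] at h1
        simp only [map_smul, Finsupp.smul_apply, smul_eq_mul] at h1
        have h2 : (α q - μ) * u.repr v q = 0 := by rw [sub_mul, h1, sub_self]
        rw [(mul_eq_zero.1 h2).resolve_left (sub_ne_zero.2 hq), zero_smul]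
        exact Submodule.zero_mem _
  rw [← hspan, finrank_span_eq_card hli, Nat.card_eq_fintype_card]

end NormalForm


/-! ### Hereditary rings -/

section Hereditary

/-- Every left ideal is projective. -/
def IsLeftHereditary (A : Type*) [Ring A] : Prop :=
  ∀ I : Submodule A A, Module.Projective A I

/-- A subring that is a direct summand as a bimodule inherits left heredity: a splitting over the
large ring, composed with the projection, is a splitting over the small one. -/
theorem IsLeftHereditary.of_bimodule_retract {A B : Type*} [Ring A] [Ring B]
    (hB : IsLeftHereditary B) (f : A →+* B) (E : B →+ A) (hl : ∀ a b, E (f a * b) = a * E b)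
    (hr : ∀ a b, E (b * f a) = E b * a) (h1 : E 1 = 1) : IsLeftHereditary A := by
  intro I
  let J : Submodule B B := Submodule.span B (f '' (I : Set A))
  have hmem : ∀ y : I, f y ∈ J := fun y => Submodule.subset_span ⟨y, y.2, rfl⟩
  -- a surjection onto `J` from the free module on `I`, which splits
  let φ : (I →₀ B) →ₗ[B] J := Finsupp.linearCombination B fun y => (⟨f y, hmem y⟩ : J)
  have hφ : Function.Surjective φ := by
    rw [← LinearMap.range_eq_top, Finsupp.range_linearCombination]
    rw [eq_top_iff]
    rintro ⟨z, hz⟩ -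
    have h2 : J ≤ (Submodule.span B (Set.range fun y : I => (⟨f y, hmem y⟩ : J))).map
        J.subtype := by
      rw [Submodule.span_le]
      rintro _ ⟨y, hy, rfl⟩
      exact ⟨⟨f y, hmem ⟨y, hy⟩⟩, Submodule.subset_span ⟨⟨y, hy⟩, rfl⟩, rfl⟩
    obtain ⟨w, hw, e⟩ := h2 hz
    have : w = ⟨z, hz⟩ := Subtype.ext e
    rwa [← this]
  have hproj : Module.Projective B J := hB J
  obtain ⟨ψ, hψ⟩ := Module.projective_lifting_property φ LinearMap.id hφ
  have hψ' : ∀ z, φ (ψ z) = z := fun z => DFunLike.congr_fun hψ z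
  let ψ' : I →ₗ[A] (I →₀ A) :=
    { toFun := fun y => (ψ ⟨f y, hmem y⟩).mapRange E (map_zero E)
      map_add' := fun x y => by
        have : (⟨f (x + y : I), hmem (x + y)⟩ : J) = ⟨f x, hmem x⟩ + ⟨f y, hmem y⟩ :=
          Subtype.ext (map_add f _ _)
        rw [this, map_add]
        ext z
        simp
      map_smul' := fun a y => by
        have : (⟨f (a • y : I), hmem (a • y)⟩ : J) = f a • ⟨f y, hmem y⟩ :=
          Subtype.ext (map_mul f _ _)
        rw [this, map_smul]
        ext z
        simp [hl] }
  let π : (I →₀ A) →ₗ[A] I := Finsupp.linearCombination A fun y => y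
  have hπ : π.comp ψ' = LinearMap.id := by
    ext y
    have h3 := congrArg Subtype.val (hψ' ⟨f y, hmem y⟩)
    simp only [φ, Finsupp.linearCombination_apply, Finsupp.sum, AddSubmonoidClass.coe_finsetSum,
      Submodule.coe_smul, smul_eq_mul] at h3
    have h4 := congrArg E h3
    rw [map_sum] at h4
    simp only [hr] at h4
    have h5 : E (f y) = y := by
      have := hl y 1
      rwa [mul_one, h1, mul_one] at this
    rw [h5] at h4
    simp only [π, ψ', LinearMap.comp_apply, LinearMap.coe_mk, AddHom.coe_mk,
      Finsupp.linearCombination_apply, LinearMap.id_apply]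
    rw [Finsupp.sum_mapRange_index (by simp)]
    simp only [Finsupp.sum, AddSubmonoidClass.coe_finsetSum, Submodule.coe_smul, smul_eq_mul]
    exact h4
  exact Module.Projective.of_split ψ' π hπ

theorem IsLeftHereditary.of_ringEquiv {A B : Type*} [Ring A] [Ring B] (hB : IsLeftHereditary B)
    (f : A ≃+* B) : IsLeftHereditary A :=
  hB.of_bimodule_retract f.toRingHom f.symm.toAddEquiv.toAddMonoidHom
    (fun a b => by change f.symm (f a * b) = a * f.symm b; simp)
    (fun a b => by change f.symm (b * f a) = f.symm b * a; simp)
    (by change f.symm 1 = 1; simp)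

/-- Matrix rings over a principal ideal domain are hereditary: a splitting over the base ring is
made linear over the matrix ring by averaging over the matrix units. -/
theorem isLeftHereditary_matrix (T : Type*) [CommRing T] [IsDomain T] [IsPrincipalIdealRing T]
    (Q : Type*) [Fintype Q] [DecidableEq Q] [Nonempty Q] : IsLeftHereditary (Matrix Q Q T) := by
  intro I
  obtain ⟨q₀⟩ := ‹Nonempty Q›
  have hfree : Module.Free T (I.restrictScalars T) := inferInstance
  have hproj : Module.Projective T (I.restrictScalars T) := inferInstance
  -- a left ideal is torsion-free and finitely generated over `T`, hence has a `T`-linear section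
  -- `ψ` of the canonical cover, moved to the cover over the matrix ring by `ψ₁`
  obtain ⟨ψ, hψ⟩ := hproj.out
  let ψ₁ : I →+ (I →₀ Matrix Q Q T) :=
    (Finsupp.mapRange.addMonoidHom (Matrix.scalar Q : T →+* Matrix Q Q T).toAddMonoidHom).comp
      (ψ : I.restrictScalars T →+ (I.restrictScalars T →₀ T))
  have hψ₁ : ∀ y z, ψ₁ y z = Matrix.scalar Q (ψ y z) := fun y z => rfl
  have hsmul : ∀ (c : T) (y : I), ψ₁ (Matrix.scalar Q c • y) = Matrix.scalar Q c • ψ₁ y := by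
    intro c y
    have h1 : ψ (Matrix.scalar Q c • y : I) = c • ψ y := by
      refine Eq.trans (congrArg ψ (Subtype.ext ?_)) (map_smul ψ c y)
      change Matrix.scalar Q c * y.1 = c • y.1
      simp [Matrix.smul_eq_diagonal_mul]
    ext1 z
    rw [Finsupp.smul_apply, hψ₁, hψ₁, h1]
    exact map_mul (Matrix.scalar Q) c (ψ y z)
  let π : (I →₀ Matrix Q Q T) →ₗ[Matrix Q Q T] I := Finsupp.linearCombination _ fun y => y
  have hπ : ∀ y, π (ψ₁ y) = y := by
    intro y
    have h := hψ y
    apply Subtype.ext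
    have h2 := congrArg Subtype.val h
    simp only [Finsupp.linearCombination_apply, Finsupp.sum, AddSubmonoidClass.coe_finsetSum,
      id_eq, Submodule.coe_smul] at h2
    rw [← h2]
    simp only [π, Finsupp.linearCombination_apply]
    have h3 : (ψ₁ y).sum (fun a c => c • a) = (ψ y).sum fun a c => Matrix.scalar Q c • (a : I) :=
      Finsupp.sum_mapRange_index (hf := map_zero _) (by simp)
    rw [h3]
    simp only [Finsupp.sum, AddSubmonoidClass.coe_finsetSum]
    refine Finset.sum_congr rfl fun a _ => ?_
    change Matrix.scalar Q (ψ y a) * a.1 = _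
    simp [Matrix.smul_eq_diagonal_mul]
  let u : Q → Matrix Q Q T := fun q => Matrix.single q₀ q 1
  let v : Q → Matrix Q Q T := fun q => Matrix.single q q₀ 1
  have hux : ∀ (X : Matrix Q Q T) (q : Q), u q * X = ∑ q', Matrix.scalar Q (X q q') * u q' := by
    intro X q
    ext a b
    simp only [u, Matrix.sum_apply, Matrix.scalar_apply, Matrix.diagonal_mul, Matrix.single_apply]
    rw [Matrix.mul_apply, Finset.sum_eq_single q (by intro c _ hc; simp [hc.symm])
      (by simp)]
    by_cases ha : q₀ = a
    · simp [ha]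
    · simp [ha]
  have hxv : ∀ (X : Matrix Q Q T) (q : Q), X * v q = ∑ q', Matrix.scalar Q (X q' q) * v q' := by
    intro X q
    ext a b
    simp only [v, Matrix.sum_apply, Matrix.scalar_apply, Matrix.diagonal_mul, Matrix.single_apply]
    rw [Matrix.mul_apply, Finset.sum_eq_single q (by intro c _ hc; simp [hc.symm])
      (by simp)]
    by_cases hb : q₀ = b
    · simp [hb]
    · simp [hb]
  have hcomm : ∀ (c : T) (X : Matrix Q Q T), X * Matrix.scalar Q c = Matrix.scalar Q c * X :=
    fun c X => ((Matrix.scalar_commute c (fun r => Commute.all _ _) X).eq).symm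
  -- the average `y ↦ ∑ v q • ψ₁ (u q • y)` is linear over the matrix ring
  let ψ' : I →ₗ[Matrix Q Q T] (I →₀ Matrix Q Q T) :=
    { toFun := fun y => ∑ q, v q • ψ₁ (u q • y)
      map_add' := fun x y => by simp only [smul_add, map_add, Finset.sum_add_distrib]
      map_smul' := fun X y => by
        simp only [RingHom.id_apply, Finset.smul_sum]
        have h1 : ∀ q, v q • ψ₁ (u q • X • y)
            = ∑ q', (v q * Matrix.scalar Q (X q q')) • ψ₁ (u q' • y) := by
          intro q
          rw [← mul_smul, hux, Finset.sum_smul, map_sum, Finset.smul_sum]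
          refine Finset.sum_congr rfl fun q' _ => ?_
          rw [mul_smul, hsmul, mul_smul]
        have h2 : ∀ q', X • v q' • ψ₁ (u q' • y)
            = ∑ q, (v q * Matrix.scalar Q (X q q')) • ψ₁ (u q' • y) := by
          intro q'
          rw [← mul_smul, hxv, Finset.sum_smul]
          exact Finset.sum_congr rfl fun q _ => by rw [hcomm]
        simp only [h1, h2]
        exact Finset.sum_comm }
  refine Module.Projective.of_split ψ' π ?_
  ext1 y
  change π (∑ q, v q • ψ₁ (u q • y)) = y
  rw [map_sum]
  simp only [map_smul, hπ]
  have : (∑ q, v q * u q) = (1 : Matrix Q Q T) := by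
    simp only [u, v, Matrix.single_mul_single_same, mul_one]
    ext a b
    rw [Matrix.sum_apply, Matrix.one_apply]
    by_cases hab : a = b
    · subst hab
      simp [Matrix.single_apply]
    · rw [if_neg hab]
      refine Finset.sum_eq_zero fun q _ => ?_
      rw [Matrix.single_apply, if_neg]
      rintro ⟨rfl, rfl⟩
      exact hab rfl
  simp only [← mul_smul]
  rw [← Finset.sum_smul, this, one_smul]

theorem isHereditary_of_isLeftHereditary {A : Type u} [Ring A] (h : IsLeftHereditary A)
    (hop : IsLeftHereditary Aᵐᵒᵖ) : IsHereditary A := by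
  refine ⟨h, fun I => ?_⟩
  let op : A ≃ₗ[Aᵐᵒᵖ] Aᵐᵒᵖ :=
    { MulOpposite.opAddEquiv with map_smul' := fun a x => rfl }
  have := hop (I.map op.toLinearMap)
  exact Module.Projective.of_equiv (op.submoduleMap I).symm

/-- Heredity of a bimodule retract of a matrix ring over a principal ideal domain. -/
theorem isHereditary_of_matrix_retract {A : Type u} [Ring A] {T : Type*} [CommRing T] [IsDomain T]
    [IsPrincipalIdealRing T] {Q : Type*} [Fintype Q] [DecidableEq Q] [Nonempty Q]
    (f : A →+* Matrix Q Q T) (E : Matrix Q Q T →+ A) (hl : ∀ a b, E (f a * b) = a * E b)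
    (hr : ∀ a b, E (b * f a) = E b * a) (h1 : E 1 = 1) : IsHereditary A := by
  apply isHereditary_of_isLeftHereditary
  · exact (isLeftHereditary_matrix T Q).of_bimodule_retract f E hl hr h1
  · refine (isLeftHereditary_matrix T Q).of_bimodule_retract
      ((Matrix.transposeRingEquiv Q T).symm.toRingHom.comp (RingHom.op f))
      (MulOpposite.opAddEquiv.toAddMonoidHom.comp
        (E.comp (Matrix.transposeAddEquiv Q Q T).toAddMonoidHom)) ?_ ?_ ?_
    · intro a b
      change MulOpposite.op (E ((f a.unop).transpose * b).transpose)
        = a * MulOpposite.op (E b.transpose)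
      rw [Matrix.transpose_mul, Matrix.transpose_transpose, hr]
      rfl
    · intro a b
      change MulOpposite.op (E (b * (f a.unop).transpose).transpose)
        = MulOpposite.op (E b.transpose) * a
      rw [Matrix.transpose_mul, Matrix.transpose_transpose, hl]
      rfl
    · change MulOpposite.op (E (1 : Matrix Q Q T).transpose) = 1
      rw [Matrix.transpose_one, h1]
      rfl

theorem IsHereditary.of_ringEquiv {A B : Type u} [Ring A] [Ring B] (hB : IsHereditary B)
    (f : A ≃+* B) : IsHereditary A := by
  have hop : IsLeftHereditary Bᵐᵒᵖ := by
    intro I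
    let op : B ≃ₗ[Bᵐᵒᵖ] Bᵐᵒᵖ :=
      { MulOpposite.opAddEquiv with map_smul' := fun a x => rfl }
    have := hB.2 (I.map op.symm.toLinearMap)
    exact Module.Projective.of_equiv (op.symm.submoduleMap I).symm
  have hl : IsLeftHereditary B := hB.1
  exact isHereditary_of_isLeftHereditary (hl.of_ringEquiv f) (hop.of_ringEquiv (RingEquiv.op f))

end Hereditary


/-! ### Averaging over a finite cyclic group -/

section Averaging

variable {k : Type*} [Field k] [CharZero k] {W : Type*} [AddCommGroup W] [Module k W]

/-- The mean of the first `n` powers of an endomorphism. -/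
def cyclicMean (n : ℕ) (a : Module.End k W) : Module.End k W :=
  (n : k)⁻¹ • ∑ i ∈ Finset.range n, a ^ i

omit [CharZero k] in
theorem cyclicMean_apply (n : ℕ) (a : Module.End k W) (x : W) :
    cyclicMean n a x = (n : k)⁻¹ • ∑ i ∈ Finset.range n, (a ^ i) x := by
  simp [cyclicMean]

theorem cyclicMean_of_fixed {n : ℕ} (hn : n ≠ 0) {a : Module.End k W} {x : W} (h : a x = x) :
    cyclicMean n a x = x := by
  have hp : ∀ i : ℕ, (a ^ i) x = x := fun i => by
    induction i with
    | zero => rfl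
    | succ i ih => rw [pow_succ, Module.End.mul_apply, h, ih]
  have hn' : (n : k) ≠ 0 := Nat.cast_ne_zero.2 hn
  rw [cyclicMean_apply]
  simp only [hp, Finset.sum_const, Finset.card_range]
  rw [← Nat.cast_smul_eq_nsmul k, smul_smul, inv_mul_cancel₀ hn', one_smul]

omit [CharZero k] in
theorem cyclicMean_mul {n : ℕ} {a : Module.End k W} (ha : a ^ n = 1) :
    cyclicMean n a * a = cyclicMean n a := by
  rw [cyclicMean, smul_mul_assoc, Finset.sum_mul]
  congr 1
  have h := Finset.sum_range_succ (fun i => a ^ i) n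
  rw [Finset.sum_range_succ'] at h
  simp only [pow_zero, ha] at h
  rw [← add_right_cancel h]
  exact Finset.sum_congr rfl fun i _ => (pow_succ a i).symm

omit [CharZero k] in
theorem mul_cyclicMean {n : ℕ} {a : Module.End k W} (ha : a ^ n = 1) :
    a * cyclicMean n a = cyclicMean n a := by
  nth_rw 2 [← cyclicMean_mul ha]
  refine (Commute.smul_right (Commute.sum_right _ _ _ fun i _ => ?_) _).eq
  exact (Commute.refl a).pow_right i

omit [CharZero k] in
theorem commute_cyclicMean {n : ℕ} {a b : Module.End k W} (h : Commute b a) :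
    Commute b (cyclicMean n a) :=
  Commute.smul_right (Commute.sum_right _ _ _ fun i _ => h.pow_right i) _

/-- The projection onto the eigenspace of a root of unity `y` for an endomorphism of finite
order. -/
def eigenMean (n : ℕ) (a : Module.End k W) (y : k) : Module.End k W := cyclicMean n (y⁻¹ • a)

omit [CharZero k] in
theorem apply_eigenMean {n : ℕ} (hn : n ≠ 0) {a : Module.End k W} (ha : a ^ n = 1) {y : k}
    (hy : y ^ n = 1) (x : W) : a (eigenMean n a y x) = y • eigenMean n a y x := by
  have hy0 : y ≠ 0 := by
    rintro rfl
    simp [hn] at hy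
  have h1 : (y⁻¹ • a) ^ n = 1 := by rw [smul_pow, inv_pow, hy, ha, inv_one, one_smul]
  have h2 := DFunLike.congr_fun (mul_cyclicMean h1) x
  rw [Module.End.mul_apply, LinearMap.smul_apply] at h2
  rw [eigenMean, ← h2, smul_smul, mul_inv_cancel₀ hy0, one_smul, h2]

theorem sum_eigenMean {n : ℕ} (hn : n ≠ 0) {a : Module.End k W} {ζ : k} (hζ : IsPrimitiveRoot ζ n)
    (x : W) : ∑ i ∈ Finset.range n, eigenMean n a (ζ ^ i) x = x := by
  have hζ0 : ζ ≠ 0 := hζ.ne_zero hn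
  have hn' : (n : k) ≠ 0 := Nat.cast_ne_zero.2 hn
  simp only [eigenMean, cyclicMean_apply, smul_pow, LinearMap.smul_apply]
  rw [← Finset.smul_sum, Finset.sum_comm]
  have key : ∀ j ∈ Finset.range n, (∑ i ∈ Finset.range n, ((ζ ^ i)⁻¹ ^ j) • (a ^ j) x)
      = if j = 0 then (n : k) • x else 0 := by
    intro j hj
    rw [← Finset.sum_smul]
    have h1 : ∑ i ∈ Finset.range n, ((ζ ^ i)⁻¹ ^ j) = ∑ i ∈ Finset.range n, ((ζ⁻¹) ^ j) ^ i :=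
      Finset.sum_congr rfl fun i _ => by rw [← inv_pow, ← pow_mul, ← pow_mul, mul_comm]
    rw [h1]
    by_cases hj0 : j = 0
    · subst hj0
      simp
    · rw [if_neg hj0]
      have h2 : (ζ⁻¹) ^ j ≠ 1 := fun h => hj0 (Nat.eq_zero_of_dvd_of_lt
        (hζ.inv.pow_eq_one_iff_dvd j |>.1 h) (Finset.mem_range.1 hj))
      have h3 := mul_geom_sum ((ζ⁻¹) ^ j) n
      rw [← pow_mul, mul_comm j, pow_mul, hζ.inv.pow_eq_one, one_pow, sub_self] at h3
      rw [(mul_eq_zero.1 h3).resolve_left (sub_ne_zero.2 h2), zero_smul]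
  rw [Finset.sum_congr rfl key, Finset.sum_ite_eq' , if_pos (Finset.mem_range.2
    (Nat.pos_of_ne_zero hn)), smul_smul, inv_mul_cancel₀ hn', one_smul]

/-- The mean over two commuting cyclic groups. -/
def reynolds (n N : ℕ) (a b : Module.End k W) : Module.End k W := cyclicMean n a * cyclicMean N b

theorem reynolds_of_fixed {n N : ℕ} (hn : n ≠ 0) (hN : N ≠ 0) {a b : Module.End k W} {x : W}
    (ha : a x = x) (hb : b x = x) : reynolds n N a b x = x := by
  rw [reynolds, Module.End.mul_apply, cyclicMean_of_fixed hN hb, cyclicMean_of_fixed hn ha]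

omit [CharZero k] in
theorem left_apply_reynolds {n N : ℕ} {a b : Module.End k W} (ha : a ^ n = 1) (x : W) :
    a (reynolds n N a b x) = reynolds n N a b x := by
  rw [← Module.End.mul_apply, reynolds, ← mul_assoc, mul_cyclicMean ha]

omit [CharZero k] in
theorem right_apply_reynolds {n N : ℕ} {a b : Module.End k W} (hb : b ^ N = 1) (hab : Commute a b)
    (x : W) : b (reynolds n N a b x) = reynolds n N a b x := by
  rw [← Module.End.mul_apply, reynolds, ← mul_assoc, (commute_cyclicMean hab.symm).eq, mul_assoc,
    mul_cyclicMean hb]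

omit [CharZero k] in
theorem reynolds_apply_left {n N : ℕ} {a b : Module.End k W} (ha : a ^ n = 1) (hab : Commute a b)
    (x : W) : reynolds n N a b (a x) = reynolds n N a b x := by
  rw [← Module.End.mul_apply, reynolds, mul_assoc, ← (commute_cyclicMean hab).eq, ← mul_assoc,
    cyclicMean_mul ha]

omit [CharZero k] in
theorem reynolds_apply_right {n N : ℕ} {a b : Module.End k W} (hb : b ^ N = 1) (x : W) :
    reynolds n N a b (b x) = reynolds n N a b x := by
  rw [← Module.End.mul_apply, reynolds, mul_assoc, cyclicMean_mul hb]

omit [CharZero k] in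
/-- Averaging commutes with equivariant maps. -/
theorem map_reynolds {W' : Type*} [AddCommGroup W'] [Module k W'] {n N : ℕ}
    {a b : Module.End k W} {a' b' : Module.End k W'} (f : W →ₗ[k] W')
    (ha : ∀ x, f (a x) = a' (f x)) (hb : ∀ x, f (b x) = b' (f x)) (x : W) :
    f (reynolds n N a b x) = reynolds n N a' b' (f x) := by
  have hpow : ∀ {c : Module.End k W} {c' : Module.End k W'}, (∀ x, f (c x) = c' (f x)) →
      ∀ (i : ℕ) (x : W), f ((c ^ i) x) = (c' ^ i) (f x) := by
    intro c c' h i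
    induction i with
    | zero => intro x; rfl
    | succ i ih => intro x; rw [pow_succ, pow_succ, Module.End.mul_apply, Module.End.mul_apply, ih, h]
  have hmean : ∀ {c : Module.End k W} {c' : Module.End k W'}, (∀ x, f (c x) = c' (f x)) →
      ∀ (i : ℕ) (x : W), f (cyclicMean i c x) = cyclicMean i c' (f x) := by
    intro c c' h i x
    rw [cyclicMean_apply, cyclicMean_apply, map_smul, map_sum]
    simp only [hpow h]
  rw [reynolds, reynolds, Module.End.mul_apply, Module.End.mul_apply, hmean ha, hmean hb]

end Averaging

/-! ### Tame actions on discrete valuation rings -/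

/-- An action of a product of two cyclic groups `⟨σ⟩ × ⟨τ⟩`, of orders `n` and `N`, on a discrete
valuation ring `T` with residue field `κ`, diagonal in a uniformiser `t` and a unit `s`: the inertia
group `⟨σ⟩` fixes `s` and acts trivially on `κ`, the complement `⟨τ⟩` fixes `t`. The ring of
invariants is `O`. -/
structure TameAction (k : Type u) [Field k] (T : Type u) [CommRing T] [Algebra k T]
    (κ : Type u) [Field κ] [Algebra k κ] (O : Subalgebra k T) where
  /-- the order of `σ` -/
  n : ℕ
  /-- the order of `τ` -/
  N : ℕ
  /-- the eigenvalue of `σ` on `t` -/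
  ζ : k
  /-- the eigenvalue of `τ` on `s` -/
  ξ : k
  /-- the generator of the inertia group -/
  σ : T →ₐ[k] T
  /-- the generator of the complement -/
  τ : T →ₐ[k] T
  /-- the residue map -/
  ev : T →ₐ[k] κ
  /-- the unit -/
  s : Tˣ
  /-- the uniformiser -/
  t : T
  n_ne_zero : n ≠ 0
  N_ne_zero : N ≠ 0
  isPrimitiveRoot_ζ : IsPrimitiveRoot ζ n
  isPrimitiveRoot_ξ : IsPrimitiveRoot ξ N
  σ_pow : σ ^ n = 1
  τ_pow : τ ^ N = 1
  comm : Commute σ τ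
  σ_s : σ s = s
  σ_t : σ t = ζ • t
  τ_s : τ s = ξ • (s : T)
  τ_t : τ t = t
  ev_σ : ∀ x, ev (σ x) = ev x
  ev_eq_zero_iff : ∀ x, ev x = 0 ↔ t ∣ x
  t_ne_zero : t ≠ 0
  factor : ∀ x, x ≠ 0 → ∃ (v : ℕ) (u : T), IsUnit u ∧ x = t ^ v * u
  mem_iff : ∀ x, x ∈ O ↔ σ x = x ∧ τ x = x

namespace TameAction

variable {k : Type u} [Field k] {T : Type u} [CommRing T] [IsDomain T] [Algebra k T]
  {κ : Type u} [Field κ] [Algebra k κ] {O : Subalgebra k T} (act : TameAction k T κ O)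

omit [IsDomain T] in
theorem isUnit_iff (x : T) : IsUnit x ↔ act.ev x ≠ 0 := by
  constructor
  · exact fun h => (h.map act.ev).ne_zero
  · intro h
    have hx : x ≠ 0 := by rintro rfl; simp at h
    obtain ⟨v, u, hu, rfl⟩ := act.factor x hx
    cases v with
    | zero => simpa using hu
    | succ v =>
      exact absurd ((act.ev_eq_zero_iff _).2 ⟨act.t ^ v * u, by ring⟩) h

omit [IsDomain T] in
theorem ζ_ne_zero : act.ζ ≠ 0 := act.isPrimitiveRoot_ζ.ne_zero act.n_ne_zero

omit [IsDomain T] in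
theorem ξ_ne_zero : act.ξ ≠ 0 := act.isPrimitiveRoot_ξ.ne_zero act.N_ne_zero

omit [IsDomain T] in
theorem σ_t_pow (v : ℕ) : act.σ (act.t ^ v) = act.ζ ^ v • act.t ^ v := by
  rw [map_pow, act.σ_t, smul_pow]

omit [IsDomain T] in
theorem τ_t_pow (v : ℕ) : act.τ (act.t ^ v) = act.t ^ v := by rw [map_pow, act.τ_t]

omit [IsDomain T] in
theorem σ_s_pow (v : ℕ) : act.σ ((act.s : T) ^ v) = (act.s : T) ^ v := by rw [map_pow, act.σ_s]

omit [IsDomain T] in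
theorem τ_s_pow (v : ℕ) : act.τ ((act.s : T) ^ v) = act.ξ ^ v • (act.s : T) ^ v := by
  rw [map_pow, act.τ_s, smul_pow]

omit [IsDomain T] in
theorem σ_s_inv : act.σ (act.s⁻¹ : Tˣ) = (act.s⁻¹ : Tˣ) := by
  have h : act.σ (act.s⁻¹ : Tˣ) * act.σ act.s = 1 := by rw [← map_mul, Units.inv_mul, map_one]
  rw [act.σ_s] at h
  exact Units.eq_inv_of_mul_eq_one_right h

omit [IsDomain T] in
theorem τ_s_inv : act.τ (act.s⁻¹ : Tˣ) = act.ξ⁻¹ • ((act.s⁻¹ : Tˣ) : T) := by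
  have h : act.τ (act.s⁻¹ : Tˣ) * act.τ act.s = 1 := by rw [← map_mul, Units.inv_mul, map_one]
  rw [act.τ_s, mul_smul_comm, ← smul_mul_assoc] at h
  have h1 := Units.eq_inv_of_mul_eq_one_right h
  conv_rhs => rw [← h1]
  rw [smul_smul, inv_mul_cancel₀ act.ξ_ne_zero, one_smul]

/-- The valuation of an eigenvector of `σ` is determined modulo `n` by its eigenvalue. -/
theorem eq_zero_or_of_σ_eq_smul {x : T} {y : k} (h : act.σ x = y • x) :
    x = 0 ∨ ∃ (v : ℕ) (u : T), IsUnit u ∧ x = act.t ^ v * u ∧ act.ζ ^ v = y := by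
  by_cases hx : x = 0
  · exact Or.inl hx
  obtain ⟨v, u, hu, rfl⟩ := act.factor x hx
  refine Or.inr ⟨v, u, hu, rfl, ?_⟩
  have h1 : act.t ^ v * (act.ζ ^ v • act.σ u - y • u) = 0 := by
    rw [map_mul, σ_t_pow] at h
    rw [mul_sub, mul_smul_comm, ← smul_mul_assoc, h, mul_smul_comm, sub_self]
  have h2 := (mul_eq_zero.1 h1).resolve_left (pow_ne_zero _ act.t_ne_zero)
  have h3 := congrArg act.ev h2
  rw [map_sub, map_smul, map_smul, act.ev_σ, map_zero, ← sub_smul] at h3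
  have h4 : act.ev u ≠ 0 := (act.isUnit_iff u).1 hu
  exact sub_eq_zero.1 ((smul_eq_zero.1 h3).resolve_right h4)

theorem t_pow_dvd_of_σ_eq_smul {x : T} {y : k} (h : act.σ x = y • x) {j c : ℕ}
    (hj : act.t ^ j ∣ x) (hc : ∀ v, j ≤ v → act.ζ ^ v = y → c ≤ v) : act.t ^ c ∣ x := by
  rcases act.eq_zero_or_of_σ_eq_smul h with rfl | ⟨v, u, hu, rfl, hv⟩
  · exact dvd_zero _
  · have ht : ¬ IsUnit act.t := fun ht => by
      rw [act.isUnit_iff] at ht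
      exact ht ((act.ev_eq_zero_iff _).2 dvd_rfl)
    have hjv : j ≤ v := by
      by_contra hcon
      push Not at hcon
      obtain ⟨w, hw⟩ := hj
      have h1 : act.t ^ v * u = act.t ^ v * (act.t ^ (j - v) * w) := by
        rw [hw, ← mul_assoc, ← pow_add, Nat.add_sub_cancel' hcon.le]
      have h2 := mul_left_cancel₀ (pow_ne_zero _ act.t_ne_zero) h1
      rw [h2] at hu
      have h3 := isUnit_of_mul_isUnit_left hu
      exact ht ((isUnit_pow_iff (by omega)).1 h3)
    exact (pow_dvd_pow _ (hc v hjv hv)).mul_right _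

theorem t_pow_dvd_of_lt {x : T} {c : ℕ} (hc : c < act.n) (h : act.σ x = act.ζ ^ c • x) :
    act.t ^ c ∣ x := by
  refine act.t_pow_dvd_of_σ_eq_smul h (j := 0) (by simp) fun v _ hv => ?_
  rw [pow_eq_pow_mod v act.isPrimitiveRoot_ζ.pow_eq_one] at hv
  have := act.isPrimitiveRoot_ζ.pow_inj (Nat.mod_lt v (Nat.pos_of_ne_zero act.n_ne_zero)) hc hv
  rw [← this]
  exact Nat.mod_le _ _

include act in
theorem cancel_mem {x y : T} (hx : x ∈ O) (hx0 : x ≠ 0) (hxy : x * y ∈ O) : y ∈ O := by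
  rw [act.mem_iff] at *
  rw [map_mul, map_mul, hx.1, hx.2] at hxy
  exact ⟨mul_left_cancel₀ hx0 hxy.1, mul_left_cancel₀ hx0 hxy.2⟩

omit [IsDomain T] in
theorem t_pow_n_mem : act.t ^ act.n ∈ O := by
  rw [act.mem_iff, σ_t_pow, τ_t_pow, act.isPrimitiveRoot_ζ.pow_eq_one, one_smul]
  exact ⟨rfl, rfl⟩

/-- The uniformiser `t ^ n` of the ring of invariants. -/
def x : O := ⟨act.t ^ act.n, act.t_pow_n_mem⟩

theorem x_ne_zero : act.x ≠ 0 := fun h => pow_ne_zero act.n act.t_ne_zero (congrArg Subtype.val h)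

theorem factor_base {r : O} (hr : r ≠ 0) : ∃ (j : ℕ) (u : O), IsUnit u ∧ r = act.x ^ j * u := by
  have hr0 : (r : T) ≠ 0 := fun h => hr (Subtype.ext h)
  have hr1 := (act.mem_iff _).1 r.2
  rcases act.eq_zero_or_of_σ_eq_smul (x := (r : T)) (y := 1) (by rw [one_smul, hr1.1]) with
    h | ⟨v, u, hu, h, hv⟩
  · exact absurd h hr0
  obtain ⟨j, rfl⟩ := (act.isPrimitiveRoot_ζ.pow_eq_one_iff_dvd v).1 hv
  have hxj : (act.t ^ act.n) ^ j ∈ O := pow_mem act.t_pow_n_mem j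
  have hxj0 : (act.t ^ act.n) ^ j ≠ 0 := pow_ne_zero _ (pow_ne_zero _ act.t_ne_zero)
  have huO : u ∈ O := act.cancel_mem hxj hxj0 (by rw [← pow_mul, ← h]; exact r.2)
  obtain ⟨w, hw⟩ := hu.exists_right_inv
  have hwO : w ∈ O := act.cancel_mem huO hu.ne_zero (by rw [hw]; exact one_mem O)
  refine ⟨j, ⟨u, huO⟩, IsUnit.of_mul_eq_one ⟨w, hwO⟩ (Subtype.ext hw), Subtype.ext ?_⟩
  rw [h, pow_mul]
  rfl

include act in
theorem isUnit_base_iff (r : O) : IsUnit r ↔ IsUnit (r : T) := by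
  constructor
  · exact fun h => h.map O.val
  · intro h
    obtain ⟨w, hw⟩ := h.exists_right_inv
    have hwO : w ∈ O := act.cancel_mem r.2 h.ne_zero (by rw [hw]; exact one_mem O)
    exact IsUnit.of_mul_eq_one ⟨w, hwO⟩ (Subtype.ext hw)

theorem not_isUnit_x : ¬ IsUnit act.x := by
  rw [act.isUnit_base_iff]
  change ¬ IsUnit (act.t ^ act.n)
  rw [act.isUnit_iff, not_not, act.ev_eq_zero_iff]
  exact dvd_pow_self _ act.n_ne_zero

include act in
theorem isDiscreteValuationRing_base : IsDiscreteValuationRing O := by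
  apply IsDiscreteValuationRing.ofHasUnitMulPowIrreducibleFactorization
  refine ⟨act.x, ⟨act.not_isUnit_x, fun a b hab => ?_⟩, fun {r} hr => ?_⟩
  · have h0 : a * b ≠ 0 := hab ▸ act.x_ne_zero
    obtain ⟨i, u, hu, rfl⟩ := act.factor_base (left_ne_zero_of_mul h0)
    obtain ⟨j, w, hw, rfl⟩ := act.factor_base (right_ne_zero_of_mul h0)
    rcases i with _ | i
    · left; simpa using hu
    rcases j with _ | j
    · right; simpa using hw
    exfalso
    have h1 : act.x * 1 = act.x * (act.x * (act.x ^ i * u * act.x ^ j * w)) := by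
      rw [mul_one, ← mul_assoc]
      nth_rw 1 [hab]
      ring
    exact act.not_isUnit_x (IsUnit.of_mul_eq_one _ (mul_left_cancel₀ act.x_ne_zero h1).symm)
  · obtain ⟨j, u, hu, rfl⟩ := act.factor_base hr
    exact ⟨j, hu.unit, rfl⟩

theorem σ_toLinearMap_pow : (act.σ.toLinearMap : Module.End k T) ^ act.n = 1 := by
  have : ∀ i : ℕ, (act.σ.toLinearMap : Module.End k T) ^ i = (act.σ ^ i).toLinearMap := fun i => by
    induction i with
    | zero => rfl
    | succ i ih => rw [pow_succ, ih, pow_succ]; rfl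
  rw [this, act.σ_pow]
  rfl

theorem τ_toLinearMap_pow : (act.τ.toLinearMap : Module.End k T) ^ act.N = 1 := by
  have : ∀ i : ℕ, (act.τ.toLinearMap : Module.End k T) ^ i = (act.τ ^ i).toLinearMap := fun i => by
    induction i with
    | zero => rfl
    | succ i ih => rw [pow_succ, ih, pow_succ]; rfl
  rw [this, act.τ_pow]
  rfl

theorem comm_toLinearMap :
    Commute (act.σ.toLinearMap : Module.End k T) (act.τ.toLinearMap : Module.End k T) := by
  ext x
  exact DFunLike.congr_fun act.comm.eq x

variable [CharZero k]

/-- The extension of `T` over the ring of invariants is free on the monomials `t ^ i * s ^ j`; in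
particular these generate. -/
theorem exists_eq_sum (f : T) : ∃ r : ℕ → ℕ → O, f = ∑ i ∈ Finset.range act.n,
    ∑ j ∈ Finset.range act.N, (r i j : T) * (act.t ^ i * (act.s : T) ^ j) := by
  let a : Module.End k T := act.σ.toLinearMap
  let b : Module.End k T := act.τ.toLinearMap
  -- the component of `f` on which `σ` and `τ` act by `ζ ^ i` and `ξ ^ j` is divisible by `t ^ i`,
  -- and the quotient by `t ^ i * s ^ j` is invariant
  have key : ∀ i j : ℕ, i < act.n → ∃ r : O,
      eigenMean act.n a (act.ζ ^ i) (eigenMean act.N b (act.ξ ^ j) f)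
        = (r : T) * (act.t ^ i * (act.s : T) ^ j) := by
    intro i j hi
    set z := eigenMean act.n a (act.ζ ^ i) (eigenMean act.N b (act.ξ ^ j) f) with hz
    have hζi : (act.ζ ^ i) ^ act.n = 1 := by
      rw [← pow_mul, mul_comm, pow_mul, act.isPrimitiveRoot_ζ.pow_eq_one, one_pow]
    have hξj : (act.ξ ^ j) ^ act.N = 1 := by
      rw [← pow_mul, mul_comm, pow_mul, act.isPrimitiveRoot_ξ.pow_eq_one, one_pow]
    have hσz : act.σ z = act.ζ ^ i • z := apply_eigenMean act.n_ne_zero act.σ_toLinearMap_pow hζi _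
    have hτz : act.τ z = act.ξ ^ j • z := by
      have h1 : Commute b (eigenMean act.n a (act.ζ ^ i)) :=
        commute_cyclicMean (act.comm_toLinearMap.symm.smul_right _)
      have h2 : b z = eigenMean act.n a (act.ζ ^ i) (b (eigenMean act.N b (act.ξ ^ j) f)) :=
        DFunLike.congr_fun h1.eq _
      change b z = _
      rw [h2, apply_eigenMean act.N_ne_zero act.τ_toLinearMap_pow hξj, map_smul]
    obtain ⟨w, hw⟩ := act.t_pow_dvd_of_lt hi hσz
    have ht := pow_ne_zero i act.t_ne_zero
    have hσw : act.σ w = w := by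
      rw [hw, map_mul, σ_t_pow, smul_mul_assoc] at hσz
      have := smul_right_injective T (pow_ne_zero i act.ζ_ne_zero) hσz
      exact mul_left_cancel₀ ht this
    have hτw : act.τ w = act.ξ ^ j • w := by
      rw [hw, map_mul, τ_t_pow, ← mul_smul_comm] at hτz
      exact mul_left_cancel₀ ht hτz
    refine ⟨⟨w * ((act.s⁻¹ : Tˣ) : T) ^ j, ?_⟩, ?_⟩
    · rw [act.mem_iff, map_mul, map_mul, map_pow, map_pow, act.σ_s_inv, act.τ_s_inv, hσw, hτw,
        smul_pow, smul_mul_smul_comm, ← mul_pow, mul_inv_cancel₀ act.ξ_ne_zero, one_pow, one_smul]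
      exact ⟨rfl, rfl⟩
    · rw [hw]
      have h3 : ((act.s⁻¹ : Tˣ) : T) ^ j * (act.s : T) ^ j = 1 := by
        rw [← mul_pow, Units.inv_mul, one_pow]
      calc act.t ^ i * w = act.t ^ i * w * 1 := (mul_one _).symm
        _ = _ := by rw [← h3]; ring
  have key' : ∀ i j : ℕ, ∃ r : O, i < act.n →
      eigenMean act.n a (act.ζ ^ i) (eigenMean act.N b (act.ξ ^ j) f)
        = (r : T) * (act.t ^ i * (act.s : T) ^ j) := by
    intro i j
    by_cases hi : i < act.n
    · obtain ⟨r, hr⟩ := key i j hi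
      exact ⟨r, fun _ => hr⟩
    · exact ⟨0, fun h => absurd h hi⟩
  choose r hr using key'
  refine ⟨r, ?_⟩
  conv_lhs => rw [← sum_eigenMean act.n_ne_zero act.isPrimitiveRoot_ζ (a := a) f]
  refine Finset.sum_congr rfl fun i hi => ?_
  conv_lhs => rw [← sum_eigenMean act.N_ne_zero act.isPrimitiveRoot_ξ (a := b) f]
  rw [map_sum]
  exact Finset.sum_congr rfl fun j _ => hr i j (Finset.mem_range.1 hi)

include act in
theorem finite_base : Module.Finite O T := by
  classical
  refine ⟨⟨(Finset.range act.n ×ˢ Finset.range act.N).image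
    fun p => act.t ^ p.1 * (act.s : T) ^ p.2, ?_⟩⟩
  rw [eq_top_iff]
  rintro f -
  obtain ⟨r, hr⟩ := act.exists_eq_sum f
  rw [hr]
  refine Submodule.sum_mem _ fun i hi => Submodule.sum_mem _ fun j hj => ?_
  exact Submodule.smul_mem _ (r i j) (Submodule.subset_span
    (Finset.mem_coe.2 (Finset.mem_image.2 ⟨(i, j), Finset.mem_product.2 ⟨hi, hj⟩, rfl⟩)))

/-- The Reynolds operator of the action. -/
def E : T →ₗ[k] T := reynolds act.n act.N (act.σ.toLinearMap : Module.End k T) act.τ.toLinearMap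

theorem E_mem (f : T) : act.E f ∈ O := by
  rw [act.mem_iff]
  exact ⟨left_apply_reynolds act.σ_toLinearMap_pow f,
    right_apply_reynolds act.τ_toLinearMap_pow act.comm_toLinearMap f⟩

theorem E_of_mem {f : T} (hf : f ∈ O) : act.E f = f := by
  rw [act.mem_iff] at hf
  exact reynolds_of_fixed act.n_ne_zero act.N_ne_zero hf.1 hf.2

theorem E_mul {r : T} (hr : r ∈ O) (f : T) : act.E (r * f) = r * act.E f := by
  rw [act.mem_iff] at hr
  exact (map_reynolds (LinearMap.mulLeft k r)
    (fun x => by simp [hr.1]) (fun x => by simp [hr.2]) f).symm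

theorem E_eq_zero_of_σ {f : T} {y : k} (hy : y ≠ 1) (h : act.σ f = y • f) : act.E f = 0 := by
  have h1 : act.E (act.σ f) = act.E f :=
    reynolds_apply_left act.σ_toLinearMap_pow act.comm_toLinearMap f
  rw [h, map_smul] at h1
  have h2 : (y - 1) • act.E f = 0 := by rw [sub_smul, h1, one_smul, sub_self]
  exact (smul_eq_zero.1 h2).resolve_left (sub_ne_zero.2 hy)

theorem E_eq_zero_of_τ {f : T} {y : k} (hy : y ≠ 1) (h : act.τ f = y • f) : act.E f = 0 := by
  have h1 : act.E (act.τ f) = act.E f := reynolds_apply_right act.τ_toLinearMap_pow f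
  rw [h, map_smul] at h1
  have h2 : (y - 1) • act.E f = 0 := by rw [sub_smul, h1, one_smul, sub_self]
  exact (smul_eq_zero.1 h2).resolve_left (sub_ne_zero.2 hy)

end TameAction


/-! ### The model order -/

/-- Weights on `ZMod e × F`: the eigenvalues `α` of `σ`, which the shift in the first variable,
given by `τ`, multiplies by the primitive `e`-th root of unity `η`. All ratios of weights are `n`-th
roots of unity, and `e ∣ N`. -/
structure ShiftWeight (k : Type u) [Field k] (n N e : ℕ) (F : Type u) where
  /-- the weight -/
  α : ZMod e × F → k
  /-- the effect of the shift on the weights -/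
  η : k
  isPrimitiveRoot_η : IsPrimitiveRoot η e
  α_shift : ∀ i l, α (i + 1, l) = η * α (i, l)
  α_ne_zero : ∀ q, α q ≠ 0
  α_pow : ∀ q q', α q ^ n = α q' ^ n
  η_pow_n : η ^ n = 1
  η_pow_N : η ^ N = 1

namespace ShiftWeight

variable {k : Type u} [Field k] {n N e : ℕ} {F : Type u} (w : ShiftWeight k n N e F)

theorem α_add_nat (i : ZMod e) (l : F) (j : ℕ) : w.α (i + j, l) = w.η ^ j * w.α (i, l) := by
  induction j with
  | zero => simp
  | succ j ih => rw [Nat.cast_succ, ← add_assoc, w.α_shift, ih, pow_succ']; ring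

include w in
theorem dvd_N : e ∣ N := (w.isPrimitiveRoot_η.pow_eq_one_iff_dvd N).1 w.η_pow_N

theorem ratio_pow (q q' : ZMod e × F) : (w.α q / w.α q') ^ n = 1 := by
  rw [div_pow, w.α_pow q q', div_self (pow_ne_zero _ (w.α_ne_zero q'))]

end ShiftWeight

variable {k : Type u} [Field k] {T : Type u} [CommRing T] [Algebra k T]
  {κ : Type u} [Field κ] [Algebra k κ] {O : Subalgebra k T} (act : TameAction k T κ O)
  {e : ℕ} {F : Type u}

/-- The shift of an index. -/
abbrev shiftIndex : ZMod e × F ≃ ZMod e × F := (Equiv.addRight 1).prodCongr (Equiv.refl F)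

theorem shiftIndex_pow (j : ℕ) (q : ZMod e × F) : (shiftIndex ^ j) q = (q.1 + j, q.2) := by
  induction j with
  | zero => simp
  | succ j ih =>
    rw [pow_succ', Equiv.Perm.mul_apply, ih]
    simp [add_assoc]

variable [NeZero e] [Fintype F] [DecidableEq F] (w : ShiftWeight k act.n act.N e F)

namespace TameAction

/-- The action of `σ` on matrices. -/
def matσ : Matrix (ZMod e × F) (ZMod e × F) T →ₐ[k] Matrix (ZMod e × F) (ZMod e × F) T :=
  AlgHom.ofLinearMap
    { toFun := fun X => Matrix.of fun q q' => (w.α q / w.α q') • act.σ (X q q')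
      map_add' := fun X Y => by
        ext q q'
        simp only [Matrix.of_apply, Matrix.add_apply, map_add, smul_add]
      map_smul' := fun c X => by
        ext q q'
        simp only [Matrix.of_apply, Matrix.smul_apply, map_smul, RingHom.id_apply]
        exact smul_comm _ _ _ }
    (by
      ext q q'
      change (w.α q / w.α q') • act.σ ((1 : Matrix _ _ T) q q') = _
      by_cases h : q = q'
      · subst h
        rw [Matrix.one_apply_eq, map_one, div_self (w.α_ne_zero q), one_smul]
      · rw [Matrix.one_apply_ne h, map_zero, smul_zero])
    (by
      intro X Y
      ext q q'
      change (w.α q / w.α q') • act.σ ((X * Y) q q') =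
        ∑ r, ((w.α q / w.α r) • act.σ (X q r)) * ((w.α r / w.α q') • act.σ (Y r q'))
      simp only [Matrix.mul_apply, map_sum, Finset.smul_sum, map_mul]
      refine Finset.sum_congr rfl fun r _ => ?_
      rw [smul_mul_smul_comm, div_mul_div_cancel₀ (w.α_ne_zero r)])

theorem matσ_apply (X : Matrix (ZMod e × F) (ZMod e × F) T) (q q' : ZMod e × F) :
    act.matσ w X q q' = (w.α q / w.α q') • act.σ (X q q') := rfl

/-- The action of `τ` on matrices. -/
def matτ : Matrix (ZMod e × F) (ZMod e × F) T →ₐ[k] Matrix (ZMod e × F) (ZMod e × F) T :=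
  (Matrix.reindexAlgEquiv k T shiftIndex).toAlgHom.comp act.τ.mapMatrix

theorem matτ_apply_shift (X : Matrix (ZMod e × F) (ZMod e × F) T) (q q' : ZMod e × F) :
    act.matτ X (shiftIndex q) (shiftIndex q') = act.τ (X q q') := by
  change act.τ (X (shiftIndex.symm (shiftIndex q)) (shiftIndex.symm (shiftIndex q'))) = _
  rw [Equiv.symm_apply_apply, Equiv.symm_apply_apply]

theorem matσ_pow_apply (j : ℕ) (X : Matrix (ZMod e × F) (ZMod e × F) T) (q q' : ZMod e × F) :
    ((act.matσ w ^ j) X) q q' = (w.α q / w.α q') ^ j • (act.σ ^ j) (X q q') := by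
  induction j generalizing X with
  | zero => simp
  | succ j ih =>
    rw [pow_succ, AlgHom.mul_apply, ih, matσ_apply, map_smul, smul_smul, ← pow_succ,
      pow_succ act.σ, AlgHom.mul_apply]

theorem matτ_pow_apply (j : ℕ) (X : Matrix (ZMod e × F) (ZMod e × F) T) (q q' : ZMod e × F) :
    ((act.matτ ^ j) X) ((shiftIndex ^ j) q) ((shiftIndex ^ j) q') = (act.τ ^ j) (X q q') := by
  induction j generalizing X with
  | zero => simp
  | succ j ih =>
    rw [pow_succ' (act.matτ (e := e) (F := F)), AlgHom.mul_apply, pow_succ' shiftIndex,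
      Equiv.Perm.mul_apply, Equiv.Perm.mul_apply, matτ_apply_shift, ih, pow_succ' act.τ,
      AlgHom.mul_apply]

theorem matσ_pow : act.matσ w ^ act.n = 1 := by
  ext X q q'
  rw [matσ_pow_apply, w.ratio_pow, act.σ_pow, one_smul]
  rfl

include w in
theorem matτ_pow : (act.matτ : Matrix (ZMod e × F) (ZMod e × F) T →ₐ[k] _) ^ act.N = 1 := by
  ext X q q'
  have h : ∀ q : ZMod e × F, (shiftIndex ^ act.N) q = q := fun q => by
    rw [shiftIndex_pow, (ZMod.natCast_eq_zero_iff _ _).2 w.dvd_N, add_zero]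
  have h1 := act.matτ_pow_apply act.N X q q'
  rw [h, h, act.τ_pow] at h1
  exact h1

theorem matσ_matτ_comm (X : Matrix (ZMod e × F) (ZMod e × F) T) :
    act.matσ w (act.matτ X) = act.matτ (act.matσ w X) := by
  ext q q'
  obtain ⟨⟨i, l⟩, rfl⟩ := shiftIndex.surjective q
  obtain ⟨⟨j, l'⟩, rfl⟩ := shiftIndex.surjective q'
  rw [matσ_apply, matτ_apply_shift, matτ_apply_shift, matσ_apply, map_smul]
  have h := DFunLike.congr_fun act.comm.eq (X (i, l) (j, l'))
  rw [AlgHom.mul_apply, AlgHom.mul_apply] at h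
  rw [h]
  congr 1
  simp only [Equiv.prodCongr_apply, Prod.map_apply, Equiv.coe_addRight, Equiv.refl_apply, w.α_shift]
  exact mul_div_mul_left _ _ (w.isPrimitiveRoot_η.ne_zero (NeZero.ne e))

/-- The order of matrices invariant under `σ` and `τ`. -/
def modelOrder : Subalgebra O (Matrix (ZMod e × F) (ZMod e × F) T) where
  carrier := {X | act.matσ w X = X ∧ act.matτ X = X}
  mul_mem' hx hy := ⟨by rw [map_mul, hx.1, hy.1], by rw [map_mul, hx.2, hy.2]⟩
  add_mem' hx hy := ⟨by rw [map_add, hx.1, hy.1], by rw [map_add, hx.2, hy.2]⟩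
  algebraMap_mem' r := by
    have hr := (act.mem_iff r).1 r.2
    constructor
    · ext q q'
      rw [matσ_apply, Matrix.algebraMap_matrix_apply]
      split_ifs with h
      · subst h
        rw [div_self (w.α_ne_zero q), one_smul]
        exact hr.1
      · rw [map_zero, smul_zero]
    · ext q q'
      obtain ⟨q, rfl⟩ := shiftIndex.surjective q
      obtain ⟨q', rfl⟩ := shiftIndex.surjective q'
      rw [matτ_apply_shift, Matrix.algebraMap_matrix_apply, Matrix.algebraMap_matrix_apply]
      simp only [EmbeddingLike.apply_eq_iff_eq]
      split_ifs with h
      · exact hr.2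
      · exact map_zero _

theorem mem_modelOrder_iff {X : Matrix (ZMod e × F) (ZMod e × F) T} :
    X ∈ act.modelOrder w ↔ act.matσ w X = X ∧ act.matτ X = X := Iff.rfl

theorem σ_apply_of_mem {X : Matrix (ZMod e × F) (ZMod e × F) T} (hX : X ∈ act.modelOrder w)
    (q q' : ZMod e × F) : act.σ (X q q') = (w.α q' / w.α q) • X q q' := by
  have h := congrFun₂ hX.1 q q'
  rw [matσ_apply] at h
  nth_rw 2 [← h]
  rw [smul_smul, div_mul_div_cancel₀ (w.α_ne_zero q), div_self (w.α_ne_zero q'), one_smul]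

theorem mem_modelOrder_of {X : Matrix (ZMod e × F) (ZMod e × F) T}
    (h : ∀ q q', act.σ (X q q') = (w.α q' / w.α q) • X q q')
    (h' : ∀ q q', X (shiftIndex q) (shiftIndex q') = act.τ (X q q')) : X ∈ act.modelOrder w := by
  constructor
  · ext q q'
    rw [matσ_apply, h, smul_smul, div_mul_div_cancel₀ (w.α_ne_zero q'), div_self (w.α_ne_zero q),
      one_smul]
  · ext q q'
    obtain ⟨q, rfl⟩ := shiftIndex.surjective q
    obtain ⟨q', rfl⟩ := shiftIndex.surjective q'
    rw [matτ_apply_shift, h']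

theorem τ_apply_of_mem {X : Matrix (ZMod e × F) (ZMod e × F) T} (hX : X ∈ act.modelOrder w)
    (q q' : ZMod e × F) : X (shiftIndex q) (shiftIndex q') = act.τ (X q q') := by
  rw [← matτ_apply_shift, hX.2]

/-- A cancellable factor in the order leaves the order. -/
theorem mem_of_mul_mem_left {X Y : Matrix (ZMod e × F) (ZMod e × F) T}
    (hX : X ∈ act.modelOrder w) (hc : ∀ Z Z', X * Z = X * Z' → Z = Z')
    (h : X * Y ∈ act.modelOrder w) : Y ∈ act.modelOrder w := by
  rw [mem_modelOrder_iff, map_mul, map_mul, hX.1, hX.2] at h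
  exact ⟨hc _ _ h.1, hc _ _ h.2⟩

theorem mem_of_mul_mem_right {X Y : Matrix (ZMod e × F) (ZMod e × F) T}
    (hX : X ∈ act.modelOrder w) (hc : ∀ Z Z', Z * X = Z' * X → Z = Z')
    (h : Y * X ∈ act.modelOrder w) : Y ∈ act.modelOrder w := by
  rw [mem_modelOrder_iff, map_mul, map_mul, hX.1, hX.2] at h
  exact ⟨hc _ _ h.1, hc _ _ h.2⟩

theorem algHom_toLinearMap_pow {A : Type*} [Semiring A] [Algebra k A] (f : A →ₐ[k] A) (i : ℕ) :
    (f.toLinearMap : Module.End k A) ^ i = (f ^ i).toLinearMap := by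
  induction i with
  | zero => rfl
  | succ i ih => rw [pow_succ, ih, pow_succ]; rfl

theorem matσ_toLinearMap_pow : ((act.matσ w).toLinearMap : Module.End k _) ^ act.n = 1 := by
  rw [algHom_toLinearMap_pow, matσ_pow]
  rfl

include w in
theorem matτ_toLinearMap_pow :
    ((act.matτ : Matrix (ZMod e × F) (ZMod e × F) T →ₐ[k] _).toLinearMap : Module.End k _) ^ act.N
      = 1 := by
  rw [algHom_toLinearMap_pow, matτ_pow act w]
  rfl

theorem mat_comm_toLinearMap :
    Commute ((act.matσ w).toLinearMap : Module.End k _) (act.matτ.toLinearMap) := by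
  refine LinearMap.ext fun X => ?_
  exact act.matσ_matτ_comm w X

/-- The Reynolds operator on matrices. -/
def matE : Matrix (ZMod e × F) (ZMod e × F) T →ₗ[k] Matrix (ZMod e × F) (ZMod e × F) T :=
  reynolds act.n act.N ((act.matσ w).toLinearMap : Module.End k _) act.matτ.toLinearMap

theorem matE_mem (X : Matrix (ZMod e × F) (ZMod e × F) T) : act.matE w X ∈ act.modelOrder w :=
  ⟨left_apply_reynolds (act.matσ_toLinearMap_pow w) X,
    right_apply_reynolds (act.matτ_toLinearMap_pow w) (act.mat_comm_toLinearMap w) X⟩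

variable [CharZero k]

theorem matE_of_mem {X : Matrix (ZMod e × F) (ZMod e × F) T} (hX : X ∈ act.modelOrder w) :
    act.matE w X = X := reynolds_of_fixed act.n_ne_zero act.N_ne_zero hX.1 hX.2

theorem matE_mul_left {X : Matrix (ZMod e × F) (ZMod e × F) T} (hX : X ∈ act.modelOrder w)
    (Y : Matrix (ZMod e × F) (ZMod e × F) T) : act.matE w (X * Y) = X * act.matE w Y :=
  (map_reynolds (LinearMap.mulLeft k X)
    (fun x => by simp [hX.1]) (fun x => by simp [hX.2]) Y).symm

theorem matE_mul_right {X : Matrix (ZMod e × F) (ZMod e × F) T} (hX : X ∈ act.modelOrder w)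
    (Y : Matrix (ZMod e × F) (ZMod e × F) T) : act.matE w (Y * X) = act.matE w Y * X :=
  (map_reynolds (LinearMap.mulRight k X)
    (fun x => by simp [hX.1]) (fun x => by simp [hX.2]) Y).symm

theorem trace_matE (X : Matrix (ZMod e × F) (ZMod e × F) T) :
    (act.matE w X).trace = act.E X.trace := by
  refine map_reynolds (Matrix.traceLinearMap (ZMod e × F) k T) (fun x => ?_) (fun x => ?_) X
  · simp [Matrix.trace, matσ_apply, div_self (w.α_ne_zero _)]
  · change (act.matτ x).trace = act.τ x.trace
    rw [Matrix.trace, Matrix.trace, map_sum, ← Equiv.sum_comp shiftIndex]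
    exact Finset.sum_congr rfl fun q _ => act.matτ_apply_shift x q q

/-- The Reynolds operator, as a bimodule retraction onto the model order. -/
def matRetract : Matrix (ZMod e × F) (ZMod e × F) T →+ act.modelOrder w where
  toFun X := ⟨act.matE w X, act.matE_mem w X⟩
  map_zero' := Subtype.ext (map_zero _)
  map_add' X Y := Subtype.ext (map_add _ X Y)

theorem isHereditary_modelOrder [IsDomain T] [IsPrincipalIdealRing T] [Nonempty F] :
    IsHereditary (act.modelOrder w) := by
  refine isHereditary_of_matrix_retract (act.modelOrder w).val.toRingHom (act.matRetract w)
    (fun a b => Subtype.ext ?_) (fun a b => Subtype.ext ?_) (Subtype.ext ?_)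
  · exact act.matE_mul_left w a.2 b
  · exact act.matE_mul_right w a.2 b
  · exact act.matE_of_mem w (one_mem _)

end TameAction


/-! ### Trace duality for the model order -/

theorem cyclicMean_mem {k W : Type*} [Field k] [AddCommGroup W] [Module k W] {a : Module.End k W}
    (p : Submodule k W) (h : ∀ x ∈ p, a x ∈ p) (n : ℕ) {x : W} (hx : x ∈ p) :
    cyclicMean n a x ∈ p := by
  rw [cyclicMean_apply]
  have hi : ∀ i : ℕ, (a ^ i) x ∈ p := fun i => by
    induction i with
    | zero => exact hx
    | succ i ih => rw [pow_succ', Module.End.mul_apply]; exact h _ ih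
  exact p.smul_mem _ (p.sum_mem fun i _ => hi i)

namespace TameAction

variable {k : Type u} [Field k] [CharZero k] {T : Type u} [CommRing T] [IsDomain T] [Algebra k T]
  {κ : Type u} [Field κ] [Algebra k κ] {O : Subalgebra k T} (act : TameAction k T κ O)

theorem E_monomial {i i' j j' : ℕ} (hi : i < act.n) (hi' : i' < act.n) (hj : j < act.N)
    (hj' : j' < act.N) :
    act.E (act.t ^ (act.n - i') * ((act.s⁻¹ : Tˣ) : T) ^ j' * (act.t ^ i * (act.s : T) ^ j)) =
      if i = i' ∧ j = j' then act.t ^ act.n else 0 := by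
  have hσ : act.σ (act.t ^ (act.n - i') * ((act.s⁻¹ : Tˣ) : T) ^ j' *
      (act.t ^ i * (act.s : T) ^ j)) = act.ζ ^ (act.n - i' + i) •
        (act.t ^ (act.n - i') * ((act.s⁻¹ : Tˣ) : T) ^ j' * (act.t ^ i * (act.s : T) ^ j)) := by
    simp only [map_mul, map_pow, act.σ_t, act.σ_s, act.σ_s_inv, smul_pow, smul_mul_assoc,
      mul_smul_comm, smul_smul, pow_add]
    rw [mul_comm (act.ζ ^ i)]
  have hτ : act.τ (act.t ^ (act.n - i') * ((act.s⁻¹ : Tˣ) : T) ^ j' *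
      (act.t ^ i * (act.s : T) ^ j)) = (act.ξ ^ j * act.ξ⁻¹ ^ j') •
        (act.t ^ (act.n - i') * ((act.s⁻¹ : Tˣ) : T) ^ j' * (act.t ^ i * (act.s : T) ^ j)) := by
    simp only [map_mul, map_pow, act.τ_t, act.τ_s, act.τ_s_inv, smul_pow, smul_mul_assoc,
      mul_smul_comm, smul_smul]
  split_ifs with h
  · obtain ⟨rfl, rfl⟩ := h
    have h1 : act.t ^ (act.n - i) * ((act.s⁻¹ : Tˣ) : T) ^ j * (act.t ^ i * (act.s : T) ^ j)
        = act.t ^ act.n := by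
      have h2 : ((act.s⁻¹ : Tˣ) : T) ^ j * (act.s : T) ^ j = 1 := by
        rw [← mul_pow, Units.inv_mul, one_pow]
      calc _ = (act.t ^ (act.n - i) * act.t ^ i) * (((act.s⁻¹ : Tˣ) : T) ^ j * (act.s : T) ^ j) := by
            ring
        _ = _ := by rw [h2, mul_one, ← pow_add, Nat.sub_add_cancel hi.le]
    rw [h1]
    exact act.E_of_mem act.t_pow_n_mem
  · by_cases hii : i = i'
    · refine act.E_eq_zero_of_τ (fun hy => h ⟨hii, ?_⟩) hτ
      rw [inv_pow, mul_inv_eq_one₀ (pow_ne_zero _ act.ξ_ne_zero)] at hy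
      exact act.isPrimitiveRoot_ξ.pow_inj hj hj' hy
    · refine act.E_eq_zero_of_σ (fun hy => hii ?_) hσ
      have h1 := (act.isPrimitiveRoot_ζ.pow_eq_one_iff_dvd _).1 hy
      -- `n` divides `n - i' + i`, which lies strictly between `0` and `2 * n`
      obtain ⟨d, hd⟩ := h1
      have h2 : d = 1 := by
        rcases d with _ | _ | d
        · rw [mul_zero] at hd
          omega
        · rfl
        · exfalso
          have : act.n * (d + 1 + 1) = act.n * d + act.n + act.n := by ring
          rw [this] at hd
          have := Nat.zero_le (act.n * d)
          omega
      subst h2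
      omega

/-- The trace form identifies `Hom_O(T, O)` with `x⁻¹ t T`, where `x = t ^ n`. -/
theorem exists_E_mul_eq (g : T →ₗ[O] O) :
    ∃ c, act.t ∣ c ∧ ∀ f, (act.x : T) * (g f : T) = act.E (c * f) := by
  -- the coefficient is read off on the basis dual, up to `x`, to the monomials
  refine ⟨∑ i ∈ Finset.range act.n, ∑ j ∈ Finset.range act.N,
    (g (act.t ^ i * (act.s : T) ^ j) : T) * (act.t ^ (act.n - i) * ((act.s⁻¹ : Tˣ) : T) ^ j),
    ?_, fun f => ?_⟩
  · refine Finset.dvd_sum fun i hi => Finset.dvd_sum fun j _ => ?_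
    refine Dvd.dvd.mul_left (Dvd.dvd.mul_right (dvd_pow_self _ ?_) _) _
    have := Finset.mem_range.1 hi
    omega
  · obtain ⟨r, hr⟩ := act.exists_eq_sum f
    have h1 : (act.x : T) * (g f : T) = ∑ i ∈ Finset.range act.n, ∑ j ∈ Finset.range act.N,
        (r i j : T) * ((act.x : T) * (g (act.t ^ i * (act.s : T) ^ j) : T)) := by
      have h2 : g f = ∑ i ∈ Finset.range act.n, ∑ j ∈ Finset.range act.N,
          r i j * g (act.t ^ i * (act.s : T) ^ j) := by
        conv_lhs => rw [hr]
        simp only [map_sum]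
        refine Finset.sum_congr rfl fun i _ => Finset.sum_congr rfl fun j _ => ?_
        exact map_smul g (r i j) _
      rw [h2]
      simp only [AddSubmonoidClass.coe_finsetSum, MulMemClass.coe_mul, Finset.mul_sum]
      exact Finset.sum_congr rfl fun i _ => Finset.sum_congr rfl fun j _ => by ring
    rw [h1]
    conv_rhs => rw [hr]
    simp only [Finset.mul_sum, map_sum]
    refine Finset.sum_congr rfl fun i hi => Finset.sum_congr rfl fun j hj => ?_
    rw [mul_left_comm (Finset.sum _ _) ((r i j : O) : T), act.E_mul (r i j).2]
    congr 1
    simp only [Finset.sum_mul, map_sum, mul_assoc]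
    have h3 : ∀ i' ∈ Finset.range act.n, ∀ j' ∈ Finset.range act.N,
        act.E ((g (act.t ^ i' * (act.s : T) ^ j') : T) * (act.t ^ (act.n - i') *
          (((act.s⁻¹ : Tˣ) : T) ^ j' * (act.t ^ i * (act.s : T) ^ j)))) =
        if i = i' then if j = j' then (g (act.t ^ i * (act.s : T) ^ j) : T) * act.t ^ act.n else 0
          else 0 := by
      intro i' hi' j' hj'
      rw [act.E_mul (g _).2, ← mul_assoc (act.t ^ (act.n - i')),
        act.E_monomial (Finset.mem_range.1 hi) (Finset.mem_range.1 hi') (Finset.mem_range.1 hj)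
          (Finset.mem_range.1 hj')]
      by_cases h : i = i'
      · by_cases h' : j = j'
        · subst h h'
          simp
        · simp [h']
      · simp [h]
    rw [Finset.sum_congr rfl fun i' hi' => Finset.sum_congr rfl fun j' hj' => h3 i' hi' j' hj']
    rw [Finset.sum_eq_single_of_mem i hi (fun i' _ hne => by
      simp [hne.symm]), Finset.sum_eq_single_of_mem j hj (fun j' _ hne => by simp [hne.symm])]
    simp only [if_true]
    exact mul_comm _ _

theorem eq_zero_of_E_mul_eq_zero {c : T} (h : ∀ f, act.E (c * f) = 0) : c = 0 := by
  by_contra hc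
  obtain ⟨v, u, hu, rfl⟩ := act.factor c hc
  obtain ⟨u', hu'⟩ := hu.exists_right_inv
  have h1 : act.t ^ v * u * (u' * act.t ^ (act.n * v - v)) = (act.t ^ act.n) ^ v := by
    have : v ≤ act.n * v := Nat.le_mul_of_pos_left v (Nat.pos_of_ne_zero act.n_ne_zero)
    calc _ = act.t ^ v * act.t ^ (act.n * v - v) * (u * u') := by ring
      _ = _ := by rw [hu', mul_one, ← pow_add, Nat.add_sub_cancel' this, pow_mul]
  have h2 := h (u' * act.t ^ (act.n * v - v))
  rw [h1, act.E_of_mem (pow_mem act.t_pow_n_mem v)] at h2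
  exact pow_ne_zero _ (pow_ne_zero _ act.t_ne_zero) h2

variable {e : ℕ} {F : Type u} [NeZero e] [Fintype F] [DecidableEq F]
  (w : ShiftWeight k act.n act.N e F)

omit [CharZero k] [IsDomain T] in
theorem dvd_matE {X : Matrix (ZMod e × F) (ZMod e × F) T} (h : ∀ q q', act.t ∣ X q q')
    (q q' : ZMod e × F) : act.t ∣ act.matE w X q q' := by
  let p : Submodule k (Matrix (ZMod e × F) (ZMod e × F) T) :=
    { carrier := {X | ∀ q q', act.t ∣ X q q'}
      add_mem' := fun hX hY q q' => dvd_add (hX q q') (hY q q')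
      zero_mem' := fun q q' => dvd_zero _
      smul_mem' := fun c X hX q q' => (hX q q').trans ⟨algebraMap k T c, by
        rw [Matrix.smul_apply, Algebra.smul_def, mul_comm]⟩ }
  have hσ : ∀ X ∈ p, (act.matσ w).toLinearMap X ∈ p := by
    intro X hX q q'
    change act.t ∣ act.matσ w X q q'
    rw [matσ_apply]
    refine Dvd.dvd.trans ?_ (show act.σ (X q q') ∣ _ from ⟨algebraMap k T (w.α q / w.α q'), by
        rw [Algebra.smul_def, mul_comm]⟩)
    rw [← act.ev_eq_zero_iff, act.ev_σ, act.ev_eq_zero_iff]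
    exact hX q q'
  have hτ : ∀ X ∈ p, (act.matτ (e := e) (F := F)).toLinearMap X ∈ p := by
    intro X hX q q'
    change act.t ∣ act.matτ X q q'
    obtain ⟨q, rfl⟩ := shiftIndex.surjective q
    obtain ⟨q', rfl⟩ := shiftIndex.surjective q'
    rw [matτ_apply_shift]
    have := map_dvd act.τ (hX q q')
    rwa [act.τ_t] at this
  exact cyclicMean_mem p hσ _ (cyclicMean_mem p hτ _ (x := X) h) q q'

theorem exists_trace_eq (h : act.modelOrder w →ₗ[O] O) :
    ∃ j ∈ act.modelOrder w, (∀ q q', act.t ∣ j q q') ∧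
      ∀ y : act.modelOrder w, (act.x : T) * (h y : T) = (j * y.1).trace := by
  let H : Matrix (ZMod e × F) (ZMod e × F) T →ₗ[O] O :=
    { toFun := fun Y => h (act.matRetract w Y)
      map_add' := fun Y Y' => by rw [map_add, map_add]
      map_smul' := fun r Y => by
        rw [RingHom.id_apply, ← map_smul]
        congr 1
        refine Subtype.ext ?_
        change act.matE w (r • Y) = r • act.matE w Y
        rw [Algebra.smul_def, Algebra.smul_def]
        exact act.matE_mul_left w ((act.modelOrder w).algebraMap_mem r) Y }
  have hg : ∀ q q' : ZMod e × F, ∃ c, act.t ∣ c ∧ ∀ f, (act.x : T) * (H (Matrix.single q q' f) : T)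
      = act.E (c * f) := by
    intro q q'
    exact act.exists_E_mul_eq (H.comp (Matrix.singleLinearMap O q q'))
  choose c hc hcE using hg
  let C : Matrix (ZMod e × F) (ZMod e × F) T := Matrix.of fun q q' => c q' q
  refine ⟨act.matE w C, act.matE_mem w C, act.dvd_matE w fun q q' => hc q' q, fun y => ?_⟩
  have h1 : h y = H y.1 := by
    change h y = h (act.matRetract w y.1)
    congr 1
    exact Subtype.ext (act.matE_of_mem w y.2).symm
  rw [h1, ← act.matE_mul_right w y.2, trace_matE]
  conv_lhs => rw [Matrix.matrix_eq_sum_single y.1]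
  simp only [map_sum, AddSubmonoidClass.coe_finsetSum, Finset.mul_sum, hcE]
  rw [Matrix.trace, map_sum]
  simp only [Matrix.diag_apply, Matrix.mul_apply, map_sum]
  rw [Finset.sum_comm]
  rfl

/-- The trace form is nondegenerate on the model order. -/
theorem eq_zero_of_trace_eq_zero {X : Matrix (ZMod e × F) (ZMod e × F) T}
    (hX : X ∈ act.modelOrder w) (h : ∀ y ∈ act.modelOrder w, (X * y).trace = 0) : X = 0 := by
  ext q q'
  refine act.eq_zero_of_E_mul_eq_zero fun f => ?_
  have h1 := h _ (act.matE_mem w (Matrix.single q' q f))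
  rw [← act.matE_mul_left w hX, trace_matE, Matrix.trace_mul_single] at h1
  exact h1

/-- A functional defined by an element divisible by `t`. -/
theorem exists_hom_of_dvd {j : Matrix (ZMod e × F) (ZMod e × F) T} (hj : j ∈ act.modelOrder w)
    (hdvd : ∀ q q', act.t ∣ j q q') :
    ∃ h : act.modelOrder w →ₗ[O] O, ∀ y, (act.x : T) * (h y : T) = (j * y.1).trace := by
  have h1 : ∀ y : act.modelOrder w, ∃ r : O, (act.x : T) * (r : T) = (j * y.1).trace := by
    intro y
    have hmem : j * y.1 ∈ act.modelOrder w := mul_mem hj y.2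
    have hO : (j * y.1).trace ∈ O := by
      rw [← act.matE_of_mem w hmem, trace_matE]
      exact act.E_mem _
    have hd : act.t ^ 1 ∣ (j * y.1).trace := by
      rw [pow_one]
      refine Finset.dvd_sum fun q _ => ?_
      rw [Matrix.diag_apply, Matrix.mul_apply]
      exact Finset.dvd_sum fun q' _ => (hdvd q q').mul_right _
    obtain ⟨r, hr⟩ : act.t ^ act.n ∣ (j * y.1).trace := by
      refine act.t_pow_dvd_of_σ_eq_smul (y := 1) ?_ hd fun v hv hv1 => ?_
      · rw [one_smul, ((act.mem_iff _).1 hO).1]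
      · exact Nat.le_of_dvd hv ((act.isPrimitiveRoot_ζ.pow_eq_one_iff_dvd v).1 hv1)
    have hrO : r ∈ O := act.cancel_mem act.t_pow_n_mem (pow_ne_zero _ act.t_ne_zero)
      (by rw [← hr]; exact hO)
    exact ⟨⟨r, hrO⟩, hr.symm⟩
  choose r hr using h1
  have hx0 : (act.x : T) ≠ 0 := pow_ne_zero _ act.t_ne_zero
  refine ⟨⟨⟨r, fun y y' => Subtype.ext (mul_left_cancel₀ hx0 ?_)⟩,
    fun c y => Subtype.ext (mul_left_cancel₀ hx0 ?_)⟩, hr⟩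
  · change _ = (act.x : T) * ((r y : T) + (r y' : T))
    rw [mul_add, hr, hr, hr, ← Matrix.trace_add, ← mul_add]
    rfl
  · change _ = (act.x : T) * ((c : T) * (r y : T))
    rw [mul_left_comm, hr, hr]
    change (j * (c • y.1)).trace = _
    rw [mul_smul_comm, Matrix.trace_smul]
    rfl

end TameAction


/-! ### Self-duality of the model order -/

namespace TameAction

variable {k : Type u} [Field k] [CharZero k] {T : Type u} [CommRing T] [IsDomain T] [Algebra k T]
  {κ : Type u} [Field κ] [Algebra k κ] {O : Subalgebra k T} (act : TameAction k T κ O)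

theorem exists_pow_ζ_eq {y : k} (hy : y ^ act.n = 1) : ∃ c < act.n, act.ζ ^ c = y :=
  haveI : NeZero act.n := ⟨act.n_ne_zero⟩
  act.isPrimitiveRoot_ζ.eq_pow_of_pow_eq_one hy

/-- The exponent in `[0, n)` of an `n`-th root of unity with respect to `ζ`. -/
def log (y : k) : ℕ := by
  classical exact if hy : y ^ act.n = 1 then (act.exists_pow_ζ_eq hy).choose else 0

theorem log_lt {y : k} (hy : y ^ act.n = 1) : act.log y < act.n := by
  rw [log, dif_pos hy]
  exact (act.exists_pow_ζ_eq hy).choose_spec.1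

theorem ζ_pow_log {y : k} (hy : y ^ act.n = 1) : act.ζ ^ act.log y = y := by
  rw [log, dif_pos hy]
  exact (act.exists_pow_ζ_eq hy).choose_spec.2

theorem log_le {y : k} {v : ℕ} (h : act.ζ ^ v = y) : act.log y ≤ v := by
  have hy : y ^ act.n = 1 := by
    rw [← h, ← pow_mul, mul_comm, pow_mul, act.isPrimitiveRoot_ζ.pow_eq_one, one_pow]
  rw [← act.ζ_pow_log hy, pow_eq_pow_mod v act.isPrimitiveRoot_ζ.pow_eq_one] at h
  rw [← act.isPrimitiveRoot_ζ.pow_inj (Nat.mod_lt v (Nat.pos_of_ne_zero act.n_ne_zero))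
    (act.log_lt hy) h]
  exact Nat.mod_le _ _

variable {e : ℕ} {F : Type u} [NeZero e] [Fintype F] [DecidableEq F]
  (w : ShiftWeight k act.n act.N e F)

theorem t_pow_log_dvd {X : Matrix (ZMod e × F) (ZMod e × F) T} (hX : X ∈ act.modelOrder w)
    (q q' : ZMod e × F) : act.t ^ act.log (w.α q' / w.α q) ∣ X q q' :=
  act.t_pow_dvd_of_σ_eq_smul (act.σ_apply_of_mem w hX q q') (j := 0) (by simp)
    fun _ _ hv => act.log_le hv

theorem α_shiftIndex (q : ZMod e × F) : w.α (shiftIndex q) = w.η * w.α q := w.α_shift q.1 q.2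

/-- The sum over an orbit of the shift of elementary matrices. -/
def orbitMatrix (v : ℕ) (q q0 : ZMod e × F) : Matrix (ZMod e × F) (ZMod e × F) T :=
  Matrix.of fun p p0 =>
    if p0.2 = q0.2 ∧ p.2 = q.2 ∧ p.1 - q.1 = p0.1 - q0.1 then act.t ^ v else 0

theorem orbitMatrix_mem {v : ℕ} {q q0 : ZMod e × F} (hv : act.ζ ^ v = w.α q0 / w.α q) :
    act.orbitMatrix v q q0 ∈ act.modelOrder w := by
  refine act.mem_modelOrder_of w (fun p p0 => ?_) (fun p p0 => ?_)
  · simp only [orbitMatrix, Matrix.of_apply]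
    split_ifs with h
    · obtain ⟨h1, h2, h3⟩ := h
      have e1 : w.α p = w.η ^ (p.1 - q.1).val * w.α q := by
        rw [← w.α_add_nat, ZMod.natCast_zmod_val, add_sub_cancel, ← h2]
      have e2 : w.α p0 = w.η ^ (p.1 - q.1).val * w.α q0 := by
        rw [← w.α_add_nat, ZMod.natCast_zmod_val, h3, add_sub_cancel, ← h1]
      rw [e1, e2, mul_div_mul_left _ _ (pow_ne_zero _ (w.isPrimitiveRoot_η.ne_zero (NeZero.ne e))),
        act.σ_t_pow, hv]
    · rw [map_zero, smul_zero]
  · simp only [orbitMatrix, Matrix.of_apply, Equiv.prodCongr_apply, Prod.map, Equiv.coe_addRight,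
      Equiv.refl_apply, add_sub_right_comm, add_left_inj]
    split_ifs with h
    · rw [act.τ_t_pow]
    · rw [map_zero]

/-- If the elements of the model order divisible by `t` form a principal right ideal, then all
weights have the same multiplicity: the valuation of the determinant of a generator is `n` times the
multiplicity of any weight. -/
theorem card_eq_of_exists_generator {π : Matrix (ZMod e × F) (ZMod e × F) T}
    (hπ : π ∈ act.modelOrder w) (hdvd : ∀ q q', act.t ∣ π q q')
    (hgen : ∀ j ∈ act.modelOrder w, (∀ q q', act.t ∣ j q q') → ∃ y ∈ act.modelOrder w, j = π * y)
    (q0 q1 : ZMod e × F) :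
    Nat.card {q // w.α q = w.α q0} = Nat.card {q // w.α q = w.α q1} := by
  classical
  have key : ∀ q0 : ZMod e × F,
      Associated π.det (act.t ^ (act.n * Nat.card {q // w.α q = w.α q0})) := by
    intro q0
    let f : ZMod e × F → ℕ := fun q => act.log (w.α q0 / w.α q)
    let g : ZMod e × F → ℕ := fun q => f q + if w.α q = w.α q0 then act.n else 0
    have hζg : ∀ q, act.ζ ^ g q = w.α q0 / w.α q := fun q => by
      simp only [g, pow_add, f, act.ζ_pow_log (w.ratio_pow q0 q)]
      split_ifs
      · rw [act.isPrimitiveRoot_ζ.pow_eq_one, mul_one]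
      · rw [pow_zero, mul_one]
    have hg1 : ∀ q, 1 ≤ g q := fun q => by
      by_cases h : w.α q = w.α q0
      · simp only [g, if_pos h]
        have := Nat.pos_of_ne_zero act.n_ne_zero
        omega
      · have h0 : g q ≠ 0 := fun h0 => by
          have h1 := hζg q
          rw [h0, pow_zero, eq_comm, div_eq_one_iff_eq (w.α_ne_zero q)] at h1
          exact h h1.symm
        omega
    have hgmin : ∀ q v, 1 ≤ v → act.ζ ^ v = w.α q0 / w.α q → g q ≤ v := fun q v hv h => by
      have h1 := act.log_le h
      by_cases hq : w.α q = w.α q0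
      · have h2 : act.log (w.α q0 / w.α q) = 0 :=
          Nat.le_zero.1 (act.log_le (by rw [hq, div_self (w.α_ne_zero q0), pow_zero]))
        simp only [g, f, if_pos hq, h2, zero_add]
        rw [hq, div_self (w.α_ne_zero q0)] at h
        exact Nat.le_of_dvd hv ((act.isPrimitiveRoot_ζ.pow_eq_one_iff_dvd v).1 h)
      · simp only [g, f, if_neg hq, add_zero]
        exact h1
    -- the entries of `π` and of the orbit matrices compare the lattices spanned by the `q0`-th
    -- columns of the order and of the ideal
    obtain ⟨Y, hY⟩ : ∃ Y, π * Matrix.diagonal (fun q => act.t ^ f q) =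
        Matrix.diagonal (fun q => act.t ^ g q) * Y := by
      have h1 : ∀ q q', ∃ y, π q q' * act.t ^ f q' = act.t ^ g q * y := fun q q' => by
        refine act.t_pow_dvd_of_σ_eq_smul (y := w.α q0 / w.α q) (j := 1) ?_ ?_ (hgmin q)
        · rw [map_mul, act.σ_apply_of_mem w hπ, act.σ_t_pow, act.ζ_pow_log (w.ratio_pow q0 q'),
            smul_mul_smul_comm, mul_comm, div_mul_div_cancel₀ (w.α_ne_zero q'), mul_comm]
        · rw [pow_one]
          exact (hdvd q q').mul_right _
      choose Y hY using h1
      refine ⟨Matrix.of Y, ?_⟩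
      ext q q'
      rw [Matrix.mul_diagonal, Matrix.diagonal_mul, hY]
      rfl
    obtain ⟨Z, hZ⟩ : ∃ Z, Matrix.diagonal (fun q => act.t ^ g q) =
        π * Matrix.diagonal (fun q => act.t ^ f q) * Z := by
      have h1 : ∀ q, ∃ z : ZMod e × F → T, ∀ p,
          (if p = q then act.t ^ g q else 0) = ∑ r, π p r * (act.t ^ f r * z r) := fun q => by
        obtain ⟨y, hy, hjy⟩ := hgen _ (act.orbitMatrix_mem w (hζg q)) (fun p p0 => by
          simp only [orbitMatrix, Matrix.of_apply]
          split_ifs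
          · exact dvd_pow_self _ (Nat.one_le_iff_ne_zero.1 (hg1 q))
          · exact dvd_zero _)
        choose z hz using fun r => act.t_pow_log_dvd w hy r q0
        refine ⟨z, fun p => ?_⟩
        have h2 := congrFun₂ hjy p q0
        rw [Matrix.mul_apply] at h2
        simp only [orbitMatrix, Matrix.of_apply, sub_self, sub_eq_zero, true_and] at h2
        rw [show (∑ r, π p r * (act.t ^ f r * z r)) = ∑ r, π p r * y r q0 from
          Finset.sum_congr rfl fun r _ => by rw [hz r], ← h2]
        simp only [Prod.ext_iff, and_comm]
      choose z hz using h1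
      refine ⟨Matrix.of fun r q => z q r, ?_⟩
      ext p q
      rw [mul_assoc, Matrix.mul_apply, Matrix.diagonal_apply]
      have h2 := hz q p
      simp only [Matrix.diagonal_mul, Matrix.of_apply]
      rw [← h2]
      by_cases hpq : p = q
      · subst hpq; simp
      · simp [hpq]
    have hd1 := congrArg Matrix.det hY
    have hd2 := congrArg Matrix.det hZ
    simp only [Matrix.det_mul, Matrix.det_diagonal, Finset.prod_pow_eq_pow_sum] at hd1 hd2
    have hsum : ∑ q, g q = ∑ q, f q + act.n * Nat.card {q // w.α q = w.α q0} := by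
      simp only [g, Finset.sum_add_distrib]
      rw [Finset.sum_ite, Finset.sum_const, Finset.sum_const_zero, add_zero, smul_eq_mul,
        Nat.card_eq_fintype_card, Fintype.card_subtype, mul_comm]
    have hassoc : Associated (act.t ^ (∑ q, f q) * π.det)
        (act.t ^ (∑ q, f q) * act.t ^ (act.n * Nat.card {q // w.α q = w.α q0})) := by
      rw [← pow_add, ← hsum, mul_comm]
      exact associated_of_dvd_dvd ⟨_, hd2⟩ ⟨_, hd1⟩
    exact hassoc.of_mul_left (Associated.refl _) (pow_ne_zero _ act.t_ne_zero)
  have h := (key q0).symm.trans (key q1)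
  have ht : ¬ IsUnit act.t := fun ht =>
    (act.isUnit_iff _).1 ht ((act.ev_eq_zero_iff _).2 dvd_rfl)
  have h1 := (pow_dvd_pow_iff act.t_ne_zero ht).1 h.dvd
  have h2 := (pow_dvd_pow_iff act.t_ne_zero ht).1 h.symm.dvd
  exact Nat.eq_of_mul_eq_mul_left (Nat.pos_of_ne_zero act.n_ne_zero) (le_antisymm h1 h2)

theorem card_eq_of_isRightSelfDual (h : IsRightSelfDual O (act.modelOrder w))
    (q0 q1 : ZMod e × F) :
    Nat.card {q // w.α q = w.α q0} = Nat.card {q // w.α q = w.α q1} := by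
  obtain ⟨φ, hφ⟩ := h
  obtain ⟨π, hπ, hdvd, hπt⟩ := act.exists_trace_eq w (φ 1)
  refine act.card_eq_of_exists_generator w hπ hdvd (fun j hj hjd => ?_) q0 q1
  obtain ⟨h', hh'⟩ := act.exists_hom_of_dvd w hj hjd
  obtain ⟨y, rfl⟩ := φ.surjective h'
  refine ⟨y.1, y.2, ?_⟩
  rw [← sub_eq_zero]
  refine act.eq_zero_of_trace_eq_zero w (sub_mem hj (mul_mem hπ y.2)) fun z hz => ?_
  have h1 := hh' ⟨z, hz⟩
  have h2 := hπt (y * ⟨z, hz⟩)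
  rw [← hφ y 1, one_mul, h1] at h2
  rw [sub_mul, Matrix.trace_sub, h2, mul_assoc]
  exact sub_self _

/-- Both self-dualities hold if the elements divisible by `t` form the ideal generated on either side
by one cancellable element. -/
theorem isSelfDual_of_generator {π : Matrix (ZMod e × F) (ZMod e × F) T}
    (hπ : π ∈ act.modelOrder w) (hdvd : ∀ q q', act.t ∣ π q q')
    (hcl : ∀ Y, π * Y = 0 → Y = 0) (hcr : ∀ Y, Y * π = 0 → Y = 0)
    (hl : ∀ j ∈ act.modelOrder w, (∀ q q', act.t ∣ j q q') → ∃ y ∈ act.modelOrder w, j = π * y)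
    (hr : ∀ j ∈ act.modelOrder w, (∀ q q', act.t ∣ j q q') → ∃ y ∈ act.modelOrder w, j = y * π) :
    IsLeftSelfDual O (act.modelOrder w) ∧ IsRightSelfDual O (act.modelOrder w) := by
  have hx0 : (act.x : T) ≠ 0 := pow_ne_zero _ act.t_ne_zero
  -- the form `h y = x⁻¹ * trace (y * π)` is the generator of the dual on either side
  obtain ⟨h, hh⟩ := act.exists_hom_of_dvd w hπ hdvd
  constructor
  · let φ : act.modelOrder w →ₗ[O] act.modelOrder w →ₗ[O] O :=
      LinearMap.mk₂ O (fun a y => h (y * a))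
        (fun a b y => by rw [mul_add, map_add]) (fun r a y => by rw [mul_smul_comm, map_smul])
        (fun a y y' => by rw [add_mul, map_add]) (fun r a y => by rw [smul_mul_assoc, map_smul])
    refine ⟨LinearEquiv.ofBijective φ ⟨?_, fun g => ?_⟩, fun a b x => ?_⟩
    · rw [injective_iff_map_eq_zero]
      intro a ha
      refine Subtype.ext (hcr a.1 (act.eq_zero_of_trace_eq_zero w (mul_mem a.2 hπ) fun y hy => ?_))
      have h1 := hh (⟨y, hy⟩ * a)
      rw [show h (⟨y, hy⟩ * a) = 0 from DFunLike.congr_fun ha ⟨y, hy⟩] at h1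
      rw [mul_assoc, Matrix.trace_mul_comm, mul_assoc]
      exact h1.symm.trans (mul_zero _)
    · obtain ⟨j, hj, hjd, hjt⟩ := act.exists_trace_eq w g
      obtain ⟨a, ha, rfl⟩ := hr j hj hjd
      refine ⟨⟨a, ha⟩, LinearMap.ext fun y => Subtype.ext (mul_left_cancel₀ hx0 ?_)⟩
      rw [hjt y]
      refine (hh _).trans ?_
      rw [mul_assoc a, Matrix.trace_mul_comm a, mul_assoc]
      rfl
    · change h (x * (a * b)) = h (x * a * b)
      rw [mul_assoc]
  · let φ : act.modelOrder w →ₗ[O] act.modelOrder w →ₗ[O] O :=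
      LinearMap.mk₂ O (fun a y => h (a * y))
        (fun a b y => by rw [add_mul, map_add]) (fun r a y => by rw [smul_mul_assoc, map_smul])
        (fun a y y' => by rw [mul_add, map_add]) (fun r a y => by rw [mul_smul_comm, map_smul])
    refine ⟨LinearEquiv.ofBijective φ ⟨?_, fun g => ?_⟩, fun a b x => ?_⟩
    · rw [injective_iff_map_eq_zero]
      intro a ha
      refine Subtype.ext (hcl a.1 (act.eq_zero_of_trace_eq_zero w (mul_mem hπ a.2) fun y hy => ?_))
      have h1 := hh (a * ⟨y, hy⟩)
      rw [show h (a * ⟨y, hy⟩) = 0 from DFunLike.congr_fun ha ⟨y, hy⟩] at h1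
      rw [mul_assoc]
      exact h1.symm.trans (mul_zero _)
    · obtain ⟨j, hj, hjd, hjt⟩ := act.exists_trace_eq w g
      obtain ⟨a, ha, rfl⟩ := hl j hj hjd
      refine ⟨⟨a, ha⟩, LinearMap.ext fun y => Subtype.ext (mul_left_cancel₀ hx0 ?_)⟩
      rw [hjt y]
      refine (hh _).trans ?_
      rw [mul_assoc]
      rfl
    · change h (b * a * x) = h (b * (a * x))
      rw [mul_assoc]

/-- Weights of equal multiplicity give self-duality. The generator moves every index to the next
smaller occurring weight, in the cyclic order of the powers of `ζ`; labels that are constant along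
the shift make this choice equivariant. -/
theorem isSelfDual_of_card_eq (ℓ : F → ℕ)
    (hinj : ∀ q q' : ZMod e × F, w.α q = w.α q' → ℓ q.2 = ℓ q'.2 → q = q')
    (hlt : ∀ q : ZMod e × F, ℓ q.2 < Nat.card {q' // w.α q' = w.α q})
    (hcard : ∀ q q0 : ZMod e × F,
      Nat.card {q' // w.α q' = w.α q} = Nat.card {q' // w.α q' = w.α q0}) :
    IsLeftSelfDual O (act.modelOrder w) ∧ IsRightSelfDual O (act.modelOrder w) := by
  classical
  have hη0 : w.η ≠ 0 := w.isPrimitiveRoot_η.ne_zero (NeZero.ne e)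
  -- the labels within a class of equal weights run through an initial interval, and all classes
  -- have the same size, so every label occurs in every class
  have hlabel : ∀ q q0 : ZMod e × F, ∃ q', w.α q' = w.α q ∧ ℓ q'.2 = ℓ q0.2 := by
    intro q q0
    let f : {q' // w.α q' = w.α q} → Fin (Nat.card {q' // w.α q' = w.α q}) :=
      fun q' => ⟨ℓ q'.1.2, by
        have := hlt q'.1
        rwa [hcard q'.1 q] at this⟩
    have hf : Function.Injective f := fun a b hab =>
      Subtype.ext (hinj _ _ (a.2.trans b.2.symm) (congrArg Fin.val hab))
    have hs : Function.Surjective f :=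
      ((Fintype.bijective_iff_injective_and_card f).2 ⟨hf, by simp⟩).2
    obtain ⟨q', hq'⟩ := hs ⟨ℓ q0.2, by
      have := hlt q0
      rwa [hcard q0 q] at this⟩
    exact ⟨q'.1, q'.2, congrArg Fin.val hq'⟩
  have hex : ∀ q, ∃ c, 1 ≤ c ∧ ∃ q', act.ζ ^ c * w.α q' = w.α q := fun q =>
    ⟨act.n, Nat.pos_of_ne_zero act.n_ne_zero, q, by
      rw [act.isPrimitiveRoot_ζ.pow_eq_one, one_mul]⟩
  -- `γ q` is the distance from the weight of `q` to the next occurring one, and `θ q` the index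
  -- with that weight and the label of `q`
  let γ : ZMod e × F → ℕ := fun q => Nat.find (hex q)
  have hγ1 : ∀ q, 1 ≤ γ q := fun q => (Nat.find_spec (hex q)).1
  have hγmin : ∀ q c q', 1 ≤ c → act.ζ ^ c * w.α q' = w.α q → γ q ≤ c := fun q c q' hc h =>
    Nat.find_min' (hex q) ⟨hc, q', h⟩
  have hθ : ∀ q, ∃ q', act.ζ ^ γ q * w.α q' = w.α q ∧ ℓ q'.2 = ℓ q.2 := fun q => by
    obtain ⟨q', hq'⟩ := (Nat.find_spec (hex q)).2
    obtain ⟨q'', h1, h2⟩ := hlabel q' q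
    exact ⟨q'', by rw [h1]; exact hq', h2⟩
  choose θ hθα hθℓ using hθ
  -- `γ` and `θ` are equivariant for the shift, and `θ` is a permutation
  have hγs : ∀ q, γ (shiftIndex q) = γ q := fun q => by
    apply le_antisymm
    · refine hγmin _ _ (shiftIndex (θ q)) (hγ1 q) ?_
      rw [act.α_shiftIndex, act.α_shiftIndex, ← hθα q]
      ring
    · obtain ⟨r, hr⟩ := shiftIndex.surjective (θ (shiftIndex q))
      refine hγmin _ _ r (hγ1 _) ?_
      have h1 := hθα (shiftIndex q)
      rw [← hr, act.α_shiftIndex, act.α_shiftIndex, mul_left_comm] at h1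
      exact mul_left_cancel₀ hη0 h1
  have hθs : ∀ q, θ (shiftIndex q) = shiftIndex (θ q) := fun q => by
    refine hinj _ _ ?_ ?_
    · have h1 := hθα (shiftIndex q)
      rw [hγs, act.α_shiftIndex, ← hθα q, mul_left_comm] at h1
      rw [act.α_shiftIndex]
      exact mul_left_cancel₀ (pow_ne_zero _ act.ζ_ne_zero) h1
    · rw [hθℓ]
      change ℓ q.2 = ℓ (θ q).2
      rw [hθℓ]
  have hγlt : ∀ q q', θ q = θ q' → γ q ≤ γ q' := fun q q' h => by
    by_contra hcon
    push Not at hcon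
    have h1 := hγmin q (γ q - γ q') q' (by omega) (by
      rw [← hθα q', ← h, ← mul_assoc, ← pow_add, Nat.sub_add_cancel hcon.le, hθα])
    have := hγ1 q'
    omega
  have hθinj : Function.Injective θ := fun q q' h => by
    have h1 : γ q = γ q' := le_antisymm (hγlt _ _ h) (hγlt _ _ h.symm)
    refine hinj _ _ ?_ ?_
    · rw [← hθα q, ← hθα q', h, h1]
    · rw [← hθℓ q, ← hθℓ q', h]
  have hθsurj : Function.Surjective θ := Finite.surjective_of_injective hθinj
  -- the generator is the monomial matrix of `θ` with entries `t ^ γ`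
  let π : Matrix (ZMod e × F) (ZMod e × F) T :=
    Matrix.of fun q q' => if q = θ q' then act.t ^ γ q' else 0
  have hπl : ∀ (Y : Matrix (ZMod e × F) (ZMod e × F) T) q q',
      (π * Y) (θ q) q' = act.t ^ γ q * Y q q' := fun Y q q' => by
    rw [Matrix.mul_apply, Finset.sum_eq_single q]
    · simp [π]
    · intro r _ hr
      have : θ q ≠ θ r := fun h => hr (hθinj h).symm
      simp [π, this]
    · simp
  have hπr : ∀ (Y : Matrix (ZMod e × F) (ZMod e × F) T) q q',
      (Y * π) q q' = act.t ^ γ q' * Y q (θ q') := fun Y q q' => by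
    rw [Matrix.mul_apply, Finset.sum_eq_single (θ q')]
    · simp [π, mul_comm]
    · intro r _ hr
      simp [π, hr]
    · simp
  have hcl : ∀ Y, π * Y = 0 → Y = 0 := fun Y h => by
    ext q q'
    have h1 := congrFun₂ h (θ q) q'
    rw [hπl] at h1
    exact (mul_eq_zero.1 h1).resolve_left (pow_ne_zero _ act.t_ne_zero)
  have hcr : ∀ Y, Y * π = 0 → Y = 0 := fun Y h => by
    ext q q'
    obtain ⟨q', rfl⟩ := hθsurj q'
    have h1 := congrFun₂ h q q'
    rw [hπr] at h1
    exact (mul_eq_zero.1 h1).resolve_left (pow_ne_zero _ act.t_ne_zero)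
  have hπ : π ∈ act.modelOrder w := by
    refine act.mem_modelOrder_of w (fun q q' => ?_) (fun q q' => ?_)
    · simp only [π, Matrix.of_apply]
      split_ifs with h
      · rw [act.σ_t_pow, h, ← hθα q', mul_div_cancel_right₀ _ (w.α_ne_zero _)]
      · rw [map_zero, smul_zero]
    · simp only [π, Matrix.of_apply, hθs, hγs, EmbeddingLike.apply_eq_iff_eq]
      split_ifs
      · rw [act.τ_t_pow]
      · rw [map_zero]
  refine act.isSelfDual_of_generator w hπ (fun q q' => ?_) hcl hcr (fun j hj hjd => ?_)
    (fun j hj hjd => ?_)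
  · simp only [π, Matrix.of_apply]
    split_ifs
    · exact dvd_pow_self _ (Nat.one_le_iff_ne_zero.1 (hγ1 q'))
    · exact dvd_zero _
  -- an entry divisible by `t` is divisible by the power of `t` given by the distance of its
  -- weights, which is at least `γ` by minimality
  · have h1 : ∀ q q', act.t ^ γ q ∣ j (θ q) q' := fun q q' => by
      refine act.t_pow_dvd_of_σ_eq_smul (act.σ_apply_of_mem w hj (θ q) q') (j := 1)
        (by rw [pow_one]; exact hjd _ _) fun v hv hv' => ?_
      by_contra hcon
      push Not at hcon
      rw [eq_div_iff (w.α_ne_zero _)] at hv'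
      have h2 := hγmin q (γ q - v) q' (by omega) (by
        rw [← hv', ← mul_assoc, ← pow_add, Nat.sub_add_cancel hcon.le, hθα])
      omega
    choose y hy using h1
    have hjy : j = π * Matrix.of y := by
      ext q q'
      obtain ⟨q, rfl⟩ := hθsurj q
      rw [hπl, hy]
      rfl
    refine ⟨_, act.mem_of_mul_mem_left w hπ (fun Z Z' h => ?_) (hjy ▸ hj), hjy⟩
    rw [← sub_eq_zero, ← mul_sub] at h
    exact sub_eq_zero.1 (hcl _ h)
  · have h1 : ∀ q q', act.t ^ γ q' ∣ j q q' := fun q q' => by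
      refine act.t_pow_dvd_of_σ_eq_smul (act.σ_apply_of_mem w hj q q') (j := 1)
        (by rw [pow_one]; exact hjd _ _) fun v hv hv' => ?_
      rw [eq_div_iff (w.α_ne_zero _)] at hv'
      exact hγmin q' v q hv hv'
    choose y hy using h1
    have hjy : j = (Matrix.of fun q q' => y q (Function.surjInv hθsurj q')) * π := by
      ext q q'
      rw [hπr, hy, Matrix.of_apply, Function.leftInverse_surjInv ⟨hθinj, hθsurj⟩]
    refine ⟨_, act.mem_of_mul_mem_right w hπ (fun Z Z' h => ?_) (hjy ▸ hj), hjy⟩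
    rw [← sub_eq_zero, ← sub_mul] at h
    exact sub_eq_zero.1 (hcr _ h)

end TameAction


/-! ### Vandermonde systems -/

section Vandermonde

variable {T : Type*} [CommRing T] {ι : Type*} [Fintype ι]

theorem existsUnique_vandermonde (a : ι → T) (ha : ∀ i j, i ≠ j → IsUnit (a i - a j)) (f : ι → T) :
    ∃! c : Fin (Fintype.card ι) → T, ∀ i, f i = ∑ j, c j * a i ^ (j : ℕ) := by
  classical
  let ε := Fintype.equivFin ι
  let V := Matrix.vandermonde (a ∘ ε.symm)
  have hdet : IsUnit V.det := by
    rw [Matrix.det_vandermonde, IsUnit.prod_univ_iff]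
    intro i
    rw [IsUnit.prod_iff]
    intro j hj
    refine ha _ _ fun h => ?_
    have := ε.symm.injective h
    simp only [Finset.mem_Ioi] at hj
    exact hj.ne this.symm
  have hV : ∀ (c : Fin (Fintype.card ι) → T), (∀ i, f i = ∑ j, c j * a i ^ (j : ℕ)) ↔
      V.mulVec c = f ∘ ε.symm := by
    intro c
    rw [funext_iff]
    refine ⟨fun h i => ?_, fun h i => ?_⟩
    · rw [Function.comp_apply, h]
      simp [V, Matrix.mulVec, dotProduct, mul_comm]
    · have := h (ε i)
      rw [Function.comp_apply, ε.symm_apply_apply] at this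
      rw [← this]
      simp [V, Matrix.mulVec, dotProduct, mul_comm]
  simp only [hV]
  have hu := Matrix.isUnit_iff_isUnit_det V |>.2 hdet
  refine Function.Bijective.existsUnique ⟨Matrix.mulVec_injective_of_isUnit hu, fun f => ?_⟩ _
  exact ⟨V⁻¹.mulVec f, by rw [Matrix.mulVec_mulVec, Matrix.mul_nonsing_inv _ hdet, Matrix.one_mulVec]⟩

/-- The coefficients of an equivariant function with respect to powers of an equivariant
parameter are fixed. -/
theorem map_coeff_eq_of_vandermonde {a : ι → T} (ha : ∀ i j, i ≠ j → IsUnit (a i - a j))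
    {f : ι → T} {c : Fin (Fintype.card ι) → T} (hc : ∀ i, f i = ∑ j, c j * a i ^ (j : ℕ))
    (φ : T →+* T) (ω : ι → ι) (hω : Function.Surjective ω) (hφa : ∀ i, φ (a i) = a (ω i))
    (hφf : ∀ i, φ (f i) = f (ω i)) (j : Fin (Fintype.card ι)) : φ (c j) = c j := by
  have h := (existsUnique_vandermonde a ha f).unique (y₁ := fun j => φ (c j)) (y₂ := c)
    (fun i => by
      obtain ⟨i, rfl⟩ := hω i
      rw [← hφf, hc i, map_sum]
      simp only [map_mul, map_pow, hφa]) hc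
  exact congrFun h j

end Vandermonde

/-! ### Generic fibres -/

section GenericFibre

variable {O : Type u} [CommRing O] [IsDomain O] {Λ : Type u} [Ring Λ] [Algebra O Λ]

theorem exists_smul_eq_one_tmul (z : GenericFibre O Λ) : ∃ (r : O) (X : Λ), r ≠ 0 ∧
    r • z = (1 : FractionRing O) ⊗ₜ[O] X := by
  obtain ⟨⟨X, r⟩, h⟩ := IsLocalizedModule.surj (nonZeroDivisors O)
    (TensorProduct.mk O (FractionRing O) Λ 1) z
  exact ⟨r, X, nonZeroDivisors.ne_zero r.2, h⟩

theorem one_tmul_eq_zero_iff (hΛ : ∀ (r : O) (X : Λ), r • X = 0 → r = 0 ∨ X = 0) (X : Λ) :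
    (1 : FractionRing O) ⊗ₜ[O] X = 0 ↔ X = 0 := by
  refine ⟨fun h => ?_, fun h => by rw [h, TensorProduct.tmul_zero]⟩
  obtain ⟨s, hs⟩ := (IsLocalizedModule.eq_zero_iff (nonZeroDivisors O)
    (TensorProduct.mk O (FractionRing O) Λ 1)).1 h
  exact (hΛ _ _ hs).resolve_left (nonZeroDivisors.ne_zero s.2)

theorem smul_eq_zero_genericFibre {r : O} (hr : r ≠ 0) {z : GenericFibre O Λ} (h : r • z = 0) :
    z = 0 := by
  rw [← algebraMap_smul (FractionRing O) r z] at h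
  have hr' : algebraMap O (FractionRing O) r ≠ 0 := by
    rwa [Ne, FaithfulSMul.algebraMap_eq_zero_iff]
  exact (smul_eq_zero.1 h).resolve_left hr'

theorem isUnit_genericFibre_of
    (h : ∀ X : Λ, X ≠ 0 → ∃ (Y : Λ) (r : O), r ≠ 0 ∧ X * Y = algebraMap O Λ r ∧
      Y * X = algebraMap O Λ r) (z : GenericFibre O Λ) : IsUnit z ∨ z = 0 := by
  obtain ⟨r, X, hr, hz⟩ := exists_smul_eq_one_tmul z
  by_cases hX : X = 0
  · right
    rw [hX, TensorProduct.tmul_zero] at hz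
    exact smul_eq_zero_genericFibre hr hz
  left
  obtain ⟨Y, c, hc, h1, h2⟩ := h X hX
  have hcu : IsUnit (algebraMap O (FractionRing O) c) := by
    rwa [isUnit_iff_ne_zero, Ne, FaithfulSMul.algebraMap_eq_zero_iff]
  have hru : IsUnit (algebraMap O (FractionRing O) r) := by
    rwa [isUnit_iff_ne_zero, Ne, FaithfulSMul.algebraMap_eq_zero_iff]
  have key : ∀ A B : Λ, A * B = algebraMap O Λ c →
      ((1 : FractionRing O) ⊗ₜ[O] A) * ((1 : FractionRing O) ⊗ₜ[O] B) =
        algebraMap (FractionRing O) (GenericFibre O Λ) (algebraMap O (FractionRing O) c) := by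
    intro A B hAB
    rw [Algebra.TensorProduct.tmul_mul_tmul, one_mul, hAB, Algebra.algebraMap_eq_smul_one,
      TensorProduct.tmul_smul, TensorProduct.smul_tmul', Algebra.algebraMap_eq_smul_one,
      Algebra.algebraMap_eq_smul_one, smul_assoc, one_smul]
    rfl
  have hXu : IsUnit ((1 : FractionRing O) ⊗ₜ[O] X) := by
    obtain ⟨b, hb⟩ := (hcu.map (algebraMap (FractionRing O) (GenericFibre O Λ))).exists_right_inv
    obtain ⟨b', hb'⟩ := (hcu.map (algebraMap (FractionRing O) (GenericFibre O Λ))).exists_left_inv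
    rw [← key X Y h1] at hb
    rw [← key Y X h2] at hb'
    rw [isUnit_iff_exists_and_exists]
    exact ⟨⟨_, by rw [← mul_assoc]; exact hb⟩, ⟨_, by rw [mul_assoc]; exact hb'⟩⟩
  rw [← hz, ← algebraMap_smul (FractionRing O) r z] at hXu
  rw [← hru.unit_spec, ← Units.smul_def] at hXu
  exact (isUnit_smul_iff _ _).1 hXu

theorem isCentral_genericFibre (hΛ : ∀ (r : O) (X : Λ), r • X = 0 → r = 0 ∨ X = 0)
    (h : ∀ X : Λ, (∀ Y, X * Y = Y * X) → ∃ r : O, X = algebraMap O Λ r) :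
    Algebra.IsCentral (FractionRing O) (GenericFibre O Λ) := by
  refine ⟨fun z hz => ?_⟩
  obtain ⟨r, X, hr, hX⟩ := exists_smul_eq_one_tmul z
  rw [Subalgebra.mem_center_iff] at hz
  obtain ⟨c, rfl⟩ := h X fun Y => by
    have h1 := hz ((1 : FractionRing O) ⊗ₜ[O] Y)
    have h2 : ((1 : FractionRing O) ⊗ₜ[O] (X * Y - Y * X) : GenericFibre O Λ) = 0 := by
      have h3 : r • (z * (1 : FractionRing O) ⊗ₜ[O] Y) = r • ((1 : FractionRing O) ⊗ₜ[O] Y * z) := by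
        rw [h1]
      rw [← smul_mul_assoc, ← mul_smul_comm, hX, Algebra.TensorProduct.tmul_mul_tmul,
        Algebra.TensorProduct.tmul_mul_tmul, one_mul] at h3
      rw [TensorProduct.tmul_sub, h3, sub_self]
    exact sub_eq_zero.1 ((one_tmul_eq_zero_iff hΛ _).1 h2)
  have hr' : algebraMap O (FractionRing O) r ≠ 0 := by
    rwa [Ne, FaithfulSMul.algebraMap_eq_zero_iff]
  rw [Algebra.mem_bot]
  refine ⟨(algebraMap O (FractionRing O) r)⁻¹ * algebraMap O (FractionRing O) c, ?_⟩
  have h1 : algebraMap O (FractionRing O) r • z =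
      algebraMap (FractionRing O) (GenericFibre O Λ) (algebraMap O (FractionRing O) c) := by
    rw [algebraMap_smul, hX, Algebra.TensorProduct.algebraMap_apply, Algebra.algebraMap_self_apply,
      Algebra.algebraMap_eq_smul_one, TensorProduct.tmul_smul, TensorProduct.smul_tmul',
      Algebra.algebraMap_eq_smul_one]
  rw [map_mul, ← h1, ← Algebra.smul_def, smul_smul, inv_mul_cancel₀ hr', one_smul]

theorem HasIndex.isCentral_and_isSimpleRing {K : Type u} [Field K] {D : Type u} [Ring D]
    [Algebra K D] {e : ℕ} (h : HasIndex K D e) : Algebra.IsCentral K D ∧ IsSimpleRing D := by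
  obtain ⟨n, E, _, _, hn, hc, _, _, ⟨f⟩⟩ := h
  have : Nonempty (Fin n) := ⟨⟨0, hn⟩⟩
  exact ⟨Algebra.IsCentral.of_algEquiv K _ _ f.symm,
    IsSimpleRing.of_ringEquiv f.symm.toRingEquiv inferInstance⟩

end GenericFibre


/-! ### The index of the model order -/

namespace TameAction

variable {k : Type u} [Field k] [CharZero k] {T : Type u} [CommRing T] [IsDomain T] [Algebra k T]
  {κ : Type u} [Field κ] [Algebra k κ] {O : Subalgebra k T} (act : TameAction k T κ O)
  {e : ℕ} {F : Type u} [NeZero e] [Fintype F] [DecidableEq F]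
  (w : ShiftWeight k act.n act.N e F)

theorem smul_eq_zero_modelOrder (r : O) (X : act.modelOrder w) (h : r • X = 0) :
    r = 0 ∨ X = 0 := by
  by_cases hr : r = 0
  · exact Or.inl hr
  refine Or.inr (Subtype.ext ?_)
  ext q q'
  have h1 : (r : T) * X.1 q q' = 0 := congrFun₂ (congrArg Subtype.val h) q q'
  exact (mul_eq_zero.1 h1).resolve_left fun h => hr (Subtype.ext h)

theorem det_mem {X : Matrix (ZMod e × F) (ZMod e × F) T} (hX : X ∈ act.modelOrder w) :
    X.det ∈ O := by
  rw [act.mem_iff]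
  constructor
  · have h1 : act.σ.mapMatrix X * Matrix.diagonal (fun q => algebraMap k T (w.α q)⁻¹) =
        Matrix.diagonal (fun q => algebraMap k T (w.α q)⁻¹) * X := by
      ext q q'
      rw [Matrix.mul_diagonal, Matrix.diagonal_mul, AlgHom.mapMatrix_apply, Matrix.map_apply,
        act.σ_apply_of_mem w hX, mul_comm, ← Algebra.smul_def, ← Algebra.smul_def, smul_smul,
        div_eq_mul_inv, ← mul_assoc, inv_mul_cancel₀ (w.α_ne_zero q'), one_mul]
    have h2 := congrArg Matrix.det h1
    rw [Matrix.det_mul, Matrix.det_mul, mul_comm] at h2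
    rw [AlgHom.map_det]
    refine mul_left_cancel₀ ?_ h2
    rw [Matrix.det_diagonal, ← map_prod, Ne, FaithfulSMul.algebraMap_eq_zero_iff,
      Finset.prod_eq_zero_iff]
    rintro ⟨q, -, hq⟩
    exact inv_ne_zero (w.α_ne_zero q) hq
  · have h1 : act.τ.mapMatrix X = X.submatrix shiftIndex shiftIndex := by
      ext q q'
      exact (act.τ_apply_of_mem w hX q q').symm
    rw [AlgHom.map_det, h1, Matrix.det_submatrix_equiv_self]

/-- When the shift acts transitively, a nonzero element of the order has nonzero determinant: the
residue of its leading coefficient is supported on a single diagonal, where it does not vanish. -/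
theorem det_ne_zero [Unique F] {X : Matrix (ZMod e × F) (ZMod e × F) T}
    (hX : X ∈ act.modelOrder w) (hX0 : X ≠ 0) : X.det ≠ 0 := by
  classical
  have hent : ∃ v, ∃ q q', ∃ u, IsUnit u ∧ X q q' = act.t ^ v * u := by
    by_contra hcon
    push Not at hcon
    refine hX0 ?_
    ext q q'
    by_contra hne
    obtain ⟨v, u, hu, h⟩ := act.factor _ hne
    exact hcon v q q' u hu h
  -- the exact power of `t` dividing `X`
  let v := Nat.find hent
  obtain ⟨q0, q1, u, hu, hq⟩ := Nat.find_spec hent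
  have hdiv : ∀ q q', act.t ^ v ∣ X q q' := fun q q' => by
    by_cases hne : X q q' = 0
    · rw [hne]; exact dvd_zero _
    obtain ⟨v', u', hu', h⟩ := act.factor _ hne
    have : v ≤ v' := Nat.find_min' hent ⟨q, q', u', hu', h⟩
    rw [h]
    exact (pow_dvd_pow _ this).mul_right _
  choose Y hY using hdiv
  have htv : act.t ^ v ≠ 0 := pow_ne_zero _ act.t_ne_zero
  have hXY : X = act.t ^ v • Matrix.of Y := by
    ext q q'
    exact hY q q'
  have hev1 : act.ev (Y q0 q1) ≠ 0 := by
    rw [hY] at hq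
    rw [mul_left_cancel₀ htv hq]
    exact (act.isUnit_iff u).1 hu
  -- the weight of a nonvanishing residue
  have hwt : ∀ q q', act.ev (Y q q') ≠ 0 → act.ζ ^ v = w.α q' / w.α q := fun q q' h => by
    have h1 := act.σ_apply_of_mem w hX q q'
    rw [hY, map_mul, act.σ_t_pow, smul_mul_assoc, ← mul_smul_comm, ← mul_smul_comm] at h1
    have h2 := congrArg act.ev (mul_left_cancel₀ htv h1)
    rw [map_smul, map_smul, act.ev_σ] at h2
    by_contra hne
    rw [← sub_eq_zero, ← sub_smul] at h2
    exact h ((smul_eq_zero.1 h2).resolve_left (sub_ne_zero.2 hne))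
  have hpos : ∀ i j : ZMod e, w.α (i, default) / w.α (j, default) =
      w.η ^ (i - j).val := fun i j => by
    rw [div_eq_iff (w.α_ne_zero _), ← w.α_add_nat, ZMod.natCast_zmod_val, add_sub_cancel]
  have hηinj : ∀ d d' : ZMod e, w.η ^ d.val = w.η ^ d'.val → d = d' := fun d d' h =>
    ZMod.val_injective e (w.isPrimitiveRoot_η.pow_inj (ZMod.val_lt d) (ZMod.val_lt d') h)
  obtain ⟨i0, l0⟩ := q0
  obtain ⟨i1, l1⟩ := q1
  obtain rfl := Subsingleton.elim l0 default
  obtain rfl := Subsingleton.elim l1 default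
  have hζv := hwt _ _ hev1
  rw [hpos] at hζv
  set d := i1 - i0 with hd
  have hzero : ∀ i j : ZMod e, j - i ≠ d → act.ev (Y (i, default) (j, default)) = 0 :=
    fun i j hij => by
      by_contra h
      have h1 := hwt _ _ h
      rw [hζv, hpos] at h1
      exact hij (hηinj _ _ h1).symm
  have hshift : ∀ q q', Y (shiftIndex q) (shiftIndex q') = act.τ (Y q q') := fun q q' => by
    have h1 := act.τ_apply_of_mem w hX q q'
    rw [hY, hY, map_mul, act.τ_t_pow] at h1
    exact mul_left_cancel₀ htv h1
  have hτunit : ∀ y, IsUnit y → IsUnit (act.τ y) := fun y hy => hy.map act.τ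
  have hnz : ∀ j : ℕ, IsUnit (Y (i0 + j, default) (i0 + j + d, default)) := fun j => by
    induction j with
    | zero =>
      rw [act.isUnit_iff, hd]
      simpa using hev1
    | succ j ih =>
      have h1 := hshift (i0 + j, default) (i0 + j + d, default)
      rw [Nat.cast_succ, ← add_assoc, add_right_comm _ 1 d]
      change Y (shiftIndex (i0 + j, default)) (shiftIndex (i0 + j + d, default)) |> IsUnit
      rw [h1]
      exact hτunit _ ih
  have hnz' : ∀ i : ZMod e, act.ev (Y (i, default) (i + d, default)) ≠ 0 := fun i => by
    have h1 := hnz (i - i0).val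
    rw [ZMod.natCast_zmod_val, add_sub_cancel] at h1
    exact (act.isUnit_iff _).1 h1
  have hYdet : act.ev (Matrix.of Y).det ≠ 0 := by
    rw [AlgHom.map_det]
    intro h0
    obtain ⟨z, hz0, hz⟩ := Matrix.exists_mulVec_eq_zero_iff.2 h0
    refine hz0 (funext fun ⟨j, l⟩ => ?_)
    obtain rfl := Subsingleton.elim l default
    have h1 := congrFun hz (j - d, default)
    rw [Matrix.mulVec, dotProduct, Finset.sum_eq_single (j, default)] at h1
    · have h2 := hnz' (j - d)
      rw [sub_add_cancel] at h2
      exact (mul_eq_zero.1 h1).resolve_left h2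
    · rintro ⟨j', l⟩ - hne
      obtain rfl := Subsingleton.elim l default
      have h2 : act.ev (Y (j - d, default) (j', default)) = 0 := hzero _ _ fun h => hne (by
        rw [sub_eq_iff_eq_add, add_comm, sub_add_cancel] at h
        rw [h])
      change act.ev (Y (j - d, default) (j', default)) * _ = 0
      rw [h2, zero_mul]
    · simp
  rw [hXY, Matrix.det_smul]
  refine mul_ne_zero (pow_ne_zero _ htv) fun h => hYdet ?_
  rw [h, map_zero]

theorem exists_mul_eq_algebraMap [Unique F] (X : act.modelOrder w) (hX : X ≠ 0) :
    ∃ (Y : act.modelOrder w) (r : O), r ≠ 0 ∧ X * Y = algebraMap O _ r ∧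
      Y * X = algebraMap O _ r := by
  have hX0 : X.1 ≠ 0 := fun h => hX (Subtype.ext h)
  have hdet := act.det_ne_zero w X.2 hX0
  have hdO := act.det_mem w X.2
  have h1 : X.1 * X.1.adjugate = algebraMap O (Matrix _ _ T) ⟨X.1.det, hdO⟩ := by
    rw [Matrix.mul_adjugate, Algebra.algebraMap_eq_smul_one]
    rfl
  have h2 : X.1.adjugate * X.1 = algebraMap O (Matrix _ _ T) ⟨X.1.det, hdO⟩ := by
    rw [Matrix.adjugate_mul, Algebra.algebraMap_eq_smul_one]
    rfl
  have hadj : X.1.adjugate ∈ act.modelOrder w := by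
    refine act.mem_of_mul_mem_left w X.2 (fun Z Z' h => ?_) (by
      rw [h1]; exact Subalgebra.algebraMap_mem _ _)
    have h3 := congrArg (X.1.adjugate * ·) h
    simp only [← mul_assoc, Matrix.adjugate_mul, smul_mul_assoc, one_mul] at h3
    exact smul_right_injective _ hdet h3
  exact ⟨⟨_, hadj⟩, ⟨_, hdO⟩, fun h => hdet (congrArg Subtype.val h), Subtype.ext h1,
    Subtype.ext h2⟩

theorem exists_ξ_pow_eq : ∃ p, act.ξ ^ p = w.η := by
  have : NeZero act.N := ⟨act.N_ne_zero⟩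
  obtain ⟨p, -, hp⟩ := act.isPrimitiveRoot_ξ.eq_pow_of_pow_eq_one w.η_pow_N
  exact ⟨p, hp⟩

/-- Multiples of a power of `s` on which the shift acts as `τ`. -/
def node (p : ℕ) (q : ZMod e × F) : T := w.α q • (act.s : T) ^ p

theorem τ_node {p : ℕ} (hp : act.ξ ^ p = w.η) (q : ZMod e × F) :
    act.τ (act.node w p q) = act.node w p (shiftIndex q) := by
  rw [node, node, map_smul, act.τ_s_pow, smul_smul, hp, act.α_shiftIndex, mul_comm]

theorem σ_node (p : ℕ) (q : ZMod e × F) : act.σ (act.node w p q) = act.node w p q := by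
  rw [node, map_smul, act.σ_s_pow]

theorem isUnit_node_sub {p : ℕ} {q q' : ZMod e × F} (h : w.α q ≠ w.α q') :
    IsUnit (act.node w p q - act.node w p q') := by
  rw [node, node, ← sub_smul, Algebra.smul_def]
  exact ((isUnit_iff_ne_zero.2 (sub_ne_zero.2 h)).map _).mul (act.s.isUnit.pow p)

theorem α_injective_of_unique [Unique F] : Function.Injective w.α := by
  rintro ⟨i, l⟩ ⟨j, l'⟩ h
  obtain rfl := Subsingleton.elim l default
  obtain rfl := Subsingleton.elim l' default
  have h1 : w.α (i, default) = w.η ^ (i - j).val * w.α (j, default) := by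
    rw [← w.α_add_nat, ZMod.natCast_zmod_val, add_sub_cancel]
  rw [h] at h1
  have h2 : w.η ^ (i - j).val = w.η ^ 0 := by
    rw [pow_zero]
    exact mul_right_cancel₀ (w.α_ne_zero (j, default)) (by rw [← h1, one_mul])
  have h3 := w.isPrimitiveRoot_η.pow_inj (ZMod.val_lt _) (Nat.pos_of_ne_zero (NeZero.ne e)) h2
  rw [ZMod.val_eq_zero, sub_eq_zero] at h3
  rw [h3]

theorem exists_eq_algebraMap_of_central [Unique F] (X : act.modelOrder w)
    (h : ∀ Y, X * Y = Y * X) : ∃ r : O, X = algebraMap O _ r := by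
  obtain ⟨p, hp⟩ := act.exists_ξ_pow_eq w
  have hY : Matrix.diagonal (act.node w p) ∈ act.modelOrder w := by
    refine act.mem_modelOrder_of w (fun q q' => ?_) (fun q q' => ?_)
    · by_cases hq : q = q'
      · subst hq
        rw [Matrix.diagonal_apply_eq, σ_node, div_self (w.α_ne_zero q), one_smul]
      · rw [Matrix.diagonal_apply_ne _ hq, map_zero, smul_zero]
    · by_cases hq : q = q'
      · subst hq
        rw [Matrix.diagonal_apply_eq, Matrix.diagonal_apply_eq, τ_node act w hp]
      · rw [Matrix.diagonal_apply_ne _ hq,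
          Matrix.diagonal_apply_ne _ (shiftIndex.injective.ne hq), map_zero]
  have hdiag : ∀ q q', q ≠ q' → X.1 q q' = 0 := fun q q' hq => by
    have h1 := congrFun₂ (congrArg Subtype.val (h ⟨_, hY⟩)) q q'
    change (X.1 * Matrix.diagonal (act.node w p) : Matrix (ZMod e × F) (ZMod e × F) T) q q' =
      (Matrix.diagonal (act.node w p) * X.1 : Matrix (ZMod e × F) (ZMod e × F) T) q q' at h1
    rw [Matrix.mul_diagonal, Matrix.diagonal_mul, mul_comm, ← sub_eq_zero, ← sub_mul] at h1
    have hne : w.α q' ≠ w.α q := fun h => hq (act.α_injective_of_unique w h).symm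
    exact (mul_eq_zero.1 h1).resolve_left (act.isUnit_node_sub w hne).ne_zero
  -- the shift permutation matrix, suitably weighted
  let q0 : ZMod e × F := (0, default)
  have hconst : ∀ q, X.1 q q = X.1 q0 q0 := fun q => by
    have h1 := congrFun₂ (congrArg Subtype.val (h ⟨_, act.orbitMatrix_mem w
      (act.ζ_pow_log (w.ratio_pow q q0))⟩)) q0 q
    change (X.1 * act.orbitMatrix _ q0 q) q0 q = (act.orbitMatrix _ q0 q * X.1) q0 q at h1
    rw [Matrix.mul_apply, Matrix.mul_apply, Finset.sum_eq_single q0, Finset.sum_eq_single q] at h1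
    · simp only [orbitMatrix, Matrix.of_apply, sub_self, and_self, if_true] at h1
      rw [mul_comm] at h1
      exact (mul_left_cancel₀ (pow_ne_zero _ act.t_ne_zero) h1).symm
    · intro r _ hr
      rw [hdiag _ _ hr, mul_zero]
    · simp
    · intro r _ hr
      rw [hdiag _ _ hr.symm, zero_mul]
    · simp
  have hO : X.1 q0 q0 ∈ O := by
    rw [act.mem_iff, act.σ_apply_of_mem w X.2, div_self (w.α_ne_zero q0), one_smul,
      ← act.τ_apply_of_mem w X.2]
    exact ⟨rfl, hconst _⟩
  refine ⟨⟨_, hO⟩, Subtype.ext ?_⟩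
  ext q q'
  change X.1 q q' = algebraMap O (Matrix _ _ T) ⟨_, hO⟩ q q'
  rw [Matrix.algebraMap_matrix_apply]
  split_ifs with hq
  · subst hq
    rw [hconst]
    rfl
  · exact hdiag _ _ hq

end TameAction


section GenericFibre

variable {O : Type u} [CommRing O] [IsDomain O] {Λ : Type u} [Ring Λ] [Algebra O Λ]
  {Λ' : Type u} [Ring Λ'] [Algebra O Λ'] {F : Type u} [Fintype F] [DecidableEq F]

/-- A linear map from an order to matrices over another order that is, up to a scalar `x` of the
base, multiplicative and bijective, becomes an isomorphism of algebras generically. -/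
theorem exists_genericFibre_algEquiv_matrix
    (hΛ' : ∀ (r : O) (Y : Λ'), r • Y = 0 → r = 0 ∨ Y = 0) {x : O} (hx : x ≠ 0)
    (f : Λ →ₗ[O] Matrix F F Λ') (hmul : ∀ X X', x • f (X * X') = f X * f X')
    (h1 : f 1 = x • 1) (hinj : ∀ X, f X = 0 → X = 0)
    (hsurj : ∀ a b Y, ∃ X, f X = Matrix.single a b (x • x • Y)) :
    Nonempty (GenericFibre O Λ ≃ₐ[FractionRing O] Matrix F F (GenericFibre O Λ')) := by
  have hx' : algebraMap O (FractionRing O) x ≠ 0 := by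
    rwa [Ne, FaithfulSMul.algebraMap_eq_zero_iff]
  let xi : FractionRing O := (algebraMap O (FractionRing O) x)⁻¹
  let ι : Λ' →ₐ[O] GenericFibre O Λ' := Algebra.TensorProduct.includeRight
  let ι' : Matrix F F Λ' →ₐ[O] Matrix F F (GenericFibre O Λ') := ι.mapMatrix
  have hxi : ∀ M : Matrix F F (GenericFibre O Λ'), xi • x • M = M := fun M => by
    rw [← algebraMap_smul (FractionRing O) x M, smul_smul, inv_mul_cancel₀ hx', one_smul]
  -- dividing by `x` turns `f` into a homomorphism of algebras
  let ψ : Λ →ₐ[O] Matrix F F (GenericFibre O Λ') := AlgHom.ofLinearMap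
    { toFun := fun X => xi • ι' (f X)
      map_add' := fun X X' => by rw [map_add, map_add, smul_add]
      map_smul' := fun r X => by
        rw [map_smul, map_smul, smul_comm, RingHom.id_apply] }
    (by
      change xi • ι' (f 1) = 1
      rw [h1, map_smul, map_one, hxi])
    (fun X X' => by
      change xi • ι' (f (X * X')) = (xi • ι' (f X)) * (xi • ι' (f X'))
      have h2 : ∀ A B : Matrix F F (GenericFibre O Λ'), (xi • A) * (xi • B) = xi • xi • (A * B) :=
        fun A B => (Algebra.smul_mul_assoc xi A (xi • B)).trans
          (congrArg _ (Algebra.mul_smul_comm xi A B))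
      rw [h2, ← map_mul, ← hmul, map_smul, hxi])
  have hψ : ∀ X, ψ X = xi • ι' (f X) := fun X => rfl
  let Ψ : GenericFibre O Λ →ₐ[FractionRing O] Matrix F F (GenericFibre O Λ') :=
    Algebra.TensorProduct.lift (Algebra.ofId _ _) ψ fun a b => Algebra.commutes a (ψ b)
  have hΨ : ∀ X, Ψ ((1 : FractionRing O) ⊗ₜ[O] X) = ψ X := fun X => by
    exact (Algebra.TensorProduct.lift_tmul _ _ _ _ _).trans (by rw [map_one, one_mul])
  refine ⟨AlgEquiv.ofBijective Ψ ⟨?_, ?_⟩⟩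
  · rw [injective_iff_map_eq_zero]
    intro z hz
    obtain ⟨r, X, hr, hzX⟩ := exists_smul_eq_one_tmul z
    have h2 : ψ X = 0 := by
      rw [← hΨ, ← hzX, ← algebraMap_smul (FractionRing O) r z, map_smul, hz, smul_zero]
    have hX : X = 0 := by
      refine hinj X ?_
      rw [hψ] at h2
      ext l l' : 2
      exact (one_tmul_eq_zero_iff hΛ' _).1
        (congrFun₂ ((smul_eq_zero.1 h2).resolve_left (inv_ne_zero hx')) l l')
    rw [hX, TensorProduct.tmul_zero] at hzX
    exact smul_eq_zero_genericFibre hr hzX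
  · rw [← AlgHom.range_eq_top, eq_top_iff]
    rintro M -
    -- elementary matrices generate, and the scalars are invertible
    rw [Matrix.matrix_eq_sum_single M]
    refine sum_mem fun a _ => sum_mem fun b _ => ?_
    obtain ⟨r, Y, hr, hY⟩ := exists_smul_eq_one_tmul (M a b)
    have hr' : algebraMap O (FractionRing O) r ≠ 0 := by
      rwa [Ne, FaithfulSMul.algebraMap_eq_zero_iff]
    have h2 : M a b = (algebraMap O (FractionRing O) r)⁻¹ • ι Y := by
      change _ = _ • ((1 : FractionRing O) ⊗ₜ[O] Y)
      rw [← hY, ← algebraMap_smul (FractionRing O) r, smul_smul, inv_mul_cancel₀ hr', one_smul]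
    obtain ⟨X, hX⟩ := hsurj a b Y
    have h3 : xi • ψ X = Matrix.single a b (ι Y) := by
      rw [hψ, hX]
      have h4 : ι' (Matrix.single a b (x • x • Y)) = x • x • Matrix.single a b (ι Y) := by
        rw [Matrix.smul_single, Matrix.smul_single, ← map_smul, ← map_smul]
        exact Matrix.map_single _ _ _ _
      rw [h4, hxi, hxi]
    rw [h2, ← Matrix.smul_single, ← h3, ← hΨ, ← map_smul, ← map_smul]
    exact ⟨_, rfl⟩

theorem hasIndex_of_algEquiv_matrix [Nontrivial (GenericFibre O Λ')] [Nonempty F] {e : ℕ}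
    [Module.Finite O Λ']
    (hdiv : ∀ z : GenericFibre O Λ', IsUnit z ∨ z = 0)
    (hcen : Algebra.IsCentral (FractionRing O) (GenericFibre O Λ'))
    (hrank : Module.finrank (FractionRing O) (GenericFibre O Λ') = e ^ 2)
    (Ψ : GenericFibre O Λ ≃ₐ[FractionRing O] Matrix F F (GenericFibre O Λ')) :
    HasIndex (FractionRing O) (GenericFibre O Λ) e :=
  ⟨Fintype.card F, GenericFibre O Λ', DivisionRing.ofIsUnitOrEqZero hdiv, inferInstance,
    Fintype.card_pos, hcen, inferInstanceAs (Module.Finite (FractionRing O) (GenericFibre O Λ')),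
    hrank, ⟨Ψ.trans (Matrix.reindexAlgEquiv _ _ (Fintype.equivFin F))⟩⟩

end GenericFibre

namespace TameAction

variable {k : Type u} [Field k] [CharZero k] {T : Type u} [CommRing T] [IsDomain T] [Algebra k T]
  {κ : Type u} [Field κ] [Algebra k κ] {O : Subalgebra k T} (act : TameAction k T κ O)
  {e : ℕ} {F : Type u} [NeZero e] [Fintype F] [DecidableEq F]
  (w : ShiftWeight k act.n act.N e F)

/-- When the shift acts transitively, the order is free of rank `e ^ 2`: every diagonal of an
element is, up to a power of `t`, a polynomial in the nodes with invariant coefficients. -/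
theorem finrank_modelOrder [Unique F] : Module.finrank O (act.modelOrder w) = e ^ 2 := by
  classical
  obtain ⟨p, hp⟩ := act.exists_ξ_pow_eq w
  let ν := act.node w p
  have hν : ∀ q q', q ≠ q' → IsUnit (ν q - ν q') := fun q q' h =>
    act.isUnit_node_sub w ((act.α_injective_of_unique w).ne h)
  -- entries on the diagonal `d` are divisible by `t ^ g d`, since `ζ ^ g d` is the ratio of their
  -- weights
  let g : ZMod e → ℕ := fun d => act.log (w.α (d, default) / w.α (0, default))
  have hg : ∀ q q' : ZMod e × F, act.ζ ^ g (q'.1 - q.1) = w.α q' / w.α q := by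
    rintro ⟨i, l⟩ ⟨j, l'⟩
    obtain rfl := Subsingleton.elim l default
    obtain rfl := Subsingleton.elim l' default
    rw [act.ζ_pow_log (w.ratio_pow _ _)]
    have h1 : w.α (j, default) = w.η ^ (j - i).val * w.α (i, default) := by
      rw [← w.α_add_nat, ZMod.natCast_zmod_val, add_sub_cancel]
    have h2 : w.α (j - i, default) = w.η ^ (j - i).val * w.α (0, default) := by
      rw [← w.α_add_nat, ZMod.natCast_zmod_val, zero_add]
    rw [h1, h2, mul_div_cancel_right₀ _ (w.α_ne_zero _), mul_div_cancel_right₀ _ (w.α_ne_zero _)]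
  have hfix : ∀ r : O, act.σ r = r ∧ act.τ r = r := fun r => (act.mem_iff r).1 r.2
  -- the diagonals with their power of `t` removed, as polynomials in the nodes
  let Φ : (ZMod e × Fin (Fintype.card (ZMod e × F)) → O) →ₗ[O] act.modelOrder w :=
    { toFun := fun c => ⟨Matrix.of fun q q' => act.t ^ g (q'.1 - q.1) *
          ∑ j, (c (q'.1 - q.1, j) : T) * ν q ^ (j : ℕ), by
        refine act.mem_modelOrder_of w (fun q q' => ?_) (fun q q' => ?_)
        · simp only [Matrix.of_apply, map_mul, map_sum, map_pow, hfix, ν, act.σ_node, act.σ_t,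
            smul_pow, hg, smul_mul_assoc]
        · simp only [Matrix.of_apply, map_mul, map_sum, map_pow, hfix, ν, act.τ_node w hp, act.τ_t,
            Equiv.prodCongr_apply, Prod.map, Equiv.coe_addRight, add_sub_add_right_eq_sub]⟩
      map_add' := fun c c' => Subtype.ext (by
        ext q q'
        simp only [Matrix.of_apply, Pi.add_apply, Subalgebra.coe_add, add_mul,
          Finset.sum_add_distrib, mul_add, Matrix.add_apply])
      map_smul' := fun r c => Subtype.ext (by
        ext q q'
        change act.t ^ g (q'.1 - q.1) * ∑ j, ((r : T) * (c (q'.1 - q.1, j) : T)) * ν q ^ (j : ℕ) =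
          (r : T) * (act.t ^ g (q'.1 - q.1) * ∑ j, (c (q'.1 - q.1, j) : T) * ν q ^ (j : ℕ))
        simp only [mul_assoc, ← Finset.mul_sum]
        rw [mul_left_comm]) }
  have hΦ : ∀ c q q', (Φ c).1 q q' = act.t ^ g (q'.1 - q.1) *
      ∑ j, (c (q'.1 - q.1, j) : T) * ν q ^ (j : ℕ) := fun c q q' => rfl
  have hbij : Function.Bijective Φ := by
    constructor
    · rw [injective_iff_map_eq_zero]
      intro c hc
      ext ⟨d, j⟩
      have h1 : ∀ q : ZMod e × F, (0 : T) = ∑ j, (c (d, j) : T) * ν q ^ (j : ℕ) := fun q => by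
        have h2 := congrFun₂ (congrArg Subtype.val hc) q (q.1 + d, q.2)
        rw [hΦ] at h2
        simp only [add_sub_cancel_left] at h2
        exact ((mul_eq_zero.1 h2).resolve_left (pow_ne_zero _ act.t_ne_zero)).symm
      exact congrFun ((existsUnique_vandermonde ν hν fun _ => 0).unique
        (y₁ := fun j => (c (d, j) : T)) (y₂ := 0) h1 (fun q => by simp)) j
    · intro X
      have hdvd : ∀ q d, act.t ^ g d ∣ X.1 q (q.1 + d, q.2) := fun q d => by
        have h1 := act.t_pow_log_dvd w X.2 q (q.1 + d, q.2)
        rwa [← hg, add_sub_cancel_left, show act.log (act.ζ ^ g d) = g d from by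
          simp only [g, act.ζ_pow_log (w.ratio_pow (d, default) (0, default))]] at h1
      choose f hf using hdvd
      have hσf : ∀ q d, act.σ (f q d) = f q d := fun q d => by
        have h1 := act.σ_apply_of_mem w X.2 q (q.1 + d, q.2)
        rw [hf, map_mul, act.σ_t_pow, ← hg, add_sub_cancel_left, smul_mul_assoc] at h1
        exact mul_left_cancel₀ (pow_ne_zero _ act.t_ne_zero)
          (smul_right_injective _ (pow_ne_zero _ act.ζ_ne_zero) h1)
      have hτf : ∀ q d, act.τ (f q d) = f (shiftIndex q) d := fun q d => by
        have h1 := act.τ_apply_of_mem w X.2 q (q.1 + d, q.2)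
        have h2 := hf (shiftIndex q) d
        have h3 : ((shiftIndex q).1 + d, (shiftIndex q).2) = shiftIndex (q.1 + d, q.2) := by
          exact Prod.ext (add_right_comm _ _ _) rfl
        rw [h3, h1, hf, map_mul, act.τ_t_pow] at h2
        exact mul_left_cancel₀ (pow_ne_zero _ act.t_ne_zero) h2
      -- interpolation at the nodes, with invariant coefficients by uniqueness
      choose c hc using fun d => (existsUnique_vandermonde ν hν fun q => f q d).exists
      have hcO : ∀ d j, c d j ∈ O := fun d j => by
        rw [act.mem_iff]
        exact ⟨map_coeff_eq_of_vandermonde hν (hc d) act.σ.toRingHom id Function.surjective_id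
            (fun q => act.σ_node w p q) (fun q => hσf q d) j,
          map_coeff_eq_of_vandermonde hν (hc d) act.τ.toRingHom shiftIndex shiftIndex.surjective
            (fun q => act.τ_node w hp q) (fun q => hτf q d) j⟩
      refine ⟨fun dj => ⟨c dj.1 dj.2, hcO _ _⟩, Subtype.ext ?_⟩
      ext q q'
      rw [hΦ]
      have h1 := hf q (q'.1 - q.1)
      rw [hc] at h1
      rw [← h1]
      exact congrArg (X.1 q) (Prod.ext (add_sub_cancel q.1 q'.1) (Subsingleton.elim _ _))
  rw [← (LinearEquiv.ofBijective Φ hbij).finrank_eq, Module.finrank_fintype_fun_eq_card,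
    Fintype.card_prod, Fintype.card_fin, Fintype.card_prod, ZMod.card, Fintype.card_unique, mul_one,
    sq]

omit [Fintype F] [DecidableEq F] in
/-- The weights along the orbit through `l0`. -/
def _root_.QuotientOrder.ShiftWeight.orbit {n N : ℕ} (w : ShiftWeight k n N e F) (l0 : F) :
    ShiftWeight k n N e PUnit.{u + 1} where
  α q := w.α (q.1, l0)
  η := w.η
  isPrimitiveRoot_η := w.isPrimitiveRoot_η
  α_shift i _ := w.α_shift i l0
  α_ne_zero _ := w.α_ne_zero _
  α_pow _ _ := w.α_pow _ _
  η_pow_n := w.η_pow_n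
  η_pow_N := w.η_pow_N

/-- The generic fibre of the order of one orbit is a central division algebra of dimension `e ^ 2`,
and the whole generic fibre is a matrix algebra over it. -/
theorem hasIndex_modelOrder [Nonempty F] :
    HasIndex (FractionRing O) (GenericFibre O (act.modelOrder w)) e := by
  classical
  obtain ⟨l0⟩ := ‹Nonempty F›
  have : IsDiscreteValuationRing O := act.isDiscreteValuationRing_base
  let w0 := w.orbit l0
  -- the weights of the orbit of `l` are those of the orbit of `l0`, multiplied by `ζ ^ h l`
  let h : F → ℕ := fun l => act.log (w.α (0, l) / w.α (0, l0))
  have hlt : ∀ l, h l < act.n := fun l => act.log_lt (w.ratio_pow _ _)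
  have hh : ∀ (i : ZMod e) (l : F), w.α (i, l) = act.ζ ^ h l * w.α (i, l0) := fun i l => by
    have e1 : ∀ l, w.α (i, l) = w.η ^ i.val * w.α (0, l) := fun l => by
      rw [← w.α_add_nat, ZMod.natCast_zmod_val, zero_add]
    rw [e1 l, e1 l0, act.ζ_pow_log (w.ratio_pow _ _), mul_left_comm,
      div_mul_cancel₀ _ (w.α_ne_zero _)]
  have hζh : ∀ l l', act.ζ ^ (act.n + h l - h l') = act.ζ ^ h l / act.ζ ^ h l' := fun l l' => by
    have := hlt l'
    rw [eq_div_iff (pow_ne_zero _ act.ζ_ne_zero), ← pow_add, Nat.sub_add_cancel (by omega), pow_add,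
      act.isPrimitiveRoot_ζ.pow_eq_one, one_mul]
  -- conjugation by the diagonal matrix of the powers `t ^ h l` makes all blocks elements of the
  -- order of the orbit of `l0`; the factor `t ^ n` avoids denominators
  let toE : act.modelOrder w → F → F → act.modelOrder w0 := fun X l l' =>
    ⟨Matrix.of fun q q' => act.t ^ (act.n + h l - h l') * X.1 (q.1, l) (q'.1, l'), by
      refine act.mem_modelOrder_of w0 (fun q q' => ?_) (fun q q' => ?_)
      · simp only [Matrix.of_apply, map_mul, act.σ_t_pow, act.σ_apply_of_mem w X.2]
        rw [smul_mul_smul_comm, hζh]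
        congr 1
        change _ = w.α (q'.1, l0) / w.α (q.1, l0)
        rw [hh q'.1 l', hh q.1 l]
        have h1 := pow_ne_zero (h l) act.ζ_ne_zero
        have h2 := pow_ne_zero (h l') act.ζ_ne_zero
        have h3 := w.α_ne_zero (q.1, l0)
        field_simp
      · simp only [Matrix.of_apply, map_mul, act.τ_t_pow, ← act.τ_apply_of_mem w X.2]
        rfl⟩
  let fromE : F → F → act.modelOrder w0 → act.modelOrder w := fun a b Y =>
    ⟨Matrix.of fun q q' => if q.2 = a ∧ q'.2 = b then
        act.t ^ (act.n + h b - h a) * Y.1 (q.1, PUnit.unit) (q'.1, PUnit.unit) else 0, by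
      refine act.mem_modelOrder_of w (fun q q' => ?_) (fun q q' => ?_)
      · obtain ⟨i, l⟩ := q
        obtain ⟨j, l'⟩ := q'
        simp only [Matrix.of_apply]
        split_ifs with hab
        · obtain ⟨rfl, rfl⟩ := hab
          rw [map_mul, act.σ_t_pow, act.σ_apply_of_mem w0 Y.2, smul_mul_smul_comm, hζh]
          congr 1
          change _ * (w.α (j, l0) / w.α (i, l0)) = _
          rw [hh j l', hh i l, mul_div_mul_comm]
        · rw [map_zero, smul_zero]
      · simp only [Matrix.of_apply]
        change (if q.2 = a ∧ q'.2 = b then _ else _) = _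
        split_ifs with hab
        · rw [map_mul, act.τ_t_pow, ← act.τ_apply_of_mem w0 Y.2]
          rfl
        · rw [map_zero]⟩
  have htf0 := act.smul_eq_zero_modelOrder w0
  have htoEmul : ∀ X X' l l', act.x • toE (X * X') l l' = ∑ r, toE X l r * toE X' r l' := by
    intro X X' l l'
    refine Subtype.ext ?_
    rw [AddSubmonoidClass.coe_finsetSum]
    ext q q'
    rw [Matrix.sum_apply]
    change act.t ^ act.n * (act.t ^ (act.n + h l - h l') * (X.1 * X'.1) (q.1, l) (q'.1, l')) =
      ∑ r, ((toE X l r).1 * (toE X' r l').1) q q'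
    simp only [Matrix.mul_apply]
    rw [Fintype.sum_prod_type_right, Finset.mul_sum, Finset.mul_sum]
    refine Finset.sum_congr rfl fun r _ => ?_
    rw [Fintype.sum_prod_type, Finset.mul_sum, Finset.mul_sum]
    refine Finset.sum_congr rfl fun i _ => ?_
    rw [Fintype.sum_unique]
    change _ = (act.t ^ (act.n + h l - h r) * X.1 (q.1, l) (i, r)) *
      (act.t ^ (act.n + h r - h l') * X'.1 (i, r) (q'.1, l'))
    have h1 := hlt r
    have h2 := hlt l'
    calc _ = act.t ^ (act.n + (act.n + h l - h l')) * (X.1 (q.1, l) (i, r) * X'.1 (i, r) (q'.1, l'))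
          := by rw [pow_add]; ring
      _ = act.t ^ ((act.n + h l - h r) + (act.n + h r - h l')) *
          (X.1 (q.1, l) (i, r) * X'.1 (i, r) (q'.1, l')) := by
            congr 2
            omega
      _ = _ := by rw [pow_add]; ring
  have htoE1 : ∀ l l', toE 1 l l' = if l = l' then act.x • 1 else 0 := fun l l' => by
    refine Subtype.ext ?_
    ext q q'
    change act.t ^ (act.n + h l - h l') * (1 : Matrix (ZMod e × F) (ZMod e × F) T) (q.1, l) (q'.1, l')
      = _
    split_ifs with hl
    · subst hl
      change _ = act.t ^ act.n * (1 : Matrix (ZMod e × PUnit) (ZMod e × PUnit) T) q q'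
      rw [Nat.add_sub_cancel]
      congr 1
      by_cases hq : q = q'
      · subst hq; simp
      · rw [Matrix.one_apply_ne hq, Matrix.one_apply_ne]
        exact fun h => hq (Prod.ext (Prod.mk.inj h).1 (Subsingleton.elim _ _))
    · rw [Matrix.one_apply_ne (fun h => hl (Prod.mk.inj h).2), mul_zero]
      rfl
  let toEₗ : act.modelOrder w →ₗ[O] Matrix F F (act.modelOrder w0) :=
    { toFun := fun X => Matrix.of (toE X)
      map_add' := fun X X' => by
        ext l l' q q'
        exact mul_add _ _ _
      map_smul' := fun r X => by
        ext l l' q q'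
        exact mul_left_comm _ _ _ }
  have hinj : ∀ X, toEₗ X = 0 → X = 0 := fun X hX => by
    refine Subtype.ext ?_
    ext ⟨i, l⟩ ⟨j, l'⟩
    have h5 : act.t ^ _ * X.1 (i, l) (j, l') = 0 :=
      congrFun₂ (congrArg Subtype.val (congrFun₂ hX l l')) (i, PUnit.unit) (j, PUnit.unit)
    exact (mul_eq_zero.1 h5).resolve_left (pow_ne_zero _ act.t_ne_zero)
  have hfrom : ∀ a b Y, toEₗ (fromE a b Y) = Matrix.single a b (act.x • act.x • Y) := by
    intro a b Y
    ext l l' q q'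
    change act.t ^ (act.n + h l - h l') * (if l = a ∧ l' = b then _ else 0) = _
    rw [Matrix.single_apply]
    by_cases hab : l = a ∧ l' = b
    · obtain ⟨rfl, rfl⟩ := hab
      rw [if_pos ⟨rfl, rfl⟩, if_pos ⟨rfl, rfl⟩]
      change _ = act.t ^ act.n * (act.t ^ act.n * Y.1 q q')
      rw [← mul_assoc, ← mul_assoc, ← pow_add, ← pow_add]
      have h1 := hlt l
      have h2 := hlt l'
      congr 2
      omega
    · rw [if_neg hab, if_neg fun h => hab ⟨h.1.symm, h.2.symm⟩, mul_zero]
      rfl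
  -- the conjugation is multiplicative up to the factor `x = t ^ n`
  obtain ⟨Ψ⟩ := exists_genericFibre_algEquiv_matrix htf0 act.x_ne_zero toEₗ
    (fun X X' => Matrix.ext fun l l' => (htoEmul X X' l l').trans (Matrix.mul_apply ..).symm)
    (Matrix.ext fun l l' => (htoE1 l l').trans (by
      rw [Matrix.smul_apply, Matrix.one_apply, smul_ite, smul_zero]))
    hinj fun a b Y => ⟨_, hfrom a b Y⟩
  -- the order of a single orbit generically is a central division algebra
  have hdiv := isUnit_genericFibre_of (O := O) (Λ := act.modelOrder w0)
    (act.exists_mul_eq_algebraMap w0)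
  have hnt : Nontrivial (GenericFibre O (act.modelOrder w0)) := ⟨⟨1 ⊗ₜ 1, 0, fun h => by
    have h1 := (one_tmul_eq_zero_iff htf0 _).1 h
    have h2 : (1 : T) = 0 := by
      have h3 := congrFun₂ (congrArg Subtype.val h1) ((0, PUnit.unit) : ZMod e × PUnit)
        (0, PUnit.unit)
      rwa [OneMemClass.coe_one, Matrix.one_apply_eq] at h3
    exact one_ne_zero h2⟩⟩
  have hcen := isCentral_genericFibre htf0 (act.exists_eq_algebraMap_of_central w0)
  have hT : Module.Finite O T := act.finite_base
  have hfin : Module.Finite O (act.modelOrder w0) :=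
    Module.Finite.of_injective (act.modelOrder w0).val.toLinearMap Subtype.val_injective
  have hfree : Module.Free O (act.modelOrder w0) := by
    have : Module.IsTorsionFree O (act.modelOrder w0) :=
      Module.IsTorsionFree.of_smul_eq_zero fun r X hrX => htf0 r X hrX
    infer_instance
  have hrank : Module.finrank (FractionRing O) (GenericFibre O (act.modelOrder w0)) = e ^ 2 := by
    rw [Module.finrank_baseChange, act.finrank_modelOrder w0]
  exact hasIndex_of_algEquiv_matrix hdiv hcen hrank Ψ

end TameAction


/-! ### Algebraically independent exponentials -/

section Exponentials

variable (k : Type u) [Field k] [CharZero k]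

/-- The exponential series `exp (μ X)`, multiplicative in `μ`. -/
def expSeries : Multiplicative k →* PowerSeries k :=
  letI : Algebra ℚ k := DivisionRing.toRatAlgebra
  { toFun := fun μ => PowerSeries.rescale μ.toAdd (PowerSeries.exp k)
    map_one' := by simp
    map_mul' := fun μ ν => by
      rw [toAdd_mul, PowerSeries.exp_mul_exp_eq_exp_add] }

theorem coeff_expSeries (μ : Multiplicative k) (j : ℕ) :
    PowerSeries.coeff j (expSeries k μ) = μ.toAdd ^ j * (j.factorial : k)⁻¹ := by
  simp [expSeries, PowerSeries.coeff_rescale, PowerSeries.coeff_exp]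

theorem linearIndependent_expSeries : LinearIndependent k (expSeries k) := by
  rw [linearIndependent_iff']
  intro s c hc μ hμ
  let ε := s.equivFin
  have h1 : (fun i => c (ε.symm i).1) = 0 := by
    refine Matrix.eq_zero_of_forall_pow_sum_mul_pow_eq_zero (f := fun i => (ε.symm i).1.toAdd)
      (fun i j h => ε.symm.injective (Subtype.ext h)) fun j => ?_
    have h2 := congrArg (PowerSeries.coeff (j : ℕ)) hc
    simp only [map_sum, PowerSeries.coeff_smul, coeff_expSeries, map_zero, smul_eq_mul,
      ← mul_assoc, ← Finset.sum_mul] at h2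
    have h3 := (mul_eq_zero.1 h2).resolve_right
      (inv_ne_zero (Nat.cast_ne_zero.2 (Nat.factorial_ne_zero _)))
    rw [← Finset.sum_coe_sort, ← Equiv.sum_comp ε.symm] at h3
    exact h3
  have h2 := congrFun h1 (ε ⟨μ, hμ⟩)
  simpa using h2

theorem algebraicIndependent_expSeries {ι : Type*} {l : ι → k}
    (hl : LinearIndependent ℕ l) :
    AlgebraicIndependent k fun i => expSeries k (Multiplicative.ofAdd (l i)) := by
  rw [algebraicIndependent_iff_injective_aeval, injective_iff_map_eq_zero]
  intro p hp
  have hmon : ∀ m : ι →₀ ℕ, (m.prod fun i n => expSeries k (Multiplicative.ofAdd (l i)) ^ n) =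
      expSeries k (Multiplicative.ofAdd (Finsupp.linearCombination ℕ l m)) := fun m => by
    rw [Finsupp.linearCombination_apply, Finsupp.sum, ofAdd_sum, map_prod]
    refine Finset.prod_congr rfl fun i _ => ?_
    rw [ofAdd_nsmul, map_pow]
  rw [MvPolynomial.aeval_def, MvPolynomial.eval₂_eq] at hp
  have h1 := linearIndependent_iff'.1 ((linearIndependent_expSeries k).comp
    (fun m : ι →₀ ℕ => Multiplicative.ofAdd (Finsupp.linearCombination ℕ l m))
    (fun m m' h => hl (Multiplicative.ofAdd.injective h))) p.support (fun m => p.coeff m) (by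
      rw [← hp]
      refine Finset.sum_congr rfl fun m _ => ?_
      rw [Algebra.smul_def]
      congr 1
      exact (hmon m).symm)
  ext m
  by_contra hm
  exact hm (h1 m (MvPolynomial.mem_support_iff.2 hm))

/-- An algebraically closed field of characteristic zero has infinite degree over `ℚ`: it contains
roots of unity of arbitrarily large degree. -/
theorem exists_linearIndependent_nat [IsAlgClosed k] : ∃ l : ℕ → k, LinearIndependent ℕ l := by
  let _ : Algebra ℚ k := DivisionRing.toRatAlgebra
  have hinf : ¬ Module.Finite ℚ k := fun h => by
    obtain ⟨p, hp, hprime⟩ := Nat.exists_infinite_primes (Module.finrank ℚ k + 2)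
    have : NeZero (p : k) := ⟨Nat.cast_ne_zero.2 hprime.ne_zero⟩
    obtain ⟨z, hz⟩ := HasEnoughRootsOfUnity.exists_primitiveRoot k p
    have h1 := minpoly.natDegree_le (A := ℚ) z
    rw [← Polynomial.cyclotomic_eq_minpoly_rat hz hprime.pos, Polynomial.natDegree_cyclotomic,
      Nat.totient_prime hprime] at h1
    omega
  let b := Module.Basis.ofVectorSpace ℚ k
  have hι : Infinite (Module.Basis.ofVectorSpaceIndex ℚ k) := by
    rw [← not_finite_iff_infinite]
    exact fun h => hinf (Module.Finite.of_basis b)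
  let f := Infinite.natEmbedding (Module.Basis.ofVectorSpaceIndex ℚ k)
  exact ⟨fun i => b (f i),
    (b.linearIndependent.comp f f.injective).restrict_scalars (R := ℕ) (by
      intro x y h
      simpa using h)⟩

theorem aleph0_le_trdeg_of_expand [IsAlgClosed k] {O : Type u} [CommRing O] [Algebra k O]
    {κ : Type u} [Field κ] [Algebra k κ] (ev : O →ₐ[k] κ) (j : PowerSeries k →ₐ[k] κ)
    (hj : Function.Injective j) {N : ℕ} (hN : N ≠ 0)
    (hev : ∀ f, j (PowerSeries.expand N hN f) ∈ ev.range) (p : Ideal O) [p.IsPrime]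
    (hp : ∀ x ∈ p, ev x = 0) :
    Cardinal.aleph0 ≤ Algebra.trdeg k p.ResidueField := by
  obtain ⟨l, hl⟩ := exists_linearIndependent_nat k
  have hexp : Function.Injective (PowerSeries.expand N hN : PowerSeries k →ₐ[k] PowerSeries k) := by
    intro f g h
    ext i
    have := congrArg (PowerSeries.coeff (N * i)) h
    simpa [PowerSeries.coeff_expand_mul] using this
  have h1 := ((algebraicIndependent_expSeries k hl).map' (f := PowerSeries.expand N hN) hexp).map' hj
  choose y hy using fun i => hev (expSeries k (Multiplicative.ofAdd (l i)))
  let π : O →ₐ[k] p.ResidueField := IsScalarTower.toAlgHom k O p.ResidueField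
  have h2 : AlgebraicIndependent k fun i => π (y i) := by
    rw [algebraicIndependent_iff_injective_aeval, injective_iff_map_eq_zero] at h1 ⊢
    intro P hP
    apply h1
    have h3 : MvPolynomial.aeval (fun i => π (y i)) P = π (MvPolynomial.aeval y P) := by
      rw [← AlgHom.comp_apply, MvPolynomial.comp_aeval]
    rw [h3] at hP
    have h4 := hp _ ((Ideal.algebraMap_residueField_eq_zero).1 hP)
    rw [← AlgHom.comp_apply, MvPolynomial.comp_aeval] at h4
    rw [← h4]
    congr 2
    funext i
    exact (hy i).symm
  exact (Cardinal.lift_le.{u}.2 le_rfl).trans (by simpa using h2.lift_cardinalMk_le_trdeg)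

end Exponentials

/-! ### Orders over a discrete valuation ring -/

section DiscreteValuationRing

variable {O : Type u} [CommRing O] {Λ : Type u} [Ring Λ] [Algebra O Λ]
  {O' : Type u} [CommRing O'] {Λ' : Type u} [Ring Λ'] [Algebra O' Λ']

theorem IsRightSelfDual.of_ringEquiv (h : IsRightSelfDual O Λ) (f : O ≃+* O') (g : Λ ≃+* Λ')
    (hfg : ∀ (r : O) (x : Λ), g (r • x) = f r • g x) : IsRightSelfDual O' Λ' := by
  obtain ⟨φ, hφ⟩ := h
  have hg : ∀ (r : O') (x : Λ'), g.symm (r • x) = f.symm r • g.symm x := fun r x => by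
    apply g.injective
    rw [hfg, g.apply_symm_apply, g.apply_symm_apply, f.apply_symm_apply]
  refine ⟨{ toFun := fun a =>
              { toFun := fun x => f (φ (g.symm a) (g.symm x))
                map_add' := fun x y => by rw [map_add, map_add, map_add]
                map_smul' := fun r x => by simp [hg] }
            invFun := fun h => g (φ.symm
              { toFun := fun x => f.symm (h (g x))
                map_add' := fun x y => by rw [map_add, map_add, map_add]
                map_smul' := fun r x => by simp [hfg] })
            map_add' := fun a b => by ext x; simp
            map_smul' := fun r a => by ext x; simp [hg]
            left_inv := fun a => by
              apply g.symm.injective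
              apply φ.injective
              ext x
              simp
            right_inv := fun h => by ext x; simp }, fun a b x => ?_⟩
  change f (φ (g.symm (b * a)) (g.symm x)) = f (φ (g.symm b) (g.symm (a * x)))
  rw [map_mul g.symm, hφ, map_mul g.symm]

theorem IsLeftSelfDual.of_ringEquiv (h : IsLeftSelfDual O Λ) (f : O ≃+* O') (g : Λ ≃+* Λ')
    (hfg : ∀ (r : O) (x : Λ), g (r • x) = f r • g x) : IsLeftSelfDual O' Λ' := by
  obtain ⟨φ, hφ⟩ := h
  have hg : ∀ (r : O') (x : Λ'), g.symm (r • x) = f.symm r • g.symm x := fun r x => by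
    apply g.injective
    rw [hfg, g.apply_symm_apply, g.apply_symm_apply, f.apply_symm_apply]
  refine ⟨{ toFun := fun a =>
              { toFun := fun x => f (φ (g.symm a) (g.symm x))
                map_add' := fun x y => by rw [map_add, map_add, map_add]
                map_smul' := fun r x => by simp [hg] }
            invFun := fun h => g (φ.symm
              { toFun := fun x => f.symm (h (g x))
                map_add' := fun x y => by rw [map_add, map_add, map_add]
                map_smul' := fun r x => by simp [hfg] })
            map_add' := fun a b => by ext x; simp
            map_smul' := fun r a => by ext x; simp [hg]
            left_inv := fun a => by
              apply g.symm.injective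
              apply φ.injective
              ext x
              simp
            right_inv := fun h => by ext x; simp }, fun a b x => ?_⟩
  change f (φ (g.symm (a * b)) (g.symm x)) = f (φ (g.symm b) (g.symm (x * a)))
  rw [map_mul g.symm, hφ, map_mul g.symm]

variable (O Λ)

/-- Localising at the maximal ideal of a local ring changes nothing. -/
theorem exists_orderAt_ringEquiv [IsLocalRing O] (p : Ideal O) [hp : p.IsPrime]
    (hpm : p = IsLocalRing.maximalIdeal O) :
    ∃ (f : Localization.AtPrime p ≃+* O) (g : OrderAt O Λ p ≃+* Λ),
      ∀ (r : Localization.AtPrime p) (x : OrderAt O Λ p), g (r • x) = f r • g x := by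
  have hU : p.primeCompl ≤ IsUnit.submonoid O := fun x hx => by
    by_contra h
    refine hx ?_
    rw [hpm]
    exact h
  let ε : O ≃ₐ[O] Localization.AtPrime p := IsLocalization.atUnits O p.primeCompl hU
  let g : OrderAt O Λ p ≃ₐ[O] Λ :=
    (Algebra.TensorProduct.congr ε.symm AlgEquiv.refl).trans (Algebra.TensorProduct.lid O Λ)
  refine ⟨ε.symm.toRingEquiv, g.toRingEquiv, fun r x => ?_⟩
  obtain ⟨r, rfl⟩ := ε.surjective r
  have h1 : ε r • x = r • x := by
    have : ε r = algebraMap O _ r := by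
      rw [← ε.commutes r]
      rfl
    rw [this, algebraMap_smul]
  rw [h1]
  change g (r • x) = ε.symm (ε r) • g x
  rw [map_smul, ε.symm_apply_apply]

theorem height_eq_one_iff_of_isDiscreteValuationRing [IsDomain O] [IsDiscreteValuationRing O]
    (p : Ideal O) [hp : p.IsPrime] : p.height = 1 ↔ p = IsLocalRing.maximalIdeal O := by
  constructor
  · intro h
    have h0 : p ≠ ⊥ := by
      rintro rfl
      rw [Ideal.height_bot] at h
      exact zero_ne_one h
    exact IsLocalRing.eq_maximalIdeal (Ideal.IsPrime.isMaximal hp h0)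
  · rintro rfl
    have h := IsLocalRing.maximalIdeal_height_eq_ringKrullDim (R := O)
    rw [IsDiscreteValuationRing.ringKrullDim_eq_one] at h
    exact_mod_cast h

/-- Over a discrete valuation ring with residue field of infinite transcendence degree, normality of
a hereditary order amounts to self-duality. -/
theorem isNormalOrder_iff (k : Type u) [Field k] [Algebra k O] [IsDomain O]
    [IsDiscreteValuationRing O] [Module.Finite O Λ]
    (htf : ∀ (r : O) (X : Λ), r • X = 0 → r = 0 ∨ X = 0)
    (hc : Algebra.IsCentral (FractionRing O) (GenericFibre O Λ))
    (hs : IsSimpleRing (GenericFibre O Λ)) (hh : IsHereditary Λ)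
    (htr : Cardinal.aleph0 ≤ Algebra.trdeg k (IsLocalRing.maximalIdeal O).ResidueField) :
    IsNormalOrder O Λ k ↔ IsLeftSelfDual O Λ ∧ IsRightSelfDual O Λ := by
  have : Module.IsTorsionFree O Λ :=
    Module.IsTorsionFree.of_smul_eq_zero fun r X hrX => htf r X hrX
  constructor
  · intro h
    have h1 := (height_eq_one_iff_of_isDiscreteValuationRing O (IsLocalRing.maximalIdeal O)).2 rfl
    obtain ⟨f, g, hfg⟩ := exists_orderAt_ringEquiv O Λ (IsLocalRing.maximalIdeal O) rfl
    exact ⟨(h.leftSelfDual _ h1).of_ringEquiv f g hfg, (h.rightSelfDual _ h1).of_ringEquiv f g hfg⟩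
  · rintro ⟨hl, hr⟩
    refine ⟨inferInstance, inferInstance, inferInstance, ⟨inferInstance, inferInstance, hc, hs⟩,
      fun p _ hp => ?_, fun p _ hp => ?_, fun p _ hp => ?_, fun p _ hp hlt => ?_, ?_⟩
    · obtain ⟨f, g, hfg⟩ := exists_orderAt_ringEquiv O Λ p
        ((height_eq_one_iff_of_isDiscreteValuationRing O p).1 hp)
      exact hh.of_ringEquiv g
    · obtain ⟨f, g, hfg⟩ := exists_orderAt_ringEquiv O Λ p
        ((height_eq_one_iff_of_isDiscreteValuationRing O p).1 hp)
      refine hl.of_ringEquiv f.symm g.symm fun r x => g.injective ?_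
      rw [hfg, g.apply_symm_apply, g.apply_symm_apply, f.apply_symm_apply]
    · obtain ⟨f, g, hfg⟩ := exists_orderAt_ringEquiv O Λ p
        ((height_eq_one_iff_of_isDiscreteValuationRing O p).1 hp)
      refine hr.of_ringEquiv f.symm g.symm fun r x => g.injective ?_
      rw [hfg, g.apply_symm_apply, g.apply_symm_apply, f.apply_symm_apply]
    · obtain rfl := (height_eq_one_iff_of_isDiscreteValuationRing O p).1 hp
      exact absurd hlt (not_lt.2 htr)
    · have : Module.Free O Λ := inferInstance
      infer_instance

end DiscreteValuationRing


/-! ### Simultaneous normal form of the matrix action -/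

section Conjugation

variable {k : Type u} [Field k] {T : Type u} [CommRing T] [Algebra k T] {Q : Type*} [Fintype Q]
  [DecidableEq Q]

/-- Conjugation by an invertible diagonal matrix. -/
def diagConj (k : Type u) [Field k] [Algebra k T] (d : Q → Tˣ) :
    Matrix Q Q T ≃ₐ[k] Matrix Q Q T where
  toFun Y := Matrix.of fun q q' => ((d q)⁻¹ : Tˣ) * d q' * Y q q'
  invFun Y := Matrix.of fun q q' => d q * ((d q')⁻¹ : Tˣ) * Y q q'
  left_inv Y := by
    ext q q'
    simp only [Matrix.of_apply]
    calc _ = ((d q : T) * ((d q)⁻¹ : Tˣ)) * ((d q' : T) * ((d q')⁻¹ : Tˣ)) * Y q q' := by ring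
      _ = _ := by rw [Units.mul_inv, Units.mul_inv, one_mul, one_mul]
  right_inv Y := by
    ext q q'
    simp only [Matrix.of_apply]
    calc _ = ((d q : T) * ((d q)⁻¹ : Tˣ)) * ((d q' : T) * ((d q')⁻¹ : Tˣ)) * Y q q' := by ring
      _ = _ := by rw [Units.mul_inv, Units.mul_inv, one_mul, one_mul]
  map_mul' Y Y' := by
    ext q q'
    simp only [Matrix.of_apply, Matrix.mul_apply, Finset.mul_sum]
    refine Finset.sum_congr rfl fun r _ => ?_
    calc _ = (((d q)⁻¹ : Tˣ) * d q' * (Y q r * Y' r q')) * 1 := (mul_one _).symm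
      _ = (((d q)⁻¹ : Tˣ) * d q' * (Y q r * Y' r q')) * ((d r : T) * ((d r)⁻¹ : Tˣ)) := by
        rw [Units.mul_inv]
      _ = _ := by ring
  map_add' Y Y' := by
    ext q q'
    simp [mul_add]
  commutes' c := by
    ext q q'
    simp only [Matrix.of_apply, Matrix.algebraMap_matrix_apply]
    split_ifs with h
    · subst h
      rw [Units.inv_mul, one_mul]
    · rw [mul_zero]

theorem diagConj_apply (d : Q → Tˣ) (Y : Matrix Q Q T) (q q' : Q) :
    diagConj k d Y q q' = ((d q)⁻¹ : Tˣ) * d q' * Y q q' := rfl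

end Conjugation

/-- A matrix algebra with two automorphisms, identified with the matrices over the index set
`ZMod e × F` such that the first automorphism multiplies the entries by ratios of weights and the
second one shifts the indices, up to powers of `ξ` with exponents `b`. -/
structure Frame {k : Type u} [Field k] (M : Type u) [Ring M] [Algebra k M] (βσ βτ : M →ₐ[k] M)
    (ξ : k) (e : ℕ) (F : Type u) [Fintype F] [DecidableEq F] [NeZero e] where
  /-- the identification -/
  conj : M ≃ₐ[k] Matrix (ZMod e × F) (ZMod e × F) k
  /-- the weights -/
  α : ZMod e × F → k
  /-- the exponents -/
  b : ZMod e × F → ℕ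
  b_shift : ∀ q, b (shiftIndex q) = b q
  conj_σ : ∀ Y q q', conj (βσ Y) q q' = (α q / α q') * conj Y q q'
  conj_τ : ∀ Y q q', ξ ^ b q * conj (βτ Y) (shiftIndex q) (shiftIndex q') = ξ ^ b q' * conj Y q q'

namespace Frame

variable {k : Type u} [Field k] {M : Type u} [Ring M] [Algebra k M] {βσ βτ : M →ₐ[k] M}
  {ξ : k} {e : ℕ} {F : Type u} [Fintype F] [DecidableEq F] [NeZero e]
  (fr : Frame M βσ βτ ξ e F) {T : Type u} [CommRing T] [Algebra k T]

/-- The identification over a base `T` with a unit `s`, on which the powers of `s` absorb the powers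
of `ξ`. -/
def equiv (s : Tˣ) : T ⊗[k] M ≃ₐ[k] Matrix (ZMod e × F) (ZMod e × F) T :=
  ((Algebra.TensorProduct.congr AlgEquiv.refl fr.conj).trans
    (matrixEquivTensor (ZMod e × F) k T).symm).trans (diagConj k fun q => s ^ fr.b q)

theorem equiv_tmul (s : Tˣ) (f : T) (Y : M) (q q' : ZMod e × F) :
    fr.equiv s (f ⊗ₜ Y) q q' =
      ((s ^ fr.b q)⁻¹ : Tˣ) * (s ^ fr.b q' : Tˣ) * (f * algebraMap k T (fr.conj Y q q')) := by
  change diagConj k (fun q => s ^ fr.b q) ((matrixEquivTensor (ZMod e × F) k T).symm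
    (f ⊗ₜ fr.conj Y)) q q' = _
  rw [diagConj_apply, matrixEquivTensor_apply_symm]
  simp [Matrix.smul_apply]

theorem equiv_smul (s : Tˣ) (r : T) (z : T ⊗[k] M) : fr.equiv s (r • z) = r • fr.equiv s z := by
  induction z using TensorProduct.induction_on with
  | zero => simp
  | add x y hx hy => rw [smul_add, map_add, hx, hy, map_add, smul_add]
  | tmul f Y =>
    ext q q'
    rw [TensorProduct.smul_tmul', equiv_tmul, Matrix.smul_apply, equiv_tmul, smul_eq_mul,
      smul_eq_mul]
    ring

theorem equiv_map_σ {s : Tˣ} {φ : T →ₐ[k] T} (hφ : φ s = s) (z : T ⊗[k] M) (q q' : ZMod e × F) :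
    fr.equiv s (Algebra.TensorProduct.map φ βσ z) q q' =
      (fr.α q / fr.α q') • φ (fr.equiv s z q q') := by
  have hu : Units.map (φ : T →* T) s = s := Units.ext hφ
  have hpow : ∀ i : ℕ, φ ((s ^ i : Tˣ) : T) = (s ^ i : Tˣ) := fun i => by
    rw [Units.val_pow_eq_pow_val, map_pow, hφ]
  have hinv : ∀ i : ℕ, φ (((s ^ i)⁻¹ : Tˣ) : T) = ((s ^ i)⁻¹ : Tˣ) := fun i => by
    have := congrArg (fun x : Tˣ => (((x ^ i)⁻¹ : Tˣ) : T)) hu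
    simp only [← map_pow, ← map_inv] at this
    exact this
  induction z using TensorProduct.induction_on with
  | zero => simp
  | add x y hx hy =>
    rw [map_add, map_add, map_add, Matrix.add_apply, Matrix.add_apply, hx, hy, map_add, smul_add]
  | tmul f Y =>
    rw [Algebra.TensorProduct.map_tmul, equiv_tmul, equiv_tmul, fr.conj_σ]
    simp only [map_mul, hpow, hinv, AlgHom.commutes, Algebra.smul_def]
    ring

theorem equiv_map_τ {s : Tˣ} {φ : T →ₐ[k] T} (hφ : φ s = ξ • (s : T)) (z : T ⊗[k] M)
    (q q' : ZMod e × F) :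
    fr.equiv s (Algebra.TensorProduct.map φ βτ z) (shiftIndex q) (shiftIndex q') =
      φ (fr.equiv s z q q') := by
  have hpow : ∀ i : ℕ, φ ((s ^ i : Tˣ) : T) = algebraMap k T (ξ ^ i) * (s ^ i : Tˣ) := fun i => by
    rw [Units.val_pow_eq_pow_val, map_pow, hφ, smul_pow, Algebra.smul_def]
  have hinv : ∀ i : ℕ, algebraMap k T (ξ ^ i) * φ (((s ^ i)⁻¹ : Tˣ) : T) = ((s ^ i)⁻¹ : Tˣ) :=
    fun i => by
      have h1 : φ (((s ^ i)⁻¹ : Tˣ) : T) * φ ((s ^ i : Tˣ) : T) = 1 := by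
        rw [← map_mul, Units.inv_mul, map_one]
      rw [hpow, ← mul_assoc] at h1
      rw [mul_comm]
      exact Units.eq_inv_of_mul_eq_one_right h1
  induction z using TensorProduct.induction_on with
  | zero => simp
  | add x y hx hy =>
    rw [map_add, map_add, map_add, Matrix.add_apply, Matrix.add_apply, hx, hy, map_add]
  | tmul f Y =>
    rw [Algebra.TensorProduct.map_tmul, equiv_tmul, equiv_tmul, fr.b_shift, fr.b_shift]
    have h1 := congrArg (algebraMap k T) (fr.conj_τ Y q q')
    rw [map_mul, map_mul] at h1
    rw [map_mul, map_mul, map_mul, hpow, AlgHom.commutes]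
    conv_lhs => rw [← hinv (fr.b q)]
    calc _ = φ (((s ^ fr.b q)⁻¹ : Tˣ) : T) * ((s ^ fr.b q' : Tˣ) : T) * φ f *
          (algebraMap k T (ξ ^ fr.b q) *
            algebraMap k T (fr.conj (βτ Y) (shiftIndex q) (shiftIndex q'))) := by ring
      _ = _ := by rw [h1]; ring

end Frame

/-- Conjugations by two matrices of finite order modulo scalars that commute up to the primitive root
of unity `η` admit a frame. Its weights are the eigenvalues of the first matrix, with multiplicity,
and the labels `ℓ` number the orbits through a given weight. -/
theorem exists_frame {k : Type u} [Field k] [IsAlgClosed k] [CharZero k] {m : ℕ} (hm : 0 < m) (A B : GL (Fin m) k)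
    (βσ βτ : Matrix (Fin m) (Fin m) k →ₐ[k] Matrix (Fin m) (Fin m) k)
    (hβσ : ∀ X, βσ X = A.1 * X * A⁻¹.1) (hβτ : ∀ X, βτ X = B.1 * X * B⁻¹.1)
    {n N : ℕ} (hn0 : n ≠ 0) (hN0 : N ≠ 0) {a b η ξ : k} (ha : a ≠ 0) (hb : b ≠ 0)
    (hA : A.1 ^ n = a • 1) (hB : B.1 ^ N = b • 1) {e : ℕ} [NeZero e] (hη : IsPrimitiveRoot η e)
    (hηn : η ^ n = 1) (hηN : η ^ N = 1)
    (hξ : IsPrimitiveRoot ξ N) (hAB : A.1 * B.1 = η • (B.1 * A.1)) :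
    ∃ (F : Type u) (_ : Fintype F) (_ : DecidableEq F) (_ : Nonempty F)
      (fr : Frame (Matrix (Fin m) (Fin m) k) βσ βτ ξ e F) (w : ShiftWeight k n N e F) (ℓ : F → ℕ),
      w.α = fr.α ∧ w.η = η ∧
      (∀ μ, Module.End.HasEigenvalue (Matrix.toLin' A.1) μ ↔ ∃ q, w.α q = μ) ∧
      (∀ μ, Module.finrank k (Module.End.eigenspace (Matrix.toLin' A.1) μ) =
        Nat.card {q // w.α q = μ}) ∧
      (∀ q q' : ZMod e × F, w.α q = w.α q' → ℓ q.2 = ℓ q'.2 → q = q') ∧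
      ∀ q : ZMod e × F, ℓ q.2 < Nat.card {q' // w.α q' = w.α q} := by
  have he0 : e ≠ 0 := NeZero.ne e
  have hη0 : η ≠ 0 := hη.ne_zero he0
  have hξ0 : ξ ≠ 0 := hξ.ne_zero hN0
  have hA' : Matrix.toLin' A.1 ^ n = a • 1 := by
    rw [← Matrix.toLin'_pow, hA, map_smul, Matrix.toLin'_one]
    rfl
  have hB' : Matrix.toLin' B.1 ^ N = b • 1 := by
    rw [← Matrix.toLin'_pow, hB, map_smul, Matrix.toLin'_one]
    rfl
  have hAB' : Matrix.toLin' A.1 * Matrix.toLin' B.1 =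
      η • (Matrix.toLin' B.1 * Matrix.toLin' A.1) := by
    rw [Module.End.mul_eq_comp, Module.End.mul_eq_comp, ← Matrix.toLin'_mul, ← Matrix.toLin'_mul,
      hAB, map_smul]
  obtain ⟨F, _, _, u, α0, c, ℓ, h1, h2, h3, h4⟩ := exists_basis_of_commute_up_to_root
    (Matrix.toLin' A.1) (Matrix.toLin' B.1) hn0 hN0 ha hb hA' hB' hη hAB'
  let α : ZMod e × F → k := fun q => η ^ q.1.val * α0 q.2
  have hAu : ∀ q, Matrix.toLin' A.1 (u q) = α q • u q := fun q => h1 q.1 q.2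
  have hBu : ∀ q, Matrix.toLin' B.1 (u q) = c q.2 • u (shiftIndex q) := fun q => h2 q.1 q.2
  have hApow : ∀ (i : ℕ) q, (Matrix.toLin' A.1 ^ i) (u q) = α q ^ i • u q := fun i q => by
    induction i with
    | zero => simp
    | succ i ih => rw [pow_succ', Module.End.mul_apply, ih, map_smul, hAu, smul_smul, pow_succ]
  have hBpow : ∀ (i : ℕ) q, (Matrix.toLin' B.1 ^ i) (u q) = c q.2 ^ i • u ((shiftIndex ^ i) q) := by
    intro i
    induction i with
    | zero => simp
    | succ i ih =>
      intro q
      rw [pow_succ', Module.End.mul_apply, ih, map_smul, hBu, smul_smul, pow_succ' shiftIndex,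
        Equiv.Perm.mul_apply, pow_succ]
      congr 3
      rw [shiftIndex_pow]
  have hαn : ∀ q, α q ^ n = a := fun q => by
    have h5 := hApow n q
    rw [hA', LinearMap.smul_apply, Module.End.one_apply] at h5
    exact (smul_left_injective k (u.ne_zero q) h5).symm
  have hcN : ∀ q : ZMod e × F, c q.2 ^ N = b := fun q => by
    have h5 := hBpow N q
    rw [hB', LinearMap.smul_apply, Module.End.one_apply, shiftIndex_pow,
      (ZMod.natCast_eq_zero_iff _ _).2 ((hη.pow_eq_one_iff_dvd N).1 hηN), add_zero] at h5
    exact (smul_left_injective k (u.ne_zero q) h5).symm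
  have hα0 : ∀ q, α q ≠ 0 := fun q h => ha (by rw [← hαn q, h, zero_pow hn0])
  have hc0 : ∀ q : ZMod e × F, c q.2 ≠ 0 := fun q h => hb (by rw [← hcN q, h, zero_pow hN0])
  have hne : Nonempty F := by
    have : Nontrivial (Fin m → k) := by
      have : Nonempty (Fin m) := ⟨⟨0, hm⟩⟩
      infer_instance
    obtain ⟨q⟩ := u.index_nonempty
    exact ⟨q.2⟩
  obtain ⟨l0⟩ := hne
  -- the scalars of the shifts agree up to powers of `ξ`
  have hb : ∀ l, ∃ i : ℕ, c l * ξ ^ i = c l0 := fun l => by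
    have : NeZero N := ⟨hN0⟩
    have h5 : (c l0 / c l) ^ N = 1 := by
      rw [div_pow, hcN (0, l0), hcN (0, l), div_self hb]
    obtain ⟨i, -, hi⟩ := hξ.eq_pow_of_pow_eq_one h5
    exact ⟨i, by rw [hi, mul_div_cancel₀ _ (hc0 (0, l))]⟩
  choose bexp hbexp using hb
  let w : ShiftWeight k n N e F :=
    { α := α
      η := η
      isPrimitiveRoot_η := hη
      α_shift := fun i l => by
        change η ^ (i + 1).val * α0 l = η * (η ^ i.val * α0 l)
        have : η ^ (i + 1).val = η ^ (i.val + 1) := by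
          rw [ZMod.val_add, ← pow_eq_pow_mod _ hη.pow_eq_one]
          rw [pow_add, pow_add, ← Nat.cast_one, ZMod.val_natCast, ← pow_eq_pow_mod _ hη.pow_eq_one]
        rw [this, pow_succ']
        ring
      α_ne_zero := hα0
      α_pow := fun q q' => by rw [hαn, hαn]
      η_pow_n := hηn
      η_pow_N := hηN }
  -- coordinates of the matrices in the basis `u`
  let C : Matrix (Fin m) (Fin m) k ≃ₐ[k] Matrix (ZMod e × F) (ZMod e × F) k :=
    Matrix.toLinAlgEquiv'.trans (LinearMap.toMatrixAlgEquiv u)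
  have hC : ∀ Y q q', C Y q q' = u.repr (Matrix.toLin' Y (u q')) q := fun Y q q' =>
    LinearMap.toMatrixAlgEquiv_apply _ _ _ _
  have hinvσ : ∀ q, Matrix.toLin' A⁻¹.1 (u q) = (α q)⁻¹ • u q := fun q => by
    have h5 : Matrix.toLin' A⁻¹.1 (Matrix.toLin' A.1 (u q)) = u q := by
      rw [← Matrix.toLin'_mul_apply, Units.inv_mul, Matrix.toLin'_one]
      rfl
    rw [hAu, map_smul] at h5
    rw [← h5, smul_smul, inv_mul_cancel₀ (hα0 q), one_smul, h5]
  have hinvτ : ∀ q, Matrix.toLin' B⁻¹.1 (u (shiftIndex q)) = (c q.2)⁻¹ • u q := fun q => by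
    have h5 : Matrix.toLin' B⁻¹.1 (Matrix.toLin' B.1 (u q)) = u q := by
      rw [← Matrix.toLin'_mul_apply, Units.inv_mul, Matrix.toLin'_one]
      rfl
    rw [hBu, map_smul] at h5
    rw [← h5, smul_smul, inv_mul_cancel₀ (hc0 q), one_smul]
  have hreprB : ∀ v q, u.repr (Matrix.toLin' B.1 v) (shiftIndex q) = c q.2 * u.repr v q := by
    intro v q
    have h5 : Matrix.toLin' B.1 v = ∑ p, (u.repr v (shiftIndex.symm p) *
        c (shiftIndex.symm p).2) • u p := by
      conv_lhs => rw [← u.sum_repr v]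
      rw [← Equiv.sum_comp shiftIndex
        fun p => (u.repr v (shiftIndex.symm p) * c (shiftIndex.symm p).2) • u p]
      simp only [map_sum, map_smul, hBu, smul_smul, Equiv.symm_apply_apply]
    rw [h5, u.repr_sum_self, Equiv.symm_apply_apply, mul_comm]
  let fr : Frame (Matrix (Fin m) (Fin m) k) βσ βτ ξ e F :=
    { conj := C
      α := α
      b := fun q => bexp q.2
      b_shift := fun q => rfl
      conj_σ := fun Y q q' => by
        rw [hβσ, hC, hC, Matrix.toLin'_mul_apply, Matrix.toLin'_mul_apply, hinvσ, map_smul, map_smul,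
          map_smul, Finsupp.smul_apply, repr_apply_of_basis hAu, smul_eq_mul, div_eq_mul_inv]
        ring
      conj_τ := fun Y q q' => by
        rw [hβτ, hC, hC, Matrix.toLin'_mul_apply, Matrix.toLin'_mul_apply, hinvτ, map_smul, map_smul,
          map_smul, Finsupp.smul_apply, hreprB, smul_eq_mul]
        have h5 : c q.2 * ξ ^ bexp q.2 = c q'.2 * ξ ^ bexp q'.2 := by rw [hbexp, hbexp]
        have h6 := hc0 q'
        field_simp
        linear_combination (u.repr (Matrix.toLin' Y (u q')) q) * h5 }
  refine ⟨F, inferInstance, inferInstance, ⟨l0⟩, fr, w, ℓ, rfl, rfl,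
    hasEigenvalue_iff_of_basis _ u α hAu, finrank_eigenspace_of_basis _ u α hAu, ?_, ?_⟩
  · have hcancel : ∀ (i : ℕ) (l l' : F) (j : ℕ), η ^ i * α0 l = η ^ j * α0 l' → ∃ r : ℕ,
        α0 l' = η ^ r * α0 l := fun i l l' j h => by
      refine ⟨j * (e - 1) + i, ?_⟩
      have h5 : η ^ (j * (e - 1)) * η ^ j = 1 := by
        rw [← pow_add, ← Nat.mul_succ, Nat.succ_eq_add_one, Nat.sub_add_cancel
          (Nat.one_le_iff_ne_zero.2 he0), mul_comm, pow_mul, hη.pow_eq_one, one_pow]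
      rw [pow_add, mul_assoc, h, ← mul_assoc, h5, one_mul]
    rintro ⟨i, l⟩ ⟨j, l'⟩ hα hℓ
    obtain ⟨r, hr⟩ := hcancel _ _ _ _ hα
    obtain rfl := h4 l l' r hℓ hr
    have h5 := mul_right_cancel₀ (fun h => hα0 (0, l) (by
      change η ^ _ * α0 l = 0
      rw [h, mul_zero])) hα
    rw [ZMod.val_injective e (hη.pow_inj (ZMod.val_lt i) (ZMod.val_lt j) h5)]
  · rintro ⟨i, l⟩
    refine (h3 l).trans_eq ?_
    rw [finrank_eigenspace_of_basis _ u α hAu]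
    -- the shift permutes the weights, so multiplicities are constant along it
    have hshift : ∀ q, w.α (shiftIndex q) = η * w.α q := fun q => w.α_shift q.1 q.2
    have h5 : ∀ (j : ℕ), Nat.card {q // α q = α0 l} = Nat.card {q // α q = η ^ j * α0 l} := by
      intro j
      refine Nat.card_congr ((shiftIndex ^ j).subtypeEquiv fun q => ?_)
      have h6 : α ((shiftIndex ^ j) q) = η ^ j * α q := by
        rw [shiftIndex_pow]
        exact w.α_add_nat q.1 q.2 j
      rw [h6, mul_right_inj' (pow_ne_zero _ hη0)]
    exact h5 i.val


/-! ### The stabiliser of a line of reflection -/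

section LineOfReflection

variable {k : Type u} [Field k]

/-- The function field of the line with parameter `s`. -/
abbrev LineField (k : Type u) [Field k] : Type u := FractionRing (PowerSeries k)

theorem rescaleAlgHom_eq (c : k) (f : PowerSeries k) :
    PowerSeries.rescaleAlgHom c f = PowerSeries.rescale c f :=
  RingHom.congr_fun (PowerSeries.coe_rescaleAlgHom c) f

theorem algebraMap_comp_rescale_injective (c : kˣ) : Function.Injective
    ((IsScalarTower.toAlgHom k (PowerSeries k) (LineField k)).comp
      (PowerSeries.rescaleAlgHom (c : k))) := by
  refine (IsFractionRing.injective (PowerSeries k) (LineField k)).comp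
    (?_ : Function.Injective (PowerSeries.rescaleAlgHom (c : k)))
  rw [funext (rescaleAlgHom_eq (c : k))]
  exact PowerSeries.rescale_injective c.ne_zero

/-- The substitution `s ↦ c s` in the function field of the line. -/
def scaleField (c : kˣ) : LineField k →ₐ[k] LineField k :=
  IsFractionRing.liftAlgHom (A := PowerSeries k) (K := LineField k)
    (algebraMap_comp_rescale_injective c)

theorem scaleField_algebraMap (c : kˣ) (f : PowerSeries k) :
    scaleField c (algebraMap (PowerSeries k) (LineField k) f) =
      algebraMap (PowerSeries k) (LineField k) (PowerSeries.rescale (c : k) f) := by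
  rw [← rescaleAlgHom_eq]
  exact IsFractionRing.lift_algebraMap (algebraMap_comp_rescale_injective c) f

variable {G : Type*} [Group G] [Finite G]

/-- The line `L = (t = 0)` has inertia group `⟨σ⟩` and stabiliser `⟨σ⟩ × ⟨τ⟩`, for a linear action
of a finite group that is diagonal on the stabiliser in the coordinates `s, t`. -/
structure IsReflectionLine (ρ : G →* (PlaneRing k ≃ₐ[k] PlaneRing k)) (s t : PlaneRing k)
    (L : Ideal (PlaneRing k)) (σ τ : G) : Prop where
  injective : Function.Injective ρ
  linear : ∀ g i, ρ g (MvPowerSeries.X i) ∈ linearForms k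
  coordinates : IsLinearCoordinates s t
  eq_span : L = Ideal.span {t}
  diagonal : ∀ h ∈ stabilizer ρ L, ∃ c : k, ρ h s = c • s
  mem_inertia : ∀ g : G, g ∈ Subgroup.zpowers σ ↔ g ∈ stabilizer ρ L ∧ ρ g s = s
  inf_eq_bot : Subgroup.zpowers σ ⊓ Subgroup.zpowers τ = ⊥
  sup_eq : Subgroup.zpowers σ ⊔ Subgroup.zpowers τ = stabilizer ρ L

omit [Finite G] in
theorem sup_zpowers_induction [Finite G] {σ τ : G} {P : G → Prop} (h1 : P 1)
    (hm : ∀ a b, P a → P b → P (a * b)) (hσ : P σ) (hτ : P τ) :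
    ∀ g ∈ Subgroup.zpowers σ ⊔ Subgroup.zpowers τ, P g := by
  have hpow : ∀ a, P a → ∀ i : ℕ, P (a ^ i) := fun a ha i => by
    induction i with
    | zero => simpa using h1
    | succ i ih => rw [pow_succ]; exact hm _ _ ih ha
  let K : Subgroup G :=
    { carrier := {g | P g}
      one_mem' := h1
      mul_mem' := fun {a b} ha hb => hm a b ha hb
      inv_mem' := fun {a} ha => by
        have : a⁻¹ = a ^ (orderOf a - 1) := by
          rw [inv_eq_iff_mul_eq_one, ← pow_succ', Nat.sub_add_cancel (orderOf_pos a),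
            pow_orderOf_eq_one]
        change P a⁻¹
        rw [this]
        exact hpow a ha _ }
  have hle : Subgroup.zpowers σ ⊔ Subgroup.zpowers τ ≤ K :=
    sup_le (Subgroup.zpowers_le.2 hσ) (Subgroup.zpowers_le.2 hτ)
  exact fun g hg => hle hg

namespace IsReflectionLine

variable {ρ : G →* (PlaneRing k ≃ₐ[k] PlaneRing k)} {s t : PlaneRing k}
  {L : Ideal (PlaneRing k)} {σ τ : G} (hl : IsReflectionLine ρ s t L σ τ)
include hl

omit [Finite G] in
theorem map_mem_linearForms (g : G) {f : PlaneRing k} (hf : f ∈ linearForms k) :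
    ρ g f ∈ linearForms k := by
  induction hf using Submodule.span_induction with
  | mem x hx => obtain ⟨i, rfl⟩ := hx; exact hl.linear g i
  | zero => simp
  | add x y _ _ hx hy => rw [map_add]; exact add_mem hx hy
  | smul a x _ hx => rw [map_smul]; exact Submodule.smul_mem _ _ hx

omit [Finite G] in
theorem s_ne_zero : s ≠ 0 := by
  have := hl.coordinates.linearIndependent.ne_zero 0
  simpa using this

omit [Finite G] in
theorem t_ne_zero : t ≠ 0 := by
  have := hl.coordinates.linearIndependent.ne_zero 1
  simpa using this

omit [Finite G] in
/-- The action is faithful on `ks + kt`. -/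
theorem eq_of_apply_eq {g h : G} (hs : ρ g s = ρ h s) (ht : ρ g t = ρ h t) : g = h := by
  apply hl.injective
  have hX : ∀ i, (ρ g : PlaneRing k →ₐ[k] PlaneRing k) (MvPowerSeries.X i) =
      (ρ h : PlaneRing k →ₐ[k] PlaneRing k) (MvPowerSeries.X i) := fun i => by
    obtain ⟨a, b, e⟩ := hl.coordinates.exists_eq_of_mem_linearForms
      (Submodule.subset_span ⟨i, rfl⟩ : MvPowerSeries.X i ∈ linearForms k)
    simp [e, hs, ht]
  have := algHom_ext_of_constantCoeff_eq_zero _ _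
    (fun i => constantCoeff_eq_zero_of_mem_linearForms (hl.linear g i)) hX
  ext1 f
  exact DFunLike.congr_fun this f

omit [Finite G] in
theorem mem_stabilizer_of_apply_eq {g : G} {c : k} (h : ρ g t = c • t) : g ∈ stabilizer ρ L := by
  have hc : c ≠ 0 := by
    rintro rfl
    rw [zero_smul] at h
    exact hl.t_ne_zero ((map_eq_zero_iff _ (ρ g).injective).1 h)
  change L = L.comap (ρ g : PlaneRing k →ₐ[k] PlaneRing k).toRingHom
  ext x
  rw [Ideal.mem_comap, hl.eq_span, Ideal.mem_span_singleton, Ideal.mem_span_singleton]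
  change t ∣ x ↔ t ∣ ρ g x
  constructor
  · rintro ⟨y, rfl⟩
    rw [map_mul, h, smul_mul_assoc, ← mul_smul_comm]
    exact dvd_mul_right _ _
  · rintro ⟨y, hy⟩
    refine ⟨c⁻¹ • (ρ g).symm y, (ρ g).injective ?_⟩
    rw [map_mul, map_smul, AlgEquiv.apply_symm_apply, h, hy, smul_mul_smul_comm,
      mul_inv_cancel₀ hc, one_smul]

variable {ev : PlaneRing k →ₐ[k] PowerSeries k} (evs : ev s = PowerSeries.X) (evt : ev t = 0)
include evs evt

omit [Finite G] in
theorem restriction_eq_zero_iff (hker : ∀ F, ev F = 0 → t ∣ F) (F : PlaneRing k) :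
    ev F = 0 ↔ t ∣ F :=
  ⟨hker F, by rintro ⟨y, rfl⟩; rw [map_mul, evt, zero_mul]⟩

omit [Finite G] in
theorem exists_apply_t {g : G} (hg : g ∈ stabilizer ρ L) : ∃ c : k, ρ g t = c • t := by
  obtain ⟨a, b, e⟩ := hl.coordinates.exists_eq_of_mem_linearForms
    (hl.map_mem_linearForms g hl.coordinates.right_mem)
  have h1 : t ∈ L := by rw [hl.eq_span]; exact Ideal.mem_span_singleton_self t
  have h2 : ρ g t ∈ L := (SetLike.ext_iff.1 hg t).1 h1
  rw [hl.eq_span, Ideal.mem_span_singleton, e] at h2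
  obtain ⟨y, hy⟩ := h2
  have h3 := congrArg ev hy
  rw [map_add, map_smul, map_smul, map_mul, evs, evt, zero_mul, smul_zero, add_zero] at h3
  have ha : a = 0 := (smul_eq_zero.1 h3).resolve_right PowerSeries.X_ne_zero
  exact ⟨b, by rw [e, ha, zero_smul, zero_add]⟩

omit [Finite G] in
/-- A group element that does not stabilise the line moves it to a transversal one. -/
theorem restriction_apply_t_ne_zero {g : G} (hg : g ∉ stabilizer ρ L) : ev (ρ g t) ≠ 0 := by
  intro h
  obtain ⟨a, b, e⟩ := hl.coordinates.exists_eq_of_mem_linearForms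
    (hl.map_mem_linearForms g hl.coordinates.right_mem)
  rw [e, map_add, map_smul, map_smul, evs, evt, smul_zero, add_zero] at h
  have ha : a = 0 := (smul_eq_zero.1 h).resolve_right PowerSeries.X_ne_zero
  exact hg (hl.mem_stabilizer_of_apply_eq (c := b) (by rw [e, ha, zero_smul, zero_add]))

omit [Finite G] in
/-- The stabiliser acts on the line by scaling the parameter. -/
theorem restriction_apply {g : G} (hg : g ∈ stabilizer ρ L) {c : k} (hc : ρ g s = c • s)
    (F : PlaneRing k) : ev (ρ g F) = PowerSeries.rescale c (ev F) := by
  obtain ⟨d, hd⟩ := hl.exists_apply_t evs evt hg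
  have evc : ∀ f ∈ linearForms k, MvPowerSeries.constantCoeff (ev f) = 0 := fun f hf => by
    obtain ⟨a, b, e⟩ := hl.coordinates.exists_eq_of_mem_linearForms hf
    rw [e, map_add, map_smul, map_smul, evs, evt, smul_zero, add_zero,
      PowerSeries.smul_eq_C_mul, map_mul]
    have : MvPowerSeries.constantCoeff (PowerSeries.X : PowerSeries k) = 0 :=
      PowerSeries.constantCoeff_X
    rw [this, mul_zero]
  have key := algHom_ext_of_constantCoeff_eq_zero
    (ev.comp (ρ g : PlaneRing k →ₐ[k] PlaneRing k)) ((PowerSeries.rescaleAlgHom c).comp ev)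
    (fun i => evc _ (hl.linear g i)) (fun i => by
      obtain ⟨a, b, e⟩ := hl.coordinates.exists_eq_of_mem_linearForms
        (Submodule.subset_span ⟨i, rfl⟩ : MvPowerSeries.X i ∈ linearForms k)
      rw [e]
      simp only [AlgHom.comp_apply, map_add, map_smul, evs, evt, AlgEquiv.coe_toAlgHom, hc, hd,
        smul_zero, add_zero, map_zero, rescaleAlgHom_eq, PowerSeries.rescale_X,
        PowerSeries.smul_eq_C_mul])
  exact (DFunLike.congr_fun key F).trans (rescaleAlgHom_eq c (ev F))

end IsReflectionLine

/-- The eigenvalues of `σ` and `τ` on linear coordinates, and the restriction of functions to the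
line. -/
structure LineData (ρ : G →* (PlaneRing k ≃ₐ[k] PlaneRing k)) (s t : PlaneRing k)
    (L : Ideal (PlaneRing k)) (σ τ : G) where
  /-- restriction to the line -/
  ev : PlaneRing k →ₐ[k] PowerSeries k
  /-- the eigenvalue of `σ` on `t` -/
  ζ : k
  /-- the eigenvalue of `τ` on `s` -/
  ξ : kˣ
  /-- the eigenvalue of `τ` on `t` is the power of `ξ` with this exponent -/
  a : ℕ
  ev_s : ev s = PowerSeries.X
  ev_t : ev t = 0
  ev_eq_zero_iff : ∀ F, ev F = 0 ↔ t ∣ F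
  ev_surjective : Function.Surjective ev
  isPrimitiveRoot_ζ : IsPrimitiveRoot ζ (orderOf σ)
  isPrimitiveRoot_ξ : IsPrimitiveRoot (ξ : k) (orderOf τ)
  mem_σ : σ ∈ stabilizer ρ L
  mem_τ : τ ∈ stabilizer ρ L
  σ_s : ρ σ s = s
  σ_t : ρ σ t = ζ • t
  τ_s : ρ τ s = (ξ : k) • s
  τ_t : ρ τ t = (ξ : k) ^ a • t
  comm : Commute σ τ

theorem IsReflectionLine.nonempty_lineData {ρ : G →* (PlaneRing k ≃ₐ[k] PlaneRing k)}
    {s t : PlaneRing k} {L : Ideal (PlaneRing k)} {σ τ : G} (hl : IsReflectionLine ρ s t L σ τ) :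
    Nonempty (LineData ρ s t L σ τ) := by
  obtain ⟨ev, evs, evt, hker, hsurj⟩ := hl.coordinates.exists_restriction
  have memσ : σ ∈ stabilizer ρ L := ((hl.mem_inertia σ).1 (Subgroup.mem_zpowers σ)).1
  have hσs : ρ σ s = s := ((hl.mem_inertia σ).1 (Subgroup.mem_zpowers σ)).2
  have memτ : τ ∈ stabilizer ρ L := by
    rw [← hl.sup_eq]
    exact (le_sup_right : _ ≤ Subgroup.zpowers σ ⊔ Subgroup.zpowers τ) (Subgroup.mem_zpowers τ)
  obtain ⟨ζ, hσt⟩ := hl.exists_apply_t evs evt memσ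
  obtain ⟨χ, hτt⟩ := hl.exists_apply_t evs evt memτ
  obtain ⟨ξ, hτs⟩ := hl.diagonal τ memτ
  have hpow : ∀ (g : G) (f : PlaneRing k) (c : k), ρ g f = c • f →
      ∀ i : ℕ, ρ (g ^ i) f = c ^ i • f := fun g f c h i => by
    induction i with
    | zero => simp
    | succ i ih => rw [pow_succ, map_mul, AlgEquiv.mul_apply, h, map_smul, ih, smul_smul, pow_succ']
  have hone : ∀ (f : PlaneRing k) (c : k), f ≠ 0 → c • f = f → c = 1 := fun f c hf h =>
    smul_left_injective k hf (by simpa using h)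
  have hsi : ∀ i : ℕ, ρ (σ ^ i) s = s := fun i => by
    simpa using hpow σ s 1 (by simpa using hσs) i
  have hξ0 : ξ ≠ 0 := by
    rintro rfl
    rw [zero_smul] at hτs
    exact hl.s_ne_zero ((map_eq_zero_iff _ (ρ τ).injective).1 hτs)
  -- `σ` acts faithfully through its eigenvalue on `t`, as it fixes `s`
  have hζ : IsPrimitiveRoot ζ (orderOf σ) :=
    { pow_eq_one := hone t _ hl.t_ne_zero (by
        rw [← hpow σ t ζ hσt, pow_orderOf_eq_one, map_one, AlgEquiv.one_apply])
      dvd_of_pow_eq_one := fun i hi => orderOf_dvd_of_pow_eq_one (hl.eq_of_apply_eq (by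
        rw [hsi, map_one, AlgEquiv.one_apply]) (by
        rw [hpow σ t ζ hσt, hi, one_smul, map_one, AlgEquiv.one_apply])) }
  -- a power of `τ` that fixes `s` lies in the inertia group, hence is trivial
  have hξ : IsPrimitiveRoot ξ (orderOf τ) :=
    { pow_eq_one := hone s _ hl.s_ne_zero (by
        rw [← hpow τ s ξ hτs, pow_orderOf_eq_one, map_one, AlgEquiv.one_apply])
      dvd_of_pow_eq_one := fun i hi => by
        have h1 : τ ^ i ∈ Subgroup.zpowers σ := (hl.mem_inertia _).2
          ⟨pow_mem memτ i, by rw [hpow τ s ξ hτs, hi, one_smul]⟩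
        have h2 : τ ^ i ∈ Subgroup.zpowers σ ⊓ Subgroup.zpowers τ :=
          ⟨h1, pow_mem (Subgroup.mem_zpowers τ) i⟩
        rw [hl.inf_eq_bot, Subgroup.mem_bot] at h2
        exact orderOf_dvd_of_pow_eq_one h2 }
  have hχ : χ ^ orderOf τ = 1 := hone t _ hl.t_ne_zero (by
    rw [← hpow τ t χ hτt, pow_orderOf_eq_one, map_one, AlgEquiv.one_apply])
  have : NeZero (orderOf τ) := ⟨(orderOf_pos τ).ne'⟩
  obtain ⟨a, -, ha⟩ := hξ.eq_pow_of_pow_eq_one hχ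
  exact ⟨{
    ev := ev
    ζ := ζ
    ξ := Units.mk0 ξ hξ0
    a := a
    ev_s := evs
    ev_t := evt
    ev_eq_zero_iff := hl.restriction_eq_zero_iff evs evt hker
    ev_surjective := hsurj
    isPrimitiveRoot_ζ := hζ
    isPrimitiveRoot_ξ := hξ
    mem_σ := memσ
    mem_τ := memτ
    σ_s := hσs
    σ_t := hσt
    τ_s := hτs
    τ_t := by rw [Units.val_mk0, ha, hτt]
    comm := hl.eq_of_apply_eq
      (by rw [map_mul, map_mul, AlgEquiv.mul_apply, AlgEquiv.mul_apply, hτs, map_smul, hσs, hτs])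
      (by rw [map_mul, map_mul, AlgEquiv.mul_apply, AlgEquiv.mul_apply, hτt, hσt, map_smul,
            map_smul, hσt, hτt, smul_comm]) }⟩

namespace LineData

variable {ρ : G →* (PlaneRing k ≃ₐ[k] PlaneRing k)} {s t : PlaneRing k}
  {L : Ideal (PlaneRing k)} {σ τ : G} (ld : LineData ρ s t L σ τ)

/-- Restriction to the line, with values in its function field. -/
def evK : PlaneRing k →ₐ[k] LineField k :=
  (IsScalarTower.toAlgHom k (PowerSeries k) (LineField k)).comp ld.ev

omit [Finite G] in
theorem evK_apply (F : PlaneRing k) :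
    ld.evK F = algebraMap (PowerSeries k) (LineField k) (ld.ev F) := rfl

omit [Finite G] in
theorem evK_eq_zero_iff (F : PlaneRing k) : ld.evK F = 0 ↔ t ∣ F := by
  rw [evK_apply, map_eq_zero_iff _ (IsFractionRing.injective _ _), ld.ev_eq_zero_iff]

omit [Finite G] in
theorem exists_mul_evK (z : LineField k) : ∃ F G, ld.evK G ≠ 0 ∧ z * ld.evK G = ld.evK F := by
  obtain ⟨a, b, hb, rfl⟩ := IsFractionRing.div_surjective (A := PowerSeries k) z
  obtain ⟨F, rfl⟩ := ld.ev_surjective a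
  obtain ⟨H, rfl⟩ := ld.ev_surjective b
  have hb' : ld.evK H ≠ 0 := by
    rw [evK_apply, Ne, map_eq_zero_iff _ (IsFractionRing.injective _ _)]
    exact nonZeroDivisors.ne_zero hb
  exact ⟨F, H, hb', div_mul_cancel₀ _ hb'⟩

omit [Finite G] in
theorem evK_σ (hl : IsReflectionLine ρ s t L σ τ) (F : PlaneRing k) :
    ld.evK (ρ σ F) = ld.evK F := by
  rw [evK_apply, hl.restriction_apply ld.ev_s ld.ev_t ld.mem_σ (c := 1)
    (by rw [ld.σ_s, one_smul]), PowerSeries.rescale_one, RingHom.id_apply, evK_apply]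

omit [Finite G] in
theorem evK_τ (hl : IsReflectionLine ρ s t L σ τ) (F : PlaneRing k) :
    ld.evK (ρ τ F) = scaleField ld.ξ (ld.evK F) := by
  rw [evK_apply, hl.restriction_apply ld.ev_s ld.ev_t ld.mem_τ ld.τ_s, evK_apply,
    scaleField_algebraMap]

end LineData

end LineOfReflection


/-! ### The tame action on the completion -/

section CompletedAction

variable {k : Type u} [Field k] {S : Type u} [CommRing S] [Algebra k S] {G : Type*} [Group G]
  (ρ : G →* (S ≃ₐ[k] S)) (L : Ideal S) [L.IsPrime]

/-- The action of the stabiliser of a point on the completion there. -/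
abbrev completedAction (g : G) (hg : g ∈ stabilizer ρ L) :
    LocalCompletion L →ₐ[k] LocalCompletion L :=
  completedMap L (ρ g : S →ₐ[k] S) hg

theorem completedMap_congr {f g : S →ₐ[k] S} (h : f = g) (hf : L = L.comap f.toRingHom)
    (hg : L = L.comap g.toRingHom) : completedMap L f hf = completedMap L g hg := by
  subst h
  rfl

theorem completedAction_one : completedAction ρ L 1 (one_mem _) = 1 := by
  have h : (ρ 1 : S →ₐ[k] S) = AlgHom.id k S := by
    rw [map_one]
    rfl
  exact (completedMap_congr L h (one_mem (stabilizer ρ L)) (h ▸ one_mem (stabilizer ρ L))).trans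
    (completedMap_id L _)

theorem completedAction_mul {a b : G} (ha : a ∈ stabilizer ρ L) (hb : b ∈ stabilizer ρ L) :
    completedAction ρ L (a * b) (mul_mem ha hb) =
      completedAction ρ L a ha * completedAction ρ L b hb := by
  have h : (ρ (a * b) : S →ₐ[k] S) = (ρ a : S →ₐ[k] S).comp (ρ b : S →ₐ[k] S) := by
    rw [map_mul]
    rfl
  exact (completedMap_congr L h (mul_mem ha hb) (h ▸ mul_mem ha hb)).trans
    (completedMap_comp L _ _ ha hb _)

theorem completedAction_congr {a b : G} (h : a = b) (ha : a ∈ stabilizer ρ L)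
    (hb : b ∈ stabilizer ρ L) : completedAction ρ L a ha = completedAction ρ L b hb := by
  subst h
  rfl

theorem completedAction_pow {a : G} (ha : a ∈ stabilizer ρ L) (i : ℕ) :
    completedAction ρ L (a ^ i) (pow_mem ha i) = completedAction ρ L a ha ^ i := by
  induction i with
  | zero =>
    exact (completedAction_congr ρ L (pow_zero a) _ _).trans (completedAction_one ρ L)
  | succ i ih =>
    refine (completedAction_congr ρ L (pow_succ a i) _ (mul_mem (pow_mem ha i) ha)).trans ?_
    rw [completedAction_mul ρ L (pow_mem ha i) ha, ih, pow_succ]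

theorem completedAction_apply_algebraMap {g : G} (hg : g ∈ stabilizer ρ L) (F : S) :
    completedAction ρ L g hg (algebraMap S _ F) = algebraMap S _ (ρ g F) :=
  completedMap_algebraMap L _ hg F

end CompletedAction

section TameCompletion

variable {k : Type u} [Field k] {G : Type*} [Group G] [Finite G]
  {ρ : G →* (PlaneRing k ≃ₐ[k] PlaneRing k)} {s t : PlaneRing k}
  {L : Ideal (PlaneRing k)} [L.IsPrime] {σ τ : G}

theorem mem_completedBaseRing_iff (hl : IsReflectionLine ρ s t L σ τ) (hσ : σ ∈ stabilizer ρ L)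
    (hτ : τ ∈ stabilizer ρ L) (z : LocalCompletion L) :
    z ∈ completedBaseRing ρ L ↔
      completedAction ρ L σ hσ z = z ∧ completedAction ρ L τ hτ z = z := by
  constructor
  · exact fun h => ⟨h ⟨σ, hσ⟩, h ⟨τ, hτ⟩⟩
  · rintro ⟨h1, h2⟩ ⟨g, hg⟩
    obtain ⟨_, h3⟩ := sup_zpowers_induction (σ := σ) (τ := τ)
      (P := fun g => ∃ hg : g ∈ stabilizer ρ L, completedAction ρ L g hg z = z)
      ⟨one_mem _, by rw [completedAction_one]; rfl⟩
      (fun a b ⟨ha, ha'⟩ ⟨hb, hb'⟩ => ⟨mul_mem ha hb, by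
        rw [completedAction_mul ρ L ha hb, AlgHom.mul_apply, hb', ha']⟩)
      ⟨hσ, h1⟩ ⟨hτ, h2⟩ g (hl.sup_eq ▸ hg)
    exact h3

theorem mem_completedOrder_iff {M : Type u} [Ring M] [Algebra k M] (β : G →* (M ≃ₐ[k] M))
    (hl : IsReflectionLine ρ s t L σ τ) (hσ : σ ∈ stabilizer ρ L)
    (hτ : τ ∈ stabilizer ρ L) (z : LocalCompletion L ⊗[k] M) :
    z ∈ completedOrder ρ β L ↔
      Algebra.TensorProduct.map (completedAction ρ L σ hσ) (β σ : M →ₐ[k] M) z = z ∧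
        Algebra.TensorProduct.map (completedAction ρ L τ hτ) (β τ : M →ₐ[k] M) z = z := by
  constructor
  · exact fun h => ⟨h ⟨σ, hσ⟩, h ⟨τ, hτ⟩⟩
  · rintro ⟨h1, h2⟩ ⟨g, hg⟩
    obtain ⟨_, h3⟩ := sup_zpowers_induction (σ := σ) (τ := τ)
      (P := fun g => ∃ hg : g ∈ stabilizer ρ L,
        Algebra.TensorProduct.map (completedAction ρ L g hg) (β g : M →ₐ[k] M) z = z)
      ⟨one_mem _, by
        have h : (β 1 : M →ₐ[k] M) = AlgHom.id k M := by
          rw [map_one]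
          rfl
        rw [completedAction_one, h]
        exact DFunLike.congr_fun Algebra.TensorProduct.map_id z⟩
      (fun a b ⟨ha, ha'⟩ ⟨hb, hb'⟩ => ⟨mul_mem ha hb, by
        have h : (β (a * b) : M →ₐ[k] M) = (β a : M →ₐ[k] M).comp (β b : M →ₐ[k] M) := by
          rw [map_mul]
          rfl
        have h' : completedAction ρ L (a * b) (mul_mem ha hb) =
            (completedAction ρ L a ha).comp (completedAction ρ L b hb) :=
          completedAction_mul ρ L ha hb
        rw [h', h, Algebra.TensorProduct.map_comp, AlgHom.comp_apply, hb', ha']⟩)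
      ⟨hσ, h1⟩ ⟨hτ, h2⟩ g (hl.sup_eq ▸ hg)
    exact h3

/-- The completion at a line of reflection carries a tame action of the stabiliser. The uniformiser
is the coordinate `t`, corrected by a power of the unit `s` to make it invariant under `τ`. -/
theorem exists_tameAction (hl : IsReflectionLine ρ s t L σ τ) (ld : LineData ρ s t L σ τ) :
    ∃ (_ : IsDomain (LocalCompletion L)) (_ : IsDiscreteValuationRing (LocalCompletion L))
      (act : TameAction k (LocalCompletion L) (LineField k) (completedBaseRing ρ L)),
      act.n = orderOf σ ∧ act.N = orderOf τ ∧ act.ξ = ld.ξ ∧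
      act.σ = completedAction ρ L σ ld.mem_σ ∧ act.τ = completedAction ρ L τ ld.mem_τ ∧
      (∀ F, act.ev (algebraMap (PlaneRing k) _ F) = ld.evK F) ∧
      (∀ z, act.ev (act.τ z) = scaleField ld.ξ (act.ev z)) := by
  have : IsDomain (PlaneRing k) := NoZeroDivisors.to_isDomain _
  obtain ⟨hdom, hdvr, êv, hêv, hsurj, hker⟩ := localCompletion_structure L hl.t_ne_zero hl.eq_span
    ld.evK ld.evK_eq_zero_iff ld.exists_mul_evK
  have hmax : IsLocalRing.maximalIdeal (LocalCompletion L) =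
      Ideal.span {algebraMap (PlaneRing k) (LocalCompletion L) t} := by
    have h1 : (RingHom.ker êv).IsMaximal := RingHom.ker_isMaximal_of_surjective _ hsurj
    rw [← IsLocalRing.eq_maximalIdeal h1]
    ext z
    rw [RingHom.mem_ker, hker, Ideal.mem_span_singleton]
  have hunit : ∀ z, êv z ≠ 0 → IsUnit z := fun z hz => by
    by_contra hcon
    rw [← mem_nonunits_iff, ← IsLocalRing.mem_maximalIdeal, hmax, Ideal.mem_span_singleton] at hcon
    exact hz ((hker z).2 hcon)
  have hs : IsUnit (algebraMap (PlaneRing k) (LocalCompletion L) s) := hunit _ (by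
    rw [hêv, ld.evK_apply, ld.ev_s, Ne, map_eq_zero_iff _ (IsFractionRing.injective _ _)]
    exact PowerSeries.X_ne_zero)
  obtain ⟨s', hs'⟩ := hs
  -- `τ` multiplies `t` by `ξ ^ a` and `s` by `ξ`
  let t' : LocalCompletion L :=
    algebraMap (PlaneRing k) _ t * ((s'⁻¹ : (LocalCompletion L)ˣ) : LocalCompletion L) ^ ld.a
  have hass : Associated (algebraMap (PlaneRing k) (LocalCompletion L) t) t' :=
    ⟨s'⁻¹ ^ ld.a, by rw [Units.val_pow_eq_pow_val]⟩
  have hirr : Irreducible t' := by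
    rw [← hass.irreducible_iff, IsDiscreteValuationRing.irreducible_iff_uniformizer, hmax]
  let σ' := completedAction ρ L σ ld.mem_σ
  let τ' := completedAction ρ L τ ld.mem_τ
  have hinv : ∀ (φ : LocalCompletion L →ₐ[k] LocalCompletion L) (c : k), c ≠ 0 →
      φ s' = c • (s' : LocalCompletion L) →
      φ (s'⁻¹ : (LocalCompletion L)ˣ) = c⁻¹ • ((s'⁻¹ : (LocalCompletion L)ˣ) : LocalCompletion L) := by
    intro φ c hc h
    have h1 : φ (s'⁻¹ : (LocalCompletion L)ˣ) * φ s' = 1 := by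
      rw [← map_mul, Units.inv_mul, map_one]
    rw [h, mul_smul_comm, ← smul_mul_assoc] at h1
    have h2 := Units.eq_inv_of_mul_eq_one_right h1
    conv_rhs => rw [← h2]
    rw [smul_smul, inv_mul_cancel₀ hc, one_smul]
  have hσs : σ' s' = s' := by
    rw [hs', completedAction_apply_algebraMap, ld.σ_s]
  have hsmul : ∀ (c : k) (F : PlaneRing k), algebraMap (PlaneRing k) (LocalCompletion L) (c • F) =
      c • algebraMap (PlaneRing k) (LocalCompletion L) F := fun c F => by
    rw [Algebra.smul_def, map_mul, ← IsScalarTower.algebraMap_apply, ← Algebra.smul_def]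
  have hτs : τ' s' = (ld.ξ : k) • (s' : LocalCompletion L) := by
    rw [hs', completedAction_apply_algebraMap, ld.τ_s, hsmul]
  refine ⟨hdom, hdvr, {
    n := orderOf σ
    N := orderOf τ
    ζ := ld.ζ
    ξ := ld.ξ
    σ := σ'
    τ := τ'
    ev := êv
    s := s'
    t := t'
    n_ne_zero := (orderOf_pos σ).ne'
    N_ne_zero := (orderOf_pos τ).ne'
    isPrimitiveRoot_ζ := ld.isPrimitiveRoot_ζ
    isPrimitiveRoot_ξ := ld.isPrimitiveRoot_ξ
    σ_pow := by
      rw [← completedAction_pow, ← completedAction_one ρ L]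
      exact completedAction_congr ρ L (pow_orderOf_eq_one σ) _ _
    τ_pow := by
      rw [← completedAction_pow, ← completedAction_one ρ L]
      exact completedAction_congr ρ L (pow_orderOf_eq_one τ) _ _
    comm := by
      rw [commute_iff_eq, ← completedAction_mul, ← completedAction_mul]
      exact completedAction_congr ρ L ld.comm.eq _ _
    σ_s := hσs
    σ_t := by
      change σ' (_ * _) = _
      rw [map_mul, map_pow, hinv σ' 1 one_ne_zero (by rw [hσs, one_smul]), inv_one, one_smul,
        completedAction_apply_algebraMap, ld.σ_t, hsmul, smul_mul_assoc]
    τ_s := hτs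
    τ_t := by
      change τ' (_ * _) = _ * _
      rw [map_mul, map_pow, hinv τ' _ ld.ξ.ne_zero hτs,
        completedAction_apply_algebraMap, ld.τ_t, hsmul, smul_pow, smul_mul_smul_comm, ← mul_pow,
        mul_inv_cancel₀ ld.ξ.ne_zero, one_pow, one_smul]
    ev_σ := fun z => residue_completedMap L ld.evK ld.evK_eq_zero_iff ld.exists_mul_evK êv hêv hker
      _ ld.mem_σ (RingHom.id _) (ld.evK_σ hl) z
    ev_eq_zero_iff := fun z => by rw [hker, hass.dvd_iff_dvd_left]
    t_ne_zero := hirr.ne_zero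
    factor := fun z hz => by
      obtain ⟨v, hv⟩ := IsDiscreteValuationRing.associated_pow_irreducible hz hirr
      obtain ⟨u, hu⟩ := hv.symm
      exact ⟨v, u, u.isUnit, hu.symm⟩
    mem_iff := mem_completedBaseRing_iff hl ld.mem_σ ld.mem_τ }, rfl, rfl, rfl, rfl, rfl, hêv,
    residue_completedMap L ld.evK ld.evK_eq_zero_iff ld.exists_mul_evK êv hêv hker _ ld.mem_τ
      (scaleField ld.ξ : LineField k →+* LineField k) (ld.evK_τ hl)⟩

end TameCompletion


/-! ### Matrices inducing commuting automorphisms -/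

section Scalars

variable {k : Type u} [Field k] {m : ℕ}

theorem exists_eq_smul_one_of_conj_eq (P : GL (Fin m) k)
    (h : ∀ X : Matrix (Fin m) (Fin m) k, P.1 * X * P⁻¹.1 = X) : ∃ a : k, P.1 = a • 1 := by
  have hc : P.1 ∈ Set.range (Matrix.scalar (Fin m) (α := k)) := by
    rw [Matrix.mem_range_scalar_iff_commute_single']
    intro i j
    have h1 := h (Matrix.single i j 1)
    rw [commute_iff_eq]
    calc _ = P.1 * Matrix.single i j 1 * P⁻¹.1 * P.1 := by rw [h1]
      _ = _ := by rw [mul_assoc, Units.inv_mul, mul_one]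
  obtain ⟨a, ha⟩ := hc
  refine ⟨a, ?_⟩
  rw [← ha, Matrix.scalar_apply, Matrix.smul_one_eq_diagonal]

theorem ne_zero_of_eq_smul_one (hm : 0 < m) {P : GL (Fin m) k} {a : k} (h : P.1 = a • 1) :
    a ≠ 0 := by
  have : Nonempty (Fin m) := ⟨⟨0, hm⟩⟩
  rintro rfl
  rw [zero_smul] at h
  exact P.ne_zero h

variable {G : Type*} [Group G]
  {β : G →* (Matrix (Fin m) (Fin m) k ≃ₐ[k] Matrix (Fin m) (Fin m) k)} {σ τ : G}
  {A B : GL (Fin m) k}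

theorem conj_mul (hA : ∀ X, β σ X = A.1 * X * A⁻¹.1) (hB : ∀ X, β τ X = B.1 * X * B⁻¹.1)
    (X : Matrix (Fin m) (Fin m) k) : β (σ * τ) X = (A * B).1 * X * (A * B)⁻¹.1 := by
  rw [map_mul, AlgEquiv.mul_apply, hB, hA, mul_inv_rev, Units.val_mul, Units.val_mul]
  simp only [mul_assoc]

theorem conj_pow (hA : ∀ X, β σ X = A.1 * X * A⁻¹.1) (i : ℕ) (X : Matrix (Fin m) (Fin m) k) :
    β (σ ^ i) X = (A ^ i).1 * X * (A ^ i)⁻¹.1 := by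
  induction i generalizing X with
  | zero => simp
  | succ i ih => rw [pow_succ, conj_mul (A := A ^ i) ih hA, pow_succ]

theorem exists_pow_eq_smul_one (hm : 0 < m) (hA : ∀ X, β σ X = A.1 * X * A⁻¹.1) {n : ℕ}
    (hn : σ ^ n = 1) : ∃ a : k, a ≠ 0 ∧ A.1 ^ n = a • 1 := by
  obtain ⟨a, ha⟩ := exists_eq_smul_one_of_conj_eq (A ^ n) fun X => by
    rw [← conj_pow hA, hn, map_one, AlgEquiv.one_apply]
  exact ⟨a, ne_zero_of_eq_smul_one hm ha, by rw [← ha, Units.val_pow_eq_pow_val]⟩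

/-- Matrices inducing commuting automorphisms commute up to a unique scalar. -/
theorem existsUnique_mul_eq_smul_mul (hm : 0 < m) (hA : ∀ X, β σ X = A.1 * X * A⁻¹.1)
    (hB : ∀ X, β τ X = B.1 * X * B⁻¹.1) (h : Commute σ τ) :
    ∃! η : k, A.1 * B.1 = η • (B.1 * A.1) := by
  have : Nonempty (Fin m) := ⟨⟨0, hm⟩⟩
  obtain ⟨η, hη⟩ := exists_eq_smul_one_of_conj_eq ((B * A)⁻¹ * (A * B)) fun X => by
    have h1 := conj_mul hA hB X
    rw [h.eq, conj_mul hB hA X] at h1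
    rw [mul_inv_rev ((B * A)⁻¹), inv_inv, Units.val_mul _ (A * B), Units.val_mul _ (B * A)]
    calc _ = (B * A)⁻¹.1 * ((A * B).1 * X * (A * B)⁻¹.1) * (B * A).1 := by simp only [mul_assoc]
      _ = ((B * A)⁻¹.1 * (B * A).1) * X * ((B * A)⁻¹.1 * (B * A).1) := by
        rw [← h1]
        simp only [mul_assoc]
      _ = X := by rw [Units.inv_mul, one_mul, mul_one]
  refine ⟨η, ?_, fun η' h' => ?_⟩
  · have h1 := congrArg (fun Y => (B * A).1 * Y) hη
    simp only [Units.val_mul, ← mul_assoc, mul_smul_comm, mul_one] at h1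
    have h2 : B.1 * A.1 * (B * A)⁻¹.1 = 1 := by rw [← Units.val_mul, Units.mul_inv]
    rw [h2, one_mul] at h1
    exact h1
  · have h1 : ((B * A)⁻¹ * (A * B)).1 = η' • 1 := by
      rw [Units.val_mul, Units.val_mul A B, h', mul_smul_comm, ← Units.val_mul B A, Units.inv_mul]
    rw [hη] at h1
    exact (smul_left_injective k (one_ne_zero (α := Matrix (Fin m) (Fin m) k)) h1).symm

theorem pow_mul_eq_smul_mul_pow {R : Type*} [Ring R] [Algebra k R] {a b : R} {η : k}
    (h : a * b = η • (b * a)) (i : ℕ) : a ^ i * b = η ^ i • (b * a ^ i) := by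
  induction i with
  | zero => simp
  | succ i ih =>
    rw [pow_succ, mul_assoc, h, mul_smul_comm, ← mul_assoc, ih, smul_mul_assoc, smul_smul,
      ← pow_succ', mul_assoc, ← pow_succ]

theorem mul_pow_eq_smul_pow_mul {R : Type*} [Ring R] [Algebra k R] {a b : R} {η : k}
    (h : a * b = η • (b * a)) (i : ℕ) : a * b ^ i = η ^ i • (b ^ i * a) := by
  induction i with
  | zero => simp
  | succ i ih =>
    rw [pow_succ, ← mul_assoc, ih, smul_mul_assoc, mul_assoc, h, mul_smul_comm, smul_smul,
      ← pow_succ, ← mul_assoc]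

/-- The commutation scalar is killed by the orders modulo scalars. -/
theorem pow_eq_one_of_left (hm : 0 < m) {η a : k} (h : A.1 * B.1 = η • (B.1 * A.1)) {n : ℕ}
    (ha : a ≠ 0) (hA : A.1 ^ n = a • 1) : η ^ n = 1 := by
  have : Nonempty (Fin m) := ⟨⟨0, hm⟩⟩
  have h1 := pow_mul_eq_smul_mul_pow h n
  rw [hA, smul_mul_assoc, one_mul, mul_smul_comm, mul_one, smul_comm] at h1
  have h2 : B.1 = η ^ n • B.1 := smul_right_injective _ ha h1
  exact (smul_left_injective k B.ne_zero (show (1 : k) • B.1 = _ by rwa [one_smul])).symm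

theorem pow_eq_one_of_right (hm : 0 < m) {η b : k} (h : A.1 * B.1 = η • (B.1 * A.1)) {n : ℕ}
    (hb : b ≠ 0) (hB : B.1 ^ n = b • 1) : η ^ n = 1 := by
  have : Nonempty (Fin m) := ⟨⟨0, hm⟩⟩
  have h1 := mul_pow_eq_smul_pow_mul h n
  rw [hB, smul_mul_assoc, one_mul, mul_smul_comm, mul_one, smul_comm] at h1
  have h2 : A.1 = η ^ n • A.1 := smul_right_injective _ hb h1
  exact (smul_left_injective k A.ne_zero (show (1 : k) • A.1 = _ by rwa [one_smul])).symm

end Scalars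

/-! ### The completed order in normal form -/

section CompletedOrder

variable {k : Type u} [Field k] {T : Type u} [CommRing T] [Algebra k T]
  {κ : Type u} [Field κ] [Algebra k κ] {O : Subalgebra k T} (act : TameAction k T κ O)
  {M : Type u} [Ring M] [Algebra k M] {βσ βτ : M →ₐ[k] M}
  {e : ℕ} {F : Type u} [Fintype F] [DecidableEq F] [NeZero e]
  (fr : Frame M βσ βτ act.ξ e F) (w : ShiftWeight k act.n act.N e F)

theorem equiv_mem_modelOrder_iff (hw : w.α = fr.α) (z : T ⊗[k] M) :
    fr.equiv act.s z ∈ act.modelOrder w ↔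
      Algebra.TensorProduct.map act.σ βσ z = z ∧ Algebra.TensorProduct.map act.τ βτ z = z := by
  rw [TameAction.mem_modelOrder_iff,
    ← (fr.equiv act.s).injective.eq_iff (a := Algebra.TensorProduct.map act.σ βσ z),
    ← (fr.equiv act.s).injective.eq_iff (a := Algebra.TensorProduct.map act.τ βτ z)]
  have h1 : act.matσ w (fr.equiv act.s z) =
      fr.equiv act.s (Algebra.TensorProduct.map act.σ βσ z) := by
    ext q q'
    rw [fr.equiv_map_σ act.σ_s, TameAction.matσ_apply, hw]
  have h2 : act.matτ (fr.equiv act.s z) =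
      fr.equiv act.s (Algebra.TensorProduct.map act.τ βτ z) := by
    ext q q'
    obtain ⟨q, rfl⟩ := shiftIndex.surjective q
    obtain ⟨q', rfl⟩ := shiftIndex.surjective q'
    rw [fr.equiv_map_τ act.τ_s, TameAction.matτ_apply_shift]
  rw [h1, h2]

/-- The invariants in `T ⊗ M` are the model order. -/
def modelOrderEquiv (hw : w.α = fr.α) (Λ : Subalgebra O (T ⊗[k] M))
    (hΛ : ∀ z, z ∈ Λ ↔ Algebra.TensorProduct.map act.σ βσ z = z ∧
      Algebra.TensorProduct.map act.τ βτ z = z) : Λ ≃ₐ[O] act.modelOrder w where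
  toFun z := ⟨fr.equiv act.s z,
    (equiv_mem_modelOrder_iff act fr w hw z.1).2 ((hΛ z.1).1 z.2)⟩
  invFun X := ⟨(fr.equiv act.s).symm X, by
    rw [hΛ, ← equiv_mem_modelOrder_iff act fr w hw, AlgEquiv.apply_symm_apply]
    exact X.2⟩
  left_inv z := Subtype.ext ((fr.equiv act.s).symm_apply_apply z.1)
  right_inv X := Subtype.ext ((fr.equiv act.s).apply_symm_apply X.1)
  map_mul' x y := Subtype.ext (map_mul (fr.equiv act.s) x.1 y.1)
  map_add' x y := Subtype.ext (map_add (fr.equiv act.s) x.1 y.1)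
  commutes' r := Subtype.ext (by
    change fr.equiv act.s (algebraMap O (T ⊗[k] M) r) = algebraMap O _ r
    have h1 : algebraMap O (T ⊗[k] M) r = (r : T) • (1 : T ⊗[k] M) := by
      rw [Algebra.smul_def, mul_one]
      rfl
    rw [h1, fr.equiv_smul, map_one, Algebra.algebraMap_eq_smul_one]
    rfl)

end CompletedOrder


/-! ### Normality and index of the completed order -/

theorem HasIndex.of_algEquiv {K : Type u} [CommRing K] {D D' : Type u} [Ring D] [Algebra K D]
    [Ring D'] [Algebra K D'] {e : ℕ} (h : HasIndex K D e) (f : D ≃ₐ[K] D') : HasIndex K D' e := by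
  obtain ⟨n, E, _, _, hn, hc, hfin, hrank, ⟨g⟩⟩ := h
  exact ⟨n, E, _, _, hn, hc, hfin, hrank, ⟨f.symm.trans g⟩⟩

theorem rescale_expand {k : Type u} [Field k] {ξ : k} {N : ℕ} (hN : N ≠ 0) (hξ : ξ ^ N = 1)
    (f : PowerSeries k) :
    PowerSeries.rescale ξ (PowerSeries.expand N hN f) = PowerSeries.expand N hN f := by
  ext i
  rw [PowerSeries.coeff_rescale, PowerSeries.coeff_expand]
  split_ifs with h
  · obtain ⟨j, rfl⟩ := h
    rw [pow_mul, hξ, one_pow, one_mul]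
  · rw [mul_zero]

section

variable {k : Type u} [Field k] [IsAlgClosed k] [CharZero k] {T : Type u} [CommRing T] [IsDomain T]
  [IsDiscreteValuationRing T] [Algebra k T] {κ : Type u} [Field κ] [Algebra k κ]
  {O : Subalgebra k T}

set_option maxHeartbeats 800000 in
/-- Normality and index of the order of invariants of a tame action on `T ⊗ Mat(k)`, read off from
the normal form of the matrix action. -/
theorem isNormalOrder_iff_and_hasIndex_of_tameAction {m : ℕ} (hm : 0 < m)
    (act : TameAction k T κ O) (A B : GL (Fin m) k)
    (βσ βτ : Matrix (Fin m) (Fin m) k →ₐ[k] Matrix (Fin m) (Fin m) k)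
    (hA : ∀ X, βσ X = A.1 * X * A⁻¹.1) (hB : ∀ X, βτ X = B.1 * X * B⁻¹.1) {a b : k} (ha : a ≠ 0)
    (hb : b ≠ 0) (hAn : A.1 ^ act.n = a • 1) (hBN : B.1 ^ act.N = b • 1) {η : k}
    (hAB : A.1 * B.1 = η • (B.1 * A.1)) {e : ℕ} (he : 0 < e) (hη : IsPrimitiveRoot η e)
    (Λ : Subalgebra O (T ⊗[k] Matrix (Fin m) (Fin m) k))
    (hΛ : ∀ z, z ∈ Λ ↔ Algebra.TensorProduct.map act.σ βσ z = z ∧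
      Algebra.TensorProduct.map act.τ βτ z = z) [IsDiscreteValuationRing O]
    (htr : Cardinal.aleph0 ≤ Algebra.trdeg k (IsLocalRing.maximalIdeal O).ResidueField) :
    (IsNormalOrder O Λ k ↔
      ∀ μ ν : k, Module.End.HasEigenvalue (Matrix.toLin' A.1) μ →
        Module.End.HasEigenvalue (Matrix.toLin' A.1) ν →
          Module.finrank k (Module.End.eigenspace (Matrix.toLin' A.1) μ) =
            Module.finrank k (Module.End.eigenspace (Matrix.toLin' A.1) ν)) ∧
    HasIndex (FractionRing O) (GenericFibre O Λ) e := by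
  have : NeZero e := ⟨he.ne'⟩
  obtain ⟨F, _, _, _, fr, w, ℓ, hwα, hwη, heig, hrank, hinj, hlt⟩ := exists_frame hm A B
    βσ βτ hA hB act.n_ne_zero act.N_ne_zero ha hb hAn hBN hη (pow_eq_one_of_left hm hAB ha hAn)
    (pow_eq_one_of_right hm hAB hb hBN) act.isPrimitiveRoot_ξ hAB
  let g : Λ ≃ₐ[O] act.modelOrder w := modelOrderEquiv act fr w hwα Λ hΛ
  have hT : Module.Finite O T := act.finite_base
  have hindex := (act.hasIndex_modelOrder w).of_algEquiv
    (Algebra.TensorProduct.congr (AlgEquiv.refl : FractionRing O ≃ₐ[FractionRing O] _) g.symm)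
  refine ⟨?_, hindex⟩
  have hfin : Module.Finite O (act.modelOrder w) :=
    Module.Finite.of_injective (act.modelOrder w).val.toLinearMap Subtype.val_injective
  have hfin' : Module.Finite O Λ := Module.Finite.equiv g.symm.toLinearEquiv
  rw [isNormalOrder_iff O Λ k (fun r X h => ?_) hindex.isCentral_and_isSimpleRing.1
    hindex.isCentral_and_isSimpleRing.2
    ((act.isHereditary_modelOrder w).of_ringEquiv g.toRingEquiv) htr]
  · constructor
    · rintro ⟨-, hr⟩ μ ν hμ hν
      have hr' : IsRightSelfDual O (act.modelOrder w) :=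
        hr.of_ringEquiv (RingEquiv.refl _) g.toRingEquiv fun r x => map_smul g r x
      obtain ⟨q, rfl⟩ := (heig μ).1 hμ
      obtain ⟨q', rfl⟩ := (heig ν).1 hν
      rw [hrank, hrank]
      exact act.card_eq_of_isRightSelfDual w hr' q q'
    · intro h
      obtain ⟨h1, h2⟩ := act.isSelfDual_of_card_eq w ℓ hinj hlt fun q q' => by
        rw [← hrank, ← hrank]
        exact h _ _ ((heig _).2 ⟨q, rfl⟩) ((heig _).2 ⟨q', rfl⟩)
      exact ⟨h1.of_ringEquiv (RingEquiv.refl _) g.symm.toRingEquiv fun r x => map_smul g.symm r x,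
        h2.of_ringEquiv (RingEquiv.refl _) g.symm.toRingEquiv fun r x => map_smul g.symm r x⟩
  · rcases act.smul_eq_zero_modelOrder w r (g X) (by rw [← map_smul, h, map_zero]) with h | h
    · exact Or.inl h
    · exact Or.inr ((map_eq_zero_iff g g.injective).1 h)

end

section CompletedOrder

variable {k : Type u} [Field k] [IsAlgClosed k] [CharZero k] {G : Type*} [Group G] [Finite G]
  {ρ : G →* (PlaneRing k ≃ₐ[k] PlaneRing k)} {s t : PlaneRing k}
  {L : Ideal (PlaneRing k)} [L.IsPrime] {σ τ : G}

/-- The residue field of the completed base has infinite transcendence degree: it contains the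
power series in the norm of the parameter of the line. -/
theorem aleph0_le_trdeg_completedBaseRing (ld : LineData ρ s t L σ τ) [IsDomain (LocalCompletion L)]
    (act : TameAction k (LocalCompletion L) (LineField k) (completedBaseRing ρ L))
    (hev : ∀ F, act.ev (algebraMap (PlaneRing k) _ F) = ld.evK F)
    (hevτ : ∀ z, act.ev (act.τ z) = scaleField ld.ξ (act.ev z))
    [IsLocalRing (completedBaseRing ρ L)] :
    Cardinal.aleph0 ≤ Algebra.trdeg k
      (IsLocalRing.maximalIdeal (completedBaseRing ρ L)).ResidueField := by
  refine aleph0_le_trdeg_of_expand k (act.ev.comp (completedBaseRing ρ L).val)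
    (IsScalarTower.toAlgHom k (PowerSeries k) (LineField k)) (IsFractionRing.injective _ _)
    (orderOf_pos τ).ne' (fun f => ?_) _ fun x hx => ?_
  -- a power series in the `N`-th power of the parameter is fixed by the scaling, so the average
  -- over the group of any lift reduces to it
  · obtain ⟨F, hF⟩ := ld.ev_surjective (PowerSeries.expand (orderOf τ) (orderOf_pos τ).ne' f)
    refine ⟨⟨act.E (algebraMap _ _ F), act.E_mem _⟩, ?_⟩
    change act.ev (act.E (algebraMap _ _ F)) = algebraMap _ _ _
    have h1 : act.ev.toLinearMap (act.E (algebraMap (PlaneRing k) (LocalCompletion L) F)) = _ :=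
      map_reynolds (a' := (1 : Module.End k (LineField k)))
        (b' := (scaleField ld.ξ).toLinearMap) act.ev.toLinearMap
        (fun x => act.ev_σ x) (fun x => hevτ x) _
    have h2 : act.ev.toLinearMap (algebraMap (PlaneRing k) (LocalCompletion L) F) =
        algebraMap (PowerSeries k) (LineField k)
          (PowerSeries.expand (orderOf τ) (orderOf_pos τ).ne' f) := by
      rw [AlgHom.toLinearMap_apply, hev, ld.evK_apply, hF]
    refine h1.trans ?_
    rw [reynolds_of_fixed act.n_ne_zero act.N_ne_zero rfl, h2]
    rw [h2, AlgHom.toLinearMap_apply, scaleField_algebraMap, rescale_expand]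
    exact ld.isPrimitiveRoot_ξ.pow_eq_one
  · by_contra hcon
    rw [IsLocalRing.mem_maximalIdeal, mem_nonunits_iff, act.isUnit_base_iff, act.isUnit_iff] at hx
    exact hx hcon
/-- Normality and index of the completed order, read off from the normal form of the matrix
action. -/
theorem completedOrder_isNormalOrder_iff_and_hasIndex {m : ℕ}
    {β : G →* (Matrix (Fin m) (Fin m) k ≃ₐ[k] Matrix (Fin m) (Fin m) k)} (hm : 0 < m)
    (hl : IsReflectionLine ρ s t L σ τ) (A B : GL (Fin m) k)
    (hA : ∀ X, β σ X = A.1 * X * A⁻¹.1) (hB : ∀ X, β τ X = B.1 * X * B⁻¹.1) {η : k}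
    (hAB : A.1 * B.1 = η • (B.1 * A.1)) {e : ℕ} (he : 0 < e) (hη : IsPrimitiveRoot η e) :
    (IsNormalOrder (completedBaseRing ρ L) (completedOrder ρ β L) k ↔
      ∀ μ ν : k, Module.End.HasEigenvalue (Matrix.toLin' A.1) μ →
        Module.End.HasEigenvalue (Matrix.toLin' A.1) ν →
          Module.finrank k (Module.End.eigenspace (Matrix.toLin' A.1) μ) =
            Module.finrank k (Module.End.eigenspace (Matrix.toLin' A.1) ν)) ∧
    HasIndex (FractionRing (completedBaseRing ρ L))
      (GenericFibre (completedBaseRing ρ L) (completedOrder ρ β L)) e := by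
  obtain ⟨ld⟩ := hl.nonempty_lineData
  obtain ⟨_, _, act, hn, hN, hξ, hσ, hτ, hev, hevτ⟩ := exists_tameAction hl ld
  obtain ⟨a, ha, hAn⟩ := exists_pow_eq_smul_one hm hA (pow_orderOf_eq_one σ)
  obtain ⟨b, hb, hBN⟩ := exists_pow_eq_smul_one hm hB (pow_orderOf_eq_one τ)
  rw [← hn] at hAn
  rw [← hN] at hBN
  have hdvr : IsDiscreteValuationRing (completedBaseRing ρ L) := act.isDiscreteValuationRing_base
  exact isNormalOrder_iff_and_hasIndex_of_tameAction hm act A B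
    (β σ : Matrix (Fin m) (Fin m) k →ₐ[k] Matrix (Fin m) (Fin m) k) (β τ) hA hB ha hb hAn hBN hAB he hη
    (completedOrder ρ β L) (fun z => by
      rw [hσ, hτ]
      exact mem_completedOrder_iff β hl ld.mem_σ ld.mem_τ z)
    (aleph0_le_trdeg_completedBaseRing ld act hev hevτ)

end CompletedOrder


/-! ### The residue algebra of an order at a prime -/

section TensorLift

/-- A homomorphism out of a tensor product of rings from homomorphisms of the factors that agree on
the base, when the first of them has central image. -/
theorem exists_tensor_lift {R A B C : Type*} [CommRing R] [CommRing A] [Algebra R A] [Ring B]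
    [Algebra R B] [Ring C] (f : A →+* C) (g : B →+* C)
    (h : ∀ r, f (algebraMap R A r) = g (algebraMap R B r)) (hc : ∀ a c, f a * c = c * f a) :
    ∃ F : A ⊗[R] B →+* C, ∀ a b, F (a ⊗ₜ b) = f a * g b := by
  let _ : Algebra R C := (f.comp (algebraMap R A)).toAlgebra' fun r c => hc _ c
  let f' : A →ₐ[R] C := { f with commutes' := fun r => rfl }
  let g' : B →ₐ[R] C := { g with commutes' := fun r => (h r).symm }
  exact ⟨(Algebra.TensorProduct.lift f' g' fun a b => hc a (g b)).toRingHom, fun a b =>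
    Algebra.TensorProduct.lift_tmul _ _ _ a b⟩

end TensorLift

theorem exists_quotient_hom {W D : Type*} [Ring W] [Ring D] (I : Ideal W) [I.IsTwoSided]
    (Φ : W →+* D) (h : ∀ z, z ∈ I ↔ Φ z = 0) : ∃ Ψ : W ⧸ I →+* D, Function.Injective Ψ ∧
      ∀ z, Ψ (Ideal.Quotient.mk I z) = Φ z := by
  refine ⟨Ideal.Quotient.lift _ Φ fun z hz => (h z).1 hz, ?_, fun z => Ideal.Quotient.lift_mk _ _ _⟩
  rw [injective_iff_map_eq_zero]
  intro z hz
  obtain ⟨z, rfl⟩ := Ideal.Quotient.mk_surjective z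
  rw [Ideal.Quotient.lift_mk] at hz
  exact Ideal.Quotient.eq_zero_iff_mem.2 ((h z).2 hz)

/-- The centre of an algebra `W` over a local ring with residue field `K`, tensored with `K`, for `W`
embedded in a `κ`-algebra `D` as a subring `Γ` with centre `dg Z`. -/
theorem exists_tensor_center_hom {V K κ D E W : Type*} [CommRing V] [Field K] [Algebra V K]
    (hK : Function.Surjective (algebraMap V K)) [Field κ] [Ring D] [Algebra κ D] [CommRing E]
    [Algebra κ E] [Ring W] [Algebra V W] (ψ : K →+* κ) {Γ : Set D} {dg : E →ₐ[κ] D} {Z : Set E}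
    (hdg : Function.Injective dg)
    (hcenter : ∀ X, (X ∈ Γ ∧ ∀ Y ∈ Γ, X * Y = Y * X) ↔ ∃ z ∈ Z, X = dg z)
    {Ψ : W →+* D} (hinj : Function.Injective Ψ) (hmem : ∀ z, Ψ z ∈ Γ)
    (hsurj : ∀ X ∈ Γ, ∃ z, Ψ z = X)
    (hΨ : ∀ c, Ψ (algebraMap V W c) = algebraMap κ D (ψ (algebraMap V K c))) :
    ∃ θ : K ⊗[V] Subalgebra.center V W →+* E,
      (∀ a, θ (algebraMap K _ a) = algebraMap κ E (ψ a)) ∧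
      Function.Injective θ ∧ ∀ z, z ∈ Z ↔ ∃ y, θ y = z := by
  have hC : ∀ c : Subalgebra.center V W, ∃ z ∈ Z, Ψ c.1 = dg z := fun c =>
    (hcenter _).1 ⟨hmem _, by
      intro Y hY
      obtain ⟨y, rfl⟩ := hsurj Y hY
      rw [← map_mul, ← map_mul, Subalgebra.mem_center_iff.1 c.2 y]⟩
  choose θ0 hθ0 hθ using hC
  let θ1 : Subalgebra.center V W →+* E :=
    { toFun := θ0
      map_one' := hdg (by rw [← hθ, map_one]; exact map_one Ψ)
      map_mul' := fun a b => hdg (by rw [map_mul, ← hθ, ← hθ, ← hθ]; exact map_mul Ψ a.1 b.1)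
      map_zero' := hdg (by rw [← hθ, map_zero]; exact map_zero Ψ)
      map_add' := fun a b => hdg (by rw [map_add, ← hθ, ← hθ, ← hθ]; exact map_add Ψ a.1 b.1) }
  have hθ1 : ∀ c : V, θ1 (algebraMap _ _ c) = algebraMap κ E (ψ (algebraMap V K c)) :=
    fun c => hdg (by
      rw [AlgHom.commutes, ← hΨ]
      exact (hθ (algebraMap _ _ c)).symm)
  obtain ⟨θ, hθt⟩ := exists_tensor_lift (R := V) (A := K) (B := Subalgebra.center V W)
    ((algebraMap κ E).comp ψ) θ1 (fun c => by rw [RingHom.comp_apply, hθ1])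
    fun a c => mul_comm _ _
  -- the residue field is a quotient of the local ring, so all tensors are elementary
  have hone : ∀ y : K ⊗[V] Subalgebra.center V W, ∃ c : Subalgebra.center V W, y = 1 ⊗ₜ c := by
    intro y
    induction y using TensorProduct.induction_on with
    | zero => exact ⟨0, by rw [TensorProduct.tmul_zero]⟩
    | tmul a c =>
      obtain ⟨a, rfl⟩ := hK a
      exact ⟨a • c, by rw [← TensorProduct.smul_tmul, ← Algebra.algebraMap_eq_smul_one]⟩
    | add y y' hy hy' =>
      obtain ⟨c, rfl⟩ := hy
      obtain ⟨c', rfl⟩ := hy'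
      exact ⟨c + c', by rw [TensorProduct.tmul_add]⟩
  refine ⟨θ, fun a => ?_, ?_, fun z => ⟨fun hz => ?_, ?_⟩⟩
  · change θ (a ⊗ₜ 1) = _
    rw [hθt, map_one, mul_one]
    rfl
  · rw [injective_iff_map_eq_zero]
    intro y hy
    obtain ⟨c, rfl⟩ := hone y
    rw [hθt, map_one, one_mul] at hy
    have h1 : Ψ c.1 = 0 := by
      rw [hθ c, ← map_zero dg]
      exact congrArg dg hy
    have h2 : c = 0 := Subtype.ext ((map_eq_zero_iff Ψ hinj).1 h1)
    rw [h2, TensorProduct.tmul_zero]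
  · have h1 := (hcenter (dg z)).2 ⟨z, hz, rfl⟩
    obtain ⟨c, hc⟩ := hsurj _ h1.1
    have hcc : c ∈ Subalgebra.center V W := Subalgebra.mem_center_iff.2 fun y => hinj (by
      rw [map_mul, map_mul, hc, h1.2 _ (hmem y)])
    refine ⟨1 ⊗ₜ ⟨c, hcc⟩, ?_⟩
    rw [hθt, map_one, one_mul]
    exact hdg ((hθ ⟨c, hcc⟩).symm.trans hc)
  · rintro ⟨y, rfl⟩
    obtain ⟨c, rfl⟩ := hone y
    rw [hθt, map_one, one_mul]
    exact hθ0 c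

/-- A presentation of the residue algebra of the order `Λ` at `p`: a homomorphism `φ` to a
`κ`-algebra `D`, semilinear for `χ : O → κ` with kernel `p`, whose localised image is the semiprimitive
subring `Γ` with centre `dg Z`, and whose kernel becomes quasi-regular after localisation. -/
structure ResidueModel (O : Type u) [CommRing O] (Λ : Type u) [Ring Λ] [Algebra O Λ] (p : Ideal O)
    (κ : Type u) [Field κ] (D : Type u) [Ring D] [Algebra κ D]
    (E : Type u) [CommRing E] [Algebra κ E] where
  /-- the map to the field -/
  χ : O →+* κ
  /-- the map to the algebra -/
  φ : Λ →+* D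
  /-- the localised image of `φ` -/
  Γ : Set D
  /-- the diagonal embedding -/
  dg : E →ₐ[κ] D
  /-- the centre -/
  Z : Set E
  χ_eq_zero_iff : ∀ r, χ r = 0 ↔ r ∈ p
  φ_algebraMap : ∀ r, φ (algebraMap O Λ r) = algebraMap κ D (χ r)
  φ_mem : ∀ x, φ x ∈ Γ
  exists_φ_eq : ∀ X ∈ Γ, ∃ x r, r ∉ p ∧ φ x = algebraMap κ D (χ r) * X
  inv_mem : ∀ X ∈ Γ, ∀ r ∉ p, algebraMap κ D (χ r)⁻¹ * X ∈ Γ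
  kernel : ∀ x r, φ x = 0 → r ∉ p → ∃ y r', r' ∉ p ∧ y * (algebraMap O Λ r + x) = algebraMap O Λ r'
  radical : ∀ X ∈ Γ, (∀ Y ∈ Γ, ∃ W, W * Y * X + W = 1) → X = 0
  dg_injective : Function.Injective dg
  center_iff : ∀ X, (X ∈ Γ ∧ ∀ Y ∈ Γ, X * Y = Y * X) ↔ ∃ z ∈ Z, X = dg z

namespace ResidueModel

variable {O : Type u} [CommRing O] {Λ : Type u} [Ring Λ] [Algebra O Λ] {p : Ideal O} [p.IsPrime]
  {κ : Type u} [Field κ] {D : Type u} [Ring D] [Algebra κ D]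
  {E : Type u} [CommRing E] [Algebra κ E] (rm : ResidueModel O Λ p κ D E)

/-- The extension of `χ` to the local ring. -/
def χLoc : Localization.AtPrime p →+* κ :=
  IsLocalization.lift (M := p.primeCompl) (g := rm.χ) fun r =>
    isUnit_iff_ne_zero.2 fun h => r.2 ((rm.χ_eq_zero_iff r).1 h)

theorem χLoc_algebraMap (r : O) : rm.χLoc (algebraMap O _ r) = rm.χ r :=
  IsLocalization.lift_eq _ r

theorem exists_orderAt_hom : ∃ Φ : OrderAt O Λ p →+* D,
    ∀ c x, Φ (c ⊗ₜ x) = algebraMap κ D (rm.χLoc c) * rm.φ x :=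
  exists_tensor_lift ((algebraMap κ D).comp rm.χLoc) rm.φ
    (fun r => by rw [RingHom.comp_apply, χLoc_algebraMap, rm.φ_algebraMap])
    fun a c => Algebra.commutes _ c

omit [p.IsPrime] in
theorem exists_smul_eq_one_tmul_orderAt [p.IsPrime] (z : OrderAt O Λ p) :
    ∃ (r : O) (x : Λ), r ∉ p ∧ r • z = (1 : Localization.AtPrime p) ⊗ₜ[O] x := by
  obtain ⟨⟨x, r⟩, h⟩ := IsLocalizedModule.surj p.primeCompl
    (TensorProduct.mk O (Localization.AtPrime p) Λ 1) z
  exact ⟨r, x, r.2, h⟩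

theorem smul_orderAt (r : O) (z : OrderAt O Λ p) :
    r • z = ((1 : Localization.AtPrime p) ⊗ₜ[O] (algebraMap O Λ r)) * z := by
  rw [Algebra.algebraMap_eq_smul_one (A := Λ), TensorProduct.tmul_smul, smul_mul_assoc]
  congr 1
  exact (one_mul z).symm

variable {Φ : OrderAt O Λ p →+* D}
  (hΦ : ∀ c x, Φ (c ⊗ₜ x) = algebraMap κ D (rm.χLoc c) * rm.φ x)
include hΦ

theorem hom_one_tmul (x : Λ) : Φ (1 ⊗ₜ x) = rm.φ x := by
  rw [hΦ, map_one, map_one, one_mul]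

theorem hom_smul (r : O) (z : OrderAt O Λ p) : Φ (r • z) = algebraMap κ D (rm.χ r) * Φ z := by
  rw [smul_orderAt, map_mul, rm.hom_one_tmul hΦ, rm.φ_algebraMap]

theorem hom_mem (z : OrderAt O Λ p) : Φ z ∈ rm.Γ := by
  obtain ⟨r, x, hr, h⟩ := exists_smul_eq_one_tmul_orderAt z
  have h1 := congrArg Φ h
  rw [rm.hom_smul hΦ, rm.hom_one_tmul hΦ] at h1
  have h2 := rm.inv_mem _ (rm.φ_mem x) r hr
  rw [← h1, ← mul_assoc, ← map_mul, inv_mul_cancel₀ (fun h => hr ((rm.χ_eq_zero_iff r).1 h)),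
    map_one, one_mul] at h2
  exact h2

theorem exists_isUnit_algebraMap (r : O) (hr : r ∉ p) :
    ∃ c : Localization.AtPrime p, c * algebraMap O _ r = 1 := by
  obtain ⟨c, hc⟩ := (IsLocalization.map_units (Localization.AtPrime p)
    (⟨r, hr⟩ : p.primeCompl)).exists_left_inv
  exact ⟨c, hc⟩

theorem exists_hom_eq {X : D} (hX : X ∈ rm.Γ) : ∃ z, Φ z = X := by
  obtain ⟨x, r, hr, h⟩ := rm.exists_φ_eq X hX
  obtain ⟨c, hc⟩ := rm.exists_isUnit_algebraMap hΦ r hr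
  refine ⟨c ⊗ₜ x, ?_⟩
  rw [hΦ, h, ← mul_assoc, ← map_mul, ← χLoc_algebraMap, ← map_mul, hc, map_one, map_one, one_mul]

/-- The Jacobson radical of the local order is the kernel of the presentation. -/
theorem mem_jacobson_iff (z : OrderAt O Λ p) : z ∈ Ring.jacobson (OrderAt O Λ p) ↔ Φ z = 0 := by
  rw [← Ideal.jacobson_bot, Ideal.mem_jacobson_iff]
  simp only [Ideal.mem_bot, sub_eq_zero]
  constructor
  · intro h
    refine rm.radical _ (rm.hom_mem hΦ z) fun Y hY => ?_
    obtain ⟨y, rfl⟩ := rm.exists_hom_eq hΦ hY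
    obtain ⟨w, hw⟩ := h y
    exact ⟨Φ w, by rw [← map_mul, ← map_mul, ← map_add, hw, map_one]⟩
  · intro h y
    have h1 : Φ (y * z) = 0 := by rw [map_mul, h, mul_zero]
    obtain ⟨r, x, hr, hx⟩ := exists_smul_eq_one_tmul_orderAt (y * z)
    have hx0 : rm.φ x = 0 := by
      rw [← rm.hom_one_tmul hΦ, ← hx, rm.hom_smul hΦ, h1, mul_zero]
    obtain ⟨v, r', hr', hv⟩ := rm.kernel x r hx0 hr
    obtain ⟨c, hc⟩ := rm.exists_isUnit_algebraMap hΦ r' hr'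
    have h2 : ((1 : Localization.AtPrime p) ⊗ₜ[O] v) * (r • (y * z + 1)) = r' • 1 := by
      rw [smul_add, hx, smul_orderAt, mul_one, ← TensorProduct.tmul_add, add_comm x,
        Algebra.TensorProduct.tmul_mul_tmul, hv, one_mul, smul_orderAt, mul_one]
    refine ⟨c • (r • ((1 : Localization.AtPrime p) ⊗ₜ[O] v)), ?_⟩
    have h3 : c • (r • ((1 : Localization.AtPrime p) ⊗ₜ[O] v)) * (y * z + 1) = 1 := by
      rw [smul_mul_assoc, smul_mul_assoc, ← mul_smul_comm, h2, ← algebraMap_smul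
        (Localization.AtPrime p) r', smul_smul, hc, one_smul]
    rw [mul_add, mul_one, ← mul_assoc] at h3
    exact h3

omit hΦ
/-- The residue field of the base and the centre of the residue algebra, inside the presenting
ring. -/
theorem exists_residueCentre_hom : ∃ (ψ : p.ResidueField →+* κ) (θ : ResidueCentre O Λ p →+* E),
    (∀ r, ψ (algebraMap O _ r) = rm.χ r) ∧
    (∀ a, θ (algebraMap p.ResidueField _ a) = algebraMap κ E (ψ a)) ∧
    Function.Injective θ ∧ ∀ z, z ∈ rm.Z ↔ ∃ y, θ y = z := by
  obtain ⟨Φ, hΦ⟩ := rm.exists_orderAt_hom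
  obtain ⟨Ψ, hinj, hΨ⟩ := exists_quotient_hom (Ring.jacobson (OrderAt O Λ p)) Φ
    (rm.mem_jacobson_iff hΦ)
  have hlocal : IsLocalHom rm.χLoc := ⟨fun c hc => by
    by_contra hcon
    obtain ⟨⟨x, r⟩, h⟩ := IsLocalization.surj p.primeCompl c
    have h1 := congrArg rm.χLoc h
    rw [map_mul, χLoc_algebraMap, χLoc_algebraMap] at h1
    have hx : x ∈ p := by
      by_contra hx
      have h2 := IsLocalization.map_units (Localization.AtPrime p) (⟨x, hx⟩ : p.primeCompl)
      rw [← h] at h2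
      exact hcon (isUnit_of_mul_isUnit_left h2)
    rw [(rm.χ_eq_zero_iff x).2 hx] at h1
    rcases mul_eq_zero.1 h1 with h2 | h2
    · exact hc.ne_zero h2
    · exact r.2 ((rm.χ_eq_zero_iff r).1 h2)⟩
  let ψ : p.ResidueField →+* κ := IsLocalRing.ResidueField.lift rm.χLoc
  have hψ : ∀ c : Localization.AtPrime p, ψ (algebraMap _ _ c) = rm.χLoc c := fun c =>
    IsLocalRing.ResidueField.lift_residue_apply _ c
  obtain ⟨θ, h1, h2, h3⟩ := exists_tensor_center_hom (V := Localization.AtPrime p)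
    (K := p.ResidueField) (W := ResidueRing O Λ p) IsLocalRing.residue_surjective ψ rm.dg_injective
    rm.center_iff hinj
    (fun z => by
      obtain ⟨z, rfl⟩ := Ideal.Quotient.mk_surjective z
      exact (hΨ z).symm ▸ rm.hom_mem hΦ z)
    (fun X hX => by
      obtain ⟨z, hz⟩ := rm.exists_hom_eq hΦ hX
      exact ⟨Ideal.Quotient.mk _ z, (hΨ z).trans hz⟩)
    (fun c => by
      refine (hΨ (c ⊗ₜ 1)).trans ?_
      rw [hΦ, map_one, mul_one, hψ])
  refine ⟨ψ, θ, fun r => ?_, h1, h2, h3⟩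
  rw [IsScalarTower.algebraMap_apply O (Localization.AtPrime p), hψ, χLoc_algebraMap]

end ResidueModel


/-! ### The residue algebra in normal form -/

section ResidueMatrices

variable {k : Type u} [Field k] {n N e : ℕ} {F : Type u} [NeZero e] [Fintype F] [DecidableEq F]
  (w : ShiftWeight k n N e F) {κ : Type u} [Field κ] (φ : κ →+* κ)

omit [Fintype F] [DecidableEq F] in
theorem ShiftWeight.eq_of_α_add_eq {i d : ZMod e} {l : F} (h : w.α (i + d, l) = w.α (i, l)) :
    d = 0 := by
  have h1 := w.α_add_nat i l d.val
  rw [ZMod.natCast_val, ZMod.cast_id, h] at h1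
  have h2 : w.η ^ d.val = 1 := by
    have h3 : (w.η ^ d.val - 1) * w.α (i, l) = 0 := by rw [sub_mul, ← h1, one_mul, sub_self]
    exact sub_eq_zero.1 ((mul_eq_zero.1 h3).resolve_right (w.α_ne_zero _))
  have h4 := (w.isPrimitiveRoot_η.pow_eq_one_iff_dvd _).1 h2
  exact (ZMod.val_eq_zero d).1 (Nat.eq_zero_of_dvd_of_lt h4 (ZMod.val_lt d))

omit [Fintype F] [DecidableEq F] in
theorem ShiftWeight.eq_of_α_eq {q q' : ZMod e × F} (h : w.α q = w.α q') (h2 : q.2 = q'.2) :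
    q = q' := by
  obtain ⟨i, l⟩ := q
  obtain ⟨j, l'⟩ := q'
  obtain rfl : l = l' := h2
  have h1 := w.eq_of_α_add_eq (i := j) (d := i - j) (l := l) (by rw [add_sub_cancel, h])
  rw [sub_eq_zero.1 h1]

/-- The block matrices, with one block for each weight, on which the shift of the indices is the
action of `φ` on the entries. -/
def residueMatrices : Set (Matrix (ZMod e × F) (ZMod e × F) κ) :=
  {X | (∀ q q', w.α q ≠ w.α q' → X q q' = 0) ∧
    ∀ q q', X (shiftIndex q) (shiftIndex q') = φ (X q q')}

/-- The functions of the weight on which the shift is the action of `φ` on the values. -/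
def weightFunctions : Set (ZMod e × F → κ) :=
  {z | (∀ q q', w.α q = w.α q' → z q = z q') ∧ ∀ q, z (shiftIndex q) = φ (z q)}

/-- The elementary matrix of an orbit of pairs of indices, with entries given by `f`. -/
def orbitSingle (q0 q1 : ZMod e × F) (f : ZMod e × F → ZMod e × F → κ) :
    Matrix (ZMod e × F) (ZMod e × F) κ := Matrix.of fun p p' =>
  if p.2 = q0.2 ∧ p'.2 = q1.2 ∧ p.1 - q0.1 = p'.1 - q1.1 then f p p' else 0

theorem orbitSingle_mem {q0 q1 : ZMod e × F} (h : w.α q0 = w.α q1)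
    {f : ZMod e × F → ZMod e × F → κ}
    (hf : ∀ q q', f (shiftIndex q) (shiftIndex q') = φ (f q q')) :
    orbitSingle q0 q1 f ∈ residueMatrices w φ := by
  constructor
  · intro p p' hp
    refine if_neg ?_
    rintro ⟨h1, h2, h3⟩
    apply hp
    obtain ⟨i, l⟩ := p
    obtain ⟨j, l'⟩ := p'
    obtain ⟨i0, l0⟩ := q0
    obtain ⟨i1, l1⟩ := q1
    obtain rfl : l = l0 := h1
    obtain rfl : l' = l1 := h2
    have h4 : ∀ (i d : ZMod e) (l : F), w.α (i + d, l) = w.η ^ d.val * w.α (i, l) := fun i d l => by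
      have := w.α_add_nat i l d.val
      rwa [ZMod.natCast_val, ZMod.cast_id] at this
    have h5 := h4 i0 (i - i0) l
    have h6 := h4 i1 (j - i1) l'
    rw [add_sub_cancel] at h5 h6
    rw [h5, h6, h]
    exact congrArg (fun d : ZMod e => w.η ^ d.val * w.α (i1, l')) h3
  · intro p p'
    change (if _ then _ else _) = φ (if _ then _ else _)
    have hiff : ((shiftIndex p).2 = q0.2 ∧ (shiftIndex p').2 = q1.2 ∧
        (shiftIndex p).1 - q0.1 = (shiftIndex p').1 - q1.1) ↔
        (p.2 = q0.2 ∧ p'.2 = q1.2 ∧ p.1 - q0.1 = p'.1 - q1.1) := by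
      refine and_congr Iff.rfl (and_congr Iff.rfl ?_)
      change p.1 + 1 - q0.1 = p'.1 + 1 - q1.1 ↔ _
      rw [add_sub_right_comm, add_sub_right_comm, add_left_inj]
    by_cases hc : p.2 = q0.2 ∧ p'.2 = q1.2 ∧ p.1 - q0.1 = p'.1 - q1.1
    · rw [if_pos hc, if_pos (hiff.2 hc), hf]
    · rw [if_neg hc, if_neg (mt hiff.1 hc), map_zero]

/-- The residue algebra has no radical: an element with a nonzero entry is not quasi-regular after
multiplication by the inverse entries along an orbit. -/
theorem eq_zero_of_residueMatrices {X : Matrix (ZMod e × F) (ZMod e × F) κ}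
    (hX : X ∈ residueMatrices w φ)
    (h : ∀ Y ∈ residueMatrices w φ, ∃ W, W * Y * X + W = 1) : X = 0 := by
  by_contra hX0
  obtain ⟨q0, q1, h01⟩ : ∃ q0 q1, X q0 q1 ≠ 0 := by
    by_contra hcon
    push Not at hcon
    exact hX0 (Matrix.ext hcon)
  have hα : w.α q0 = w.α q1 := by
    by_contra hcon
    exact h01 (hX.1 _ _ hcon)
  let Y := orbitSingle q1 q0 fun p p' => -(X p' p)⁻¹
  obtain ⟨W, hW⟩ := h Y (orbitSingle_mem w φ hα.symm fun q q' => by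
    rw [hX.2, map_neg, map_inv₀])
  have hY : ∀ p, (Y * X + 1) p q1 = 0 := by
    intro p
    have hterm : ∀ p', p' ≠ q0 ∨ p ≠ q1 → Y p p' * X p' q1 = 0 := by
      intro p' hp
      by_contra hcon
      have h1 : X p' q1 ≠ 0 := right_ne_zero_of_mul hcon
      have h2 : Y p p' ≠ 0 := left_ne_zero_of_mul hcon
      have h3 : p.2 = q1.2 ∧ p'.2 = q0.2 ∧ p.1 - q1.1 = p'.1 - q0.1 := by
        by_contra h3
        exact h2 (if_neg h3)
      have h4 : w.α p' = w.α q1 := by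
        by_contra h4
        exact h1 (hX.1 _ _ h4)
      have h5 : p' = q0 := w.eq_of_α_eq (h4.trans hα.symm) h3.2.1
      subst h5
      rw [sub_self, sub_eq_zero] at h3
      exact hp.elim (fun h => h rfl) fun h => h (Prod.ext h3.2.2 h3.1)
    rw [Matrix.add_apply, Matrix.mul_apply, Finset.sum_eq_single q0
      (fun p' _ hp' => hterm p' (Or.inl hp')) (fun h => absurd (Finset.mem_univ _) h)]
    by_cases hp : p = q1
    · subst hp
      rw [Matrix.one_apply_eq]
      have : Y p q0 = -(X q0 p)⁻¹ := if_pos ⟨rfl, rfl, by rw [sub_self, sub_self]⟩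
      rw [this, neg_mul, inv_mul_cancel₀ h01, neg_add_cancel]
    · rw [hterm q0 (Or.inr hp), Matrix.one_apply_ne hp, zero_add]
  have h1 : (W * (Y * X + 1)) q1 q1 = 0 := by
    rw [Matrix.mul_apply]
    exact Finset.sum_eq_zero fun p _ => by rw [hY, mul_zero]
  rw [mul_add, ← mul_assoc, mul_one, hW, Matrix.one_apply_eq] at h1
  exact one_ne_zero h1

/-- The centre of the residue algebra consists of the diagonal matrices of weight functions. -/
theorem mem_center_residueMatrices_iff (X : Matrix (ZMod e × F) (ZMod e × F) κ) :
    (X ∈ residueMatrices w φ ∧ ∀ Y ∈ residueMatrices w φ, X * Y = Y * X) ↔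
      ∃ z ∈ weightFunctions w φ, X = Matrix.diagonal z := by
  constructor
  · rintro ⟨hX, hc⟩
    have hentry : ∀ q0 q1 p, w.α q0 = w.α q1 →
        (X * orbitSingle q0 q1 fun _ _ => 1 : Matrix (ZMod e × F) (ZMod e × F) κ) p q1 = X p q0 := by
      intro q0 q1 p h01
      rw [Matrix.mul_apply, Finset.sum_eq_single q0]
      · have : (orbitSingle q0 q1 (fun _ _ => (1 : κ))) q0 q1 = 1 :=
          if_pos ⟨rfl, rfl, by rw [sub_self, sub_self]⟩
        rw [this, mul_one]
      · intro p' _ hp'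
        rw [show orbitSingle q0 q1 (fun _ _ => (1 : κ)) p' q1 = 0 from if_neg ?_, mul_zero]
        rintro ⟨h1, -, h3⟩
        rw [sub_self, sub_eq_zero] at h3
        exact hp' (Prod.ext h3 h1)
      · exact fun h => absurd (Finset.mem_univ _) h
    have hentry' : ∀ q0 q1 p, w.α q0 = w.α q1 →
        ((orbitSingle q0 q1 fun _ _ => 1) * X : Matrix (ZMod e × F) (ZMod e × F) κ) q0 p = X q1 p := by
      intro q0 q1 p h01
      rw [Matrix.mul_apply, Finset.sum_eq_single q1]
      · have : (orbitSingle q0 q1 (fun _ _ => (1 : κ))) q0 q1 = 1 :=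
          if_pos ⟨rfl, rfl, by rw [sub_self, sub_self]⟩
        rw [this, one_mul]
      · intro p' _ hp'
        rw [show orbitSingle q0 q1 (fun _ _ => (1 : κ)) q0 p' = 0 from if_neg ?_, zero_mul]
        rintro ⟨-, h1, h3⟩
        rw [sub_self, eq_comm, sub_eq_zero] at h3
        exact hp' (Prod.ext h3 h1)
      · exact fun h => absurd (Finset.mem_univ _) h
    have hmem : ∀ q0 q1, w.α q0 = w.α q1 →
        orbitSingle q0 q1 (fun _ _ => (1 : κ)) ∈ residueMatrices w φ := fun q0 q1 h =>
      orbitSingle_mem w φ h fun _ _ => (map_one φ).symm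
    have hdiag : ∀ q q', q ≠ q' → X q q' = 0 := by
      intro q q' hq
      by_cases hα : w.α q = w.α q'
      · have h1 : X q q' = (orbitSingle q' q' (fun _ _ => (1 : κ)) * X) q q' := by
          rw [← hc _ (hmem q' q' rfl), hentry _ _ _ rfl]
        rw [h1, Matrix.mul_apply]
        refine Finset.sum_eq_zero fun p _ => ?_
        rw [show orbitSingle q' q' (fun _ _ => (1 : κ)) q p = 0 from if_neg ?_, zero_mul]
        rintro ⟨h2, -, -⟩
        exact hq (w.eq_of_α_eq hα h2)
      · exact hX.1 q q' hα
    refine ⟨fun q => X q q, ⟨fun q q' h => ?_, fun q => hX.2 q q⟩, ?_⟩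
    · have h1 := congrFun₂ (hc _ (hmem q q' h)) q q'
      rw [hentry _ _ _ h, hentry' _ _ _ h] at h1
      exact h1
    · ext q q'
      by_cases h : q = q'
      · subst h
        rw [Matrix.diagonal_apply_eq]
      · rw [Matrix.diagonal_apply_ne _ h, hdiag q q' h]
  · rintro ⟨z, hz, rfl⟩
    refine ⟨⟨fun q q' h => Matrix.diagonal_apply_ne _ fun hq => h (congrArg w.α hq),
      fun q q' => ?_⟩, fun Y hY => ?_⟩
    · by_cases h : q = q'
      · subst h
        rw [Matrix.diagonal_apply_eq, Matrix.diagonal_apply_eq, hz.2]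
      · rw [Matrix.diagonal_apply_ne _ h, Matrix.diagonal_apply_ne _ (shiftIndex.injective.ne h),
          map_zero]
    · ext q q'
      rw [Matrix.diagonal_mul, Matrix.mul_diagonal]
      by_cases h : w.α q = w.α q'
      · rw [hz.1 q q' h, mul_comm]
      · rw [hY.1 q q' h, mul_zero, zero_mul]

end ResidueMatrices


/-! ### Quasi-regularity of the kernel of reduction -/

section Kernel

variable {k : Type u} [Field k] {m : ℕ}

/-- `S ⊗ Mat(k)` as a matrix ring. -/
abbrev tensorMatrixEquiv (k : Type u) [Field k] (m : ℕ) (S : Type u) [CommRing S] [Algebra k S] :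
    S ⊗[k] Matrix (Fin m) (Fin m) k ≃ₐ[k] Matrix (Fin m) (Fin m) S :=
  (matrixEquivTensor (Fin m) k S).symm

theorem tensorMatrixEquiv_tmul {S : Type u} [CommRing S] [Algebra k S] (f : S)
    (X : Matrix (Fin m) (Fin m) k) (i j : Fin m) :
    tensorMatrixEquiv k m S (f ⊗ₜ X) i j = f * algebraMap k S (X i j) := by
  rw [matrixEquivTensor_apply_symm]
  simp [Matrix.smul_apply]

theorem tensorMatrixEquiv_tmul_one {S : Type u} [CommRing S] [Algebra k S] (f : S) :
    tensorMatrixEquiv k m S (f ⊗ₜ 1) = f • 1 := by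
  ext i j
  rw [tensorMatrixEquiv_tmul, Matrix.smul_apply, Matrix.one_apply, Matrix.one_apply]
  split_ifs <;> simp

theorem tensorMatrixEquiv_map {S S' : Type u} [CommRing S] [Algebra k S] [CommRing S']
    [Algebra k S'] (φ : S →ₐ[k] S') (z : S ⊗[k] Matrix (Fin m) (Fin m) k) :
    tensorMatrixEquiv k m S' (Algebra.TensorProduct.map φ (AlgHom.id k _) z) =
      φ.mapMatrix (tensorMatrixEquiv k m S z) := by
  induction z using TensorProduct.induction_on with
  | zero => simp only [map_zero]
  | add x y hx hy => simp only [map_add, hx, hy]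
  | tmul f X =>
    ext i j
    rw [Algebra.TensorProduct.map_tmul, tensorMatrixEquiv_tmul, AlgHom.mapMatrix_apply,
      Matrix.map_apply, tensorMatrixEquiv_tmul, map_mul, AlgHom.commutes, AlgHom.id_apply]

variable {S : Type u} [CommRing S] [IsDomain S] [Algebra k S] {G : Type*} [Group G] [Finite G]
  {ρ : G →* (S ≃ₐ[k] S)}

omit [IsDomain S] in
theorem prod_apply_mem_baseRing [Fintype G] (f : S) : ∏ g, ρ g f ∈ baseRing ρ := by
  intro h
  change ρ h (∏ g, ρ g f) = _
  rw [map_prod, ← Equiv.prod_comp (Equiv.mulLeft h) fun g => ρ g f]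
  exact Finset.prod_congr rfl fun g _ => by
    rw [Equiv.coe_mulLeft, map_mul, AlgEquiv.mul_apply]

variable {κ : Type u} [Field κ] [Algebra k κ] (ev : S →ₐ[k] κ)
  {β : G →* (Matrix (Fin m) (Fin m) k ≃ₐ[k] Matrix (Fin m) (Fin m) k)}

/-- An invariant that reduces to a nonzero scalar is a unit up to an invariant function not vanishing
on the curve: the product of the adjugate with the conjugates of the determinant is an inverse, and
it is invariant because inverses are unique. -/
theorem exists_mul_eq_algebraMap (x : quotientOrder ρ β) (r : baseRing ρ)
    (hx : Algebra.TensorProduct.map ev (AlgHom.id k _) (x : S ⊗[k] Matrix (Fin m) (Fin m) k) = 0)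
    (hr : ev r ≠ 0) : ∃ (y : quotientOrder ρ β) (r' : baseRing ρ), ev r' ≠ 0 ∧
      y * (algebraMap (baseRing ρ) (quotientOrder ρ β) r + x) = algebraMap _ _ r' := by
  classical
  have := Fintype.ofFinite G
  let c : S ⊗[k] Matrix (Fin m) (Fin m) k := (r : S) ⊗ₜ 1 + x.1
  let ε := tensorMatrixEquiv k m S
  let δ := (ε c).det
  let r' : S := ∏ g, ρ g δ
  let y : S ⊗[k] Matrix (Fin m) (Fin m) k :=
    ε.symm ((∏ g ∈ Finset.univ.erase (1 : G), ρ g δ) • (ε c).adjugate)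
  have hr'δ : (∏ g ∈ Finset.univ.erase (1 : G), ρ g δ) * δ = r' := by
    have h1 := Finset.prod_erase_mul Finset.univ (fun g => ρ g δ) (Finset.mem_univ (1 : G))
    rwa [map_one, AlgEquiv.one_apply] at h1
  have hεr' : ε (r' ⊗ₜ 1) = r' • 1 := tensorMatrixEquiv_tmul_one r'
  have hyc : y * c = r' ⊗ₜ 1 := ε.injective (by
    rw [map_mul, AlgEquiv.apply_symm_apply, hεr', smul_mul_assoc, Matrix.adjugate_mul, smul_smul,
      hr'δ])
  have hcy : c * y = r' ⊗ₜ 1 := ε.injective (by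
    rw [map_mul, AlgEquiv.apply_symm_apply, hεr', mul_smul_comm, Matrix.mul_adjugate, smul_smul,
      hr'δ])
  have hr'mem : r' ∈ baseRing ρ := prod_apply_mem_baseRing δ
  have hc : ∀ g, Algebra.TensorProduct.map (ρ g : S →ₐ[k] S)
      (β g : Matrix (Fin m) (Fin m) k →ₐ[k] Matrix (Fin m) (Fin m) k) c = c := fun g => by
    rw [map_add, x.2 g, Algebra.TensorProduct.map_tmul, map_one, r.2 g]
  -- as `g` fixes `c`, applying `ρ g` to the coefficients of `c` amounts to applying the inverse of
  -- `β g` to the matrices, which leaves the scalar reduction of `c` unchanged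
  have hevr' : ev r' ≠ 0 := by
    rw [map_prod]
    refine Finset.prod_ne_zero_iff.2 fun g _ => ?_
    have h1 : Algebra.TensorProduct.map (ev.comp (ρ g : S →ₐ[k] S)) (AlgHom.id k _) c =
        ev r ⊗ₜ 1 := by
      have h2 : Algebra.TensorProduct.map (ev.comp (ρ g : S →ₐ[k] S)) (AlgHom.id k _) =
          (Algebra.TensorProduct.map (AlgHom.id k κ)
            ((β g).symm : Matrix (Fin m) (Fin m) k →ₐ[k] Matrix (Fin m) (Fin m) k)).comp
            ((Algebra.TensorProduct.map ev (AlgHom.id k _)).comp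
              (Algebra.TensorProduct.map (ρ g : S →ₐ[k] S)
              (β g : Matrix (Fin m) (Fin m) k →ₐ[k] Matrix (Fin m) (Fin m) k))) := by
        rw [← Algebra.TensorProduct.map_comp, ← Algebra.TensorProduct.map_comp]
        congr 1
        ext1 X
        simp
      rw [h2, AlgHom.comp_apply, AlgHom.comp_apply, hc, map_add, hx, add_zero,
        Algebra.TensorProduct.map_tmul, Algebra.TensorProduct.map_tmul, map_one, map_one]
      rfl
    have h2 : ev (ρ g δ) = ((ev.comp (ρ g : S →ₐ[k] S)).mapMatrix (ε c)).det := by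
      rw [← AlgHom.map_det]
      rfl
    rw [h2, ← tensorMatrixEquiv_map, h1, tensorMatrixEquiv_tmul_one, Matrix.det_smul, Matrix.det_one,
      mul_one]
    exact pow_ne_zero _ hr
  have hr'0 : r' ≠ 0 := fun h => hevr' (by rw [h, map_zero])
  -- `γ y` is also an inverse up to `r'`
  have hy : y ∈ quotientOrder ρ β := by
    intro g
    let γ := Algebra.TensorProduct.map (ρ g : S →ₐ[k] S)
      (β g : Matrix (Fin m) (Fin m) k →ₐ[k] Matrix (Fin m) (Fin m) k)
    have h1 : γ y * c = r' ⊗ₜ 1 := by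
      have h2 := congrArg γ hyc
      rw [map_mul, hc g] at h2
      rw [h2, Algebra.TensorProduct.map_tmul, map_one, hr'mem g]
    have h2 : γ y * (r' ⊗ₜ 1) = (r' ⊗ₜ 1) * y := by
      conv_lhs => rw [← hcy, ← mul_assoc, h1]
    have h3 := congrArg ε h2
    rw [map_mul, map_mul, hεr', mul_smul_comm, mul_one, smul_mul_assoc, one_mul] at h3
    exact ε.injective (smul_right_injective _ hr'0 h3)
  exact ⟨⟨y, hy⟩, ⟨r', hr'mem⟩, hevr', Subtype.ext hyc⟩

end Kernel

/-! ### Surjectivity of reduction -/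

section Reduction

variable {k : Type u} [Field k] [CharZero k] {S : Type u} [CommRing S] [Algebra k S]
  {G : Type*} [Group G] [Finite G] {ρ : G →* (S ≃ₐ[k] S)} {κ : Type u} [Field κ] [Algebra k κ]
  (ev : S →ₐ[k] κ) {H : Subgroup G} {t : S}

omit [CharZero k] in
/-- A function invariant under `H`, divisible by a given one, nonzero on the curve, and with a
cofactor that vanishes on the curve after translation by elements outside `H`. -/
theorem exists_invariant_multiple (ht : ev t = 0)
    (hH : ∀ g ∈ H, ∀ F, ev (ρ g F) = 0 → ev F = 0)
    (htg : ∀ g ∉ H, ev (ρ g t) ≠ 0) {f : S} (hf : ev f ≠ 0) :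
    ∃ f1, (∀ g ∈ H, ρ g (f * f1) = f * f1) ∧ ev (f * f1) ≠ 0 ∧ ∀ g ∉ H, ev (ρ g f1) = 0 := by
  classical
  have := Fintype.ofFinite G
  let c : G → S := fun g => if g ∈ H then f else t
  have hc1 : c 1 = f := if_pos (one_mem H)
  have hprod : f * ∏ g ∈ Finset.univ.erase (1 : G), ρ g (c g) = ∏ g, ρ g (c g) := by
    have h1 := Finset.mul_prod_erase Finset.univ (fun g => ρ g (c g)) (Finset.mem_univ (1 : G))
    rwa [map_one, AlgEquiv.one_apply, hc1] at h1
  refine ⟨∏ g ∈ Finset.univ.erase (1 : G), ρ g (c g), fun h hh => ?_, ?_, fun g hg => ?_⟩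
  · rw [hprod, map_prod, ← Equiv.prod_comp (Equiv.mulLeft h) fun g => ρ g (c g)]
    refine Finset.prod_congr rfl fun g _ => ?_
    have : c (h * g) = c g := by
      simp only [c, Subgroup.mul_mem_cancel_left H hh]
    rw [Equiv.coe_mulLeft, this, map_mul, AlgEquiv.mul_apply]
  · rw [hprod, map_prod]
    refine Finset.prod_ne_zero_iff.2 fun g _ => ?_
    by_cases hg : g ∈ H
    · rw [show c g = f from if_pos hg]
      exact fun h => hf (hH g hg f h)
    · rw [show c g = t from if_neg hg]
      exact htg g hg
  · have hg' : g⁻¹ ∉ H := fun h => hg (inv_mem_iff.1 h)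
    have hmem : g⁻¹ ∈ Finset.univ.erase (1 : G) := Finset.mem_erase.2
      ⟨fun h => hg' (h ▸ one_mem H), Finset.mem_univ _⟩
    rw [map_prod, map_prod]
    refine Finset.prod_eq_zero hmem ?_
    rw [show c g⁻¹ = t from if_neg hg', ← AlgEquiv.mul_apply, ← map_mul, mul_inv_cancel, map_one,
      AlgEquiv.one_apply, ht]

/-- An element fixed by the stabiliser is, up to an invariant factor, the reduction of an
invariant. -/
theorem exists_invariant_reduction {M : Type u} [Ring M] [Algebra k M] {β : G →* (M ≃ₐ[k] M)}
    (ht : ev t = 0) (htg : ∀ g ∉ H, ev (ρ g t) ≠ 0)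
    (hfrac : ∀ z : κ, ∃ f f', ev f' ≠ 0 ∧ z * ev f' = ev f) {z : κ ⊗[k] M}
    (hz : ∀ g ∈ H, ∃ φ : κ →ₐ[k] κ, (∀ f, ev (ρ g f) = φ (ev f)) ∧
      Algebra.TensorProduct.map φ (β g : M →ₐ[k] M) z = z) :
    ∃ (x : quotientOrder ρ β) (r : baseRing ρ), ev r ≠ 0 ∧
      Algebra.TensorProduct.map ev (AlgHom.id k M) (x : S ⊗[k] M) = ev r • z := by
  classical
  have := Fintype.ofFinite G
  let red : S ⊗[k] M →ₐ[k] κ ⊗[k] M := Algebra.TensorProduct.map ev (AlgHom.id k M)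
  have hred : ∀ (f : S) (y : S ⊗[k] M), red (f • y) = ev f • red y := fun f y => by
    induction y using TensorProduct.induction_on with
    | zero => simp
    | add a b ha hb => rw [smul_add, map_add, ha, hb, map_add, smul_add]
    | tmul a b => rw [TensorProduct.smul_tmul', Algebra.TensorProduct.map_tmul,
        Algebra.TensorProduct.map_tmul, TensorProduct.smul_tmul', smul_eq_mul, smul_eq_mul, map_mul]
  -- clear denominators
  obtain ⟨f, y0, hf, hy0⟩ : ∃ (f : S) (y0 : S ⊗[k] M), ev f ≠ 0 ∧ red y0 = ev f • z := by
    clear hz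
    induction z using TensorProduct.induction_on with
    | zero => exact ⟨1, 0, by simp, by simp⟩
    | add a b ha hb =>
      obtain ⟨f, y, hf, hy⟩ := ha
      obtain ⟨f', y', hf', hy'⟩ := hb
      refine ⟨f * f', f' • y + f • y', by rw [map_mul]; exact mul_ne_zero hf hf', ?_⟩
      rw [map_add, hred, hred, hy, hy', smul_smul, smul_smul, smul_add, map_mul, mul_comm (ev f')]
    | tmul a b =>
      obtain ⟨f, f', hf', h⟩ := hfrac a
      refine ⟨f', f ⊗ₜ b, hf', ?_⟩
      rw [Algebra.TensorProduct.map_tmul, ← h, TensorProduct.smul_tmul', smul_eq_mul, mul_comm]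
      rfl
  -- make the denominator invariant under `H`, by a cofactor whose other conjugates vanish on the
  -- curve
  obtain ⟨f1, h1, h2, h3⟩ := exists_invariant_multiple (ρ := ρ) (H := H) ev ht
    (fun g hg F hF => by
      obtain ⟨φ, hφ, -⟩ := hz g hg
      rw [hφ] at hF
      exact (map_eq_zero φ).1 hF) htg hf
  let γ : G → (S ⊗[k] M →ₐ[k] S ⊗[k] M) := fun g =>
    Algebra.TensorProduct.map (ρ g : S →ₐ[k] S) (β g : M →ₐ[k] M)
  have hγ : ∀ g h y, γ (g * h) y = γ g (γ h y) := fun g h y => by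
    have : γ (g * h) = (γ g).comp (γ h) := by
      rw [← Algebra.TensorProduct.map_comp]
      simp only [γ, map_mul]
      rfl
    rw [this, AlgHom.comp_apply]
  have hγsmul : ∀ g (a : S) y, γ g (a • y) = ρ g a • γ g y := fun g a y => by
    induction y using TensorProduct.induction_on with
    | zero => simp
    | add b c hb hc => rw [smul_add, map_add, hb, hc, map_add, smul_add]
    | tmul b c => rw [TensorProduct.smul_tmul', Algebra.TensorProduct.map_tmul,
        Algebra.TensorProduct.map_tmul, TensorProduct.smul_tmul', smul_eq_mul, smul_eq_mul]
                  exact congrArg (· ⊗ₜ[k] _) (map_mul (ρ g) a b)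
  -- sum over the group; only the terms from `H` survive the reduction, and these agree
  refine ⟨⟨∑ g, γ g (f1 • y0), fun h => ?_⟩, ⟨∑ g, ρ g (f * f1), fun h => ?_⟩, ?_, ?_⟩
  · change γ h _ = _
    rw [map_sum, ← Equiv.sum_comp (Equiv.mulLeft h) fun g => γ g (f1 • y0)]
    exact Finset.sum_congr rfl fun g _ => (hγ h g _).symm
  · change ρ h _ = _
    rw [map_sum, ← Equiv.sum_comp (Equiv.mulLeft h) fun g => ρ g (f * f1)]
    exact Finset.sum_congr rfl fun g _ => by
      rw [Equiv.coe_mulLeft, map_mul ρ, AlgEquiv.mul_apply]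
  · have hterm : ∀ g, ev (ρ g (f * f1)) = if g ∈ H then ev (f * f1) else 0 := fun g => by
      split_ifs with hg
      · rw [h1 g hg]
      · rw [map_mul, map_mul, h3 g hg, mul_zero]
    change ev (∑ g, ρ g (f * f1)) ≠ 0
    have : CharZero κ := charZero_of_injective_algebraMap (algebraMap k κ).injective
    rw [map_sum, Finset.sum_congr rfl fun g _ => hterm g, ← Finset.sum_filter, Finset.sum_const,
      nsmul_eq_mul]
    refine mul_ne_zero (Nat.cast_ne_zero.2 (Finset.card_ne_zero.2 ⟨1, ?_⟩)) h2
    exact Finset.mem_filter.2 ⟨Finset.mem_univ _, one_mem H⟩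
  · change red (∑ g, γ g (f1 • y0)) = ev (∑ g, ρ g (f * f1)) • z
    rw [map_sum, map_sum, Finset.sum_smul]
    refine Finset.sum_congr rfl fun g _ => ?_
    by_cases hg : g ∈ H
    · obtain ⟨φ, hφ, hφz⟩ := hz g hg
      have h4 : red.comp (γ g) = (Algebra.TensorProduct.map φ (β g : M →ₐ[k] M)).comp red := by
        rw [← Algebra.TensorProduct.map_comp, ← Algebra.TensorProduct.map_comp]
        have : ev.comp (ρ g : S →ₐ[k] S) = φ.comp ev := AlgHom.ext hφ
        rw [this]
        rfl
      have h5 : ∀ (a : κ) y, Algebra.TensorProduct.map φ (β g : M →ₐ[k] M) (a • y) =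
          φ a • Algebra.TensorProduct.map φ (β g : M →ₐ[k] M) y := fun a y => by
        induction y using TensorProduct.induction_on with
        | zero => simp
        | add b c hb hc => rw [smul_add, map_add, hb, hc, map_add, smul_add]
        | tmul b c => rw [TensorProduct.smul_tmul', Algebra.TensorProduct.map_tmul,
            Algebra.TensorProduct.map_tmul, TensorProduct.smul_tmul', smul_eq_mul, smul_eq_mul,
            map_mul]
      have h6 := DFunLike.congr_fun h4 (f1 • y0)
      rw [AlgHom.comp_apply, AlgHom.comp_apply, hred, hy0, smul_smul, ← map_mul, mul_comm f1, h5,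
        hφz, ← hφ] at h6
      exact h6
    · rw [hγsmul, hred, h3 g hg, zero_smul, map_mul, map_mul, h3 g hg, mul_zero, zero_smul]

end Reduction


/-! ### The residue algebra along the image of the line -/

section AlongLine

variable {k : Type u} [Field k] [CharZero k] {G : Type*} [Group G] [Finite G]
  {ρ : G →* (PlaneRing k ≃ₐ[k] PlaneRing k)} {s t : PlaneRing k}
  {L : Ideal (PlaneRing k)} [L.IsPrime] {σ τ : G}

/-- The parameter of the line, as a unit of its function field. -/
def lineParameter (k : Type u) [Field k] : (LineField k)ˣ :=
  Units.mk0 (algebraMap (PowerSeries k) (LineField k) PowerSeries.X) (by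
    rw [Ne, map_eq_zero_iff _ (IsFractionRing.injective _ _)]
    exact PowerSeries.X_ne_zero)

omit [CharZero k] in
theorem scaleField_lineParameter (c : kˣ) :
    scaleField c (lineParameter k : LineField k) = (c : k) • (lineParameter k : LineField k) := by
  change scaleField c (algebraMap (PowerSeries k) (LineField k) PowerSeries.X) =
    (c : k) • algebraMap (PowerSeries k) (LineField k) PowerSeries.X
  rw [scaleField_algebraMap, PowerSeries.rescale_X, Algebra.smul_def,
    IsScalarTower.algebraMap_apply k (PowerSeries k) (LineField k), ← map_mul,
    PowerSeries.algebraMap_apply]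
  rfl

omit [CharZero k] [Finite G] [L.IsPrime] in
/-- Elements of the stabiliser act on the function field of the line. -/
theorem exists_lineField_action [Finite G] (hl : IsReflectionLine ρ s t L σ τ)
    (ld : LineData ρ s t L σ τ) {M : Type u} [Ring M] [Algebra k M] (β : G →* (M ≃ₐ[k] M))
    {z : LineField k ⊗[k] M}
    (hσ : Algebra.TensorProduct.map (AlgHom.id k _) (β σ : M →ₐ[k] M) z = z)
    (hτ : Algebra.TensorProduct.map (scaleField ld.ξ) (β τ : M →ₐ[k] M) z = z) :
    ∀ g ∈ stabilizer ρ L, ∃ φ : LineField k →ₐ[k] LineField k,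
      (∀ f, ld.evK (ρ g f) = φ (ld.evK f)) ∧
      Algebra.TensorProduct.map φ (β g : M →ₐ[k] M) z = z := by
  rw [← hl.sup_eq]
  refine sup_zpowers_induction ⟨AlgHom.id k _, fun f => by rw [map_one]; rfl, ?_⟩ ?_
    ⟨_, ld.evK_σ hl, hσ⟩ ⟨_, ld.evK_τ hl, hτ⟩
  · have h : (β 1 : M →ₐ[k] M) = AlgHom.id k M := by
      rw [map_one]
      rfl
    rw [h, Algebra.TensorProduct.map_id]
    rfl
  · rintro a b ⟨φ, hφ, ha⟩ ⟨φ', hφ', hb⟩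
    refine ⟨φ.comp φ', fun f => ?_, ?_⟩
    · rw [map_mul, AlgEquiv.mul_apply, hφ, hφ', AlgHom.comp_apply]
    · have h : (β (a * b) : M →ₐ[k] M) = (β a : M →ₐ[k] M).comp (β b : M →ₐ[k] M) := by
        rw [map_mul]
        rfl
      rw [h, Algebra.TensorProduct.map_comp, AlgHom.comp_apply, hb, ha]

variable {e : ℕ} [NeZero e] {F : Type u} [Fintype F] [DecidableEq F] {n N : ℕ}
  (w : ShiftWeight k n N e F)

omit [CharZero k] in
theorem equiv_mem_residueMatrices_iff {M : Type u} [Ring M] [Algebra k M] {βσ βτ : M →ₐ[k] M}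
    {ξ : kˣ} (fr : Frame M βσ βτ (ξ : k) e F) (hw : w.α = fr.α) (z : LineField k ⊗[k] M) :
    fr.equiv (lineParameter k) z ∈
        residueMatrices w (scaleField ξ : LineField k →+* LineField k) ↔
      Algebra.TensorProduct.map (AlgHom.id k _) βσ z = z ∧
        Algebra.TensorProduct.map (scaleField ξ) βτ z = z := by
  let Ψ := fr.equiv (lineParameter k)
  refine and_congr ?_ ?_
  · rw [← Ψ.injective.eq_iff, ← Matrix.ext_iff]
    refine forall_congr' fun q => forall_congr' fun q' => ?_
    rw [fr.equiv_map_σ (φ := AlgHom.id k _) rfl, AlgHom.id_apply, ← hw]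
    constructor
    · intro h
      by_cases hα : w.α q = w.α q'
      · rw [hα, div_self (w.α_ne_zero q'), one_smul]
      · rw [h hα, smul_zero]
    · intro h hα
      have h1 : (w.α q / w.α q' - 1) • fr.equiv (lineParameter k) z q q' = 0 := by
        rw [sub_smul, h, one_smul, sub_self]
      refine (smul_eq_zero.1 h1).resolve_left fun h2 => hα ?_
      rw [sub_eq_zero, div_eq_one_iff_eq (w.α_ne_zero q')] at h2
      exact h2
  · rw [← Ψ.injective.eq_iff, ← Matrix.ext_iff]
    constructor
    · intro h q q'
      obtain ⟨q, rfl⟩ := shiftIndex.surjective q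
      obtain ⟨q', rfl⟩ := shiftIndex.surjective q'
      rw [fr.equiv_map_τ (scaleField_lineParameter ξ), h]
      rfl
    · intro h q q'
      rw [← h, fr.equiv_map_τ (scaleField_lineParameter ξ)]
      rfl

omit [CharZero k] [Finite G] [L.IsPrime] in
theorem reduction_fixed [Finite G] (hl : IsReflectionLine ρ s t L σ τ) (ld : LineData ρ s t L σ τ)
    {M : Type u} [Ring M] [Algebra k M] {β : G →* (M ≃ₐ[k] M)} (x : quotientOrder ρ β) :
    Algebra.TensorProduct.map (AlgHom.id k _) (β σ : M →ₐ[k] M)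
        (Algebra.TensorProduct.map ld.evK (AlgHom.id k M) x.1) =
      Algebra.TensorProduct.map ld.evK (AlgHom.id k M) x.1 ∧
    Algebra.TensorProduct.map (scaleField ld.ξ) (β τ : M →ₐ[k] M)
        (Algebra.TensorProduct.map ld.evK (AlgHom.id k M) x.1) =
      Algebra.TensorProduct.map ld.evK (AlgHom.id k M) x.1 := by
  have key : ∀ (g : G) (φ : LineField k →ₐ[k] LineField k),
      (∀ f, ld.evK (ρ g f) = φ (ld.evK f)) →
      Algebra.TensorProduct.map φ (β g : M →ₐ[k] M)
        (Algebra.TensorProduct.map ld.evK (AlgHom.id k M) x.1) =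
      Algebra.TensorProduct.map ld.evK (AlgHom.id k M) x.1 := by
    intro g φ hφ
    conv_rhs => rw [← x.2 g]
    rw [← AlgHom.comp_apply, ← AlgHom.comp_apply, ← Algebra.TensorProduct.map_comp,
      ← Algebra.TensorProduct.map_comp]
    have : ld.evK.comp (ρ g : PlaneRing k →ₐ[k] PlaneRing k) = φ.comp ld.evK := AlgHom.ext hφ
    rw [this]
    rfl
  exact ⟨key σ _ (ld.evK_σ hl), key τ _ (ld.evK_τ hl)⟩

variable {m : ℕ} {β : G →* (Matrix (Fin m) (Fin m) k ≃ₐ[k] Matrix (Fin m) (Fin m) k)}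

/-- The residue algebra along the image of the line, in the normal form of the matrix action. -/
def lineResidueModel (hl : IsReflectionLine ρ s t L σ τ) (ld : LineData ρ s t L σ τ)
    (fr : Frame (Matrix (Fin m) (Fin m) k) (β σ : _ →ₐ[k] Matrix (Fin m) (Fin m) k)
      (β τ : _ →ₐ[k] Matrix (Fin m) (Fin m) k) (ld.ξ : k) e F) (hw : w.α = fr.α) :
    ResidueModel (baseRing ρ) (quotientOrder ρ β) (imagePrime ρ L) (LineField k)
      (Matrix (ZMod e × F) (ZMod e × F) (LineField k)) (ZMod e × F → LineField k) where
  χ := (ld.evK : PlaneRing k →+* LineField k).comp (algebraMap (baseRing ρ) (PlaneRing k))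
  φ := ((fr.equiv (lineParameter k)).toAlgHom.comp
    (Algebra.TensorProduct.map ld.evK (AlgHom.id k (Matrix (Fin m) (Fin m) k)))).toRingHom.comp
      (quotientOrder ρ β).val.toRingHom
  Γ := residueMatrices w (scaleField ld.ξ : LineField k →+* LineField k)
  dg := Matrix.diagonalAlgHom (LineField k)
  Z := weightFunctions w (scaleField ld.ξ : LineField k →+* LineField k)
  χ_eq_zero_iff r := by
    change ld.evK r = 0 ↔ (r : PlaneRing k) ∈ L
    rw [ld.evK_eq_zero_iff, hl.eq_span, Ideal.mem_span_singleton]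
  φ_algebraMap r := by
    change fr.equiv (lineParameter k) (Algebra.TensorProduct.map ld.evK (AlgHom.id k _)
      ((r : PlaneRing k) ⊗ₜ 1)) = algebraMap _ _ (ld.evK r)
    have h1 : (ld.evK r ⊗ₜ[k] 1 : LineField k ⊗[k] Matrix (Fin m) (Fin m) k) =
        ld.evK r • 1 := by
      rw [Algebra.TensorProduct.one_def, TensorProduct.smul_tmul', smul_eq_mul, mul_one]
    rw [Algebra.TensorProduct.map_tmul, map_one, h1, fr.equiv_smul, map_one,
      Algebra.algebraMap_eq_smul_one]
  φ_mem x := (equiv_mem_residueMatrices_iff w fr hw _).2 (reduction_fixed hl ld x)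
  exists_φ_eq X hX := by
    obtain ⟨z, rfl⟩ := (fr.equiv (lineParameter k)).surjective X
    obtain ⟨h1, h2⟩ := (equiv_mem_residueMatrices_iff w fr hw z).1 hX
    obtain ⟨x, r, hr, hx⟩ := exists_invariant_reduction (β := β) ld.evK (H := stabilizer ρ L) (t := t)
      (by rw [ld.evK_eq_zero_iff])
      (fun g hg h => hl.restriction_apply_t_ne_zero ld.ev_s ld.ev_t hg (by
        rw [ld.evK_eq_zero_iff, ← ld.ev_eq_zero_iff] at h
        exact h))
      ld.exists_mul_evK (exists_lineField_action hl ld β h1 h2)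
    refine ⟨x, r, fun h => hr ?_, ?_⟩
    · rw [ld.evK_eq_zero_iff, ← Ideal.mem_span_singleton, ← hl.eq_span]
      exact h
    · change fr.equiv (lineParameter k) (Algebra.TensorProduct.map ld.evK (AlgHom.id k _) x.1) =
        algebraMap _ _ (ld.evK r) * _
      rw [hx, fr.equiv_smul, Algebra.smul_def]
  inv_mem X hX r hr := by
    change algebraMap _ _ (ld.evK r)⁻¹ * X ∈ _
    have h1 : scaleField ld.ξ (ld.evK r) = ld.evK r := by
      rw [← ld.evK_τ hl]
      exact congrArg ld.evK (r.2 τ)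
    rw [← Algebra.smul_def]
    refine ⟨fun q q' h => ?_, fun q q' => ?_⟩
    · rw [Matrix.smul_apply, hX.1 q q' h, smul_zero]
    · rw [Matrix.smul_apply, hX.2, Matrix.smul_apply, smul_eq_mul, smul_eq_mul, map_mul, map_inv₀]
      congr 2
      exact h1.symm
  kernel x r hx hr := by
    have : IsDomain (PlaneRing k) := NoZeroDivisors.to_isDomain _
    obtain ⟨y, r', hr', h⟩ := exists_mul_eq_algebraMap ld.evK x r
      ((map_eq_zero_iff _ (fr.equiv (lineParameter k)).injective).1 hx) (fun h => hr (by
        change (r : PlaneRing k) ∈ L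
        rw [hl.eq_span, Ideal.mem_span_singleton, ← ld.evK_eq_zero_iff, h]))
    refine ⟨y, r', fun h' => hr' ?_, h⟩
    rw [ld.evK_eq_zero_iff, ← Ideal.mem_span_singleton, ← hl.eq_span]
    exact h'
  radical X hX h := eq_zero_of_residueMatrices w _ hX h
  dg_injective := Matrix.diagonal_injective
  center_iff X := mem_center_residueMatrices_iff w _ X

/-- A function on the line fixed by `τ` is a quotient of restrictions of invariants. -/
theorem exists_invariant_of_scaleField_eq (hl : IsReflectionLine ρ s t L σ τ)
    (ld : LineData ρ s t L σ τ) {y : LineField k} (hy : scaleField ld.ξ y = y) :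
    ∃ f r : baseRing ρ, ld.evK r ≠ 0 ∧ ld.evK f = ld.evK r * y := by
  obtain ⟨x, r, hr, hx⟩ := exists_invariant_reduction (β := (1 : G →* (k ≃ₐ[k] k))) ld.evK
    (H := stabilizer ρ L) (t := t) (z := y ⊗ₜ 1)
    (by rw [ld.evK_eq_zero_iff])
    (fun g hg h => hl.restriction_apply_t_ne_zero ld.ev_s ld.ev_t hg (by
      rw [ld.evK_eq_zero_iff, ← ld.ev_eq_zero_iff] at h
      exact h))
    ld.exists_mul_evK (exists_lineField_action hl ld _ (by
      rw [Algebra.TensorProduct.map_tmul]; rfl) (by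
      rw [Algebra.TensorProduct.map_tmul, hy]; rfl))
  obtain ⟨f, hf⟩ := (Algebra.TensorProduct.rid k (PlaneRing k) (PlaneRing k)).symm.surjective x.1
  have hf' : x.1 = f ⊗ₜ 1 := hf.symm
  have hfR : f ∈ baseRing ρ := fun g => by
    have h5 := x.2 g
    rw [hf', Algebra.TensorProduct.map_tmul, map_one] at h5
    simpa using congrArg (Algebra.TensorProduct.rid k (PlaneRing k) (PlaneRing k)) h5
  have hfy : ld.evK f = ld.evK r * y := by
    rw [hf', Algebra.TensorProduct.map_tmul, map_one, TensorProduct.smul_tmul'] at hx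
    simpa using congrArg (Algebra.TensorProduct.rid k (LineField k) (LineField k)) hx
  exact ⟨⟨f, hfR⟩, r, hr, hfy⟩

end AlongLine


/-! ### Ramification over a closed point -/

section Ramification

/-- If `P` is, locally, generated by the nonzerodivisor `ϖ`, and the prime below is generated by an
associate of `ϖ ^ e`, then the ramification index is `e`. -/
theorem ramificationIdx_eq_of_uniformizer {C T : Type*} [CommRing C] [CommRing T] [Algebra C T]
    (P : Ideal T) [P.IsMaximal] {ϖ : T} (hϖ : ϖ ∈ nonZeroDivisors T) (hmem : ϖ ∈ P)
    (hgen : ∀ f ∈ P, ∃ u ∉ P, ϖ ∣ u * f) {x : C} (hx : P.under C = Ideal.span {x}) {e : ℕ}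
    (hxe : Associated (algebraMap C T x) (ϖ ^ e)) : P.ramificationIdx C = e := by
  rw [Ideal.ramificationIdx_def]
  let Tp := Localization.AtPrime P
  have hreg : algebraMap T Tp ϖ ∈ nonZeroDivisors Tp :=
    IsLocalization.map_nonZeroDivisors_le P.primeCompl Tp ⟨ϖ, hϖ, rfl⟩
  -- in the local ring `ϖ` generates the maximal ideal, so `ϖ ^ i` has length `i`
  have hmax : Ideal.span {algebraMap T Tp ϖ} = IsLocalRing.maximalIdeal Tp := by
    rw [← Localization.AtPrime.map_eq_maximalIdeal]
    refine le_antisymm ?_ ?_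
    · rw [Ideal.span_singleton_le_iff_mem]
      exact Ideal.mem_map_of_mem _ hmem
    · rw [Ideal.map_le_iff_le_comap]
      intro f hf
      obtain ⟨u, hu, g, hg⟩ := hgen f hf
      rw [Ideal.mem_comap, Ideal.mem_span_singleton]
      have hu' := IsLocalization.map_units Tp (⟨u, hu⟩ : P.primeCompl)
      rw [← IsUnit.dvd_mul_left (a := algebraMap T Tp ϖ) hu', ← map_mul]
      exact map_dvd _ ⟨g, hg⟩
  have h1 : Ring.ord Tp (algebraMap T Tp ϖ) = 1 := by
    unfold Ring.ord
    rw [Module.length_eq_one_iff, isSimpleModule_iff_isCoatom, ← Ideal.isMaximal_def, hmax]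
    infer_instance
  have h2 : ∀ i : ℕ, Ring.ord Tp (algebraMap T Tp ϖ ^ i) = i := by
    intro i
    induction i with
    | zero => rw [pow_zero, Ring.ord_one, Nat.cast_zero]
    | succ i ih => rw [pow_succ, Ring.ord_mul Tp hreg, ih, h1, Nat.cast_succ]
  have h3 : (P.under C).map (algebraMap C Tp) = Ideal.span {algebraMap T Tp ϖ ^ e} := by
    rw [hx, Ideal.map_span, Set.image_singleton, IsScalarTower.algebraMap_apply C T Tp,
      ← map_pow]
    have h4 := hxe.map (algebraMap T Tp)
    exact le_antisymm (Ideal.span_singleton_le_span_singleton.2 h4.dvd')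
      (Ideal.span_singleton_le_span_singleton.2 h4.dvd)
  rw [h3]
  have h4 := h2 e
  unfold Ring.ord at h4
  rw [h4]
  rfl

end Ramification

section CyclicCover

variable {k : Type u} [Field k] {n N e : ℕ} [NeZero e] {F : Type u}
  (w : ShiftWeight k n N e F)

/-- The condition on a family of power series, indexed by the index set of a weight, to depend only on
the weight and to be carried to itself by the shift of the indices and the scaling of the parameter. -/
def IsWeightSeries (ξ : kˣ) (f : ZMod e × F → PowerSeries k) : Prop :=
  (∀ q q', w.α q = w.α q' → f q = f q') ∧ ∀ q, f (shiftIndex q) = PowerSeries.rescale (ξ : k) (f q)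

variable {w} {ξ : kˣ}

theorem IsWeightSeries.of_mul {f g h : ZMod e × F → PowerSeries k} (hf : IsWeightSeries w ξ f)
    (hh : IsWeightSeries w ξ h) (hf0 : ∀ q, f q ≠ 0) (hfg : ∀ q, f q * g q = h q) :
    IsWeightSeries w ξ g := by
  constructor
  · intro q q' hq
    refine mul_left_cancel₀ (hf0 q) ?_
    rw [hfg, hh.1 q q' hq, ← hfg, hf.1 q q' hq]
  · intro q
    refine mul_left_cancel₀ (hf0 (shiftIndex q)) ?_
    rw [hfg, hh.2, ← hfg, hf.2, map_mul]

theorem IsWeightSeries.rescale_pow_eq {f : ZMod e × F → PowerSeries k} (hf : IsWeightSeries w ξ f)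
    (q : ZMod e × F) : PowerSeries.rescale ((ξ : k) ^ e) (f q) = f q := by
  have h : ∀ i : ℕ, f (q.1 + i, q.2) = PowerSeries.rescale ((ξ : k) ^ i) (f q) := by
    intro i
    induction i with
    | zero => simp
    | succ i ih =>
      rw [pow_succ, PowerSeries.rescale_mul, RingHom.comp_apply, ← ih, ← hf.2, Nat.cast_succ,
        ← add_assoc]
      rfl
  rw [← h, ZMod.natCast_self, add_zero]

omit [NeZero e] in
theorem X_pow_dvd_of_rescale_eq {ξ : k} (hξ : IsPrimitiveRoot ξ N) {f : PowerSeries k}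
    (hf : PowerSeries.rescale ξ f = f) (h0 : PowerSeries.constantCoeff f = 0) :
    (PowerSeries.X : PowerSeries k) ^ N ∣ f := by
  rw [PowerSeries.X_pow_dvd_iff]
  intro i hi
  by_contra hne
  have h1 := congrArg (PowerSeries.coeff i) hf
  rw [PowerSeries.coeff_rescale] at h1
  have h2 : ξ ^ i = 1 := mul_right_cancel₀ hne (h1.trans (one_mul _).symm)
  have h3 := Nat.eq_zero_of_dvd_of_lt ((hξ.pow_eq_one_iff_dvd i).1 h2) hi
  subst h3
  exact hne (by rw [PowerSeries.coeff_zero_eq_constantCoeff_apply, h0])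

omit [NeZero e] in
theorem rescale_monomial (ξ : k) (d : ℕ) (a : k) :
    PowerSeries.rescale ξ (PowerSeries.monomial d a) = PowerSeries.monomial d (ξ ^ d * a) := by
  ext i
  rw [PowerSeries.coeff_rescale, PowerSeries.coeff_monomial, PowerSeries.coeff_monomial]
  by_cases h : i = d
  · rw [if_pos h, if_pos h, h]
  · rw [if_neg h, if_neg h, mul_zero]

omit [NeZero e] in
theorem constantCoeff_rescale (ξ : k) (f : PowerSeries k) :
    PowerSeries.constantCoeff (PowerSeries.rescale ξ f) = PowerSeries.constantCoeff f := by
  rw [← PowerSeries.coeff_zero_eq_constantCoeff_apply, PowerSeries.coeff_rescale, pow_zero, one_mul,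
    PowerSeries.coeff_zero_eq_constantCoeff_apply]

variable {C T : Type*} [CommRing C] [CommRing T] [Algebra C T]

/-- The algebra of weight series is totally ramified of index `e` over the power series fixed by the
scaling: each of its factors is `k⟦X ^ (N / e)⟧`, over the base `k⟦X ^ N⟧`. -/
theorem ramificationIdx_weightSeries (hξ : IsPrimitiveRoot (ξ : k) N) (hN : N ≠ 0)
    (Θ : T →+* (ZMod e × F → PowerSeries k)) (hΘ : Function.Injective Θ)
    (hrange : ∀ f, IsWeightSeries w ξ f ↔ ∃ y, Θ y = f) (c : C →+* PowerSeries k)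
    (hc : Function.Injective c)
    (hcrange : ∀ f, PowerSeries.rescale (ξ : k) f = f ↔ ∃ y, c y = f)
    (hΘc : ∀ x q, Θ (algebraMap C T x) q = c x) (P : Ideal T) [P.IsMaximal] :
    P.ramificationIdx C = e := by
  have hΘmem : ∀ y, IsWeightSeries w ξ (Θ y) := fun y => (hrange _).2 ⟨y, rfl⟩
  have he := w.dvd_N
  have he0 : e ≠ 0 := NeZero.ne e
  have hNe : N / e ≠ 0 := (Nat.div_pos (Nat.le_of_dvd (Nat.pos_of_ne_zero hN) he)
    (Nat.pos_of_ne_zero he0)).ne'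
  -- entrywise units of `T` are units
  have hunit : ∀ y : T, (∀ q, IsUnit (Θ y q)) → IsUnit y := by
    intro y hy
    choose g hg using fun q => (hy q).exists_right_inv
    obtain ⟨z, hz⟩ := (hrange g).1 ((hΘmem y).of_mul (h := 1)
      ⟨fun _ _ _ => rfl, fun q => (map_one _).symm⟩ (fun q => (hy q).ne_zero) hg)
    refine IsUnit.of_mul_eq_one z (hΘ ?_)
    rw [map_mul, hz, map_one]
    exact funext hg
  -- `ξ ^ (N / e)` is an `e`-th root of unity, hence a power of `η`; this power of the weights
  -- makes `X ^ (N / e)` equivariant for the shift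
  obtain ⟨c', -, hc'⟩ := w.isPrimitiveRoot_η.eq_pow_of_pow_eq_one (ξ := (ξ : k) ^ (N / e)) (by
    rw [← pow_mul, Nat.div_mul_cancel he, hξ.pow_eq_one])
  let p0 : ZMod e × F → PowerSeries k := fun q => PowerSeries.monomial (N / e) (w.α q ^ c')
  have hshift : ∀ q : ZMod e × F, w.α (shiftIndex q) = w.η * w.α q := fun q => w.α_shift q.1 q.2
  have hp0 : IsWeightSeries w ξ p0 := by
    refine ⟨fun q q' h => congrArg (fun a => PowerSeries.monomial (N / e) (a ^ c')) h, fun q => ?_⟩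
    change PowerSeries.monomial (N / e) (w.α (shiftIndex q) ^ c') =
      PowerSeries.rescale (ξ : k) (PowerSeries.monomial (N / e) (w.α q ^ c'))
    rw [rescale_monomial, ← hc', hshift, mul_pow]
  have hp0X : ∀ q, p0 q = PowerSeries.C (w.α q ^ c') * PowerSeries.X ^ (N / e) := fun q =>
    by
    ext i
    rw [PowerSeries.coeff_monomial, PowerSeries.coeff_C_mul_X_pow]
  have hp0ne : ∀ q, p0 q ≠ 0 := fun q h => pow_ne_zero c' (w.α_ne_zero q) (by
    simpa [p0] using congrArg (PowerSeries.coeff (N / e)) h)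
  have hp0c : ∀ q, PowerSeries.constantCoeff (p0 q) = 0 := fun q => by
    rw [← PowerSeries.coeff_zero_eq_constantCoeff_apply, PowerSeries.coeff_monomial, if_neg hNe.symm]
  obtain ⟨ϖ, hϖ⟩ := (hrange p0).1 hp0
  have hunit' : ∀ y : T, (∀ q, PowerSeries.constantCoeff (Θ y q) ≠ 0) → IsUnit y := fun y hy =>
    hunit y fun q => PowerSeries.isUnit_iff_constantCoeff.2 (isUnit_iff_ne_zero.2 (hy q))
  -- series without constant term lie in the radical
  have hmem : ∀ g, (∀ q, PowerSeries.constantCoeff (Θ g q) = 0) → g ∈ P := by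
    intro g hg
    by_contra hgP
    obtain ⟨a, i, hi, ha⟩ := Ideal.IsMaximal.exists_inv (I := P) ‹_› hgP
    refine Ideal.IsPrime.ne_top (I := P) inferInstance (Ideal.eq_top_of_isUnit_mem P hi
      (hunit' i fun q => ?_))
    have h1 := congrArg (fun y => PowerSeries.constantCoeff (Θ y q)) ha
    simp only [map_add, map_mul, Pi.add_apply, Pi.mul_apply, hg, mul_zero, zero_add, map_one,
      Pi.one_apply] at h1
    rw [h1]
    exact one_ne_zero
  have hnotmem : ∀ y, (∀ q, PowerSeries.constantCoeff (Θ y q) ≠ 0) → y ∉ P := fun y hy hyP =>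
    Ideal.IsPrime.ne_top (I := P) inferInstance (Ideal.eq_top_of_isUnit_mem P hyP (hunit' y hy))
  -- divisibility by the uniformiser can be tested entrywise
  have hdvd : ∀ y, (∀ q, p0 q ∣ Θ y q) → ϖ ∣ y := by
    intro y hy
    choose g hg using hy
    obtain ⟨z, hz⟩ := (hrange g).1 (hp0.of_mul (hΘmem y) hp0ne fun q => (hg q).symm)
    refine ⟨z, hΘ ?_⟩
    rw [map_mul, hz, hϖ]
    exact funext hg
  have hprim : IsPrimitiveRoot ((ξ : k) ^ e) (N / e) :=
    hξ.pow (Nat.pos_of_ne_zero hN) (Nat.mul_div_cancel' he).symm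
  have hpdvd : ∀ y q, PowerSeries.constantCoeff (Θ y q) = 0 → p0 q ∣ Θ y q := by
    intro y q h0
    rw [hp0X, IsUnit.mul_left_dvd ((isUnit_iff_ne_zero.2 (pow_ne_zero _ (w.α_ne_zero q))).map _)]
    exact X_pow_dvd_of_rescale_eq hprim ((hΘmem y).rescale_pow_eq q) h0
  have hcX : ∀ y, PowerSeries.constantCoeff (c y) = 0 → PowerSeries.X ^ N ∣ c y := fun y =>
    X_pow_dvd_of_rescale_eq hξ ((hcrange _).2 ⟨y, rfl⟩)
  have hXN : PowerSeries.rescale (ξ : k) (PowerSeries.X ^ N) = PowerSeries.X ^ N := by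
    rw [PowerSeries.X_pow_eq, rescale_monomial, hξ.pow_eq_one, one_mul]
  obtain ⟨x, hx⟩ := (hcrange _).1 hXN
  have hx0 : PowerSeries.constantCoeff (c x) = 0 := by
    rw [hx, map_pow, PowerSeries.constantCoeff_X, zero_pow hN]
  refine ramificationIdx_eq_of_uniformizer P (ϖ := ϖ) (x := x) ?_
    (hmem ϖ fun q => by rw [hϖ, hp0c]) (fun f hf => ?_) ?_ ?_
  · rw [mem_nonZeroDivisors_iff_right]
    intro y hy
    refine hΘ ?_
    rw [map_zero]
    funext q
    have h1 := congrFun (congrArg Θ hy) q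
    rw [map_mul, map_zero, hϖ] at h1
    exact (mul_eq_zero.1 h1).resolve_right (hp0ne q)
  · classical
    -- the idempotent of the factors on which `f` has no constant term
    obtain ⟨u, hu⟩ := (hrange fun q => if PowerSeries.constantCoeff (Θ f q) = 0 then 1 else 0).1
      ⟨fun q q' h => by simp only [(hΘmem f).1 q q' h], fun q => by
        beta_reduce
        rw [(hΘmem f).2, apply_ite (PowerSeries.rescale (ξ : k)), map_one, map_zero,
          constantCoeff_rescale]⟩
    refine ⟨u, fun hu' => hnotmem (u + f) (fun q => ?_) (add_mem hu' hf), hdvd _ fun q => ?_⟩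
    · rw [map_add, Pi.add_apply, hu, map_add]
      beta_reduce
      by_cases h : PowerSeries.constantCoeff (Θ f q) = 0
      · rw [if_pos h, h, add_zero, map_one]
        exact one_ne_zero
      · rw [if_neg h, map_zero, zero_add]
        exact h
    · refine hpdvd _ q ?_
      rw [map_mul, Pi.mul_apply, hu]
      beta_reduce
      by_cases h : PowerSeries.constantCoeff (Θ f q) = 0
      · rw [if_pos h, one_mul, h]
      · rw [if_neg h, zero_mul, map_zero]
  · refine le_antisymm (fun y hy => ?_) ?_
    · rw [Ideal.mem_span_singleton]
      have h0 : PowerSeries.constantCoeff (c y) = 0 := by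
        by_contra h0
        exact hnotmem _ (fun q => by rw [hΘc]; exact h0) (Ideal.mem_comap.1 hy)
      obtain ⟨g, hg⟩ := hcX y h0
      have hgfix : PowerSeries.rescale (ξ : k) g = g := by
        refine mul_left_cancel₀ (pow_ne_zero N PowerSeries.X_ne_zero) ?_
        conv_lhs => rw [← hXN]
        rw [← map_mul, ← hg]
        exact (hcrange _).2 ⟨y, rfl⟩
      obtain ⟨z, hz⟩ := (hcrange g).1 hgfix
      exact ⟨z, hc (by rw [map_mul, hx, hz, hg])⟩
    · rw [Ideal.span_singleton_le_iff_mem, Ideal.mem_comap]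
      exact hmem _ fun q => by rw [hΘc, hx0]
  · have hpe : ∀ q, p0 q ^ e = PowerSeries.C ((w.α q ^ c') ^ e) * PowerSeries.X ^ N := fun q => by
      rw [hp0X, mul_pow, ← pow_mul, Nat.div_mul_cancel he, map_pow PowerSeries.C (w.α q ^ c') e]
    obtain ⟨v, hv⟩ := (hrange fun q => PowerSeries.C ((w.α q ^ c') ^ e)).1
      ⟨fun q q' h => by simp only [h], fun q => by
        beta_reduce
        rw [← PowerSeries.monomial_zero_eq_C_apply ((w.α q ^ c') ^ e), rescale_monomial, pow_zero, one_mul,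
          PowerSeries.monomial_zero_eq_C_apply, hshift, mul_pow, mul_pow, pow_right_comm,
          w.isPrimitiveRoot_η.pow_eq_one, one_pow, one_mul]⟩
    have hvu : IsUnit v := hunit' v fun q => by
      rw [hv, PowerSeries.constantCoeff_C]
      exact pow_ne_zero _ (pow_ne_zero _ (w.α_ne_zero q))
    refine ⟨hvu.unit, hΘ ?_⟩
    rw [IsUnit.unit_spec, map_mul, hv, map_pow, hϖ]
    funext q
    rw [Pi.mul_apply, hΘc, hx, Pi.pow_apply, hpe, mul_comm]

end CyclicCover


/-! ### The centre of the residue algebra -/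

section CentreModel

variable {k : Type u} [Field k] {n N e : ℕ} [NeZero e] {F : Type u}

/-- A `K`-algebra `E` identified with the weight functions with values in the function field of the
line, with `K` corresponding to the functions on the quotient of the line by the scaling. -/
structure CentreModel (w : ShiftWeight k n N e F) (ξ : kˣ) (K : Type u) [Field K] (E : Type u)
    [CommRing E] [Algebra K E] where
  /-- the embedding of the field -/
  ψ : K →+* LineField k
  /-- the embedding of the algebra -/
  θ : E →+* (ZMod e × F → LineField k)
  θ_algebraMap : ∀ a q, θ (algebraMap K E a) q = ψ a
  θ_injective : Function.Injective θ
  mem_iff : ∀ z, z ∈ weightFunctions w (scaleField ξ : LineField k →+* LineField k) ↔ ∃ y, θ y = z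
  scaleField_eq_iff : ∀ y, scaleField ξ y = y ↔ ∃ a, ψ a = y

namespace CentreModel

variable {w : ShiftWeight k n N e F} {ξ : kˣ} {K : Type u} [Field K] {E : Type u}
    [CommRing E] [Algebra K E] (cm : CentreModel w ξ K E)

include cm in
/-- Interpolation at the weights, twisted by a power of the parameter to become equivariant, gives a
basis with as many elements as there are weights. -/
theorem finrank_eq [Finite F] [NeZero N] (hξ : IsPrimitiveRoot (ξ : k) N) :
    Module.finrank K E = {μ | ∃ q, w.α q = μ}.ncard := by
  classical
  let φ : LineField k →+* LineField k := (scaleField ξ : LineField k →ₐ[k] LineField k)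
  let ι := {μ : k // ∃ q, w.α q = μ}
  let mk : ZMod e × F → ι := fun q => ⟨w.α q, q, rfl⟩
  have hmk : Function.Surjective mk := by
    rintro ⟨_, q, rfl⟩
    exact ⟨q, rfl⟩
  have : Finite ι := Finite.of_surjective mk hmk
  have : Fintype ι := Fintype.ofFinite ι
  obtain ⟨p, -, hp⟩ := hξ.eq_pow_of_pow_eq_one w.η_pow_N
  let X : LineField k := lineParameter k
  have hX : X ≠ 0 := (lineParameter k).ne_zero
  -- the nodes: the weights times the power of the parameter on which the scaling acts by `η`
  let a : ι → LineField k := fun μ => μ.1 • X ^ p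
  have ha : ∀ i j, i ≠ j → IsUnit (a i - a j) := by
    intro i j hij
    rw [isUnit_iff_ne_zero]
    change i.1 • X ^ p - j.1 • X ^ p ≠ 0
    rw [← sub_smul]
    exact smul_ne_zero (sub_ne_zero.2 fun h => hij (Subtype.ext h)) (pow_ne_zero p hX)
  let ω : ι → ι := fun μ => ⟨w.η * μ.1, by
    obtain ⟨q, hq⟩ := μ.2
    exact ⟨shiftIndex q, by rw [← hq]; exact w.α_shift q.1 q.2⟩⟩
  have hω : ∀ q, ω (mk q) = mk (shiftIndex q) := fun q => Subtype.ext (w.α_shift q.1 q.2).symm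
  have hωs : Function.Surjective ω := by
    intro μ
    obtain ⟨q, rfl⟩ := hmk μ
    obtain ⟨q, rfl⟩ := shiftIndex.surjective q
    exact ⟨mk q, hω q⟩
  have hφa : ∀ i, φ (a i) = a (ω i) := by
    intro i
    change scaleField ξ (i.1 • X ^ p) = (w.η * i.1) • X ^ p
    rw [map_smul, map_pow, scaleField_lineParameter, smul_pow, smul_smul, hp, mul_comm]
  have hv : ∀ j : Fin (Fintype.card ι), ∃ y, cm.θ y = fun q => a (mk q) ^ (j : ℕ) := fun j =>
    (cm.mem_iff _).1 ⟨fun q q' h => congrArg (fun μ : k => (μ • X ^ p) ^ (j : ℕ)) h, fun q => by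
      beta_reduce
      rw [map_pow]
      exact congrArg (· ^ (j : ℕ)) ((congrArg a (hω q)).symm.trans (hφa (mk q)).symm)⟩
  choose v hv using hv
  have hθ : ∀ (c : Fin (Fintype.card ι) → K) q,
      cm.θ (Fintype.linearCombination K v c) q = ∑ j, cm.ψ (c j) * a (mk q) ^ (j : ℕ) := by
    intro c q
    rw [Fintype.linearCombination_apply, map_sum, Finset.sum_apply]
    refine Finset.sum_congr rfl fun j _ => ?_
    rw [Algebra.smul_def, map_mul, Pi.mul_apply, cm.θ_algebraMap, hv]
  have hbij : Function.Bijective (Fintype.linearCombination K v) := by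
    constructor
    · intro c c' h
      have h1 : (fun j => cm.ψ (c j)) = fun j => cm.ψ (c' j) :=
        (existsUnique_vandermonde a ha fun i => ∑ j, cm.ψ (c j) * a i ^ (j : ℕ)).unique
          (fun i => rfl) fun i => by
            obtain ⟨q, rfl⟩ := hmk i
            rw [← hθ, ← hθ, h]
      funext j
      exact cm.ψ.injective (congrFun h1 j)
    · intro y
      have hy := (cm.mem_iff _).2 ⟨y, rfl⟩
      let f : ι → LineField k := fun i => cm.θ y (hmk i).choose
      have hf : ∀ q, f (mk q) = cm.θ y q := fun q =>
        hy.1 _ _ (congrArg Subtype.val (hmk (mk q)).choose_spec)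
      obtain ⟨c, hc, -⟩ := existsUnique_vandermonde a ha f
      have hcφ := fun j => map_coeff_eq_of_vandermonde ha hc φ ω hωs hφa (fun i => by
        obtain ⟨q, rfl⟩ := hmk i
        rw [hω, hf, hf]
        exact (hy.2 q).symm) j
      choose b hb using fun j => (cm.scaleField_eq_iff _).1 (hcφ j)
      refine ⟨b, cm.θ_injective (funext fun q => ?_)⟩
      rw [hθ, ← hf, hc]
      simp only [hb]
  rw [← (LinearEquiv.ofBijective _ hbij).finrank_eq, Module.finrank_fin_fun,
    ← Nat.card_eq_fintype_card]
  rfl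

end CentreModel

theorem exists_lift_powerSeries {T : Type*} [CommRing T] (g : T →+* LineField k)
    (h : ∀ y, ∃ f : PowerSeries k, algebraMap _ _ f = g y) :
    ∃ g0 : T →+* PowerSeries k, ∀ y, algebraMap _ (LineField k) (g0 y) = g y := by
  have hinj := IsFractionRing.injective (PowerSeries k) (LineField k)
  choose g0 hg0 using h
  exact ⟨{ toFun := g0
           map_one' := hinj (by rw [hg0, map_one, map_one])
           map_mul' := fun a b => hinj (by rw [map_mul, hg0, hg0, hg0, map_mul])
           map_zero' := hinj (by rw [hg0, map_zero, map_zero])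
           map_add' := fun a b => hinj (by rw [map_add, hg0, hg0, hg0, map_add]) }, hg0⟩

/-- Power series are integrally closed, so that integrality over a ring of power series entails
being a power series. -/
theorem exists_powerSeries_of_isIntegralElem {T : Type*} [CommRing T] {g : T →+* LineField k}
    (h : ∀ y, ∃ f : PowerSeries k, algebraMap _ _ f = g y) {x : LineField k}
    (hx : g.IsIntegralElem x) : ∃ f : PowerSeries k, algebraMap _ _ f = x := by
  obtain ⟨g0, hg0⟩ := exists_lift_powerSeries g h
  obtain ⟨P, hP, hPx⟩ := hx
  have h1 : g = (algebraMap (PowerSeries k) (LineField k)).comp g0 :=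
    RingHom.ext fun y => (hg0 y).symm
  refine IsIntegrallyClosed.isIntegral_iff.1 ⟨P.map g0, hP.map g0, ?_⟩
  rw [Polynomial.eval₂_map, ← h1, hPx]

namespace CentreModel

variable {w : ShiftWeight k n N e F} {ξ : kˣ} {K : Type u} [Field K] {E : Type u}
    [CommRing E] [Algebra K E] (cm : CentreModel w ξ K E) {O : Type u} [CommRing O] [Algebra O K]
    (hO : ∀ r, ∃ f : PowerSeries k, algebraMap _ _ f = cm.ψ (algebraMap O K r))
    (hint : ∀ f : PowerSeries k, (cm.ψ.comp (algebraMap O K)).IsIntegralElem (algebraMap _ _ f))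
include hO hint

theorem isIntegral_field_iff (x : K) :
    IsIntegral O x ↔ ∃ f : PowerSeries k, algebraMap _ _ f = cm.ψ x := by
  constructor
  · rintro ⟨P, hP, hPx⟩
    refine exists_powerSeries_of_isIntegralElem (g := cm.ψ.comp (algebraMap O K)) hO ⟨P, hP, ?_⟩
    rw [← Polynomial.hom_eval₂, hPx, map_zero]
  · rintro ⟨f, hf⟩
    obtain ⟨P, hP, hPf⟩ := hint f
    refine ⟨P, hP, cm.ψ.injective ?_⟩
    rw [Polynomial.hom_eval₂, ← hf, hPf, map_zero]

theorem isIntegral_algebra_iff [Finite F] (y : E) : IsIntegral (integralClosure O K) y ↔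
    ∀ q, ∃ f : PowerSeries k, algebraMap _ _ f = cm.θ y q := by
  have hC : ∀ c : integralClosure O K, ∃ f : PowerSeries k, algebraMap _ _ f = cm.ψ c := fun c =>
    (cm.isIntegral_field_iff hO hint _).1 c.2
  have hq : ∀ q, ((Pi.evalRingHom _ q).comp cm.θ).comp (algebraMap (integralClosure O K) E) =
      cm.ψ.comp (integralClosure O K).subtype := fun q => RingHom.ext fun c =>
    cm.θ_algebraMap c q
  constructor
  · rintro ⟨P, hP, hPy⟩ q
    refine exists_powerSeries_of_isIntegralElem (g := cm.ψ.comp (integralClosure O K).subtype) hC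
      ⟨P, hP, ?_⟩
    have h1 := congrArg ((Pi.evalRingHom _ q).comp cm.θ) hPy
    rw [Polynomial.hom_eval₂, map_zero, hq] at h1
    exact h1
  · intro h
    have : Fintype F := Fintype.ofFinite F
    choose f hf using h
    -- the product of integral equations for the values
    choose P hP hPf using fun q => hint (f q)
    refine ⟨(∏ q, P q).map (algebraMap O (integralClosure O K)),
      (Polynomial.monic_prod_of_monic _ _ fun q _ => hP q).map _, cm.θ_injective ?_⟩
    funext q
    rw [map_zero]
    change ((Pi.evalRingHom _ q).comp cm.θ) _ = 0
    rw [Polynomial.hom_eval₂, hq, Polynomial.eval₂_map, Polynomial.eval₂_finsetProd]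
    refine Finset.prod_eq_zero (Finset.mem_univ q) ?_
    have h1 := hPf q
    rw [hf] at h1
    exact h1

/-- Every closed point of the cover determined by the algebra is ramified of index `e`. -/
theorem ramificationIdx_eq [Finite F] [NeZero N] (hξ : IsPrimitiveRoot (ξ : k) N)
    (P : Ideal (integralClosure (integralClosure O K) E)) [P.IsMaximal] :
    P.ramificationIdx (integralClosure O K) = e := by
  have hinj := IsFractionRing.injective (PowerSeries k) (LineField k)
  obtain ⟨c, hc⟩ := exists_lift_powerSeries (T := integralClosure O K)
    (cm.ψ.comp (integralClosure O K).subtype) fun c => (cm.isIntegral_field_iff hO hint _).1 c.2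
  choose Θ0 hΘ0 using fun q => exists_lift_powerSeries
    (T := integralClosure (integralClosure O K) E) (((Pi.evalRingHom _ q).comp cm.θ).comp
    (integralClosure (integralClosure O K) E).subtype) fun y =>
      (cm.isIntegral_algebra_iff hO hint _).1 y.2 q
  have hc' : ∀ x, algebraMap _ (LineField k) (c x) = cm.ψ x := hc
  have hΘ' : ∀ q y, algebraMap _ (LineField k) (Θ0 q y) = cm.θ y q := hΘ0
  refine ramificationIdx_weightSeries (w := w) hξ (NeZero.ne N) (RingHom.pi Θ0)
    (fun y y' h => Subtype.ext (cm.θ_injective (funext fun q => ?_))) (fun f => ?_) c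
    (fun x x' h => Subtype.ext (cm.ψ.injective ?_)) (fun f => ?_) (fun x q => hinj ?_) P
  · rw [← hΘ', ← hΘ']
    exact congrArg _ (congrFun h q)
  · have h1 : IsWeightSeries w ξ f ↔ (fun q => algebraMap _ (LineField k) (f q)) ∈
        weightFunctions w (scaleField ξ : LineField k →+* LineField k) := by
      refine and_congr (forall_congr' fun q => forall_congr' fun q' => imp_congr_right fun _ =>
        hinj.eq_iff.symm) (forall_congr' fun q => ?_)
      change _ ↔ _ = scaleField ξ (algebraMap _ _ (f q))
      rw [scaleField_algebraMap, hinj.eq_iff]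
    rw [h1, cm.mem_iff]
    constructor
    · rintro ⟨y, hy⟩
      refine ⟨⟨y, (cm.isIntegral_algebra_iff hO hint y).2 fun q => ⟨f q, (congrFun hy q).symm⟩⟩,
        funext fun q => hinj ?_⟩
      exact (hΘ' q _).trans (congrFun hy q)
    · rintro ⟨y, rfl⟩
      exact ⟨y, funext fun q => (hΘ' q y).symm⟩
  · rw [← hc', ← hc', h]
  · rw [← hinj.eq_iff, ← scaleField_algebraMap, cm.scaleField_eq_iff]
    constructor
    · rintro ⟨x, hx⟩
      exact ⟨⟨x, (cm.isIntegral_field_iff hO hint x).2 ⟨f, hx.symm⟩⟩, hinj ((hc' _).trans hx)⟩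
    · rintro ⟨x, rfl⟩
      exact ⟨x, (hc' x).symm⟩
  · rw [hc']
    exact (hΘ' q _).trans (cm.θ_algebraMap x q)

end CentreModel

end CentreModel


/-! ### Ramification of the order of invariants along the image of the line -/

section Ramification

variable {k : Type u} [Field k] {n N e : ℕ} [NeZero e] [NeZero N] {F : Type u} [Finite F]
  {w : ShiftWeight k n N e F} {ξ : kˣ}

/-- If the centre of the residue algebra at `p` consists of the weight functions, then the ramification
index of the order at `p` is the number of weights, and the cover of the normalised curve has
ramification index `e` at every closed point. -/
theorem ResidueModel.ramification {O : Type u} [CommRing O] {Λ : Type u} [Ring Λ] [Algebra O Λ]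
    {p : Ideal O} [p.IsPrime] {D : Type u} [Ring D] [Algebra (LineField k) D]
    (rm : ResidueModel O Λ p (LineField k) D (ZMod e × F → LineField k))
    (hZ : rm.Z = weightFunctions w (scaleField ξ : LineField k →+* LineField k))
    (hχ : ∀ r, scaleField ξ (rm.χ r) = rm.χ r)
    (hfix : ∀ y, scaleField ξ y = y → ∃ f r, rm.χ r ≠ 0 ∧ rm.χ f = rm.χ r * y)
    (hrange : ∀ r, ∃ f : PowerSeries k, algebraMap _ _ f = rm.χ r)
    (hint : ∀ f : PowerSeries k, rm.χ.IsIntegralElem (algebraMap _ _ f))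
    (hξ : IsPrimitiveRoot (ξ : k) N) :
    ramificationIndex O Λ p = {μ | ∃ q, w.α q = μ}.ncard ∧ HasClosedPointRamification O Λ p e := by
  obtain ⟨ψ, θ, h1, h2, h3, h4⟩ := rm.exists_residueCentre_hom
  rw [hZ] at h4
  have h5 : (scaleField ξ : LineField k →+* LineField k).comp ψ = ψ := by
    apply Ideal.ResidueField.ringHom_ext
    ext r
    rw [RingHom.comp_apply, RingHom.comp_apply, RingHom.comp_apply, h1]
    exact hχ r
  let cm : CentreModel w ξ p.ResidueField (ResidueCentre O Λ p) :=
    { ψ := ψ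
      θ := θ
      θ_algebraMap := fun a q => congrFun (h2 a) q
      θ_injective := h3
      mem_iff := h4
      scaleField_eq_iff := fun y => ⟨fun hy => by
          obtain ⟨f, r, hr, hfy⟩ := hfix y hy
          refine ⟨algebraMap _ _ f / algebraMap _ _ r, ?_⟩
          rw [map_div₀, h1, h1, hfy, mul_div_cancel_left₀ _ hr], by
        rintro ⟨a, rfl⟩
        exact RingHom.congr_fun h5 a⟩ }
  have h6 : cm.ψ.comp (algebraMap O p.ResidueField) = rm.χ := RingHom.ext h1
  refine ⟨cm.finrank_eq hξ, fun P hP => cm.ramificationIdx_eq (O := O) (fun r => ?_) (fun f => ?_) hξ P⟩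
  · obtain ⟨f, hf⟩ := hrange r
    exact ⟨f, hf.trans (h1 r).symm⟩
  · rw [h6]
    exact hint f

end Ramification

section AlongLine

variable {k : Type u} [Field k] {G : Type*} [Group G] [Finite G]

theorem isIntegral_baseRing (ρ : G →* (PlaneRing k ≃ₐ[k] PlaneRing k)) (f : PlaneRing k) :
    IsIntegral (baseRing ρ) f := by
  let act : MulSemiringAction G (PlaneRing k) := MulSemiringAction.compHom _ ρ
  have hfix : ∀ (g : G) (r : baseRing ρ), ρ g r = r := fun g r => r.2 g
  have : SMulCommClass G (baseRing ρ) (PlaneRing k) := ⟨fun g r x => by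
    change ρ g (r.1 * x) = r.1 * ρ g x
    rw [map_mul, hfix]⟩
  have : Algebra.IsInvariant (baseRing ρ) (PlaneRing k) G :=
    ⟨fun f hf => ⟨⟨f, hf⟩, rfl⟩⟩
  exact (Algebra.IsInvariant.isIntegral (baseRing ρ) (PlaneRing k) G).isIntegral f

variable [CharZero k] {ρ : G →* (PlaneRing k ≃ₐ[k] PlaneRing k)} {s t : PlaneRing k}
  {L : Ideal (PlaneRing k)} [L.IsPrime] {σ τ : G} {m : ℕ}
  {β : G →* (Matrix (Fin m) (Fin m) k ≃ₐ[k] Matrix (Fin m) (Fin m) k)}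

/-- The ramification of the order of invariants along the image of the line, read off from the normal
form of the matrix action. -/
theorem quotientOrder_ramification [IsAlgClosed k] (hm : 0 < m)
    (hl : IsReflectionLine ρ s t L σ τ) (A B : GL (Fin m) k)
    (hA : ∀ X, β σ X = A.1 * X * A⁻¹.1) (hB : ∀ X, β τ X = B.1 * X * B⁻¹.1) {η : k}
    (hAB : A.1 * B.1 = η • (B.1 * A.1)) {e : ℕ} (he : 0 < e) (hη : IsPrimitiveRoot η e) :
    ramificationIndex (baseRing ρ) (quotientOrder ρ β) (imagePrime ρ L) =
        {μ : k | Module.End.HasEigenvalue (Matrix.toLin' A.1) μ}.ncard ∧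
      HasClosedPointRamification (baseRing ρ) (quotientOrder ρ β) (imagePrime ρ L) e := by
  obtain ⟨ld⟩ := hl.nonempty_lineData
  obtain ⟨a, ha, hAn⟩ := exists_pow_eq_smul_one hm hA (pow_orderOf_eq_one σ)
  obtain ⟨b, hb, hBN⟩ := exists_pow_eq_smul_one hm hB (pow_orderOf_eq_one τ)
  have : NeZero e := ⟨he.ne'⟩
  have : NeZero (orderOf τ) := ⟨(orderOf_pos τ).ne'⟩
  obtain ⟨F, _, _, _, fr, w, -, hw, -, heig, -⟩ := exists_frame hm A B
    (β σ : Matrix (Fin m) (Fin m) k →ₐ[k] Matrix (Fin m) (Fin m) k) (β τ) hA hB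
    (orderOf_pos σ).ne' (orderOf_pos τ).ne' ha hb hAn hBN hη (pow_eq_one_of_left hm hAB ha hAn)
    (pow_eq_one_of_right hm hAB hb hBN) ld.isPrimitiveRoot_ξ hAB
  have hset : {μ : k | Module.End.HasEigenvalue (Matrix.toLin' A.1) μ} = {μ | ∃ q, w.α q = μ} :=
    Set.ext heig
  rw [hset]
  refine (lineResidueModel w hl ld fr hw).ramification (ξ := ld.ξ) rfl (fun r => ?_)
    (fun y hy => exists_invariant_of_scaleField_eq hl ld hy) (fun r => ⟨ld.ev r, rfl⟩)
    (fun f => ?_) ld.isPrimitiveRoot_ξ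
  · change scaleField ld.ξ (ld.evK r) = ld.evK r
    rw [← ld.evK_τ hl]
    exact congrArg ld.evK (r.2 τ)
  · obtain ⟨f, rfl⟩ := ld.ev_surjective f
    obtain ⟨P, hP, hPf⟩ := isIntegral_baseRing ρ f
    refine ⟨P, hP, ?_⟩
    have h1 := congrArg (ld.evK : PlaneRing k →+* LineField k) hPf
    rw [Polynomial.hom_eval₂, map_zero] at h1
    exact h1

end AlongLine

end QuotientOrder

end

set_option maxHeartbeats 1000000 in
theorem mainTheorem6 {k : Type u} [Field k] [IsAlgClosed k] [CharZero k]
    -- a finite subgroup `G` of `GL(ku + kv)`, acting on `S = k[[u, v]]`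
    {G : Type*} [Group G] [Finite G]
    (ρ : G →* (MvPowerSeries (Fin 2) k ≃ₐ[k] MvPowerSeries (Fin 2) k))
    (hρ : Function.Injective ρ)
    (hlin : ∀ g i, ρ g (MvPowerSeries.X i) ∈
      Submodule.span k (Set.range (MvPowerSeries.X : Fin 2 → MvPowerSeries (Fin 2) k)))
    -- an action of `G` on the matrix algebra
    {m : ℕ} (hm : 0 < m)
    (β : G →* (Matrix (Fin m) (Fin m) k ≃ₐ[k] Matrix (Fin m) (Fin m) k))
    -- linear coordinates `s, t` and the line `L = (t = 0)`, with `(s = 0)` stable under the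
    -- stabiliser `H` of `L`
    (s t : MvPowerSeries (Fin 2) k)
    (hs : s ∈ Submodule.span k
      (Set.range (MvPowerSeries.X : Fin 2 → MvPowerSeries (Fin 2) k)))
    (ht : t ∈ Submodule.span k
      (Set.range (MvPowerSeries.X : Fin 2 → MvPowerSeries (Fin 2) k)))
    (hst : LinearIndependent k ![s, t])
    (L : Ideal (MvPowerSeries (Fin 2) k)) [L.IsPrime] (hL : L = Ideal.span {t})
    (hdiag : ∀ h ∈ QuotientOrder.stabilizer ρ L, ∃ c : k, ρ h s = c • s)
    -- the inertia group `I = ⟨σ⟩`, nontrivial since `L` is a line of reflection, and `H = I × J`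
    -- with `J = ⟨τ⟩`
    (σ τ : G) (hσ : σ ≠ 1)
    (hI : ∀ g : G, g ∈ Subgroup.zpowers σ ↔ g ∈ QuotientOrder.stabilizer ρ L ∧ ρ g s = s)
    (hIJ : Subgroup.zpowers σ ⊓ Subgroup.zpowers τ = ⊥)
    (hH : Subgroup.zpowers σ ⊔ Subgroup.zpowers τ = QuotientOrder.stabilizer ρ L)
    -- `σ` and `τ` act on matrices as conjugation by `bσ` and `bτ`
    (bσ bτ : GL (Fin m) k)
    (hbσ : ∀ X, β σ X = bσ.1 * X * bσ⁻¹.1)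
    (hbτ : ∀ X, β τ X = bτ.1 * X * bτ⁻¹.1) :
    (QuotientOrder.IsNormalOrder (QuotientOrder.completedBaseRing ρ L)
        (QuotientOrder.completedOrder ρ β L) k ↔
      ∀ μ ν : k, Module.End.HasEigenvalue (Matrix.toLin' bσ.1) μ →
        Module.End.HasEigenvalue (Matrix.toLin' bσ.1) ν →
          Module.finrank k (Module.End.eigenspace (Matrix.toLin' bσ.1) μ) =
            Module.finrank k (Module.End.eigenspace (Matrix.toLin' bσ.1) ν)) ∧
    (QuotientOrder.IsNormalOrder (QuotientOrder.completedBaseRing ρ L)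
        (QuotientOrder.completedOrder ρ β L) k →
      QuotientOrder.ramificationIndex (QuotientOrder.baseRing ρ)
          (QuotientOrder.quotientOrder ρ β) (QuotientOrder.imagePrime ρ L) =
        {μ : k | Module.End.HasEigenvalue (Matrix.toLin' bσ.1) μ}.ncard) ∧
    (∃! η : k, bσ.1 * bτ.1 = η • (bτ.1 * bσ.1)) ∧
    ∀ η : k, bσ.1 * bτ.1 = η • (bτ.1 * bσ.1) →
      ∃ e : ℕ, 0 < e ∧ IsPrimitiveRoot η e ∧
        QuotientOrder.HasIndex (FractionRing (QuotientOrder.completedBaseRing ρ L))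
          (QuotientOrder.GenericFibre (QuotientOrder.completedBaseRing ρ L)
            (QuotientOrder.completedOrder ρ β L)) e ∧
        QuotientOrder.HasClosedPointRamification (QuotientOrder.baseRing ρ)
          (QuotientOrder.quotientOrder ρ β) (QuotientOrder.imagePrime ρ L) e := by
  have hl : QuotientOrder.IsReflectionLine ρ s t L σ τ :=
    { injective := hρ
      linear := hlin
      coordinates := ⟨hs, ht, hst⟩
      eq_span := hL
      diagonal := hdiag
      mem_inertia := hI
      inf_eq_bot := hIJ
      sup_eq := hH }
  obtain ⟨ld⟩ := hl.nonempty_lineData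
  obtain ⟨η, hη, huniq⟩ := QuotientOrder.existsUnique_mul_eq_smul_mul hm hbσ hbτ ld.comm
  obtain ⟨a, ha, hAn⟩ := QuotientOrder.exists_pow_eq_smul_one hm hbσ (pow_orderOf_eq_one σ)
  have he : 0 < orderOf η := orderOf_pos_iff.2 (isOfFinOrder_iff_pow_eq_one.2
    ⟨orderOf σ, orderOf_pos σ, QuotientOrder.pow_eq_one_of_left hm hη ha hAn⟩)
  have hprim := IsPrimitiveRoot.orderOf η
  obtain ⟨h1, h2⟩ := QuotientOrder.completedOrder_isNormalOrder_iff_and_hasIndex hm hl bσ bτ hbσ hbτ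
    hη he hprim
  obtain ⟨h3, h4⟩ := QuotientOrder.quotientOrder_ramification hm hl bσ bτ hbσ hbτ hη he hprim
  refine ⟨h1, fun _ => h3, ⟨η, hη, huniq⟩, fun η' hη' => ?_⟩
  obtain rfl := huniq η' hη'
  exact ⟨orderOf η', he, hprim, h2, h4⟩
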